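/- **Notation.** Let $q,t$ be independent indeterminates, and let $\Lambda$ be the ring of symmetric functions in $x=(x_1,x_2,\dots)$ over $\mathbf Q(q,t)$, with monomial symmetric functions $m_\lambda$ and power sums $p_n$. For $\lambda=(1^{m_1}2^{m_2}\cdots)$ put $p_\lambda=\prod_i p_{\lambda_i}$ and let $\langle\cdot,\cdot\rangle_{q,t}$ be the bilinear scalar product on $\Lambda$ with $$\langle p_\lambda,p_\mu\rangle_{q,t}=\delta_{\lambda\mu}\prod_{r\ge1}r^{m_r}m_r!\prod_{i=1}^{\ell(\lambda)}\frac{1-q^{\lambda_i}}{1-t^{\lambda_i}} .$$ The Macdonald symmetric functions $P_\lambda=P_\lambda(x;q,t)\in\Lambda$ are characterized by (A) $P_\lambda-m_\lambda$ is a $\mathbf Q(q,t)$-linear combination of the $m_\mu$ with $\mu<\lambda$ in the dominance order, and (B) $\langle P_\lambda,P_\mu\rangle_{q,t}=0$ for $\lambda\ne\mu$. *Bosons.* Let $[a_n,a_m]=n\frac{1-q^{|n|}}{1-t^{|n|}}\delta_{n+m,0}$ for nonzero integers $n,m$. The Fock space is $\mathbf Q(q,t)[a_{-1},a_{-2},\dots]|0\rangle$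 with $a_n|0\rangle=0$ for $n>0$, the dual Fock space is $\langle0|\mathbf Q(q,t)[a_1,a_2,\dots]$ with $\langle 0|a_{-n}=0$ for $n>0$, and $\langle0|0\rangle=1$. Put $$C(x)=\exp\Big(\sum_{n\ge1}\tfrac{1-t^n}{1-q^n}\tfrac{a_n}{n}p_n\Big),\qquad C^*(x)=\exp\Big(\sum_{n\ge1}\tfrac{1-t^n}{1-q^n}\tfrac{a_{-n}}{n}p_n\Big).$$ Let $\hat P_\lambda(q,t)\in\mathbf Q(q,t)[a_{-1},a_{-2},\dots]$ and $\hat P^*_\lambda(q,t)\in\mathbf Q(q,t)[a_1,a_2,\dots]$ be the operators with $\langle0|C(x)\hat P_\lambda|0\rangle=P_\lambda(x;q,t)$ and $\langle0|\hat P^*_\lambda C^*(x)|0\rangle=P_\lambda(x;q,t)$. *Kernels.* For real $q,t\in(0,1)$ put $(a;q)_\infty=\prod_{k\ge0}(1-aq^k)$, $$\Delta(x;q,t)=\prod_{i\ne j}\frac{(x_i/x_j;q)_\infty}{(tx_i/x_j;q)_\infty},\qquad \Pi(x,y;q,t)=\prod_{i,j}\frac{(tx_iy_j;q)_\infty}{(x_iy_j;q)_\infty},$$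 $$\langle f,g\rangle'_{n;q,t}=\frac1{n!}\oint_{|x_j|=1}\prod_{j=1}^n\frac{dx_j}{2\pi i x_j}\,f(\overline x)\,g(x)\,\Delta(x;q,t),\qquad \overline x=(1/x_1,1/x_2,\dots),$$ where symmetric functions are restricted to $n$ variables. *Rectangles.* Every partition is uniquely a sum of rectangles, $\lambda=(s_N^{r_N})+\cdots+(s_1^{r_1})$ with $r_N>\cdots>r_1\ge1$, all $s_a\ge1$, and $(s^r)$ the partition with $r$ parts equal to $s$. Put $\lambda^{(a)}=(s_a^{r_a})+\cdots+(s_1^{r_1})$ and $$C^+_\lambda(q,t)=\prod_{a=1}^N\frac{\langle P_{\lambda^{(a)}},P_{\lambda^{(a)}}\rangle_{q,t}}{r_a!\,\langle P_{\lambda^{(a)}},P_{\lambda^{(a)}}\rangle'_{r_a;q,t}},\qquad C^-_\lambda(q,t)=\frac{C^+_\lambda(q,t)}{\langle P_\lambda,P_\lambda\rangle_{q,t}}.$$ For $x^a=(x^a_1,\dots,x^a_{r_a})$ define $G_\lambda(x^N;q,t)$ by $$G_\lambda(x^N;q,t)=\Delta(x^N;q,t)\prod_{j=1}^{r_N}(x^N_j)^{s_N}\oint\prod_{a=1}^{N-1}\prod_{j=1}^{r_a}\frac{dx^a_j}{2\pi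 i x^a_j}(x^a_j)^{s_a}\prod_{a=1}^{N-1}\Pi(x^{a+1},\overline{x^a};q,t)\,\Delta(x^a;q,t),$$ and put $$F^+_\lambda(x;q,t)=C^+_\lambda(q,t)\,G_\lambda(x;q,t),\qquad F^-_{\lambda'}(x;q,t)=C^-_\lambda(t,q)\,G_\lambda(x;t,q),$$ where $\lambda'$ is the conjugate of $\lambda$. Thus $F^+_\lambda$ has $\ell(\lambda)$ variables and $F^-_\lambda$ has $\ell(\lambda')=\lambda_1$ variables. The contours are circles $|x^a_j|=\rho_a$ with arbitrary radii $\rho_1>\rho_2>\cdots>\rho_N>0$. For the empty partition ($N=0$) there are no variables and $G=1$. **Proposition 3.6.** The Macdonald symmetric functions satisfying (A) and (B) exist. For every partition $\lambda$ one has $$\langle0|C(x)\hat P_\lambda(q,t)|0\rangle=\langle0|\hat P_\lambda^*(q,t)C^*(x)|0\rangle=P_\lambda(x;q,t).$$ For all real $q,t\in(0,1)$ the coefficients of $\hat P_\lambda$ and $\hat P^*_\lambda$ have no pole at $(q,t)$, and, coefficientwise in the monomials in the oscillators, $$\hat P_\lambda(q,t)=\oint\prod_{j=1}^{\ell(\lambda)}\frac{dx_j}{2\pi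 i x_j}\,F^+_\lambda(x;q,t)\prod_{j=1}^{\ell(\lambda)}\exp\Big(\sum_{n\ge1}\frac{1-t^n}{1-q^n}\frac{a_{-n}}n x_j^{-n}\Big)=\oint\prod_{j=1}^{\ell(\lambda')}\frac{dx_j}{2\pi i x_j}\,F^-_\lambda(x;q,t)\prod_{j=1}^{\ell(\lambda')}\exp\Big(-\sum_{n\ge1}\frac{a_{-n}}n(-x_j)^{-n}\Big),$$ $$\hat P^*_\lambda(q,t)=\oint\prod_{j=1}^{\ell(\lambda)}\frac{dx_j}{2\pi i x_j}\,F^+_\lambda(x;q,t)\prod_{j=1}^{\ell(\lambda)}\exp\Big(\sum_{n\ge1}\frac{1-t^n}{1-q^n}\frac{a_{n}}n x_j^{-n}\Big)=\oint\prod_{j=1}^{\ell(\lambda')}\frac{dx_j}{2\pi i x_j}\,F^-_\lambda(x;q,t)\prod_{j=1}^{\ell(\lambda')}\exp\Big(-\sum_{n\ge1}\frac{a_{n}}n(-x_j)^{-n}\Big).$$ Each integral is over the circles $|x_j|=\rho_N$, with the $\rho_a$ and $N$ that belong to the decomposition of $\lambda$ (for $F^+_\lambda$) or of $\lambda'$ (for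 $F^-_\lambda$). -/

import Mathlib

noncomputable section

namespace MacdonaldBoson

/-! ### Partitions -/

/-- Dominance order on partitions: `lam ≥ mu` iff `|lam| = |mu|` and all partial sums of `lam`
are at least those of `mu`. (This is not Mathlib's order on Young diagrams, which is
containment.) -/
def Dominates (lam mu : YoungDiagram) : Prop :=
  lam.card = mu.card ∧
    ∀ k : ℕ, ∑ i ∈ Finset.range k, mu.rowLen i ≤ ∑ i ∈ Finset.range k, lam.rowLen i

/-- The Young diagram with row lengths `f 0 ≥ f 1 ≥ ⋯`, where `f i = 0` for `i ≥ n`. -/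
def diagramOfRows (f : ℕ → ℕ) (hf : Antitone f) (n : ℕ) : YoungDiagram where
  cells := (Finset.range n).biUnion fun i => (Finset.range (f i)).image fun j => (i, j)
  isLowerSet := by
    rintro ⟨a, b⟩ ⟨c, d⟩ h hab
    obtain ⟨h1, h2⟩ := Prod.mk_le_mk.mp h
    simp only [Finset.coe_biUnion, Finset.coe_image, Finset.coe_range, Set.mem_iUnion,
      Set.mem_image, Set.mem_Iio, Prod.mk.injEq] at hab ⊢
    obtain ⟨i, hi, j, hj, rfl, rfl⟩ := hab
    have h3 : f i ≤ f c := hf h1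
    exact ⟨c, by omega, d, by omega, rfl, rfl⟩

theorem diagramOfRows_rowLen (f : ℕ → ℕ) (hf : Antitone f) (n : ℕ)
    (hn : ∀ i, n ≤ i → f i = 0) (i : ℕ) : (diagramOfRows f hf n).rowLen i = f i := by
  have key : ∀ j, j < (diagramOfRows f hf n).rowLen i ↔ j < f i := by
    intro j
    rw [← YoungDiagram.mem_iff_lt_rowLen, ← YoungDiagram.mem_cells]
    simp only [diagramOfRows, Finset.mem_biUnion, Finset.mem_range, Finset.mem_image,
      Prod.mk.injEq]
    constructor
    · rintro ⟨i', _, j', hj, rfl, rfl⟩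
      exact hj
    · intro hj
      refine ⟨i, ?_, j, hj, rfl, rfl⟩
      by_contra hi
      rw [hn i (by omega)] at hj
      omega
  exact le_antisymm (le_of_not_gt fun h => lt_irrefl _ ((key _).mp h))
    (le_of_not_gt fun h => lt_irrefl _ ((key _).mpr h))

/-- The data of a decomposition of a Young diagram into rectangles,
`lam = (s_N^{r_N}) + ⋯ + (s_1^{r_1})` with `r_N > ⋯ > r_1 ≥ 1` and `s_a ≥ 1`.
Indices run over `1, …, N`; the value `r_0 = 0` is a convention that starts the recursions
(in particular `N = 0` is the empty partition), and values beyond `N` are irrelevant. -/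
structure RectDecomp where
  N : ℕ
  r : ℕ → ℕ
  s : ℕ → ℕ
  r_zero : r 0 = 0
  r_lt : ∀ a, a < N → r a < r (a + 1)
  s_pos : ∀ a, 1 ≤ a → a ≤ N → 0 < s a

/-- The row lengths (rows numbered from `0`) of `lam^(a) = (s_a^{r_a}) + ⋯ + (s_1^{r_1})`. -/
def RectDecomp.rows (D : RectDecomp) (a i : ℕ) : ℕ :=
  ∑ b ∈ Finset.Icc 1 a, if i < D.r b then D.s b else 0

theorem RectDecomp.rows_antitone (D : RectDecomp) (a : ℕ) : Antitone (D.rows a) := by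
  intro i j hij
  refine Finset.sum_le_sum fun b _ => ?_
  split_ifs <;> omega

/-- Beyond `r_1 + ⋯ + r_a` there are no rows. -/
theorem RectDecomp.rows_eq_zero (D : RectDecomp) (a i : ℕ)
    (hi : (∑ b ∈ Finset.Icc 1 a, D.r b) ≤ i) : D.rows a i = 0 := by
  refine Finset.sum_eq_zero fun b hb => if_neg ?_
  have := Finset.single_le_sum (f := D.r) (fun _ _ => Nat.zero_le _) hb
  omega

/-- The partition `lam^(a) = (s_a^{r_a}) + ⋯ + (s_1^{r_1})`. -/
def RectDecomp.sub (D : RectDecomp) (a : ℕ) : YoungDiagram :=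
  diagramOfRows (D.rows a) (D.rows_antitone a) (∑ b ∈ Finset.Icc 1 a, D.r b)

/-- The partition `lam = lam^(N)` that is decomposed. -/
def RectDecomp.partition (D : RectDecomp) : YoungDiagram := D.sub D.N

/-! ### Symmetric functions in infinitely many variables

Symmetric functions are represented by formal power series in the variables
`x_0, x_1, x_2, …` over `K`. -/

/-- The monomial symmetric function: the sum of all distinct `x^α`, where `α` is a permutation
of the sequence `lam`. -/
def monomialSymm (K : Type) [Field K] (lam : YoungDiagram) : MvPowerSeries ℕ K :=
  fun d => if d.support.val.map d = (lam.rowLens : Multiset ℕ) then 1 else 0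

open Classical in
/-- The power sum `p_n = ∑ x_i ^ n`, for `n ≥ 1`. -/
def powerSum (K : Type) [Field K] (n : ℕ+) : MvPowerSeries ℕ K :=
  fun d => if ∃ i : ℕ, d = Finsupp.single i (n : ℕ) then 1 else 0

/-- The substitution of the power sums in a polynomial in the letters `p_1, p_2, …`. -/
def ofPowerSums (K : Type) [Field K] : MvPolynomial ℕ+ K →ₐ[K] MvPowerSeries ℕ K :=
  MvPolynomial.aeval (powerSum K)

/-- The expansion of a symmetric function as a polynomial in the power sums. -/
def powerSumExpansion {K : Type} [Field K] (f : MvPowerSeries ℕ K) : MvPolynomial ℕ+ K :=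
  Function.invFun (ofPowerSums K) f

/-- `z_lam(q,t) = ∏ r^{m_r} m_r! ∏ (1 - q^{lam_i}) / (1 - t^{lam_i})` for the partition
`lam = (1^{m_1} 2^{m_2} ⋯)`. -/
def zFactor {K : Type} [Field K] (q t : K) (m : ℕ+ →₀ ℕ) : K :=
  m.prod fun r k => ((r : ℕ) : K) ^ k * (k.factorial : K) *
    ((1 - q ^ (r : ℕ)) / (1 - t ^ (r : ℕ))) ^ k

/-- The bilinear scalar product on symmetric functions with
`⟨p_lam, p_mu⟩ = δ_{lam,mu} z_lam(q,t)`. -/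
def scalarProd {K : Type} [Field K] (q t : K) (f g : MvPowerSeries ℕ K) : K :=
  ∑ m ∈ (powerSumExpansion f).support,
    (powerSumExpansion f).coeff m * (powerSumExpansion g).coeff m * zFactor q t m

/-- The characterization of the family of the Macdonald symmetric functions:
(A) `P_lam` is `m_lam` plus a linear combination of the `m_mu` with `mu < lam`;
(B) `⟨P_lam, P_mu⟩_{q,t} = 0` if `lam ≠ mu`. -/
def IsMacdonaldFamily {K : Type} [Field K] (q t : K)
    (P : YoungDiagram → MvPowerSeries ℕ K) : Prop :=
  (∀ lam, P lam - monomialSymm K lam ∈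
    Submodule.span K (monomialSymm K '' {mu | Dominates lam mu ∧ mu ≠ lam})) ∧
  (∀ lam mu, lam ≠ mu → scalarProd q t (P lam) (P mu) = 0)

/-- The field `ℚ(q,t)` of rational functions in two independent indeterminates. -/
abbrev RatQT : Type := FractionRing (MvPolynomial (Fin 2) ℚ)

/-- The indeterminate `q`. -/
def indQ : RatQT := algebraMap (MvPolynomial (Fin 2) ℚ) RatQT (MvPolynomial.X 0)

/-- The indeterminate `t`. -/
def indT : RatQT := algebraMap (MvPolynomial (Fin 2) ℚ) RatQT (MvPolynomial.X 1)

/-- The Macdonald symmetric functions `P_lam(x;q,t)` over `ℚ(q,t)`. -/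
def macdonaldP : YoungDiagram → MvPowerSeries ℕ RatQT :=
  Classical.epsilon (IsMacdonaldFamily indQ indT)

/-! ### Specialization of the indeterminates -/

/-- `u ∈ ℚ(q,t)` has no pole at the point `(q, t)`. -/
def RegularAt (q t : ℝ) (u : RatQT) : Prop :=
  MvPolynomial.aeval ![(q : ℂ), (t : ℂ)]
    (IsFractionRing.den (MvPolynomial (Fin 2) ℚ) u : MvPolynomial (Fin 2) ℚ) ≠ 0

/-- The value of `u ∈ ℚ(q,t)` at the point `(q, t)`. -/
def ratEval (q t : ℝ) (u : RatQT) : ℂ :=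
  MvPolynomial.aeval ![(q : ℂ), (t : ℂ)] (IsFractionRing.num (MvPolynomial (Fin 2) ℚ) u) /
  MvPolynomial.aeval ![(q : ℂ), (t : ℂ)]
    (IsFractionRing.den (MvPolynomial (Fin 2) ℚ) u : MvPolynomial (Fin 2) ℚ)

/-- `f(x_1, …, x_n, 0, 0, …)` at numerical values of `q`, `t` and of the `x_i`; the sum is
finite if `f` is of bounded degree. -/
def evalSymm (q t : ℝ) (f : MvPowerSeries ℕ RatQT) {n : ℕ} (x : Fin n → ℂ) : ℂ :=
  ∑ᶠ d : Fin n →₀ ℕ,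
    ratEval q t (MvPowerSeries.coeff (d.embDomain Fin.valEmbedding) f) *
      d.prod fun i k => x i ^ k

/-! ### Contour integrals, the kernels and the second scalar product -/

/-- `∮ ∏_j dx_j / (2 π i x_j) f(x)` over the torus `|x_j| = ρ`, `j = 1, …, n`. -/
def contour {n : ℕ} (ρ : ℝ) (f : (Fin n → ℂ) → ℂ) : ℂ :=
  torusIntegral (fun x => (∏ j, (2 * (Real.pi : ℂ) * Complex.I * x j)⁻¹) * f x)
    0 (fun _ => ρ)

/-- `(a;q)_∞ = ∏_{k ≥ 0} (1 - a q^k)`. -/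
def qPoch (a : ℂ) (q : ℝ) : ℂ := ∏' k : ℕ, (1 - a * (q : ℂ) ^ k)

/-- `Δ(x;q,t) = ∏_{i ≠ j} (x_i/x_j;q)_∞ / (t x_i/x_j;q)_∞`. -/
def weight (q t : ℝ) {n : ℕ} (x : Fin n → ℂ) : ℂ :=
  ∏ i, ∏ j, if i = j then 1 else qPoch (x i / x j) q / qPoch (t * (x i / x j)) q

/-- `Π(x,y;q,t) = ∏_{i,j} (t x_i y_j;q)_∞ / (x_i y_j;q)_∞`. -/
def kernel (q t : ℝ) {n m : ℕ} (x : Fin n → ℂ) (y : Fin m → ℂ) : ℂ :=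
  ∏ i, ∏ j, qPoch (t * (x i * y j)) q / qPoch (x i * y j) q

/-- `⟨f, g⟩'_{n;q,t} = (1/n!) ∮ ∏_j dx_j / (2 π i x_j) f(1/x) g(x) Δ(x;q,t)`
over the unit torus. -/
def scalarProd' (q t : ℝ) (n : ℕ) (f g : MvPowerSeries ℕ RatQT) : ℂ :=
  (n.factorial : ℂ)⁻¹ * contour 1 fun x : Fin n → ℂ =>
    evalSymm q t f (fun j => (x j)⁻¹) * evalSymm q t g x * weight q t x

/-- `C^+_lam(q,t) = ∏_a ⟨P_{lam^(a)}, P_{lam^(a)}⟩_{q,t} /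
(r_a! ⟨P_{lam^(a)}, P_{lam^(a)}⟩'_{r_a;q,t})`. -/
def constPlus (q t : ℝ) (D : RectDecomp) : ℂ :=
  ∏ a ∈ Finset.Icc 1 D.N,
    ratEval q t (scalarProd indQ indT (macdonaldP (D.sub a)) (macdonaldP (D.sub a))) /
      (((D.r a).factorial : ℂ) *
        scalarProd' q t (D.r a) (macdonaldP (D.sub a)) (macdonaldP (D.sub a)))

/-- `C^-_lam(q,t) = C^+_lam(q,t) / ⟨P_lam, P_lam⟩_{q,t}`. -/
def constMinus (q t : ℝ) (D : RectDecomp) : ℂ :=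
  constPlus q t D /
    ratEval q t (scalarProd indQ indT (macdonaldP D.partition) (macdonaldP D.partition))

/-- The nested integral
`Δ(x^a) ∏_j (x^a_j)^{s_a} ∮ ∏_{b<a} ∏_j dx^b_j / (2 π i x^b_j) (x^b_j)^{s_b}
∏_{b<a} Π(x^{b+1}, 1/x^b) Δ(x^b)` as a function of `x = x^a`, where the variables `x^b_j`
run over the circle of radius `ρ b`. -/
def nested (q t : ℝ) (D : RectDecomp) (ρ : ℕ → ℝ) : (a : ℕ) → (Fin (D.r a) → ℂ) → ℂ
  | 0, _ => 1
  | a + 1, x => weight q t x * (∏ j, x j ^ D.s (a + 1)) *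
      contour (ρ a) fun y : Fin (D.r a) → ℂ =>
        kernel q t x (fun j => (y j)⁻¹) * nested q t D ρ a y

/-- Radii of the contours: `ρ_1 > ρ_2 > ⋯ > ρ_N > 0`, so that `|x^{a+1}_i / x^a_j| < 1`. -/
def RectDecomp.Radii (D : RectDecomp) (ρ : ℕ → ℝ) : Prop :=
  (∀ a, 1 ≤ a → a ≤ D.N → 0 < ρ a) ∧ ∀ a, 1 ≤ a → a < D.N → ρ (a + 1) < ρ a

/-- `F^+_lam(x;q,t)`, where `D` is the rectangle decomposition of `lam`. -/
def FPlus (q t : ℝ) (D : RectDecomp) (ρ : ℕ → ℝ) (x : Fin (D.r D.N) → ℂ) : ℂ :=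
  constPlus q t D * nested q t D ρ D.N x

/-- `F^-_{lam'}(x;q,t)`, where `D` is the rectangle decomposition of `lam` and `lam'` is the
conjugate of `lam`. The parameters `q` and `t` are interchanged. -/
def FMinus (q t : ℝ) (D : RectDecomp) (ρ : ℕ → ℝ) (x : Fin (D.r D.N) → ℂ) : ℂ :=
  constMinus t q D * nested t q D ρ D.N x

/-! ### Bosons -/

/-- `n (1 - q^n) / (1 - t^n)`. -/
def oscCoeff {K : Type} [Field K] (q t : K) (n : ℕ+) : K :=
  ((n : ℕ) : K) * ((1 - q ^ (n : ℕ)) / (1 - t ^ (n : ℕ)))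

/-- The Fock space `R[a_{-1}, a_{-2}, …]|0⟩`; the letter `X n` is `a_{-n}`. -/
abbrev Fock (R : Type) [CommRing R] : Type := MvPolynomial ℕ+ R

/-- The dual Fock space `⟨0|R[a_1, a_2, …]`; the letter `X n` is `a_n`. -/
abbrev DualFock (R : Type) [CommRing R] : Type := MvPolynomial ℕ+ R

/-- The left action of the oscillator `a_n`, `n ≠ 0`, on the Fock space: `a_{-k}` is the
multiplication, and `a_k` is the derivation that kills `|0⟩` and satisfies
`[a_k, a_{-l}] = δ_{k,l} k (1 - q^k) / (1 - t^k)`, for `k, l > 0`. -/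
def osc {K : Type} [Field K] (R : Type) [CommRing R] [Algebra K R] (q t : K) (n : ℤ) :
    Module.End R (Fock R) :=
  if n < 0 then LinearMap.mulLeft R (MvPolynomial.X n.natAbs.toPNat')
  else if 0 < n then algebraMap K R (oscCoeff q t n.natAbs.toPNat') •
    (MvPolynomial.pderiv n.natAbs.toPNat').toLinearMap
  else 0

/-- The right action `⟨v| ↦ ⟨v|a_n` of the oscillator `a_n`, `n ≠ 0`, on the dual Fock space,
with the same commutation relations and with `⟨0|a_{-k} = 0` for `k > 0`. -/
def oscDual {K : Type} [Field K] (R : Type) [CommRing R] [Algebra K R] (q t : K) (n : ℤ) :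
    Module.End R (DualFock R) :=
  if 0 < n then LinearMap.mulLeft R (MvPolynomial.X n.natAbs.toPNat')
  else if n < 0 then algebraMap K R (oscCoeff q t n.natAbs.toPNat') •
    (MvPolynomial.pderiv n.natAbs.toPNat').toLinearMap
  else 0

/-- The exponential `∑ E^k v / k!` of a locally nilpotent operator. -/
def expOp (K : Type) [Field K] {V : Type} [AddCommGroup V] [Module K V] (E : V → V) (v : V) :
    V :=
  ∑ᶠ k : ℕ, ((k.factorial : K)⁻¹) • E^[k] v

/-- The action of `C(x) = exp (∑_{n ≥ 1} (1-t^n)/(1-q^n) (a_n/n) p_n)` on the Fock space with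
coefficients extended to functions of `x`; the sum over `n` is finite on every vector. -/
def opC {K : Type} [Field K] (q t : K) (v : Fock (MvPowerSeries ℕ K)) :
    Fock (MvPowerSeries ℕ K) :=
  expOp K (fun w => ∑ᶠ n : ℕ+,
    (((1 - t ^ (n : ℕ)) / (1 - q ^ (n : ℕ)) / ((n : ℕ) : K)) • powerSum K n) •
      osc (MvPowerSeries ℕ K) q t ((n : ℕ) : ℤ) w) v

/-- The right action of `C^*(x) = exp (∑_{n ≥ 1} (1-t^n)/(1-q^n) (a_{-n}/n) p_n)` on the dual
Fock space with coefficients extended to functions of `x`. -/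
def opCStar {K : Type} [Field K] (q t : K) (v : DualFock (MvPowerSeries ℕ K)) :
    DualFock (MvPowerSeries ℕ K) :=
  expOp K (fun w => ∑ᶠ n : ℕ+,
    (((1 - t ^ (n : ℕ)) / (1 - q ^ (n : ℕ)) / ((n : ℕ) : K)) • powerSum K n) •
      oscDual (MvPowerSeries ℕ K) q t (-((n : ℕ) : ℤ)) w) v

/-- `⟨0|C(x) A|0⟩` for an operator `A ∈ K[a_{-1}, a_{-2}, …]`. The vector `A|0⟩` is `A * 1`,
and `⟨0|v⟩` is the constant term of `v`. -/
def vevC {K : Type} [Field K] (q t : K) (A : MvPolynomial ℕ+ K) : MvPowerSeries ℕ K :=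
  MvPolynomial.constantCoeff
    (opC q t (MvPolynomial.map (algebraMap K (MvPowerSeries ℕ K)) A * 1))

/-- `⟨0|A C^*(x)|0⟩` for an operator `A ∈ K[a_1, a_2, …]`. The vector `⟨0|A` is `1 * A`,
and `⟨v|0⟩` is the constant term of `v`. -/
def vevCStar {K : Type} [Field K] (q t : K) (A : MvPolynomial ℕ+ K) : MvPowerSeries ℕ K :=
  MvPolynomial.constantCoeff
    (opCStar q t (1 * MvPolynomial.map (algebraMap K (MvPowerSeries ℕ K)) A))

/-- The operator `f̂ ∈ K[a_{-1}, a_{-2}, …]` with `⟨0|C(x) f̂|0⟩ = f(x)`. -/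
def hat {K : Type} [Field K] (q t : K) (f : MvPowerSeries ℕ K) : MvPolynomial ℕ+ K :=
  Function.invFun (vevC q t) f

/-- The operator `f̂^* ∈ K[a_1, a_2, …]` with `⟨0|f̂^* C^*(x)|0⟩ = f(x)`. -/
def hatStar {K : Type} [Field K] (q t : K) (f : MvPowerSeries ℕ K) : MvPolynomial ℕ+ K :=
  Function.invFun (vevCStar q t) f

/-! ### Vertex operators -/

/-- The formal series `exp (∑_{n ≥ 1} c_n b_n)` in commuting letters `b_n`. -/
def expLinear (c : ℕ+ → ℂ) : MvPowerSeries ℕ+ ℂ :=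
  (PowerSeries.exp ℂ).subst
    ((fun d => ∑ n ∈ d.support, if d = Finsupp.single n 1 then c n else 0 :
      MvPowerSeries ℕ+ ℂ))

/-- `∏_j exp (∑_{n ≥ 1} (1-t^n)/(1-q^n) (b_n/n) x_j^{-n})`, where `b_n` stands for
`a_{-n}` or for `a_n`. -/
def vertexPlus (q t : ℝ) {m : ℕ} (x : Fin m → ℂ) : MvPowerSeries ℕ+ ℂ :=
  ∏ j, expLinear fun n =>
    (1 - (t : ℂ) ^ (n : ℕ)) / (1 - (q : ℂ) ^ (n : ℕ)) * (1 / ((n : ℕ) : ℂ)) *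
      ((x j) ^ (n : ℕ))⁻¹

/-- `∏_j exp (-∑_{n ≥ 1} (b_n/n) (-x_j)^{-n})`, where `b_n` stands for `a_{-n}` or for
`a_n`. -/
def vertexMinus {m : ℕ} (x : Fin m → ℂ) : MvPowerSeries ℕ+ ℂ :=
  ∏ j, expLinear fun n => -((1 / ((n : ℕ) : ℂ)) * ((-(x j)) ^ (n : ℕ))⁻¹)

/-- The series in the letters `b_n` obtained by integrating `F(x) V(x)` over the torus
`|x_j| = ρ`, coefficient by coefficient. -/
def bosonContour {m : ℕ} (ρ : ℝ) (F : (Fin m → ℂ) → ℂ)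
    (V : (Fin m → ℂ) → MvPowerSeries ℕ+ ℂ) : MvPowerSeries ℕ+ ℂ :=
  fun d => contour ρ fun x => F x * MvPowerSeries.coeff d (V x)

/-- The coefficients of the polynomial `A` over `ℚ(q,t)` have no pole at the point `(q, t)`,
and `A` becomes the series `S` there. -/
def SpecializesTo (q t : ℝ) (A : MvPolynomial ℕ+ RatQT) (S : MvPowerSeries ℕ+ ℂ) : Prop :=
  ∀ d : ℕ+ →₀ ℕ, RegularAt q t (A.coeff d) ∧
    ratEval q t (A.coeff d) = MvPowerSeries.coeff d S

end MacdonaldBoson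

end

/-! Everything rests on one operator, `macOp q t⁻¹`, written in the power sums without reference to
a number of variables. In `n` variables it is Macdonald's `q`-difference operator (`psEval_macOp`).
It is triangular on the monomial functions for the dominance order, with eigenvalues `eps`, and it
is self-adjoint both for `⟨,⟩_{q,t}` (`form_macOp`) and for the torus product with weight `Δ`
(`torusForm_macOp`). For independent `q`, `t` the eigenvalues separate all partitions, so
interpolation in the operator yields eigenfunctions `macP` with (A) and (B), and such a family is
unique (`IsOrthoFamily.eq_of_isMacdonaldFamily`).

For `q, t ∈ (0,1)` the eigenvalues of two partitions comparable for dominance still differ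
(`eps_ne_of_dominates`), so no denominator of `macP` vanishes there. Orthogonality is transported to
numerical parameters: for `⟨,⟩_{q,t}` by evaluating an identity in the local ring of the point, for
the torus product by continuity in `t` (`torusForm_macC`).

Since `C(x)` translates `a_{-n}` by `p_n`, the operators `P̂_lam` and `P̂*_lam` are the expansion of
`P_lam` in the power sums (`vevC_eq`). What remains is that the integrals compute the coefficients
of this expansion. Two facts do this. (1) The kernel `Π` reproduces for `⟨,⟩_{q,t}` and `P_lam` is
orthogonal to the other `P_mu` for both products. Hence integrating `Π(x, 1/y) Δ(y) P_lam(y)` over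
`y` returns `P_lam(x)` times the ratio of the two norms (`contour_kernel_mul_macC`). (2) In exactly
`r` variables, multiplication by `(x_1 ⋯ x_r)^s` sends `P_lam` to `P` of `lam` plus the rectangle
`(s^r)` (`toFin_mac_boost`). Alternating them, the nested integral collapses to `Δ P_lam` times norm
ratios (`nested_eq`). The coefficient of `b^d` in the vertex operator is `p_d(1/x) / z_d`, so the
last integration extracts the coefficient of `p_d` in `P_lam`, and `C^+` cancels the norm ratios.

The second formula is the first for `lam'` with `q` and `t` interchanged, combined with the duality
that relates `P_lam(q,t)` to `P_{lam'}(t,q)` by a rescaling of the power sums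
(`IsOrthoFamily.dual`). -/

noncomputable section

namespace MacdonaldBoson

/-! ### Exponentials of integrals of power series -/

section NewtonExp

variable {R S : Type*} [CommRing R] [Algebra ℚ R] [CommRing S] [Algebra ℚ S]

/-- The coefficients of the solution of `y' = B y`, `y(0) = 1`. -/
def newtonCoeff (B : PowerSeries R) : ℕ → R
  | 0 => 1
  | k + 1 => ((k + 1 : ℚ)⁻¹) • ∑ i : Fin (k + 1),
      PowerSeries.coeff (k - i : ℕ) B * newtonCoeff B i

/-- The power series `exp (∫ B)`, i.e. the solution of `y' = B y`, `y(0) = 1`. -/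
def newtonExp (B : PowerSeries R) : PowerSeries R := PowerSeries.mk (newtonCoeff B)

theorem constantCoeff_newtonExp (B : PowerSeries R) :
    PowerSeries.constantCoeff (newtonExp B) = 1 := by
  simp [newtonExp, ← PowerSeries.coeff_zero_eq_constantCoeff_apply, newtonCoeff]

theorem derivative_newtonExp (B : PowerSeries R) :
    PowerSeries.derivative R (newtonExp B) = B * newtonExp B := by
  ext k
  rw [PowerSeries.coeff_derivative, newtonExp, PowerSeries.coeff_mk, newtonCoeff,
    PowerSeries.coeff_mul, Finset.Nat.sum_antidiagonal_eq_sum_range_succ_mk,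
    ← Finset.sum_range_reflect, Finset.sum_range]
  simp only [PowerSeries.coeff_mk]
  have h : ((k + 1 : ℕ) : R) = algebraMap ℚ R (k + 1) := by simp
  have h2 : ((k : R) + 1) = algebraMap ℚ R (k + 1) := by simp
  rw [h2, Algebra.smul_def, mul_right_comm, ← map_mul,
    inv_mul_cancel₀ (by positivity), map_one, one_mul]
  refine Finset.sum_congr rfl fun i _ => ?_
  have := i.2
  congr 3
  omega

theorem isAddTorsionFree_of_algebraRat : IsAddTorsionFree R :=
  IsAddTorsionFree.of_module_rat R

theorem newtonExp_zero : newtonExp (0 : PowerSeries R) = 1 := by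
  have := isAddTorsionFree_of_algebraRat (R := R)
  refine PowerSeries.derivative.ext ?_ ?_
  · rw [derivative_newtonExp]; simp
  · rw [constantCoeff_newtonExp]; simp

/-- Multiplication by `newtonExp (-B)` removes `B` from a logarithmic derivative (`key`). Hence
`newtonExp (B + C) * newtonExp (-B) * newtonExp (-C)` has derivative zero and constant term one. -/
theorem newtonExp_add (B C : PowerSeries R) :
    newtonExp (B + C) = newtonExp B * newtonExp C := by
  have := isAddTorsionFree_of_algebraRat (R := R)
  have key : ∀ B C : PowerSeries R, ∀ z : PowerSeries R,
      PowerSeries.derivative R z = (B + C) * z → PowerSeries.derivative R (z * newtonExp (-B))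
        = C * (z * newtonExp (-B)) := by
    intro B C z hz
    rw [Derivation.leibniz, hz, derivative_newtonExp, smul_eq_mul, smul_eq_mul]; ring
  have one : ∀ B : PowerSeries R, newtonExp B * newtonExp (-B) = 1 := by
    intro B
    refine PowerSeries.derivative.ext ?_ ?_
    · rw [key B 0 _ (by rw [derivative_newtonExp, add_zero])]; simp
    · simp [constantCoeff_newtonExp]
  have h : newtonExp (B + C) * newtonExp (-B) * newtonExp (-C) = 1 := by
    refine PowerSeries.derivative.ext ?_ ?_
    · rw [key C 0 _ (by rw [add_zero, key B C _ (derivative_newtonExp _)])]; simp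
    · simp [constantCoeff_newtonExp]
  calc newtonExp (B + C) = newtonExp (B + C) * (newtonExp B * newtonExp (-B)) *
        (newtonExp C * newtonExp (-C)) := by rw [one, one, mul_one, mul_one]
    _ = (newtonExp (B + C) * newtonExp (-B) * newtonExp (-C)) * (newtonExp B * newtonExp C) := by
        ring
    _ = _ := by rw [h, one_mul]

/-- The solutions of `z' = B z`. -/
theorem eq_newtonExp_of_derivative {B z : PowerSeries R}
    (hz : PowerSeries.derivative R z = B * z) :
    z = PowerSeries.C (PowerSeries.constantCoeff z) * newtonExp B := by
  have := isAddTorsionFree_of_algebraRat (R := R)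
  have h1 : newtonExp B * newtonExp (-B) = 1 := by
    rw [← newtonExp_add, add_neg_cancel, newtonExp_zero]
  have h : z * newtonExp (-B) = PowerSeries.C (PowerSeries.constantCoeff z) := by
    refine PowerSeries.derivative.ext ?_ ?_
    · rw [Derivation.leibniz, hz, derivative_newtonExp, smul_eq_mul, smul_eq_mul,
        PowerSeries.derivative_C]; ring
    · simp [constantCoeff_newtonExp]
  rw [← h, mul_assoc, mul_comm (newtonExp (-B)), h1, mul_one]

theorem newtonExp_unique {B z : PowerSeries R} (hz : PowerSeries.derivative R z = B * z)
    (h0 : PowerSeries.constantCoeff z = 1) : z = newtonExp B := by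
  rw [eq_newtonExp_of_derivative hz, h0, map_one, one_mul]

theorem newtonExp_sum {ι : Type*} (s : Finset ι) (B : ι → PowerSeries R) :
    newtonExp (∑ i ∈ s, B i) = ∏ i ∈ s, newtonExp (B i) := by
  classical
  induction s using Finset.induction_on with
  | empty => simp [newtonExp_zero]
  | insert a s ha ih => rw [Finset.sum_insert ha, Finset.prod_insert ha, newtonExp_add, ih]

theorem map_newtonExp (φ : R →+* S) (B : PowerSeries R) :
    PowerSeries.map φ (newtonExp B) = newtonExp (PowerSeries.map φ B) := by
  refine newtonExp_unique ?_ ?_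
  · rw [← map_mul, ← derivative_newtonExp]
    ext k
    simp [PowerSeries.coeff_derivative]
  · rw [← PowerSeries.coeff_zero_eq_constantCoeff_apply, PowerSeries.coeff_map,
      PowerSeries.coeff_zero_eq_constantCoeff_apply, constantCoeff_newtonExp, map_one]

theorem coeff_newtonExp_succ (B : PowerSeries R) (k : ℕ) :
    PowerSeries.coeff (k + 1) (newtonExp B) * ((k : R) + 1) =
      ∑ x ∈ Finset.HasAntidiagonal.antidiagonal k, PowerSeries.coeff x.1 B * PowerSeries.coeff x.2 (newtonExp B) := by
  rw [← PowerSeries.coeff_derivative, derivative_newtonExp, PowerSeries.coeff_mul]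

/-- `exp (∑ a^n u^n / n) = 1 / (1 - a u)`. -/
theorem newtonExp_geom_mul (a : R) :
    newtonExp (PowerSeries.mk fun n => a ^ (n + 1)) * (1 - PowerSeries.C a * PowerSeries.X) = 1 := by
  have := isAddTorsionFree_of_algebraRat (R := R)
  have h : (PowerSeries.mk fun n => a ^ (n + 1)) * (1 - PowerSeries.C a * PowerSeries.X) =
      PowerSeries.C a := by
    ext n
    rw [mul_sub, mul_one, map_sub, mul_comm (PowerSeries.C a), ← mul_assoc, PowerSeries.coeff_mul_C,
      PowerSeries.coeff_mk, PowerSeries.coeff_C]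
    cases n with
    | zero => simp
    | succ n => simp [pow_succ]
  refine PowerSeries.derivative.ext ?_ ?_
  · have : PowerSeries.derivative R (1 - PowerSeries.C a * PowerSeries.X) = - PowerSeries.C a := by
      simp [Derivation.leibniz]
    rw [Derivation.leibniz, derivative_newtonExp, smul_eq_mul, smul_eq_mul, this, ← mul_assoc,
      mul_comm _ (PowerSeries.mk _), h]
    simp [mul_comm]
  · simp [constantCoeff_newtonExp]

theorem newtonExp_geom (a : R) :
    newtonExp (PowerSeries.mk fun n => a ^ (n + 1)) = PowerSeries.mk fun n => a ^ n := by
  have h : (PowerSeries.mk fun n => a ^ n) * (1 - PowerSeries.C a * PowerSeries.X) = 1 := by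
    ext n
    rw [mul_sub, mul_one, map_sub, mul_comm (PowerSeries.C a), ← mul_assoc, PowerSeries.coeff_mul_C,
      PowerSeries.coeff_mk]
    cases n with
    | zero => simp
    | succ n => simp [pow_succ, PowerSeries.coeff_one]
  calc _ = newtonExp (PowerSeries.mk fun n => a ^ (n + 1)) *
        ((PowerSeries.mk fun n => a ^ n) * (1 - PowerSeries.C a * PowerSeries.X)) := by
        rw [h, mul_one]
    _ = (PowerSeries.mk fun n => a ^ n) * (newtonExp (PowerSeries.mk fun n => a ^ (n + 1)) *
        (1 - PowerSeries.C a * PowerSeries.X)) := by ring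
    _ = _ := by rw [newtonExp_geom_mul, mul_one]

theorem newtonExp_neg_geom (a : R) :
    newtonExp (PowerSeries.mk fun n => -a ^ (n + 1)) = 1 - PowerSeries.C a * PowerSeries.X := by
  have h : newtonExp (PowerSeries.mk fun n => -a ^ (n + 1)) *
      newtonExp (PowerSeries.mk fun n => a ^ (n + 1)) = 1 := by
    rw [← newtonExp_add, ← newtonExp_zero]
    congr 1
    ext n
    simp
  calc _ = newtonExp (PowerSeries.mk fun n => -a ^ (n + 1)) *
        (newtonExp (PowerSeries.mk fun n => a ^ (n + 1)) *
        (1 - PowerSeries.C a * PowerSeries.X)) := by rw [newtonExp_geom_mul, mul_one]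
    _ = _ := by rw [← mul_assoc, h, one_mul]

end NewtonExp

/-! ### Shifts of the power sums, generating functions and the bilinear form -/

section Shift

variable {R : Type} [CommRing R]

/-- The substitution `p_n ↦ p_n + γ_n u^n`. -/
def shift (γ : ℕ+ → R) : MvPolynomial ℕ+ R →ₐ[R] Polynomial (MvPolynomial ℕ+ R) :=
  MvPolynomial.aeval fun n => Polynomial.C (MvPolynomial.X n) +
    Polynomial.C (MvPolynomial.C (γ n)) * Polynomial.X ^ (n : ℕ)

theorem shift_X (γ : ℕ+ → R) (n : ℕ+) : shift γ (MvPolynomial.X n) =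
    Polynomial.C (MvPolynomial.X n) +
      Polynomial.C (MvPolynomial.C (γ n)) * Polynomial.X ^ (n : ℕ) := by
  simp [shift]

theorem shift_C (γ : ℕ+ → R) (a : R) :
    shift γ (MvPolynomial.C a) = Polynomial.C (MvPolynomial.C a) := by
  simp [shift]

theorem coeff_shift_X_mul (γ : ℕ+ → R) (m : ℕ+) (F : MvPolynomial ℕ+ R) (k : ℕ) :
    (shift γ (MvPolynomial.X m * F)).coeff k = MvPolynomial.X m * (shift γ F).coeff k +
      if (m : ℕ) ≤ k then MvPolynomial.C (γ m) * (shift γ F).coeff (k - m) else 0 := by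
  rw [map_mul, shift_X, add_mul, Polynomial.coeff_add, Polynomial.coeff_C_mul, mul_assoc,
    Polynomial.coeff_C_mul, Polynomial.coeff_X_pow_mul']
  split_ifs <;> simp

theorem coeff_zero_shift (γ : ℕ+ → R) (F : MvPolynomial ℕ+ R) :
    (shift γ F).coeff 0 = F := by
  induction F using MvPolynomial.induction_on with
  | C a => simp
  | add p q hp hq => rw [map_add, Polynomial.coeff_add, hp, hq]
  | mul_X p n hp => rw [mul_comm, coeff_shift_X_mul, hp, if_neg (by simp), add_zero]

/-- Replacing `u` by `s u` multiplies `γ_n u^n` by `s^n`. -/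
theorem coeff_shift_scale (s : R) (k : ℕ) (γ : ℕ+ → R)
    (F : MvPolynomial ℕ+ R) :
    (shift (fun n => s ^ (n : ℕ) * γ n) F).coeff k = s ^ k • (shift γ F).coeff k := by
  induction F using MvPolynomial.induction_on generalizing k with
  | C a =>
    rw [shift_C, shift_C, Polynomial.coeff_C]
    split_ifs with h
    · simp [h]
    · simp
  | add p q hp hq => simp only [map_add, Polynomial.coeff_add, hp, hq, smul_add]
  | mul_X p m hp =>
    rw [mul_comm, coeff_shift_X_mul, coeff_shift_X_mul, hp, smul_add]
    congr 1
    · rw [mul_smul_comm]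
    · split_ifs with h
      · rw [hp, MvPolynomial.smul_eq_C_mul, MvPolynomial.smul_eq_C_mul]
        have : s ^ k = s ^ (m : ℕ) * s ^ (k - m) := by rw [← pow_add]; congr 1; omega
        rw [this]; simp only [map_mul, map_pow]; ring
      · simp

variable [Algebra ℚ R]

/-- The logarithmic derivative `∑ β_n p_n u^{n-1}`. -/
def logSeries (β : ℕ+ → R) : PowerSeries (MvPolynomial ℕ+ R) :=
  PowerSeries.mk fun n => MvPolynomial.C (β n.succPNat) * MvPolynomial.X n.succPNat

/-- The generating function `exp (∑ β_n p_n u^n / n)`. -/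
def genSeries (β : ℕ+ → R) : PowerSeries (MvPolynomial ℕ+ R) := newtonExp (logSeries β)

/-- For `y = exp (∑ β_n p_n u^n / n)` this is `m ∂y/∂p_m = β_m u^m y`, read off at `u^k`. The
difference `w` of the two sides solves the same linear equation `w' = B w` as `y`, with initial
value zero, so it vanishes. -/
theorem pderiv_genSeries (β : ℕ+ → R) (m : ℕ+) (k : ℕ) :
    MvPolynomial.C ((m : ℕ) : R) * MvPolynomial.pderiv m (PowerSeries.coeff k (genSeries β)) =
      if (m : ℕ) ≤ k then MvPolynomial.C (β m) * PowerSeries.coeff (k - m) (genSeries β) else 0 := by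
  set B := logSeries β with hB
  set y := genSeries β with hy
  -- the termwise derivation
  set D : PowerSeries (MvPolynomial ℕ+ R) → PowerSeries (MvPolynomial ℕ+ R) := fun f =>
    PowerSeries.mk fun k => MvPolynomial.pderiv m (PowerSeries.coeff k f) with hD
  have hDmul : ∀ f g, D (f * g) = D f * g + f * D g := by
    intro f g
    ext1 k
    simp only [hD, PowerSeries.coeff_mk, PowerSeries.coeff_mul, map_sum, Derivation.leibniz,
      map_add, smul_eq_mul]
    rw [← Finset.sum_add_distrib]
    exact Finset.sum_congr rfl fun _ _ => by ring
  have hDder : PowerSeries.derivative _ (D y) = D (PowerSeries.derivative _ y) := by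
    ext1 k
    simp only [hD, PowerSeries.coeff_mk, PowerSeries.coeff_derivative]
    rw [Derivation.leibniz, show ((k : MvPolynomial ℕ+ R) + 1) = ((k + 1 : ℕ) : MvPolynomial ℕ+ R) by
      push_cast; rfl, Derivation.map_natCast]
    simp [mul_comm]
  have hDB : D B = PowerSeries.C (MvPolynomial.C (β m)) * PowerSeries.X ^ ((m : ℕ) - 1) := by
    ext1 k
    simp only [hD, hB, logSeries, PowerSeries.coeff_mk, PowerSeries.coeff_C_mul,
      PowerSeries.coeff_X_pow, MvPolynomial.pderiv_C_mul]
    by_cases h : k.succPNat = m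
    · subst h
      simp
    · have h' : k ≠ (m : ℕ) - 1 := by
        intro h'
        apply h
        apply PNat.eq
        have := m.pos
        rw [Nat.succPNat_coe]; omega
      rw [MvPolynomial.pderiv_X_of_ne h, if_neg h', mul_zero, mul_zero]
  have hM : ∀ c : PowerSeries (MvPolynomial ℕ+ R), ∀ j : ℕ, c * PowerSeries.X ^ j = PowerSeries.X ^ j * c :=
    fun _ _ => mul_comm _ _
  set w := PowerSeries.C (MvPolynomial.C ((m : ℕ) : R)) * D y -
    PowerSeries.C (MvPolynomial.C (β m)) * PowerSeries.X ^ (m : ℕ) * y with hw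
  have hw0 : PowerSeries.constantCoeff w = 0 := by
    rw [hw, map_sub, map_mul, map_mul, map_mul, map_pow, PowerSeries.constantCoeff_X,
      zero_pow m.ne_zero]
    have : PowerSeries.constantCoeff (D y) = 0 := by
      rw [← PowerSeries.coeff_zero_eq_constantCoeff_apply, hD, PowerSeries.coeff_mk,
        PowerSeries.coeff_zero_eq_constantCoeff_apply, hy, genSeries, constantCoeff_newtonExp,
        Derivation.map_one_eq_zero]
    rw [this]; simp
  have hmm : ((m : ℕ) : MvPolynomial ℕ+ R) = MvPolynomial.C ((m : ℕ) : R) := by simp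
  -- The two inhomogeneous terms, both `m β_m u^(m-1) y`, cancel.
  have hw1 : PowerSeries.derivative _ w = B * w := by
    have e1 : PowerSeries.derivative _ y = B * y := derivative_newtonExp _
    rw [hw, map_sub, Derivation.leibniz, Derivation.leibniz, Derivation.leibniz, hDder, e1, hDmul, hDB,
      PowerSeries.derivative_C, PowerSeries.derivative_C, PowerSeries.derivative_pow,
      PowerSeries.derivative_X]
    simp only [smul_eq_mul, map_natCast]
    ring
  have hw2 : w = 0 := by
    rw [eq_newtonExp_of_derivative hw1, hw0, map_zero, zero_mul]
  have := congrArg (PowerSeries.coeff k) hw2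
  rw [hw, map_sub, mul_assoc, PowerSeries.coeff_C_mul, PowerSeries.coeff_C_mul, map_zero,
    sub_eq_zero, hD, PowerSeries.coeff_mk, PowerSeries.coeff_X_pow_mul'] at this
  rw [this]
  split_ifs <;> simp

end Shift

/-! ### The bilinear form on the power sums and the self-adjointness of the Macdonald operator. -/

section Form

variable {R : Type} [CommRing R]

/-- `∏ o_n^{m_n} m_n!`. -/
def normFactor (o : ℕ+ → R) (m : ℕ+ →₀ ℕ) : R := m.prod fun n k => o n ^ k * (k.factorial : R)

/-- The bilinear form on polynomials in the power sums with
`⟨p_m, p_m'⟩ = δ_{m m'} ∏ o_n^{m_n} m_n!`. -/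
def form (o : ℕ+ → R) (F G : MvPolynomial ℕ+ R) : R :=
  ∑ m ∈ F.support, F.coeff m * G.coeff m * normFactor o m

theorem form_eq_sum (o : ℕ+ → R) (F G : MvPolynomial ℕ+ R) {s : Finset (ℕ+ →₀ ℕ)}
    (hs : F.support ⊆ s) : form o F G = ∑ m ∈ s, F.coeff m * G.coeff m * normFactor o m := by
  refine Finset.sum_subset hs fun m _ hm => ?_
  rw [MvPolynomial.notMem_support_iff.mp hm]; ring

theorem form_comm (o : ℕ+ → R) (F G : MvPolynomial ℕ+ R) : form o F G = form o G F := by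
  classical
  rw [form_eq_sum o F G (Finset.subset_union_left (s₂ := G.support)),
    form_eq_sum o G F (Finset.subset_union_right (s₁ := F.support))]
  exact Finset.sum_congr rfl fun _ _ => by ring

theorem form_add_right (o : ℕ+ → R) (F G H : MvPolynomial ℕ+ R) :
    form o F (G + H) = form o F G + form o F H := by
  simp only [form, MvPolynomial.coeff_add, mul_add, add_mul, Finset.sum_add_distrib]

theorem form_smul_right (o : ℕ+ → R) (a : R) (F G : MvPolynomial ℕ+ R) :
    form o F (a • G) = a * form o F G := by
  simp only [form, MvPolynomial.coeff_smul, Finset.mul_sum, smul_eq_mul]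
  exact Finset.sum_congr rfl fun _ _ => by ring

theorem form_add_left (o : ℕ+ → R) (F G H : MvPolynomial ℕ+ R) :
    form o (F + G) H = form o F H + form o G H := by
  rw [form_comm, form_add_right, form_comm, form_comm o H]

theorem form_smul_left (o : ℕ+ → R) (a : R) (F G : MvPolynomial ℕ+ R) :
    form o (a • F) G = a * form o F G := by
  rw [form_comm, form_smul_right, form_comm]

/-- The form as a bilinear map. -/
def formL (o : ℕ+ → R) : MvPolynomial ℕ+ R →ₗ[R] MvPolynomial ℕ+ R →ₗ[R] R :=
  LinearMap.mk₂ R (form o) (form_add_left o) (form_smul_left o) (form_add_right o)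
    (form_smul_right o)

theorem formL_apply (o : ℕ+ → R) (F G : MvPolynomial ℕ+ R) : formL o F G = form o F G := rfl

theorem form_monomial_left (o : ℕ+ → R) (d : ℕ+ →₀ ℕ) (a : R) (G : MvPolynomial ℕ+ R) :
    form o (MvPolynomial.monomial d a) G = a * G.coeff d * normFactor o d := by
  classical
  rw [form_eq_sum o _ G (MvPolynomial.support_monomial_subset), Finset.sum_singleton,
    MvPolynomial.coeff_monomial, if_pos rfl]

theorem normFactor_add_single (o : ℕ+ → R) (d : ℕ+ →₀ ℕ) (n : ℕ+) :
    normFactor o (d + Finsupp.single n 1) = normFactor o d * (o n * ((d n : R) + 1)) := by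
  classical
  have hne : ∀ i ∈ (insert n d.support).erase n, (d + Finsupp.single n 1 : ℕ+ →₀ ℕ) i = d i := by
    intro i hi
    rw [Finsupp.add_apply, Finsupp.single_eq_of_ne (Finset.ne_of_mem_erase hi), add_zero]
  have h1 : (d + Finsupp.single n 1).support ⊆ insert n d.support := by
    intro i hi
    by_contra hc
    rw [Finset.mem_insert, not_or, Finsupp.notMem_support_iff] at hc
    apply Finsupp.mem_support_iff.mp hi
    rw [Finsupp.add_apply, hc.2, Finsupp.single_eq_of_ne hc.1, add_zero]
  rw [normFactor, normFactor, Finsupp.prod_of_support_subset _ h1 _ (by simp),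
    Finsupp.prod_of_support_subset d (Finset.subset_insert n _) _ (by simp),
    ← Finset.mul_prod_erase _ _ (Finset.mem_insert_self n _),
    ← Finset.mul_prod_erase _ _ (Finset.mem_insert_self n _),
    Finset.prod_congr rfl fun i hi => by rw [hne i hi]]
  rw [Finsupp.add_apply, Finsupp.single_eq_same, Nat.factorial_succ, pow_succ]
  push_cast
  ring

/-- The factor `o n * (d n + 1)` gained by `normFactor` when `d n` grows by one splits into the
scalar `o n` and the exponent produced by differentiation. -/
theorem form_X_mul_left (o : ℕ+ → R) (n : ℕ+) (F G : MvPolynomial ℕ+ R) :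
    form o (MvPolynomial.X n * F) G = form o F (MvPolynomial.C (o n) * MvPolynomial.pderiv n G) := by
  induction F using MvPolynomial.induction_on' with
  | monomial d a =>
    rw [MvPolynomial.X, MvPolynomial.monomial_mul, form_monomial_left, form_monomial_left,
      add_comm, normFactor_add_single, MvPolynomial.coeff_C_mul, MvPolynomial.coeff_pderiv]
    ring
  | add p q hp hq => rw [mul_add, form_add_left, form_add_left, hp, hq]

theorem form_C_right (o : ℕ+ → R) (F : MvPolynomial ℕ+ R) (a : R) :
    form o F (MvPolynomial.C a) = a * MvPolynomial.constantCoeff F := by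
  rw [form_comm, MvPolynomial.C_apply, form_monomial_left, normFactor, Finsupp.prod_zero_index,
    mul_one]; rfl

variable [Algebra ℚ R]

theorem constantCoeff_genSeries (β : ℕ+ → R) (k : ℕ) :
    MvPolynomial.constantCoeff (PowerSeries.coeff k (genSeries β)) = if k = 0 then 1 else 0 := by
  have h := map_newtonExp (MvPolynomial.constantCoeff (σ := ℕ+) (R := R)) (logSeries β)
  have h0 : PowerSeries.map (MvPolynomial.constantCoeff (σ := ℕ+) (R := R)) (logSeries β) = 0 := by
    ext n; simp [logSeries]
  rw [h0, newtonExp_zero] at h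
  have := congrArg (PowerSeries.coeff k) h
  rwa [PowerSeries.coeff_map, PowerSeries.coeff_one] at this

/-- Multiplication by the coefficients of `exp (∑ β_n p_n u^n / n)` is adjoint to the shift
`p_n ↦ p_n + (o_n β_n / n) u^n`. -/
theorem form_genSeries_mul (o β γ : ℕ+ → R) (hγ : ∀ n : ℕ+, o n * β n = ((n : ℕ) : R) * γ n)
    (F G : MvPolynomial ℕ+ R) (k : ℕ) :
    form o (PowerSeries.coeff k (genSeries β) * F) G = form o F ((shift γ G).coeff k) := by
  induction G using MvPolynomial.induction_on generalizing F k with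
  | C a =>
    rw [form_C_right, shift_C, Polynomial.coeff_C, map_mul, constantCoeff_genSeries]
    split_ifs
    · rw [form_C_right]; ring
    · rw [form_comm]; simp [form]
  | add p q hp hq => rw [form_add_right, hp, hq, map_add, Polynomial.coeff_add, form_add_right]
  -- Moved to the left, `p_m` becomes `o_m ∂/∂p_m`. By the Leibniz rule it falls either on `F`,
  -- which gives the unshifted term, or on the generating function, where `pderiv_genSeries` lowers
  -- the index by `m` and gives the term with `γ_m u^m`.
  | mul_X p m hp =>
    rw [mul_comm p, coeff_shift_X_mul, form_add_right, form_comm, form_X_mul_left,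
      Derivation.leibniz, form_comm o F, form_X_mul_left, ← form_comm, form_comm o _ (_ * _), smul_eq_mul,
      smul_eq_mul, mul_add, form_add_left]
    have e1 : MvPolynomial.C (o m) * (PowerSeries.coeff k (genSeries β) *
        MvPolynomial.pderiv m F) = PowerSeries.coeff k (genSeries β) *
          (MvPolynomial.C (o m) * MvPolynomial.pderiv m F) := by ring
    rw [e1, hp, form_comm o _ ((shift γ p).coeff k), add_right_inj]
    have hm : algebraMap ℚ R ((m : ℕ) : ℚ)⁻¹ * ((m : ℕ) : R) = 1 := by
      rw [← map_natCast (algebraMap ℚ R), ← map_mul, inv_mul_cancel₀ (by simp), map_one]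
    have e2 : MvPolynomial.C (o m) * (F * MvPolynomial.pderiv m (PowerSeries.coeff k (genSeries β)))
        = if (m : ℕ) ≤ k then MvPolynomial.C (γ m) * (PowerSeries.coeff (k - m) (genSeries β) * F)
          else 0 := by
      calc _ = MvPolynomial.C (algebraMap ℚ R ((m : ℕ) : ℚ)⁻¹ * o m) * F *
            (MvPolynomial.C ((m : ℕ) : R) *
              MvPolynomial.pderiv m (PowerSeries.coeff k (genSeries β))) := by
            nth_rw 1 [← one_mul (o m)]
            rw [← hm]; simp only [map_mul]; ring
        _ = _ := by
            rw [pderiv_genSeries]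
            split_ifs
            · have : algebraMap ℚ R ((m : ℕ) : ℚ)⁻¹ * o m * β m = γ m := by
                rw [mul_assoc, hγ, ← mul_assoc, hm, one_mul]
              rw [← this]; simp only [map_mul]; ring
            · rw [mul_zero]
    rw [e2]
    split_ifs
    · rw [← MvPolynomial.smul_eq_C_mul, ← MvPolynomial.smul_eq_C_mul, form_smul_left, hp,
        form_smul_right]
    · simp [form]

/-- The Macdonald operator `∑ Q_k U_k`, where `∑ Q_k u^k = exp (∑ (1 - s^n) p_n u^n / n)` and
`∑ U_k u^k` is the shift `p_n ↦ p_n + (q^n - 1) u^n`. -/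
def macOp (q s : R) : MvPolynomial ℕ+ R →ₗ[R] MvPolynomial ℕ+ R where
  toFun F := (shift (fun n => q ^ (n : ℕ) - 1) F).sum fun k a =>
    PowerSeries.coeff k (genSeries fun n : ℕ+ => 1 - s ^ (n : ℕ)) * a
  map_add' F G := by
    rw [map_add, Polynomial.sum_add_index] <;> intros <;> simp [mul_add]
  map_smul' a F := by
    rw [map_smul, Polynomial.sum_def, Polynomial.sum_def, Finset.smul_sum]
    rw [Finset.sum_subset (Polynomial.support_smul a _)]
    · simp
    · intro x _ hx
      rw [Polynomial.notMem_support_iff.mp hx, mul_zero]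

theorem macOp_eq_sum (q s : R) (F : MvPolynomial ℕ+ R) {N : ℕ}
    (hN : (shift (fun n => q ^ (n : ℕ) - 1) F).natDegree < N) :
    macOp q s F = ∑ k ∈ Finset.range N,
      PowerSeries.coeff k (genSeries fun n : ℕ+ => 1 - s ^ (n : ℕ)) *
        (shift (fun n => q ^ (n : ℕ) - 1) F).coeff k :=
  Polynomial.sum_over_range' _ (fun _ => mul_zero _) _ hN

/-- The Macdonald operator is self-adjoint. -/
theorem form_macOp (q s : R) (o : ℕ+ → R)
    (ho : ∀ n : ℕ+, o n * (1 - s ^ (n : ℕ)) = ((n : ℕ) : R) * (s ^ (n : ℕ) * (q ^ (n : ℕ) - 1)))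
    (F G : MvPolynomial ℕ+ R) : form o (macOp q s F) G = form o F (macOp q s G) := by
  set N := (shift (fun n => q ^ (n : ℕ) - 1) F).natDegree +
    (shift (fun n => q ^ (n : ℕ) - 1) G).natDegree + 1
  -- By `ho`, the adjoint of multiplication by `Q_k` is `s^k U_k`. So the form is `∑ s^k ⟨U_k F, U_k
  -- G⟩`, which is symmetric in `F` and `G`.
  have key : ∀ F G : MvPolynomial ℕ+ R, (shift (fun n => q ^ (n : ℕ) - 1) F).natDegree < N →
      form o (macOp q s F) G = ∑ k ∈ Finset.range N, s ^ k *
        form o ((shift (fun n => q ^ (n : ℕ) - 1) F).coeff k)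
          ((shift (fun n => q ^ (n : ℕ) - 1) G).coeff k) := by
    intro F G h
    rw [macOp_eq_sum q s F h, ← formL_apply, map_sum, LinearMap.sum_apply]
    refine Finset.sum_congr rfl fun k _ => ?_
    rw [formL_apply, form_genSeries_mul o _ _ ho, coeff_shift_scale s, form_smul_right]
  rw [key F G (by omega), form_comm, key G F (by omega)]
  exact Finset.sum_congr rfl fun _ _ => by rw [form_comm]

end Form

/-! ### Exponents and partitions -/

/-- The multiset of the nonzero exponents. -/
def parts (d : ℕ →₀ ℕ) : Multiset ℕ := d.support.val.map d

theorem parts_eq_erase (d : ℕ →₀ ℕ) (i : ℕ) :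
    parts d = (if d i = 0 then 0 else {d i}) + parts (d.erase i) := by
  classical
  have h : parts (d.erase i) = (d.support.erase i).val.map d := by
    rw [parts, Finsupp.support_erase]
    refine Multiset.map_congr (by congr) fun j hj => ?_
    rw [Finsupp.erase_ne (Finset.ne_of_mem_erase hj)]
  rw [h]
  split_ifs with h0
  · rw [Finset.erase_eq_of_notMem (by simpa using h0), zero_add, parts]
  · have hi : i ∈ d.support := Finsupp.mem_support_iff.mpr h0
    conv_lhs => rw [parts, ← Finset.insert_erase hi, Finset.insert_val_of_notMem
      (Finset.notMem_erase i _), Multiset.map_cons]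
    rfl

theorem erase_sub_single (d : ℕ →₀ ℕ) (i n : ℕ) :
    (d - Finsupp.single i n).erase i = d.erase i := by
  ext j
  by_cases h : j = i
  · subst h; simp
  · simp [Finsupp.erase_ne h, Finsupp.single_eq_of_ne h]

theorem parts_sub_single (d : ℕ →₀ ℕ) (i n : ℕ) :
    parts (d - Finsupp.single i n) =
      (if d i - n = 0 then 0 else {d i - n}) + parts (d.erase i) := by
  rw [parts_eq_erase _ i, erase_sub_single]
  simp

theorem pos_of_mem_parts {d : ℕ →₀ ℕ} {a : ℕ} (h : a ∈ parts d) : 0 < a := by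
  obtain ⟨i, hi, rfl⟩ := Multiset.mem_map.mp h
  exact Nat.pos_of_ne_zero (Finsupp.mem_support_iff.mp hi)

theorem rowLen_ne_zero_iff (lam : YoungDiagram) (i : ℕ) :
    lam.rowLen i ≠ 0 ↔ i < lam.colLen 0 := by
  rw [← YoungDiagram.mem_iff_lt_colLen, YoungDiagram.mem_iff_lt_rowLen, Nat.pos_iff_ne_zero]

/-- The exponent vector of a partition. -/
def expo (lam : YoungDiagram) : ℕ →₀ ℕ :=
  Finsupp.onFinset (Finset.range (lam.colLen 0)) lam.rowLen fun i hi =>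
    Finset.mem_range.mpr ((rowLen_ne_zero_iff lam i).mp hi)

theorem expo_apply (lam : YoungDiagram) (i : ℕ) : expo lam i = lam.rowLen i := rfl

theorem parts_expo (lam : YoungDiagram) : parts (expo lam) = (lam.rowLens : Multiset ℕ) := by
  have : (expo lam).support = Finset.range (lam.colLen 0) := by
    ext i
    rw [Finsupp.mem_support_iff, expo_apply, rowLen_ne_zero_iff, Finset.mem_range]
  rw [parts, this]
  rfl

theorem rowLens_injective {lam mu : YoungDiagram}
    (h : (lam.rowLens : Multiset ℕ) = (mu.rowLens : Multiset ℕ)) : lam = mu := by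
  have h2 : lam.rowLens = mu.rowLens :=
    (Multiset.coe_eq_coe.mp h).eq_of_sortedGE lam.rowLens_sorted mu.rowLens_sorted
  apply YoungDiagram.equivListRowLens.injective
  exact Subtype.ext h2

theorem exists_rowLens_eq (M : Multiset ℕ) (hM : ∀ a ∈ M, 0 < a) :
    ∃ lam : YoungDiagram, (lam.rowLens : Multiset ℕ) = M := by
  have hp : ∀ x ∈ M.sort (· ≥ ·), 0 < x := fun x hx => hM x ((Multiset.mem_sort _).mp hx)
  have hs : (M.sort (· ≥ ·)).SortedGE := (Multiset.pairwise_sort M _).sortedGE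
  refine ⟨YoungDiagram.ofRowLens _ hs, ?_⟩
  rw [YoungDiagram.rowLens_ofRowLens_eq_self hp, Multiset.sort_eq]

theorem ext_rowLen {lam mu : YoungDiagram} (h : ∀ i, lam.rowLen i = mu.rowLen i) : lam = mu := by
  ext ⟨i, j⟩
  rw [YoungDiagram.mem_cells, YoungDiagram.mem_cells, YoungDiagram.mem_iff_lt_rowLen,
    YoungDiagram.mem_iff_lt_rowLen, h]

theorem card_filter_fst_lt (lam : YoungDiagram) (k : ℕ) :
    (lam.cells.filter fun c => c.1 < k).card = ∑ i ∈ Finset.range k, lam.rowLen i := by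
  rw [Finset.card_eq_sum_card_fiberwise (f := Prod.fst) (t := Finset.range k)]
  · refine Finset.sum_congr rfl fun i hi => ?_
    rw [YoungDiagram.rowLen_eq_card]
    congr 1
    ext ⟨a, b⟩
    simp only [Finset.mem_filter, YoungDiagram.row]
    rw [Finset.mem_range] at hi
    constructor
    · rintro ⟨⟨h1, _⟩, h3⟩; exact ⟨h1, h3⟩
    · rintro ⟨h1, h3⟩; exact ⟨⟨h1, by rw [show a = i from h3]; exact hi⟩, h3⟩
  · intro c hc
    simpa using (Finset.mem_filter.mp (Finset.mem_coe.mp hc)).2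

theorem fst_lt_card {lam : YoungDiagram} {c : ℕ × ℕ} (hc : c ∈ lam.cells) : c.1 < lam.card := by
  have h : (Finset.range (c.1 + 1)).image (fun i => (i, c.2)) ⊆ lam.cells := by
    intro x hx
    obtain ⟨i, hi, rfl⟩ := Finset.mem_image.mp hx
    rw [Finset.mem_range] at hi
    exact lam.isLowerSet (Prod.mk_le_mk.mpr ⟨by omega, le_rfl⟩) hc
  have := Finset.card_le_card h
  rw [Finset.card_image_of_injective _ (fun a b h => (Prod.mk.inj h).1), Finset.card_range] at this
  exact this

theorem sum_rowLen_range {lam : YoungDiagram} {k : ℕ} (hk : lam.colLen 0 ≤ k) :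
    ∑ i ∈ Finset.range k, lam.rowLen i = lam.card := by
  rw [← card_filter_fst_lt, Finset.filter_true_of_mem]
  rintro ⟨i, j⟩ hc
  have h0 : (i, 0) ∈ lam := lam.isLowerSet (Prod.mk_le_mk.mpr ⟨le_rfl, Nat.zero_le j⟩) hc
  exact (YoungDiagram.mem_iff_lt_colLen.mp h0).trans_le hk

theorem colLen_le_card (lam : YoungDiagram) : lam.colLen 0 ≤ lam.card := by
  by_contra h
  have : (lam.card, 0) ∈ lam := YoungDiagram.mem_iff_lt_colLen.mpr (not_le.mp h)
  exact lt_irrefl _ (fst_lt_card this)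

theorem sum_rowLens (lam : YoungDiagram) : (lam.rowLens : Multiset ℕ).sum = lam.card := by
  rw [← sum_rowLen_range le_rfl, YoungDiagram.rowLens, Multiset.sum_coe]
  rfl

theorem card_transpose (lam : YoungDiagram) : lam.transpose.card = lam.card := by
  simp [YoungDiagram.card, YoungDiagram.transpose]

theorem finite_card_eq (N : ℕ) : {lam : YoungDiagram | lam.card = N}.Finite := by
  let f : {lam : YoungDiagram | lam.card = N} → Nat.Partition N := fun x =>
    ⟨(x.1.rowLens : Multiset ℕ), fun {i} hi => x.1.pos_of_mem_rowLens i hi,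
      by rw [sum_rowLens]; exact x.2⟩
  have hf : Function.Injective f := fun x y h => Subtype.ext (rowLens_injective
    (congrArg Nat.Partition.parts h))
  have := Finite.of_injective f hf
  exact Set.toFinite _

/-- The partitions of `N`. -/
def diagrams (N : ℕ) : Finset YoungDiagram := (finite_card_eq N).toFinset

theorem mem_diagrams {N : ℕ} {lam : YoungDiagram} : lam ∈ diagrams N ↔ lam.card = N := by
  simp [diagrams]

/-! ### Power sums in infinitely many variables -/

section PowerSums

variable {K : Type} [Field K]

theorem coeff_powerSum_mul (n : ℕ+) (f : MvPowerSeries ℕ K) (d : ℕ →₀ ℕ) :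
    MvPowerSeries.coeff d (powerSum K n * f) = ∑ i ∈ d.support,
      if (n : ℕ) ≤ d i then MvPowerSeries.coeff (d - Finsupp.single i (n : ℕ)) f else 0 := by
  classical
  rw [MvPowerSeries.coeff_mul, ← Finset.sum_filter]
  have hinj : ∀ i j : ℕ, (Finsupp.single i (n : ℕ), d - Finsupp.single i (n : ℕ)) =
      (Finsupp.single j (n : ℕ), d - Finsupp.single j (n : ℕ)) → i = j := by
    intro i j h
    exact (Finsupp.single_left_inj n.ne_zero).mp (Prod.mk.inj h).1
  symm
  have hle : ∀ i, (n : ℕ) ≤ d i → Finsupp.single i (n : ℕ) ≤ d := by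
    intro i h
    rw [Finsupp.single_le_iff]; exact h
  calc _ = ∑ x ∈ (d.support.filter fun i => (n : ℕ) ≤ d i).image (fun i : ℕ =>
        ((Finsupp.single i (n : ℕ), d - Finsupp.single i (n : ℕ)) : (ℕ →₀ ℕ) × (ℕ →₀ ℕ))),
        MvPowerSeries.coeff x.1 (powerSum K n) * MvPowerSeries.coeff x.2 f := by
        rw [Finset.sum_image fun i _ j _ h => hinj i j h]
        refine Finset.sum_congr rfl fun i _ => ?_
        have : MvPowerSeries.coeff (Finsupp.single i (n : ℕ)) (powerSum K n) = 1 := by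
          change (if _ then (1 : K) else 0) = 1
          rw [if_pos ⟨i, rfl⟩]
        rw [this, one_mul]
    _ = _ := by
        refine Finset.sum_subset ?_ ?_
        · intro x hx
          obtain ⟨i, hi, rfl⟩ := Finset.mem_image.mp hx
          rw [Finset.HasAntidiagonal.mem_antidiagonal]
          exact add_tsub_cancel_of_le (hle i (Finset.mem_filter.mp hi).2)
        · rintro ⟨a, b⟩ hab hx
          rw [Finset.HasAntidiagonal.mem_antidiagonal] at hab
          simp only at hab ⊢
          have : MvPowerSeries.coeff a (powerSum K n) = 0 := by
            change (if _ then (1 : K) else 0) = 0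
            rw [if_neg]
            rintro ⟨i, rfl⟩
            apply hx
            have hni : (n : ℕ) ≤ d i := by rw [← hab]; simp
            refine Finset.mem_image.mpr ⟨i, Finset.mem_filter.mpr ⟨?_, hni⟩, ?_⟩
            · rw [Finsupp.mem_support_iff]; have := n.pos; omega
            · rw [← hab]; simp
          rw [this, zero_mul]

/-- A series whose coefficients depend only on the multiset of exponents. -/
def IsSymm (f : MvPowerSeries ℕ K) : Prop :=
  ∃ φ : Multiset ℕ → K, ∀ d, MvPowerSeries.coeff d f = φ (parts d)

/-- The coefficient at `d` is a sum over the entries of `d`, where one entry `a ≥ n` is replaced by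
`a - n` and dropped if this is zero. Such a sum depends only on the multiset of entries. -/
theorem IsSymm.powerSum_mul (n : ℕ+) {f : MvPowerSeries ℕ K} (hf : IsSymm f) :
    IsSymm (powerSum K n * f) := by
  obtain ⟨φ, hφ⟩ := hf
  refine ⟨fun M => (M.map fun a => if (n : ℕ) ≤ a then
    φ ((if a - n = 0 then 0 else {a - (n : ℕ)}) + M.erase a) else 0).sum, fun d => ?_⟩
  beta_reduce
  rw [coeff_powerSum_mul, parts, Multiset.map_map, Finset.sum]
  congr 1
  refine Multiset.map_congr rfl fun i hi => ?_
  have hi0 : d i ≠ 0 := Finsupp.mem_support_iff.mp hi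
  have h1 : (d.support.val.map d).erase (d i) = parts (d.erase i) := by
    have := parts_eq_erase d i
    rw [if_neg hi0, parts] at this
    rw [this, Multiset.singleton_add, Multiset.erase_cons_head]
  simp only [Function.comp]
  rw [h1, hφ, parts_sub_single]

theorem coeff_monomialSymm (lam : YoungDiagram) (d : ℕ →₀ ℕ) :
    MvPowerSeries.coeff d (monomialSymm K lam) =
      if parts d = (lam.rowLens : Multiset ℕ) then 1 else 0 := rfl

open Classical in
theorem coeff_expo_monomialSymm (lam mu : YoungDiagram) :
    MvPowerSeries.coeff (expo mu) (monomialSymm K lam) = if mu = lam then 1 else 0 := by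
  rw [coeff_monomialSymm, parts_expo]
  by_cases h : mu = lam
  · simp [h]
  · rw [if_neg h, if_neg fun h' => h (rowLens_injective h')]

theorem IsSymm.coeff_eq {f : MvPowerSeries ℕ K} (hf : IsSymm f) {d e : ℕ →₀ ℕ}
    (h : parts d = parts e) : MvPowerSeries.coeff d f = MvPowerSeries.coeff e f := by
  obtain ⟨φ, hφ⟩ := hf
  rw [hφ, hφ, h]

theorem IsSymm.sub {f g : MvPowerSeries ℕ K} (hf : IsSymm f) (hg : IsSymm g) : IsSymm (f - g) := by
  obtain ⟨φ, hφ⟩ := hf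
  obtain ⟨ψ, hψ⟩ := hg
  exact ⟨fun M => φ M - ψ M, fun d => by rw [map_sub, hφ, hψ]⟩

theorem IsSymm.smul (a : K) {f : MvPowerSeries ℕ K} (hf : IsSymm f) : IsSymm (a • f) := by
  obtain ⟨φ, hφ⟩ := hf
  exact ⟨fun M => a * φ M, fun d => by rw [MvPowerSeries.coeff_smul, hφ]⟩

theorem IsSymm.add {f g : MvPowerSeries ℕ K} (hf : IsSymm f) (hg : IsSymm g) : IsSymm (f + g) := by
  obtain ⟨φ, hφ⟩ := hf
  obtain ⟨ψ, hψ⟩ := hg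
  exact ⟨fun M => φ M + ψ M, fun d => by rw [map_add, hφ, hψ]⟩

theorem isSymm_monomialSymm (lam : YoungDiagram) : IsSymm (monomialSymm K lam) :=
  ⟨fun M => if M = (lam.rowLens : Multiset ℕ) then 1 else 0, fun _ => rfl⟩

theorem exists_rowLens_eq_parts (d : ℕ →₀ ℕ) :
    ∃ lam : YoungDiagram, (lam.rowLens : Multiset ℕ) = parts d :=
  exists_rowLens_eq _ fun _ => pos_of_mem_parts

/-- A symmetric series of bounded degree is a combination of monomial symmetric functions. -/
theorem IsSymm.eq_sum {f : MvPowerSeries ℕ K} (hf : IsSymm f) {S : Finset YoungDiagram}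
    (hS : ∀ mu, MvPowerSeries.coeff (expo mu) f ≠ 0 → mu ∈ S) :
    f = ∑ mu ∈ S, MvPowerSeries.coeff (expo mu) f • monomialSymm K mu := by
  ext d
  obtain ⟨lam, hlam⟩ := exists_rowLens_eq_parts d
  have hc : MvPowerSeries.coeff d f = MvPowerSeries.coeff (expo lam) f :=
    hf.coeff_eq (by rw [parts_expo, hlam])
  rw [map_sum, hc]
  simp only [MvPowerSeries.coeff_smul, coeff_monomialSymm, ← hlam]
  by_cases hl : lam ∈ S
  · rw [Finset.sum_eq_single lam]
    · simp
    · intro mu _ hmu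
      rw [if_neg fun h => hmu (rowLens_injective h).symm, mul_zero]
    · exact fun h => absurd hl h
  · have h0 : MvPowerSeries.coeff (expo lam) f = 0 := by
      by_contra h; exact hl (hS lam h)
    rw [h0, Finset.sum_eq_zero]
    intro mu hmu
    rw [if_neg, mul_zero]
    intro h
    rw [rowLens_injective h] at hl
    exact hl hmu

/-- Leading terms of the products of power sums. -/
theorem coeff_prod_powerSum (M : Multiset ℕ+) (e : ℕ →₀ ℕ) :
    ∃ c : ℕ, MvPowerSeries.coeff e (M.map (powerSum K)).prod = c ∧
      (c ≠ 0 → (parts e).sum = (M.map PNat.val).sum ∧ (parts e).card ≤ M.card ∧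
        ((parts e).card = M.card → parts e = M.map PNat.val)) ∧
      (parts e = M.map PNat.val → c ≠ 0) := by
  classical
  induction M using Multiset.induction_on generalizing e with
  | empty =>
    refine ⟨if e = 0 then 1 else 0, ?_, ?_, ?_⟩
    · simp [MvPowerSeries.coeff_one]
    · intro h
      have : e = 0 := by by_contra h'; exact h (if_neg h')
      subst this
      simp [parts]
    · intro h
      have : e = 0 := by simpa [parts] using h
      simp [this]
  | cons n M ih =>
    choose c hc1 hc2 hc3 using ih
    refine ⟨∑ i ∈ e.support, if (n : ℕ) ≤ e i then c (e - Finsupp.single i (n : ℕ)) else 0,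
      ?_, ?_, ?_⟩
    · rw [Multiset.map_cons, Multiset.prod_cons, coeff_powerSum_mul]
      push_cast
      refine Finset.sum_congr rfl fun i _ => ?_
      split_ifs
      · rw [hc1]
      · simp
    · intro h
      obtain ⟨i, hi, hci⟩ := Finset.exists_ne_zero_of_sum_ne_zero h
      split_ifs at hci with hn
      · obtain ⟨h1, h2, h3⟩ := hc2 _ hci
        have hi0 : e i ≠ 0 := Finsupp.mem_support_iff.mp hi
        rw [parts_sub_single] at h1 h2 h3
        have hp := parts_eq_erase e i
        rw [if_neg hi0] at hp
        rw [hp]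
        simp only [Multiset.sum_add, Multiset.card_add, Multiset.sum_singleton,
          Multiset.card_singleton, Multiset.map_cons, Multiset.sum_cons, Multiset.card_cons] at *
        -- If `n` exhausts the entry `e i`, one part disappears. Otherwise the number of parts is
        -- unchanged and is at most `M.card`, so equality with the card of `n ::ₘ M` is impossible.
        split_ifs at h1 h2 h3 with h0
        · simp only [Multiset.sum_zero, Multiset.card_zero, zero_add] at h1 h2 h3
          refine ⟨by change e i + _ = (n : ℕ) + _; omega, by omega, fun h4 => ?_⟩
          rw [h3 (by omega), Multiset.singleton_add]
          congr 1
          omega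
        · simp only [Multiset.sum_singleton, Multiset.card_singleton] at h1 h2 h3
          refine ⟨by change e i + _ = (n : ℕ) + _; omega, by omega, fun h4 => ?_⟩
          omega
      · exact absurd rfl hci
    · intro h
      have hn : (n : ℕ) ∈ parts e := by rw [h]; simp
      obtain ⟨i, hi, hin⟩ := Multiset.mem_map.mp hn
      have hp := parts_eq_erase e i
      have hi0 : e i ≠ 0 := Finsupp.mem_support_iff.mp hi
      rw [if_neg hi0, h, Multiset.map_cons, hin, Multiset.singleton_add] at hp
      have h5 := (Multiset.cons_inj_right _).mp hp
      -- The summands are natural numbers, so nothing can cancel: a vanishing sum forces the summand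
      -- at `i` to vanish.
      intro hsum
      have := (Finset.sum_eq_zero_iff.mp hsum) i hi
      rw [if_pos hin.ge] at this
      refine hc3 _ ?_ this
      rw [parts_sub_single, if_pos (by omega), zero_add, h5]

theorem ofPowerSums_monomial (d : ℕ+ →₀ ℕ) (a : K) :
    ofPowerSums K (MvPolynomial.monomial d a) =
      a • ((Finsupp.toMultiset d).map (powerSum K)).prod := by
  rw [ofPowerSums, MvPolynomial.aeval_monomial, Finsupp.toMultiset_map, Finsupp.prod_toMultiset,
    Finsupp.prod_mapDomain_index (by simp) (by simp [pow_add]), Algebra.smul_def]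

theorem isSymm_ofPowerSums (F : MvPolynomial ℕ+ K) : IsSymm (ofPowerSums K F) := by
  induction F using MvPolynomial.induction_on with
  | C a =>
    refine ⟨fun M => if M = 0 then a else 0, fun d => ?_⟩
    have : ofPowerSums K (MvPolynomial.C a) = MvPowerSeries.C a := by
      rw [ofPowerSums, MvPolynomial.aeval_C]; rfl
    rw [this, MvPowerSeries.coeff_C]
    by_cases h : d = 0
    · simp [h, parts]
    · beta_reduce
      rw [if_neg h, if_neg (by simpa [parts] using h)]
  | add p q hp hq => rw [map_add]; exact hp.add hq
  | mul_X p n hp =>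
    rw [map_mul, mul_comm, ofPowerSums, MvPolynomial.aeval_X]
    exact hp.powerSum_mul n

/-- The coefficient of `x^lam` in a symmetric function. -/
def coeffAt (lam : YoungDiagram) : MvPolynomial ℕ+ K →ₗ[K] K :=
  (MvPowerSeries.coeff (expo lam)).comp (ofPowerSums K).toLinearMap

theorem coeffAt_apply (lam : YoungDiagram) (F : MvPolynomial ℕ+ K) :
    coeffAt lam F = MvPowerSeries.coeff (expo lam) (ofPowerSums K F) := rfl

theorem sum_toMultiset (d : ℕ+ →₀ ℕ) :
    ((Finsupp.toMultiset d).map PNat.val).sum = Finsupp.weight (fun n : ℕ+ => (n : ℕ)) d := by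
  induction d using Finsupp.induction_linear with
  | zero => simp
  | add f g hf hg => rw [map_add, map_add, Multiset.map_add, Multiset.sum_add, hf, hg]
  | single n k =>
    rw [Finsupp.toMultiset_single, Multiset.map_nsmul, Multiset.sum_nsmul, Finsupp.weight_single]
    simp

/-- Homogeneity for the degree of symmetric functions. -/
abbrev IsHomog {R : Type} [CommSemiring R] (F : MvPolynomial ℕ+ R) (N : ℕ) : Prop :=
  MvPolynomial.IsWeightedHomogeneous (fun n : ℕ+ => (n : ℕ)) F N

theorem card_eq_of_coeffAt_ne_zero {F : MvPolynomial ℕ+ K} {N : ℕ} (hF : IsHomog F N)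
    {nu : YoungDiagram} (h : coeffAt nu F ≠ 0) : nu.card = N := by
  rw [coeffAt_apply, F.as_sum, map_sum, map_sum] at h
  obtain ⟨d, hd, h⟩ := Finset.exists_ne_zero_of_sum_ne_zero h
  rw [ofPowerSums_monomial, MvPowerSeries.coeff_smul] at h
  obtain ⟨c, hc, hc2, -⟩ := coeff_prod_powerSum (K := K) (Finsupp.toMultiset d) (expo nu)
  have hc0 : c ≠ 0 := by
    rintro rfl
    rw [hc] at h
    simp at h
  have := (hc2 hc0).1
  rw [parts_expo, sum_rowLens, sum_toMultiset] at this
  rw [this, hF (MvPolynomial.mem_support_iff.mp hd)]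

variable [CharZero K]

/-- Take a monomial of `F` with the largest number of factors. Its product of power sums contains
the monomial `x^lam` with the same parts. Another product contains `x^lam` only if it has more
factors, or equally many and the same ones; both are excluded. -/
theorem ofPowerSums_injective : Function.Injective (ofPowerSums K) := by
  classical
  rw [injective_iff_map_eq_zero]
  intro F hF
  by_contra hne
  obtain ⟨d, hd, hmax⟩ := Finset.exists_max_image F.support
    (fun d => Multiset.card (Finsupp.toMultiset d)) (MvPolynomial.support_nonempty.mpr hne)
  obtain ⟨lam, hlam⟩ := exists_rowLens_eq ((Finsupp.toMultiset d).map PNat.val)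
    (fun a ha => by obtain ⟨n, _, rfl⟩ := Multiset.mem_map.mp ha; exact n.pos)
  have h1 : MvPowerSeries.coeff (expo lam) (ofPowerSums K F) = ∑ m ∈ F.support, F.coeff m *
      MvPowerSeries.coeff (expo lam) ((Finsupp.toMultiset m).map (powerSum K)).prod := by
    conv_lhs => rw [F.as_sum, map_sum, map_sum]
    simp only [ofPowerSums_monomial, MvPowerSeries.coeff_smul]
  rw [hF, map_zero, Finset.sum_eq_single d] at h1
  · obtain ⟨c, hc, -, hc3⟩ := coeff_prod_powerSum (K := K) (Finsupp.toMultiset d) (expo lam)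
    have := hc3 (by rw [parts_expo, hlam])
    rw [hc] at h1
    exact mul_ne_zero (MvPolynomial.mem_support_iff.mp hd) (Nat.cast_ne_zero.mpr this) h1.symm
  · intro m hm hmd
    obtain ⟨c, hc, hc2, -⟩ := coeff_prod_powerSum (K := K) (Finsupp.toMultiset m) (expo lam)
    rw [hc]
    by_cases h0 : c = 0
    · simp [h0]
    · exfalso
      obtain ⟨-, h3, h4⟩ := hc2 h0
      rw [parts_expo, hlam, Multiset.card_map] at h3 h4
      have h5 := h4 (le_antisymm h3 (hmax m hm))
      apply hmd
      have h6 := Multiset.map_injective PNat.coe_injective h5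
      rw [← Finsupp.toMultiset_toFinsupp m, ← Finsupp.toMultiset_toFinsupp d, h6]
  · exact fun h => absurd hd h

/-- The product of power sums with indices the parts of `lam` is a nonzero integer times `m_lam`
plus monomial functions with fewer parts, whence the induction on the number of parts. -/
theorem exists_ofPowerSums_eq (lam : YoungDiagram) :
    ∃ F : MvPolynomial ℕ+ K, IsHomog F lam.card ∧ ofPowerSums K F = monomialSymm K lam := by
  classical
  induction hl : lam.colLen 0 using Nat.strong_induction_on generalizing lam with
  | _ l ih =>
  obtain ⟨M, hM⟩ : ∃ M : Multiset ℕ+, M.map PNat.val = (lam.rowLens : Multiset ℕ) := by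
    refine ⟨(lam.rowLens : Multiset ℕ).map Nat.toPNat', ?_⟩
    rw [Multiset.map_map, Multiset.map_congr rfl, Multiset.map_id]
    exact fun n hn => PNat.toPNat'_coe (lam.pos_of_mem_rowLens n hn)
  obtain ⟨c, hc, hc2, hc3⟩ := coeff_prod_powerSum (K := K) M (expo lam)
  have hc0 := hc3 (by rw [parts_expo, hM])
  set g := (M.map (powerSum K)).prod - (c : K) • monomialSymm K lam with hg
  have hpM : ofPowerSums K (MvPolynomial.monomial (Multiset.toFinsupp M) 1) =
      (M.map (powerSum K)).prod := by
    rw [ofPowerSums_monomial, one_smul, Multiset.toFinsupp_toMultiset]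
  have hgs : IsSymm g := by
    rw [hg, ← hpM]
    exact (isSymm_ofPowerSums _).sub ((isSymm_monomialSymm _).smul _)
  have hcard : M.card = lam.colLen 0 := by
    rw [← Multiset.card_map PNat.val, hM, Multiset.coe_card, YoungDiagram.length_rowLens]
  have hcoef : ∀ mu, MvPowerSeries.coeff (expo mu) g ≠ 0 → mu ∈ diagrams lam.card ∧
      mu.colLen 0 < l := by
    intro mu hmu
    rw [hg, map_sub, MvPowerSeries.coeff_smul, coeff_expo_monomialSymm] at hmu
    obtain ⟨c', hc', hc2', -⟩ := coeff_prod_powerSum (K := K) M (expo mu)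
    by_cases hml : mu = lam
    · subst hml
      rw [hc, if_pos rfl, mul_one, sub_self] at hmu
      exact absurd rfl hmu
    · rw [if_neg hml, mul_zero, sub_zero, hc'] at hmu
      obtain ⟨h1, h2, h3⟩ := hc2' (by rintro rfl; simp at hmu)
      rw [parts_expo] at h1 h2 h3
      rw [hM] at h1 h3
      rw [sum_rowLens, sum_rowLens] at h1
      rw [Multiset.coe_card, YoungDiagram.length_rowLens, hcard] at h2 h3
      refine ⟨mem_diagrams.mpr h1, ?_⟩
      rw [← hl]
      refine lt_of_le_of_ne h2 fun h => hml (rowLens_injective (h3 h))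
  have hgsum := hgs.eq_sum (S := (diagrams lam.card).filter fun mu => mu.colLen 0 < l)
    (fun mu hmu => Finset.mem_filter.mpr (hcoef mu hmu))
  have hgr : g ∈ Submodule.map (ofPowerSums K).toLinearMap
      (MvPolynomial.weightedHomogeneousSubmodule K (fun n : ℕ+ => (n : ℕ)) lam.card) := by
    rw [hgsum]
    refine Submodule.sum_mem _ fun mu hmu => Submodule.smul_mem _ _ ?_
    obtain ⟨F, hF, hF2⟩ := ih _ (Finset.mem_filter.mp hmu).2 mu rfl
    rw [mem_diagrams.mp (Finset.mem_filter.mp hmu).1] at hF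
    exact ⟨F, hF, hF2⟩
  obtain ⟨G, hG1, hG⟩ := hgr
  refine ⟨MvPolynomial.C (c : K)⁻¹ * (MvPolynomial.monomial (Multiset.toFinsupp M) 1 - G), ?_, ?_⟩
  · refine MvPolynomial.IsWeightedHomogeneous.C_mul (MvPolynomial.IsWeightedHomogeneous.sub
      (MvPolynomial.isWeightedHomogeneous_monomial _ _ _ ?_) hG1) _
    rw [← sum_toMultiset, Multiset.toFinsupp_toMultiset, hM, sum_rowLens]
  · rw [← MvPolynomial.smul_eq_C_mul, map_smul, map_sub, hpM, show ofPowerSums K G = g from hG, hg,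
      sub_sub_cancel, smul_smul, inv_mul_cancel₀ (Nat.cast_ne_zero.mpr hc0), one_smul]

end PowerSums

/-! ### The dominance order -/

theorem Dominates.trans {lam mu nu : YoungDiagram} (h1 : Dominates lam mu) (h2 : Dominates mu nu) :
    Dominates lam nu := ⟨h1.1.trans h2.1, fun k => (h2.2 k).trans (h1.2 k)⟩

theorem Dominates.antisymm {lam mu : YoungDiagram} (h1 : Dominates lam mu)
    (h2 : Dominates mu lam) : lam = mu := by
  refine ext_rowLen fun i => ?_
  have e : ∀ k, ∑ i ∈ Finset.range k, lam.rowLen i = ∑ i ∈ Finset.range k, mu.rowLen i :=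
    fun k => le_antisymm (h2.2 k) (h1.2 k)
  have := e (i + 1)
  rw [Finset.sum_range_succ, Finset.sum_range_succ, e i] at this
  omega

open Classical in
/-- The partitions strictly below `lam` in the dominance order. -/
def lower (lam : YoungDiagram) : Finset YoungDiagram :=
  (diagrams lam.card).filter fun mu => Dominates lam mu ∧ mu ≠ lam

theorem mem_lower {lam mu : YoungDiagram} : mu ∈ lower lam ↔ Dominates lam mu ∧ mu ≠ lam := by
  classical
  rw [lower, Finset.mem_filter, mem_diagrams]
  exact ⟨fun h => h.2, fun h => ⟨h.1.1.symm, h⟩⟩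

theorem coe_lower (lam : YoungDiagram) :
    (lower lam : Set YoungDiagram) = {mu | Dominates lam mu ∧ mu ≠ lam} := by
  ext mu; exact mem_lower

theorem lower_ssubset {lam mu : YoungDiagram} (h : mu ∈ lower lam) : lower mu ⊂ lower lam := by
  obtain ⟨h1, h2⟩ := mem_lower.mp h
  refine (Finset.ssubset_iff_of_subset fun nu hnu => ?_).mpr ⟨mu, h, fun h' => (mem_lower.mp h').2 rfl⟩
  obtain ⟨h3, h4⟩ := mem_lower.mp hnu
  refine mem_lower.mpr ⟨h1.trans h3, ?_⟩
  rintro rfl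
  exact h4 (h1.antisymm h3)

/-- Induction on the dominance order. -/
theorem dominance_induction {p : YoungDiagram → Prop}
    (h : ∀ lam, (∀ mu ∈ lower lam, p mu) → p lam) (lam : YoungDiagram) : p lam := by
  induction hn : (lower lam).card using Nat.strong_induction_on generalizing lam with
  | _ n ih =>
  refine h lam fun mu hmu => ih _ ?_ mu rfl
  rw [← hn]
  exact Finset.card_lt_card (lower_ssubset hmu)

/-- Double counting of the cells below the graph of `d`, by rows and by columns. -/
theorem sum_range_eq_sum_card (d : ℕ → ℕ) (k N : ℕ) (hN : ∀ i, i < k → d i ≤ N) :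
    ∑ i ∈ Finset.range k, d i =
      ∑ j ∈ Finset.range N, ((Finset.range k).filter fun i => j < d i).card := by
  simp only [Finset.card_filter]
  rw [Finset.sum_comm]
  refine Finset.sum_congr rfl fun i hi => ?_
  rw [← Finset.card_filter]
  have : (Finset.range N).filter (fun j => j < d i) = Finset.range (d i) := by
    ext j
    have := hN i (Finset.mem_range.mp hi)
    simp only [Finset.mem_filter, Finset.mem_range]
    omega
  rw [this, Finset.card_range]

theorem rowLen_le_card (lam : YoungDiagram) (i : ℕ) : lam.rowLen i ≤ lam.card := by
  have h := colLen_le_card lam.transpose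
  rw [YoungDiagram.colLen_transpose, card_transpose] at h
  exact (lam.rowLen_anti 0 i (Nat.zero_le i)).trans h

theorem lt_rowLen_iff (lam : YoungDiagram) (i j : ℕ) : j < lam.rowLen i ↔ i < lam.colLen j := by
  rw [← YoungDiagram.mem_iff_lt_rowLen, YoungDiagram.mem_iff_lt_colLen]

theorem sum_rowLen_eq_sum_min (lam : YoungDiagram) (k N : ℕ) (hN : lam.card ≤ N) :
    ∑ i ∈ Finset.range k, lam.rowLen i = ∑ j ∈ Finset.range N, min k (lam.colLen j) := by
  rw [sum_range_eq_sum_card _ _ N fun i _ => (rowLen_le_card lam i).trans hN]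
  refine Finset.sum_congr rfl fun j _ => ?_
  have : (Finset.range k).filter (fun i => j < lam.rowLen i) =
      Finset.range (min k (lam.colLen j)) := by
    ext i
    rw [Finset.mem_filter, lt_rowLen_iff, Finset.mem_range, Finset.mem_range, lt_min_iff]
  rw [this, Finset.card_range]

/-- The partial sums of a rearrangement are at most those of the partition. -/
theorem sum_range_le_of_parts {d : ℕ →₀ ℕ} {lam : YoungDiagram}
    (h : parts d = (lam.rowLens : Multiset ℕ)) (k : ℕ) :
    ∑ i ∈ Finset.range k, d i ≤ ∑ i ∈ Finset.range k, lam.rowLen i := by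
  classical
  have hcount : ∀ e : ℕ →₀ ℕ, ∀ j, (e.support.filter fun i => j < e i).card =
      Multiset.card ((parts e).filter fun a => j < a) := by
    intro e j
    rw [parts, Multiset.filter_map, Multiset.card_map]; rfl
  have hle : ∀ i, d i ≤ lam.card := by
    intro i
    by_cases h0 : d i = 0
    · omega
    · have : d i ∈ parts d := Multiset.mem_map_of_mem _ (Finsupp.mem_support_iff.mpr h0)
      rw [h] at this
      rw [← sum_rowLens]
      exact Multiset.single_le_sum (fun _ _ => Nat.zero_le _) _ this
  rw [sum_range_eq_sum_card _ _ lam.card fun i _ => hle i, sum_rowLen_eq_sum_min lam k _ le_rfl]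
  -- Column `j` meets the first `k` rows in at most `k` cells. It also has at most `lam.colLen j`
  -- cells in all, because `d` and `lam` have equally many entries exceeding `j`.
  refine Finset.sum_le_sum fun j _ => le_min ?_ ?_
  · exact (Finset.card_filter_le _ _).trans (Finset.card_range k).le
  · have h1 : ((Finset.range k).filter fun i => j < d i).card ≤
        (d.support.filter fun i => j < d i).card := by
      refine Finset.card_le_card fun i hi => ?_
      obtain ⟨_, h2⟩ := Finset.mem_filter.mp hi
      exact Finset.mem_filter.mpr ⟨Finsupp.mem_support_iff.mpr (by omega), h2⟩
    have h2 : ((expo lam).support.filter fun i => j < expo lam i).card ≤ lam.colLen j := by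
      rw [← Finset.card_range (lam.colLen j)]
      refine Finset.card_le_card fun i hi => ?_
      obtain ⟨_, h2⟩ := Finset.mem_filter.mp hi
      rw [expo_apply, lt_rowLen_iff] at h2
      exact Finset.mem_range.mpr h2
    rw [hcount, h, ← parts_expo, ← hcount] at h1
    exact h1.trans h2

/-- The first `m` columns contain `∑ min m (rowLen i)` cells. Cut at `k = mu.colLen m`: for `mu` the
minimum is `m` before `k` and `rowLen i` after it, while for `lam` these are upper bounds. The
dominance inequality at `k` and the equality of the sizes conclude. -/
theorem Dominates.transpose {lam mu : YoungDiagram} (h : Dominates lam mu) :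
    Dominates mu.transpose lam.transpose := by
  refine ⟨by rw [card_transpose, card_transpose, h.1], fun m => ?_⟩
  set N := lam.card with hN
  have hN' : mu.card = N := h.1.symm
  rw [sum_rowLen_eq_sum_min _ m N (by rw [card_transpose]),
    sum_rowLen_eq_sum_min _ m N (by rw [card_transpose, hN'])]
  simp only [YoungDiagram.colLen_transpose]
  set k := mu.colLen m with hk
  have hkN : k ≤ N := by
    rw [← hN']
    exact (mu.colLen_anti 0 m (Nat.zero_le m)).trans (colLen_le_card mu)
  have hsplit : ∀ f : ℕ → ℕ, ∑ i ∈ Finset.range N, f i = ∑ i ∈ Finset.range k, f i +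
      ∑ i ∈ Finset.Ico k N, f i := fun f => (Finset.sum_range_add_sum_Ico f hkN).symm
  have e1 : ∑ i ∈ Finset.range N, lam.rowLen i = N := sum_rowLen_range (colLen_le_card lam)
  have e2 : ∑ i ∈ Finset.range N, mu.rowLen i = N := by
    rw [← hN']; exact sum_rowLen_range (colLen_le_card mu)
  rw [hsplit] at e1 e2
  rw [hsplit, hsplit (fun i => min m (mu.rowLen i))]
  have a1 : ∑ i ∈ Finset.range k, min m (lam.rowLen i) ≤ ∑ i ∈ Finset.range k, m :=
    Finset.sum_le_sum fun i _ => min_le_left _ _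
  have a2 : ∑ i ∈ Finset.Ico k N, min m (lam.rowLen i) ≤ ∑ i ∈ Finset.Ico k N, lam.rowLen i :=
    Finset.sum_le_sum fun i _ => min_le_right _ _
  have b1 : ∑ i ∈ Finset.range k, min m (mu.rowLen i) = ∑ i ∈ Finset.range k, m := by
    refine Finset.sum_congr rfl fun i hi => min_eq_left ?_
    exact ((lt_rowLen_iff mu i m).mpr (Finset.mem_range.mp hi)).le
  have b2 : ∑ i ∈ Finset.Ico k N, min m (mu.rowLen i) = ∑ i ∈ Finset.Ico k N, mu.rowLen i := by
    refine Finset.sum_congr rfl fun i hi => min_eq_right ?_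
    by_contra hc
    have := (lt_rowLen_iff mu i m).mp (not_le.mp hc)
    have := (Finset.mem_Ico.mp hi).1
    omega
  have := h.2 k
  omega

/-! ### The eigenvalues -/

/-- The eigenvalue `1 + (1 - s) ∑ s^i (q^{lam_i} - 1)`. -/
def eps {R : Type*} [CommRing R] (q s : R) (lam : YoungDiagram) : R :=
  1 + (1 - s) * ∑ i ∈ Finset.range (lam.colLen 0), s ^ i * (q ^ lam.rowLen i - 1)

/-- The right side is the eigenvalue as it arises in `n` variables; it does not depend on `n`
because the empty rows contribute a geometric sum. -/
theorem eps_eq {R : Type*} [CommRing R] (q s : R) (lam : YoungDiagram) {n : ℕ}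
    (hn : lam.colLen 0 ≤ n) :
    eps q s lam = s ^ n + (1 - s) * ∑ i ∈ Finset.range n, s ^ i * q ^ lam.rowLen i := by
  have h : ∑ i ∈ Finset.range (lam.colLen 0), s ^ i * (q ^ lam.rowLen i - 1) =
      ∑ i ∈ Finset.range n, s ^ i * (q ^ lam.rowLen i - 1) := by
    refine Finset.sum_subset (Finset.range_subset_range.mpr hn) fun i _ hi => ?_
    have : lam.rowLen i = 0 := by
      by_contra h; exact hi (Finset.mem_range.mpr ((rowLen_ne_zero_iff lam i).mp h))
    simp [this]
  have h2 := mul_neg_geom_sum s n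
  rw [eps, h]
  simp only [mul_sub, Finset.sum_sub_distrib, mul_one]
  linear_combination -h2

theorem map_eps {R S : Type*} [CommRing R] [CommRing S] (φ : R →+* S) (q s : R)
    (lam : YoungDiagram) : φ (eps q s lam) = eps (φ q) (φ s) lam := by
  simp [eps]

/-- Abel summation: `w n` times the `n`-th partial sum stays a lower bound, since the partial sums
are nonpositive and `w` increases. -/
theorem sum_mul_nonneg_of_partial_sums {w x : ℕ → ℝ} (hw : Monotone w)
    (hx : ∀ k, ∑ i ∈ Finset.range k, x i ≤ 0) {n : ℕ} (hn : ∑ i ∈ Finset.range n, x i = 0) :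
    0 ≤ ∑ i ∈ Finset.range n, w i * x i := by
  have key : ∀ n, w n * ∑ i ∈ Finset.range n, x i ≤ ∑ i ∈ Finset.range n, w i * x i := by
    intro n
    induction n with
    | zero => simp
    | succ n ih =>
      rw [Finset.sum_range_succ, Finset.sum_range_succ (fun i => w i * x i)]
      have h1 := hx (n + 1)
      rw [Finset.sum_range_succ] at h1
      have h2 : w n ≤ w (n + 1) := hw (Nat.le_succ n)
      nlinarith [mul_le_mul_of_nonpos_right h2 h1]
  have := key n
  rwa [hn, mul_zero] at this

/-- With `L = -log q`, convexity of the exponential gives `q^{lam_i} ≥ q^{mu_i} (1 + L (mu_i -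
lam_i))`, strictly where the rows differ. The weights `s^i q^{mu_i}` increase with `i` and the
partial sums of `mu - lam` are nonpositive with total zero, so the linear terms add up to something
nonnegative by Abel summation. -/
theorem sum_pow_lt_of_dominates {q s : ℝ} (hq0 : 0 < q) (hq1 : q < 1) (hs : 1 < s)
    {lam mu : YoungDiagram} (h : Dominates lam mu) (hne : mu ≠ lam) {n : ℕ} (hn : lam.card ≤ n) :
    ∑ i ∈ Finset.range n, s ^ i * q ^ mu.rowLen i <
      ∑ i ∈ Finset.range n, s ^ i * q ^ lam.rowLen i := by
  set L := -Real.log q with hL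
  have hLpos : 0 < L := by rw [hL]; linarith [Real.log_neg hq0 hq1]
  have hqe : ∀ k : ℕ, q ^ k = Real.exp (-L * k) := by
    intro k
    rw [hL, neg_neg, mul_comm, Real.exp_nat_mul, Real.exp_log hq0]
  set w : ℕ → ℝ := fun i => s ^ i * q ^ mu.rowLen i with hw
  set x : ℕ → ℝ := fun i => (mu.rowLen i : ℝ) - lam.rowLen i with hx
  have hwmono : Monotone w := by
    refine monotone_nat_of_le_succ fun i => ?_
    rw [hw]
    refine mul_le_mul (pow_le_pow_right₀ hs.le (Nat.le_succ i))
      (pow_le_pow_of_le_one hq0.le hq1.le (mu.rowLen_anti i (i + 1) (Nat.le_succ i))) (by positivity)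
      (by positivity)
  have hsum : ∀ k, ∑ i ∈ Finset.range k, x i =
      ((∑ i ∈ Finset.range k, mu.rowLen i : ℕ) : ℝ) - ((∑ i ∈ Finset.range k, lam.rowLen i : ℕ) : ℝ) := by
    intro k
    push_cast
    rw [hx, Finset.sum_sub_distrib]
  have hx1 : ∀ k, ∑ i ∈ Finset.range k, x i ≤ 0 := fun k => by
    rw [hsum, sub_nonpos]; exact_mod_cast h.2 k
  have hx2 : ∑ i ∈ Finset.range n, x i = 0 := by
    rw [hsum, sum_rowLen_range ((colLen_le_card mu).trans (h.1 ▸ hn)),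
      sum_rowLen_range ((colLen_le_card lam).trans hn), h.1, sub_self]
  have habel := sum_mul_nonneg_of_partial_sums hwmono hx1 hx2
  have hterm : ∀ i, s ^ i * q ^ mu.rowLen i + L * (w i * x i) ≤ s ^ i * q ^ lam.rowLen i ∧
      (lam.rowLen i ≠ mu.rowLen i →
        s ^ i * q ^ mu.rowLen i + L * (w i * x i) < s ^ i * q ^ lam.rowLen i) := by
    intro i
    have e1 : q ^ lam.rowLen i = q ^ mu.rowLen i * Real.exp (L * x i) := by
      rw [hqe, hqe, ← Real.exp_add, hx]; congr 1; ring
    have hp : 0 < s ^ i * q ^ mu.rowLen i := by positivity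
    have e2 : s ^ i * q ^ lam.rowLen i = w i * Real.exp (L * x i) := by rw [e1, hw]; ring
    have e3 : s ^ i * q ^ mu.rowLen i + L * (w i * x i) = w i * (L * x i + 1) := by rw [hw]; ring
    rw [e2, e3]
    refine ⟨mul_le_mul_of_nonneg_left (Real.add_one_le_exp _) hp.le, fun hne => ?_⟩
    refine mul_lt_mul_of_pos_left (Real.add_one_lt_exp ?_) hp
    refine mul_ne_zero hLpos.ne' ?_
    rw [hx, sub_ne_zero]
    exact_mod_cast hne.symm
  obtain ⟨i, hi⟩ : ∃ i, lam.rowLen i ≠ mu.rowLen i := by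
    by_contra hc
    push Not at hc
    exact hne (ext_rowLen hc).symm
  have hin : i ∈ Finset.range n := by
    rw [Finset.mem_range]
    by_contra hc
    have h1 : ∀ nu : YoungDiagram, nu.card ≤ n → nu.rowLen i = 0 := by
      intro nu hnu
      by_contra h
      have := (rowLen_ne_zero_iff nu i).mp h
      have := colLen_le_card nu
      omega
    exact hi (by rw [h1 lam hn, h1 mu (h.1 ▸ hn)])
  calc _ ≤ ∑ i ∈ Finset.range n, s ^ i * q ^ mu.rowLen i + L * ∑ i ∈ Finset.range n, w i * x i := by
        have := mul_nonneg hLpos.le habel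
        linarith
    _ = ∑ i ∈ Finset.range n, (s ^ i * q ^ mu.rowLen i + L * (w i * x i)) := by
        rw [Finset.sum_add_distrib, Finset.mul_sum]
    _ < _ := Finset.sum_lt_sum (fun i _ => (hterm i).1) ⟨i, hin, (hterm i).2 hi⟩

/-- Incomparable partitions are not covered, but the denominators of `macP` only involve comparable
ones. This is what excludes poles at real `q, t ∈ (0,1)`, where `s = t⁻¹ > 1`. -/
theorem eps_ne_of_dominates {q s : ℝ} (hq0 : 0 < q) (hq1 : q < 1) (hs : 1 < s)
    {lam mu : YoungDiagram} (h : mu ∈ lower lam) : eps q s lam ≠ eps q s mu := by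
  obtain ⟨h1, h2⟩ := mem_lower.mp h
  have hc : mu.colLen 0 ≤ lam.card := h1.1.symm ▸ colLen_le_card mu
  rw [eps_eq q s lam (colLen_le_card lam), eps_eq q s mu hc]
  intro h3
  have h4 := mul_left_cancel₀ (by linarith : (1 - s) ≠ 0) (add_left_cancel h3)
  exact (sum_pow_lt_of_dominates hq0 hq1 hs h1 h2 le_rfl).ne' h4

/-! ### Homogeneity of the Macdonald operator -/

section Homogeneity

variable {R : Type} [CommRing R]

theorem IsHomog.X_mul {F : MvPolynomial ℕ+ R} {N : ℕ} (hF : IsHomog F N) (n : ℕ+) :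
    IsHomog (MvPolynomial.X n * F) (n + N) :=
  (MvPolynomial.isWeightedHomogeneous_X R _ n).mul hF

/-- The letters `p_n` and `u^n` have the same degree, so the shift preserves the total degree.
Writing `j + k = N` avoids a truncated subtraction. -/
theorem isHomog_shift_coeff (γ : ℕ+ → R) {F : MvPolynomial ℕ+ R} {N : ℕ} (hF : IsHomog F N)
    (k : ℕ) : (∀ j, j + k = N → IsHomog ((shift γ F).coeff k) j) ∧
      (N < k → (shift γ F).coeff k = 0) := by
  have mono : ∀ (M : Multiset ℕ+) (k : ℕ),
      (∀ j, j + k = (M.map PNat.val).sum →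
        IsHomog ((shift γ (M.map MvPolynomial.X).prod).coeff k) j) ∧
      ((M.map PNat.val).sum < k → (shift γ (M.map MvPolynomial.X).prod).coeff k = 0) := by
    intro M
    induction M using Multiset.induction_on with
    | empty =>
      intro k
      simp only [Multiset.map_zero, Multiset.prod_zero, Multiset.sum_zero, map_one,
        Polynomial.coeff_one]
      constructor
      · intro j hj
        obtain ⟨rfl, rfl⟩ : j = 0 ∧ k = 0 := by omega
        rw [if_pos rfl]
        exact MvPolynomial.isWeightedHomogeneous_one R _
      · intro hk
        rw [if_neg hk.ne']
    | cons m M ih =>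
      intro k
      simp only [Multiset.map_cons, Multiset.prod_cons, Multiset.sum_cons]
      rw [coeff_shift_X_mul]
      change (∀ j, j + k = (m : ℕ) + _ → _) ∧ ((m : ℕ) + _ < k → _)
      constructor
      · intro j hj
        refine MvPolynomial.IsWeightedHomogeneous.add ?_ ?_
        · by_cases h : (M.map PNat.val).sum < k
          · rw [(ih k).2 h, mul_zero]; exact MvPolynomial.isWeightedHomogeneous_zero R _ _
          · have := ((ih k).1 ((M.map PNat.val).sum - k) (by omega)).X_mul m
            rwa [show (m : ℕ) + ((M.map PNat.val).sum - k) = j by omega] at this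
        · split_ifs with h
          · exact MvPolynomial.IsWeightedHomogeneous.C_mul ((ih _).1 _ (by omega)) _
          · exact MvPolynomial.isWeightedHomogeneous_zero R _ _
      · intro hk
        have := m.pos
        rw [(ih k).2 (by omega), mul_zero, zero_add, if_pos (by omega), (ih _).2 (by omega),
          mul_zero]
  refine MvPolynomial.IsWeightedHomogeneous.induction_on
    (motive := fun F _ => (∀ j, j + k = N → IsHomog ((shift γ F).coeff k) j) ∧
      (N < k → (shift γ F).coeff k = 0)) ?_ ?_ ?_ hF
  · rw [map_zero, Polynomial.coeff_zero]
    exact ⟨fun j _ => MvPolynomial.isWeightedHomogeneous_zero R _ _, fun _ => rfl⟩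
  · intro p r _ _ hp hr
    rw [map_add, Polynomial.coeff_add]
    exact ⟨fun j hj => (hp.1 j hj).add (hr.1 j hj), fun h => by rw [hp.2 h, hr.2 h, add_zero]⟩
  · intro d a hd
    have e : MvPolynomial.monomial d a =
        MvPolynomial.C a * ((Finsupp.toMultiset d).map MvPolynomial.X).prod := by
      rw [MvPolynomial.monomial_eq, Finsupp.toMultiset_map, Finsupp.prod_toMultiset,
        Finsupp.prod_mapDomain_index (by simp) (by simp [pow_add])]
    have h := mono (Finsupp.toMultiset d) k
    rw [sum_toMultiset, hd] at h
    rw [e, map_mul, shift_C, Polynomial.coeff_C_mul]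
    exact ⟨fun j hj => MvPolynomial.IsWeightedHomogeneous.C_mul (h.1 j hj) _,
      fun hk => by rw [h.2 hk, mul_zero]⟩

variable [Algebra ℚ R]

theorem isHomog_genSeries (β : ℕ+ → R) (k : ℕ) :
    IsHomog (PowerSeries.coeff k (genSeries β)) k := by
  induction k using Nat.strong_induction_on with
  | _ k ih =>
  cases k with
  | zero =>
    rw [PowerSeries.coeff_zero_eq_constantCoeff_apply, genSeries, constantCoeff_newtonExp]
    exact MvPolynomial.isWeightedHomogeneous_one R _
  | succ k =>
    have h := coeff_newtonExp_succ (logSeries β) k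
    have hu : PowerSeries.coeff (k + 1) (genSeries β) =
        MvPolynomial.C (algebraMap ℚ R ((k : ℚ) + 1)⁻¹) *
          (PowerSeries.coeff (k + 1) (genSeries β) * ((k : MvPolynomial ℕ+ R) + 1)) := by
      have e : ((k : MvPolynomial ℕ+ R) + 1) = MvPolynomial.C (algebraMap ℚ R ((k : ℚ) + 1)) := by
        simp
      rw [e, mul_comm, mul_assoc, ← map_mul, ← map_mul, mul_inv_cancel₀ (by positivity), map_one,
        map_one, mul_one]
    rw [hu, genSeries, h]
    refine MvPolynomial.IsWeightedHomogeneous.C_mul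
      (MvPolynomial.IsWeightedHomogeneous.sum _ _ _ fun x hx => ?_) _
    rw [Finset.HasAntidiagonal.mem_antidiagonal] at hx
    rw [logSeries, PowerSeries.coeff_mk]
    have := (MvPolynomial.IsWeightedHomogeneous.C_mul
      (MvPolynomial.isWeightedHomogeneous_X R (fun n : ℕ+ => (n : ℕ)) x.1.succPNat)
        (β x.1.succPNat)).mul (ih x.2 (by omega))
    rw [Nat.succPNat_coe] at this
    rwa [show x.1.succ + x.2 = k + 1 by omega] at this

theorem isHomog_macOp (q s : R) {F : MvPolynomial ℕ+ R} {N : ℕ} (hF : IsHomog F N) :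
    IsHomog (macOp q s F) N := by
  rw [macOp_eq_sum q s F (N := N + (shift (fun n => q ^ (n : ℕ) - 1) F).natDegree + 1) (by omega)]
  refine MvPolynomial.IsWeightedHomogeneous.sum _ _ _ fun k _ => ?_
  obtain ⟨h1, h2⟩ := isHomog_shift_coeff (fun n => q ^ (n : ℕ) - 1) hF k
  by_cases h : N < k
  · rw [h2 h, mul_zero]; exact MvPolynomial.isWeightedHomogeneous_zero R _ _
  · have := (isHomog_genSeries (fun n : ℕ+ => 1 - s ^ (n : ℕ)) k).mul (h1 (N - k) (by omega))
    rwa [show k + (N - k) = N by omega] at this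

end Homogeneity

/-! ### Symmetric functions of finitely many variables -/

section FiniteVariables

variable {R : Type} [CommRing R]

/-- The evaluation of a symmetric function at `n` elements of an algebra. -/
def psEval {A : Type*} [CommRing A] [Algebra R A] {n : ℕ} (x : Fin n → A) :
    MvPolynomial ℕ+ R →ₐ[R] A :=
  MvPolynomial.aeval fun k => ∑ j, x j ^ (k : ℕ)

theorem psEval_X {A : Type*} [CommRing A] [Algebra R A] {n : ℕ} (x : Fin n → A) (k : ℕ+) :
    psEval x (MvPolynomial.X k : MvPolynomial ℕ+ R) = ∑ j, x j ^ (k : ℕ) := by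
  simp [psEval]

theorem map_psEval {A B : Type*} [CommRing A] [Algebra R A] [CommRing B] [Algebra R B] {n : ℕ}
    (φ : A →ₐ[R] B) (x : Fin n → A) (F : MvPolynomial ℕ+ R) :
    φ (psEval x F) = psEval (fun j => φ (x j)) F := by
  have : φ.comp (psEval x) = psEval (R := R) fun j => φ (x j) := by
    refine MvPolynomial.algHom_ext fun k => ?_
    simp [psEval_X]
  exact DFunLike.congr_fun this F

/-- The restriction of a symmetric function to `n` variables. -/
def toFin (n : ℕ) : MvPolynomial ℕ+ R →ₐ[R] MvPolynomial (Fin n) R := psEval MvPolynomial.X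

theorem aeval_toFin {A : Type*} [CommRing A] [Algebra R A] {n : ℕ} (x : Fin n → A)
    (F : MvPolynomial ℕ+ R) : MvPolynomial.aeval x (toFin n F) = psEval x F := by
  rw [toFin, map_psEval]
  simp

end FiniteVariables

/-! ### Partial fractions and the `q`-difference form of the Macdonald operator. -/

section Lagrange

variable {F : Type*} [Field F] {n : ℕ}

/-- The coefficients of the Macdonald difference operator. -/
def opCoeff (s : F) (x : Fin n → F) (i : Fin n) : F :=
  (1 - s) * ∏ j ∈ Finset.univ.erase i, (x i - s * x j) / (x i - x j)

/-- Both sides are polynomials in `v` of degree at most `n` that agree at the `n + 1` distinct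
points `0` and `x i`. -/
theorem lagrange_identity (s : F) {x : Fin n → F} (hx : Function.Injective x)
    (hx0 : ∀ i, x i ≠ 0) (v : F) :
    ∏ j, (v - s * x j) = s ^ n * ∏ j, (v - x j) +
      v * ∑ i, opCoeff s x i * ∏ j ∈ Finset.univ.erase i, (v - x j) := by
  classical
  set f : Polynomial F := ∏ j, (Polynomial.X - Polynomial.C (s * x j)) with hf
  set g : Polynomial F := Polynomial.C (s ^ n) * ∏ j, (Polynomial.X - Polynomial.C (x j)) +
    Polynomial.X * ∑ i, Polynomial.C (opCoeff s x i) *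
      ∏ j ∈ Finset.univ.erase i, (Polynomial.X - Polynomial.C (x j)) with hg
  have hprod : ∀ (T : Finset (Fin n)) (y : Fin n → F),
      (∏ j ∈ T, (Polynomial.X - Polynomial.C (y j))).degree ≤ (T.card : WithBot ℕ) := by
    intro T y
    rw [Polynomial.degree_prod]
    simp
  have hC : ∀ (a : F) (p : Polynomial F), (Polynomial.C a * p).degree ≤ p.degree := fun a p => by
    rw [← Polynomial.smul_eq_C_mul]; exact Polynomial.degree_smul_le a p
  have hfd : f.degree < ((insert 0 (Finset.univ.image x)).card : ℕ) ∧
      g.degree < ((insert 0 (Finset.univ.image x)).card : ℕ) := by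
    have hcard : (insert 0 (Finset.univ.image x)).card = n + 1 := by
      rw [Finset.card_insert_of_notMem (by simpa using hx0), Finset.card_image_of_injective _ hx,
        Finset.card_univ, Fintype.card_fin]
    rw [hcard]
    have hlt : (n : WithBot ℕ) < ((n + 1 : ℕ) : WithBot ℕ) := by exact_mod_cast Nat.lt_succ_self n
    have hu : (Finset.univ : Finset (Fin n)).card = n := by simp
    refine ⟨((hprod _ _).trans (by rw [hu])).trans_lt hlt, lt_of_le_of_lt ?_ hlt⟩
    refine (Polynomial.degree_add_le _ _).trans (max_le ?_ ?_)
    · refine (hC _ _).trans ((hprod _ _).trans (by rw [hu]))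
    · rw [Finset.mul_sum]
      refine (Polynomial.degree_sum_le _ _).trans (Finset.sup_le fun i _ => ?_)
      rw [← mul_assoc, mul_comm Polynomial.X, mul_assoc]
      refine (hC _ _).trans ?_
      rw [Polynomial.degree_mul, Polynomial.degree_X]
      have h1 := hprod (Finset.univ.erase i) x
      rw [Finset.card_erase_of_mem (Finset.mem_univ i), hu] at h1
      have hn : 1 + (n - 1) = n := by have := i.2; omega
      calc _ ≤ (1 : WithBot ℕ) + ((n - 1 : ℕ) : WithBot ℕ) := by gcongr
        _ = (n : WithBot ℕ) := by exact_mod_cast hn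
  have hfg : f = g := by
    refine Polynomial.eq_of_degrees_lt_of_eval_finset_eq (insert 0 (Finset.univ.image x)) hfd.1 hfd.2 ?_
    intro y hy
    simp only [hf, hg, Polynomial.eval_prod, Polynomial.eval_add, Polynomial.eval_mul,
      Polynomial.eval_sub, Polynomial.eval_X, Polynomial.eval_C, Polynomial.eval_finsetSum]
    rcases Finset.mem_insert.mp hy with rfl | hy
    · simp only [zero_sub, zero_mul, add_zero]
      calc ∏ j, -(s * x j) = ∏ j, s * -x j := Finset.prod_congr rfl fun _ _ => by ring
        _ = _ := by rw [Finset.prod_mul_distrib]; simp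
    · obtain ⟨i, -, rfl⟩ := Finset.mem_image.mp hy
      rw [Finset.prod_eq_zero (f := fun j => x i - x j) (Finset.mem_univ i) (sub_self _), mul_zero,
        zero_add, Finset.sum_eq_single i]
      · have h2 : ∏ j ∈ Finset.univ.erase i, (x i - x j) ≠ 0 :=
          Finset.prod_ne_zero_iff.mpr fun j hj =>
            sub_ne_zero.mpr fun h => (Finset.ne_of_mem_erase hj) (hx h).symm
        rw [opCoeff, Finset.prod_div_distrib, mul_assoc (1 - s), div_mul_cancel₀ _ h2,
          ← Finset.mul_prod_erase _ _ (Finset.mem_univ i)]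
        ring
      · intro j _ hj
        rw [Finset.prod_eq_zero (Finset.mem_erase.mpr ⟨hj.symm, Finset.mem_univ i⟩) (sub_self _),
          mul_zero]
      · exact fun h => absurd (Finset.mem_univ i) h
  have := congrArg (Polynomial.eval v) hfg
  simpa only [hf, hg, Polynomial.eval_prod, Polynomial.eval_add, Polynomial.eval_mul,
      Polynomial.eval_sub, Polynomial.eval_X, Polynomial.eval_C, Polynomial.eval_finsetSum] using this

/-- This is `lagrange_identity` at `v = u⁻¹` multiplied by `u ^ n`; it holds for the infinitely many
nonzero `u`, hence as an identity of polynomials. -/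
theorem lagrange_identity_inv [Infinite F] (s : F) {x : Fin n → F} (hx : Function.Injective x)
    (hx0 : ∀ i, x i ≠ 0) :
    ∏ j, (1 - Polynomial.C (s * x j) * Polynomial.X) =
      Polynomial.C (s ^ n) * ∏ j, (1 - Polynomial.C (x j) * Polynomial.X) +
      ∑ i, Polynomial.C (opCoeff s x i) *
        ∏ j ∈ Finset.univ.erase i, (1 - Polynomial.C (x j) * Polynomial.X) := by
  refine Polynomial.eq_of_infinite_eval_eq _ _ ((Set.finite_singleton (0 : F)).infinite_compl.mono ?_)
  intro u hu
  have hu0 : u ≠ 0 := hu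
  change Polynomial.eval u _ = Polynomial.eval u _
  simp only [Polynomial.eval_prod, Polynomial.eval_add, Polynomial.eval_mul,
    Polynomial.eval_sub, Polynomial.eval_X, Polynomial.eval_C, Polynomial.eval_finsetSum,
    Polynomial.eval_one]
  have h := congrArg (fun y => u ^ n * y) (lagrange_identity s hx hx0 u⁻¹)
  have hp : ∀ (T : Finset (Fin n)) (y : Fin n → F),
      ∏ j ∈ T, (1 - y j * u) = u ^ T.card * ∏ j ∈ T, (u⁻¹ - y j) := by
    intro T y
    rw [← Finset.prod_const, ← Finset.prod_mul_distrib]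
    refine Finset.prod_congr rfl fun j _ => ?_
    rw [mul_sub, mul_inv_cancel₀ hu0, mul_comm]
  rw [hp, hp, Finset.sum_congr rfl fun i _ => by rw [hp]]
  simp only [Finset.card_univ, Fintype.card_fin] at h ⊢
  rw [h]
  rw [mul_add, mul_left_comm, add_right_inj, Finset.mul_sum, Finset.mul_sum]
  refine Finset.sum_congr rfl fun i _ => ?_
  rw [Finset.card_erase_of_mem (Finset.mem_univ i), Finset.card_univ, Fintype.card_fin]
  have hn : u ^ n * u⁻¹ = u ^ (n - 1) := by
    obtain ⟨m, hm⟩ : ∃ m, n = m + 1 := ⟨n - 1, by have := i.2; omega⟩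
    rw [hm, pow_succ, mul_assoc, mul_inv_cancel₀ hu0, mul_one]; rfl
  rw [← hn]; ring

/-- The generating function `∏ (1 - s x_j u) / (1 - x_j u)` by partial fractions. -/
theorem newtonExp_eq_partial_fractions [Algebra ℚ F] (s : F) {x : Fin n → F}
    (hx : Function.Injective x) (hx0 : ∀ i, x i ≠ 0) :
    newtonExp (PowerSeries.mk fun k => (1 - s ^ (k + 1)) * ∑ j, x j ^ (k + 1)) =
      PowerSeries.C (s ^ n) + ∑ i, PowerSeries.C (opCoeff s x i) * PowerSeries.mk fun k => x i ^ k := by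
  have : CharZero F := algebraRat.charZero F
  have e1 : (PowerSeries.mk fun k => (1 - s ^ (k + 1)) * ∑ j, x j ^ (k + 1)) =
      ∑ j, (PowerSeries.mk fun k => x j ^ (k + 1)) +
        ∑ j, (PowerSeries.mk fun k => -(s * x j) ^ (k + 1)) := by
    ext k
    simp only [PowerSeries.coeff_mk, map_add, map_sum]
    rw [sub_mul, one_mul, sub_eq_add_neg, Finset.mul_sum, ← Finset.sum_neg_distrib]
    simp only [mul_pow]
  rw [e1, newtonExp_add, newtonExp_sum, newtonExp_sum]
  simp only [newtonExp_neg_geom, newtonExp_geom]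
  have hg : ∀ a : F, (PowerSeries.mk fun k => a ^ k) *
      (1 - PowerSeries.C a * PowerSeries.X) = 1 := fun a => by
    rw [← newtonExp_geom, newtonExp_geom_mul]
  have h := congrArg (Polynomial.coeToPowerSeries.ringHom (R := F)) (lagrange_identity_inv s hx hx0)
  simp only [map_add, map_sum, map_mul, map_prod, map_sub, map_one,
    Polynomial.coeToPowerSeries.ringHom_apply, Polynomial.coe_C, Polynomial.coe_X] at h
  simp only [map_mul] at h ⊢
  rw [h, mul_add]
  congr 1
  · rw [mul_left_comm, ← Finset.prod_mul_distrib, Finset.prod_congr rfl fun j _ => hg (x j)]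
    simp
  · rw [Finset.mul_sum]
    refine Finset.sum_congr rfl fun i _ => ?_
    rw [← Finset.mul_prod_erase _ _ (Finset.mem_univ i)]
    have := Finset.prod_congr (rfl : Finset.univ.erase i = Finset.univ.erase i)
      (fun j _ => hg (x j))
    rw [Finset.prod_mul_distrib, Finset.prod_const_one] at this
    linear_combination (PowerSeries.mk fun k => x i ^ k) * PowerSeries.C (opCoeff s x i) * this

variable {R : Type} [CommRing R] [Algebra ℚ R] [Algebra R F] [Algebra ℚ F]

theorem coeff_map_genSeries (s : R) (x : Fin n → F) (k : ℕ) :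
    psEval x (PowerSeries.coeff k (genSeries fun m : ℕ+ => 1 - s ^ (m : ℕ))) =
      PowerSeries.coeff k (newtonExp (PowerSeries.mk fun k =>
        (1 - (algebraMap R F s) ^ (k + 1)) * ∑ j, x j ^ (k + 1))) := by
  rw [← AlgHom.coe_toRingHom, ← PowerSeries.coeff_map, genSeries, map_newtonExp]
  congr 3
  ext k
  rw [PowerSeries.coeff_map, logSeries, PowerSeries.coeff_mk, PowerSeries.coeff_mk,
    AlgHom.coe_toRingHom, map_mul, psEval_X, ← MvPolynomial.algebraMap_eq, AlgHom.commutes]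
  simp

/-- The Macdonald operator acts on symmetric functions of `n` variables as a `q`-difference
operator. -/
theorem psEval_macOp (q s : R) {x : Fin n → F} (hx : Function.Injective x)
    (hx0 : ∀ i, x i ≠ 0) (G : MvPolynomial ℕ+ R) :
    psEval x (macOp q s G) = (algebraMap R F s) ^ n * psEval x G +
      ∑ i, opCoeff (algebraMap R F s) x i *
        psEval (Function.update x i (algebraMap R F q * x i)) G := by
  set U := shift (fun n => q ^ (n : ℕ) - 1) G with hU
  -- Dilating `x i` by `q` adds `(q^m - 1) (x i)^m` to the power sum `p_m`, which is the shift
  -- evaluated at `u = x i`.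
  have hev : ∀ i, psEval (Function.update x i (algebraMap R F q * x i)) G =
      (U.map (psEval x : MvPolynomial ℕ+ R →ₐ[R] F).toRingHom).eval (x i) := by
    intro i
    have : psEval (Function.update x i (algebraMap R F q * x i)) =
        (((Polynomial.aeval (R := F) (x i)).restrictScalars R).comp
          (Polynomial.mapAlgHom (psEval x : MvPolynomial ℕ+ R →ₐ[R] F))).comp
            (shift fun n => q ^ (n : ℕ) - 1) := by
      refine MvPolynomial.algHom_ext fun m => ?_
      simp only [AlgHom.comp_apply, shift_X, map_add, map_mul, map_pow]
      simp only [Polynomial.coe_mapAlgHom, Polynomial.map_C, Polynomial.map_X,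
        AlgHom.restrictScalars_apply, Polynomial.aeval_C, Polynomial.aeval_X, psEval_X,
        RingHom.coe_coe, Algebra.algebraMap_self_apply]
      rw [← Finset.add_sum_erase _ _ (Finset.mem_univ i),
        ← Finset.add_sum_erase _ (fun j => x j ^ (m : ℕ)) (Finset.mem_univ i)]
      rw [Function.update_self]
      rw [Finset.sum_congr rfl fun j hj => by
        rw [Function.update_of_ne (Finset.ne_of_mem_erase hj)]]
      rw [← MvPolynomial.algebraMap_eq, AlgHom.commutes, map_sub, map_pow, map_one]
      ring
    rw [this]
    simp [hU]
  have h0 : psEval x G = (U.map (psEval x : MvPolynomial ℕ+ R →ₐ[R] F).toRingHom).coeff 0 := by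
    rw [Polynomial.coeff_map, hU, coeff_zero_shift]; rfl
  rw [macOp_eq_sum q s G (Nat.lt_succ_self _), map_sum]
  -- By partial fractions, `Q_k` in `n` variables is `s^n` at `k = 0` plus `∑ opCoeff s x i * (x
  -- i)^k`. Summing against `U_k` gives the constant coefficient of the shift and its values at `u =
  -- x i`.
  simp only [map_mul, coeff_map_genSeries, newtonExp_eq_partial_fractions _ hx hx0, map_add, map_sum,
    PowerSeries.coeff_C_mul, PowerSeries.coeff_mk, add_mul, Finset.sum_add_distrib]
  congr 1
  · rw [Finset.sum_eq_single 0]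
    · rw [PowerSeries.coeff_C, if_pos rfl, h0, Polynomial.coeff_map]; rfl
    · intro k _ hk
      rw [PowerSeries.coeff_C, if_neg hk, zero_mul]
    · simp
  · simp only [Finset.sum_mul]
    rw [Finset.sum_comm]
    refine Finset.sum_congr rfl fun i _ => ?_
    rw [hev, Polynomial.eval_eq_sum_range' (n := U.natDegree.succ)
      (Nat.lt_succ_of_le (Polynomial.natDegree_map_le)), Finset.mul_sum]
    refine Finset.sum_congr rfl fun k _ => ?_
    rw [Polynomial.coeff_map]
    simp only [AlgHom.toRingHom_eq_coe, RingHom.coe_coe]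
    ring

end Lagrange

/-! ### The Macdonald operator on polynomials in `n` variables -/

section Polynomials

open MvPolynomial

variable {K : Type} [Field K] {n : ℕ}

/-- The product of `x_j - x_k` over the ordered pairs `j ≠ k`. -/
def vand (K : Type) [Field K] (n : ℕ) : MvPolynomial (Fin n) K :=
  ∏ j, ∏ k ∈ Finset.univ.erase j, (X j - X k)

/-- The product `vand` with `x_i - x_k` replaced by `x_i - s x_k`. -/
def vandShift (s : K) (i : Fin n) : MvPolynomial (Fin n) K :=
  ∏ j, ∏ k ∈ Finset.univ.erase j, (X j - C (if j = i then s else 1) * X k)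

/-- The dilation `x_i ↦ q x_i`. -/
def dilate (q : K) (i : Fin n) : MvPolynomial (Fin n) K →ₐ[K] MvPolynomial (Fin n) K :=
  aeval (Function.update X i (C q * X i))

theorem X_sub_ne_zero {j k : Fin n} (h : j ≠ k) (c : K) :
    (X j - C c * X k : MvPolynomial (Fin n) K) ≠ 0 := by
  classical
  intro h0
  have := congrArg (coeff (Finsupp.single j 1)) h0
  have hs : (Finsupp.single k 1 : Fin n →₀ ℕ) ≠ Finsupp.single j 1 := fun h' =>
    h ((Finsupp.single_left_inj one_ne_zero).mp h').symm
  rw [coeff_sub, coeff_C_mul, coeff_X, coeff_X, if_pos rfl, if_neg hs, mul_zero, sub_zero,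
    coeff_zero] at this
  exact one_ne_zero this

theorem vand_ne_zero : vand K n ≠ 0 := by
  refine Finset.prod_ne_zero_iff.mpr fun j _ => Finset.prod_ne_zero_iff.mpr fun k hk => ?_
  have := X_sub_ne_zero (K := K) (Finset.ne_of_mem_erase hk).symm 1
  rwa [C_1, one_mul] at this

theorem coeff_dilate (q : K) (i : Fin n) (f : MvPolynomial (Fin n) K) (d : Fin n →₀ ℕ) :
    coeff d (dilate q i f) = q ^ d i * coeff d f := by
  classical
  induction f using MvPolynomial.induction_on' with
  | monomial e a =>
    have : dilate q i (monomial e a) = C (q ^ e i) * monomial e a := by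
      rw [dilate, aeval_monomial, algebraMap_eq, monomial_eq, Finsupp.prod_fintype _ _ (by simp),
        Finsupp.prod_fintype _ _ (by simp), ← Finset.mul_prod_erase _ _ (Finset.mem_univ i),
        ← Finset.mul_prod_erase _ (fun i => X i ^ e i) (Finset.mem_univ i), Function.update_self,
        Finset.prod_congr rfl fun j hj => by rw [Function.update_of_ne (Finset.ne_of_mem_erase hj)],
        mul_pow, C_pow]
      ring
    rw [this, coeff_C_mul, coeff_monomial]
    split_ifs with h
    · rw [h]
    · ring
  | add p r hp hr => rw [map_add, coeff_add, coeff_add, hp, hr, mul_add]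

/-- The `q`-difference formula with cleared denominators. It is obtained in the fraction field of
the polynomial ring, where the variables are distinct and nonzero; `vand` times `opCoeff` is
`vandShift` up to the factor `1 - s`. -/
theorem vand_mul_toFin_macOp [Algebra ℚ K] (q s : K) (G : MvPolynomial ℕ+ K) :
    vand K n * toFin n (macOp q s G) = C (s ^ n) * (vand K n * toFin n G) +
      C (1 - s) * ∑ i, vandShift s i * dilate q i (toFin n G) := by
  set L := FractionRing (MvPolynomial (Fin n) K)
  set x : Fin n → L := fun j => algebraMap (MvPolynomial (Fin n) K) L (X j) with hx
  have hinj : Function.Injective (algebraMap (MvPolynomial (Fin n) K) L) :=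
    IsFractionRing.injective _ _
  have hxi : Function.Injective x := fun i j h => X_injective (hinj h)
  have hx0 : ∀ i, x i ≠ 0 := fun i h => X_ne_zero i (hinj (h.trans (map_zero _).symm))
  have hto : ∀ F : MvPolynomial ℕ+ K, algebraMap (MvPolynomial (Fin n) K) L (toFin n F) = psEval x F := fun F =>
    map_psEval (IsScalarTower.toAlgHom K (MvPolynomial (Fin n) K) L) X F
  have hCK : ∀ a : K, algebraMap (MvPolynomial (Fin n) K) L (C a) = algebraMap K L a := fun a =>
    (IsScalarTower.algebraMap_apply K (MvPolynomial (Fin n) K) L a).symm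
  have hdil : ∀ i, algebraMap (MvPolynomial (Fin n) K) L (dilate q i (toFin n G)) =
      psEval (Function.update x i (algebraMap K L q * x i)) G := by
    intro i
    rw [dilate, aeval_toFin]
    have := map_psEval (IsScalarTower.toAlgHom K (MvPolynomial (Fin n) K) L)
      (Function.update X i (C q * X i)) G
    rw [IsScalarTower.coe_toAlgHom'] at this
    rw [this]
    congr 2
    ext j
    by_cases h : j = i
    · subst h; simp [hx, hCK]
    · simp [Function.update_of_ne h, hx]
  have hvs : ∀ i, algebraMap (MvPolynomial (Fin n) K) L (vand K n) * opCoeff (algebraMap K L s) x i =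
      algebraMap (MvPolynomial (Fin n) K) L (C (1 - s)) * algebraMap (MvPolynomial (Fin n) K) L (vandShift s i) := by
    intro i
    have h2 : ∏ j ∈ Finset.univ.erase i, (x i - x j) ≠ 0 :=
      Finset.prod_ne_zero_iff.mpr fun j hj =>
        sub_ne_zero.mpr fun h => (Finset.ne_of_mem_erase hj) (hxi h).symm
    simp only [vand, vandShift, map_prod, map_sub, map_mul, hCK]
    rw [opCoeff, Finset.prod_div_distrib,
      ← Finset.mul_prod_erase Finset.univ (fun j => ∏ k ∈ Finset.univ.erase j,
        (algebraMap (MvPolynomial (Fin n) K) L (X j) - algebraMap (MvPolynomial (Fin n) K) L (X k))) (Finset.mem_univ i),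
      ← Finset.mul_prod_erase Finset.univ (fun j => ∏ k ∈ Finset.univ.erase j,
        (algebraMap (MvPolynomial (Fin n) K) L (X j) - algebraMap K L (if j = i then s else 1) * algebraMap (MvPolynomial (Fin n) K) L (X k)))
        (Finset.mem_univ i)]
    have h3 : ∏ j ∈ Finset.univ.erase i, ∏ k ∈ Finset.univ.erase j,
        (algebraMap (MvPolynomial (Fin n) K) L (X j) - algebraMap K L (if j = i then s else 1) * algebraMap (MvPolynomial (Fin n) K) L (X k)) =
        ∏ j ∈ Finset.univ.erase i, ∏ k ∈ Finset.univ.erase j,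
        (algebraMap (MvPolynomial (Fin n) K) L (X j) - algebraMap (MvPolynomial (Fin n) K) L (X k)) := by
      refine Finset.prod_congr rfl fun j hj => Finset.prod_congr rfl fun k _ => ?_
      rw [if_neg (Finset.ne_of_mem_erase hj), map_one, one_mul]
    rw [h3, if_pos rfl, map_one]
    change (∏ k ∈ Finset.univ.erase i, (x i - x k)) * _ * _ = _
    rw [show (∏ k ∈ Finset.univ.erase i, (algebraMap (MvPolynomial (Fin n) K) L (X i) -
      algebraMap K L s * algebraMap (MvPolynomial (Fin n) K) L (X k))) = ∏ k ∈ Finset.univ.erase i,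
        (x i - algebraMap K L s * x k) from rfl]
    generalize ∏ k ∈ Finset.univ.erase i, (x i - algebraMap K L s * x k) = b
    generalize (∏ k ∈ Finset.univ.erase i, (x i - x k)) = a at h2 ⊢
    rw [mul_comm a, mul_assoc, mul_left_comm a, mul_div_cancel₀ _ h2]
    ring
  apply hinj
  simp only [map_add, map_mul, map_sum, hto, hdil, psEval_macOp q s hxi hx0, mul_add]
  rw [← hto, hCK, map_pow, Finset.mul_sum, Finset.mul_sum]
  congr 1
  · ring
  · refine Finset.sum_congr rfl fun i _ => ?_
    rw [← mul_assoc, hvs, mul_assoc]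

/-! ### Weighted degrees -/

/-- The substitution `x_i ↦ x_i Z^{w_i}`. -/
def grade (w : Fin n → ℕ) :
    MvPolynomial (Fin n) K →ₐ[K] Polynomial (MvPolynomial (Fin n) K) :=
  aeval fun i => Polynomial.C (X i) * Polynomial.X ^ w i

theorem coeff_coeff_grade (w : Fin n → ℕ) (f : MvPolynomial (Fin n) K) (k : ℕ) (d : Fin n →₀ ℕ) :
    coeff d ((grade w f).coeff k) = if ∑ i, d i * w i = k then coeff d f else 0 := by
  classical
  induction f using MvPolynomial.induction_on' with
  | monomial e a =>
    have : grade w (monomial e a) = Polynomial.C (monomial e a) *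
        Polynomial.X ^ (∑ i, e i * w i) := by
      rw [grade, aeval_monomial, Finsupp.prod_fintype _ _ (by simp), monomial_eq,
        Finsupp.prod_fintype _ _ (by simp), map_mul, map_prod, ← Finset.prod_pow_eq_pow_sum,
        mul_assoc, ← Finset.prod_mul_distrib]
      congr 1
      refine Finset.prod_congr rfl fun i _ => ?_
      rw [mul_pow, ← pow_mul, map_pow, mul_comm (w i)]
    rw [this, Polynomial.coeff_C_mul, Polynomial.coeff_X_pow]
    by_cases h : e = d
    · subst h
      by_cases h2 : k = ∑ i, e i * w i
      · rw [if_pos h2, if_pos h2.symm, mul_one]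
      · rw [if_neg h2, if_neg (Ne.symm h2), mul_zero, coeff_zero]
    · have h0 : coeff d (monomial e a) = 0 := by rw [coeff_monomial, if_neg h]
      rw [h0, ite_self]
      split_ifs
      · rw [mul_one, h0]
      · rw [mul_zero, coeff_zero]
  | add p r hp hr =>
    rw [map_add, Polynomial.coeff_add, coeff_add, hp, hr, coeff_add]
    split_ifs <;> simp

theorem le_natDegree_grade (w : Fin n → ℕ) {f : MvPolynomial (Fin n) K} {d : Fin n →₀ ℕ}
    (hd : coeff d f ≠ 0) : ∑ i, d i * w i ≤ (grade w f).natDegree := by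
  refine Polynomial.le_natDegree_of_ne_zero fun h => hd ?_
  have := coeff_coeff_grade w f (∑ i, d i * w i) d
  rw [h, if_pos rfl, coeff_zero] at this
  exact this.symm

theorem natDegree_grade_le (w : Fin n → ℕ) {f : MvPolynomial (Fin n) K} {N : ℕ}
    (h : ∀ d, coeff d f ≠ 0 → ∑ i, d i * w i ≤ N) : (grade w f).natDegree ≤ N := by
  refine Polynomial.natDegree_le_iff_coeff_eq_zero.mpr fun k hk => ?_
  ext d
  rw [coeff_coeff_grade, coeff_zero]
  split_ifs with h2
  · by_contra hc
    have := h d hc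
    omega
  · rfl

theorem grade_ne_zero (w : Fin n → ℕ) {f : MvPolynomial (Fin n) K} (hf : f ≠ 0) :
    grade w f ≠ 0 := by
  obtain ⟨d, hd⟩ := ne_zero_iff.mp hf
  intro h
  have := coeff_coeff_grade w f (∑ i, d i * w i) d
  rw [h, if_pos rfl, Polynomial.coeff_zero, coeff_zero] at this
  exact hd this.symm

theorem natDegree_grade_mul (w : Fin n → ℕ) {f g : MvPolynomial (Fin n) K} (hf : f ≠ 0)
    (hg : g ≠ 0) : (grade w (f * g)).natDegree = (grade w f).natDegree + (grade w g).natDegree := by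
  rw [map_mul, Polynomial.natDegree_mul (grade_ne_zero w hf) (grade_ne_zero w hg)]

theorem sum_single_mul (w : Fin n → ℕ) (j : Fin n) :
    ∑ i, (Finsupp.single j 1 : Fin n →₀ ℕ) i * w i = w j := by
  rw [Finset.sum_eq_single j]
  · simp
  · intro i _ hi; rw [Finsupp.single_eq_of_ne hi, zero_mul]
  · simp

/-- The weighted degree of `x_j - c x_k` is at most the larger of the two weights, which is attained
for `c = 1`. Degrees add in the product `vand` because no factor is zero. -/
theorem natDegree_grade_vandShift_le (w : Fin n → ℕ) (s : K) (i : Fin n) :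
    (grade w (vandShift s i)).natDegree ≤ (grade w (vand K n)).natDegree := by
  classical
  have hfac : ∀ j k : Fin n, j ≠ k → ∀ c : K, (grade w (X j - C c * X k)).natDegree ≤
      (grade w (X j - X k : MvPolynomial (Fin n) K)).natDegree := by
    intro j k hjk c
    have hs : (Finsupp.single j 1 : Fin n →₀ ℕ) ≠ Finsupp.single k 1 := fun h =>
      hjk ((Finsupp.single_left_inj one_ne_zero).mp h)
    have h1 : w j ≤ (grade w (X j - X k : MvPolynomial (Fin n) K)).natDegree := by
      rw [← sum_single_mul w j]
      refine le_natDegree_grade w ?_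
      rw [coeff_sub, coeff_X, coeff_X, if_neg hs.symm]; simp
    have h2 : w k ≤ (grade w (X j - X k : MvPolynomial (Fin n) K)).natDegree := by
      rw [← sum_single_mul w k]
      refine le_natDegree_grade w ?_
      rw [coeff_sub, coeff_X, coeff_X, if_neg hs]; simp
    refine natDegree_grade_le w fun d hd => ?_
    rw [coeff_sub, coeff_C_mul, coeff_X, coeff_X] at hd
    by_cases hj : Finsupp.single j 1 = d
    · rw [← hj, sum_single_mul]; exact h1
    · by_cases hk : Finsupp.single k 1 = d
      · rw [← hk, sum_single_mul]; exact h2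
      · rw [if_neg hj, if_neg hk] at hd; simp at hd
  have hne : ∀ j, ∀ k ∈ Finset.univ.erase j, grade w (X j - X k : MvPolynomial (Fin n) K) ≠ 0 := by
    intro j k hk
    have := X_sub_ne_zero (K := K) (Finset.ne_of_mem_erase hk).symm 1
    rw [C_1, one_mul] at this
    exact grade_ne_zero w this
  rw [vand, vandShift, map_prod, map_prod, Finset.prod_congr rfl fun j _ => map_prod (grade w) _ _,
    Finset.prod_congr (f := fun j => grade w (∏ k ∈ Finset.univ.erase j, (X j - X k))) rfl
      fun j _ => map_prod (grade w) _ _]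
  rw [Polynomial.natDegree_prod _ _ fun j _ => Finset.prod_ne_zero_iff.mpr (hne j)]
  refine (Polynomial.natDegree_prod_le _ _).trans (Finset.sum_le_sum fun j _ => ?_)
  rw [Polynomial.natDegree_prod _ _ (hne j)]
  refine (Polynomial.natDegree_prod_le _ _).trans (Finset.sum_le_sum fun k hk => ?_)
  exact hfac j k (Finset.ne_of_mem_erase hk).symm _

/-- The Macdonald operator does not raise weighted degrees. -/
theorem natDegree_grade_macOp_le [Algebra ℚ K] (w : Fin n → ℕ) (q s : K) (G : MvPolynomial ℕ+ K) :
    (grade w (toFin n (macOp q s G))).natDegree ≤ (grade w (toFin n G)).natDegree := by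
  by_cases h0 : toFin n (macOp q s G) = 0
  · rw [h0]; simp
  -- Degrees in `Z` add for products in a domain, so the degree of `vand` cancels from the identity
  -- with cleared denominators.
  have h := congrArg (fun f => (grade w f).natDegree) (vand_mul_toFin_macOp (n := n) q s G)
  rw [natDegree_grade_mul w vand_ne_zero h0] at h
  have hC : ∀ (a : K) (f : MvPolynomial (Fin n) K), (grade w (C a * f)).natDegree ≤
      (grade w f).natDegree := fun a f => natDegree_grade_le w fun d hd => by
    rw [coeff_C_mul] at hd
    exact le_natDegree_grade w (right_ne_zero_of_mul hd)
  have hle : (grade w (C (s ^ n) * (vand K n * toFin n G) +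
      C (1 - s) * ∑ i, vandShift s i * dilate q i (toFin n G))).natDegree ≤
      (grade w (vand K n)).natDegree + (grade w (toFin n G)).natDegree := by
    rw [map_add]
    refine (Polynomial.natDegree_add_le _ _).trans (max_le ?_ ?_)
    · refine (hC _ _).trans ?_
      rw [map_mul]
      exact Polynomial.natDegree_mul_le
    · refine (hC _ _).trans ?_
      rw [map_sum]
      refine Polynomial.natDegree_sum_le_of_forall_le _ _ fun i _ => ?_
      rw [map_mul]
      refine Polynomial.natDegree_mul_le.trans (add_le_add (natDegree_grade_vandShift_le w s i) ?_)
      refine natDegree_grade_le w fun d hd => ?_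
      rw [coeff_dilate] at hd
      exact le_natDegree_grade w (right_ne_zero_of_mul hd)
  omega

/-! ### Leading terms for the lexicographic order -/

/-- The lexicographic order of the monomials, with `x_0 > x_1 > ⋯`. -/
abbrev lexOrder (n : ℕ) : MonomialOrder (Fin n) := MonomialOrder.lex

theorem single_lex_lt {j k : Fin n} (h : j < k) :
    (lexOrder n).toSyn (Finsupp.single k 1) < (lexOrder n).toSyn (Finsupp.single j 1) := by
  rw [MonomialOrder.lex_lt_iff]
  refine ⟨j, fun i hi => ?_, ?_⟩
  · change (Finsupp.single k 1 : Fin n →₀ ℕ) i = (Finsupp.single j 1 : Fin n →₀ ℕ) i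
    rw [Finsupp.single_eq_of_ne hi.ne, Finsupp.single_eq_of_ne (hi.trans h).ne]
  · change (Finsupp.single k 1 : Fin n →₀ ℕ) j < (Finsupp.single j 1 : Fin n →₀ ℕ) j
    rw [Finsupp.single_eq_of_ne h.ne, Finsupp.single_eq_same]
    exact one_pos

theorem degree_X_sub {j k : Fin n} (h : j ≠ k) {c : K} (hc : c ≠ 0) :
    (lexOrder n).degree (X j - C c * X k : MvPolynomial (Fin n) K) = Finsupp.single (min j k) 1 ∧
      (lexOrder n).leadingCoeff (X j - C c * X k : MvPolynomial (Fin n) K) =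
        if j < k then 1 else -c := by
  classical
  have e : (X j - C c * X k : MvPolynomial (Fin n) K) = X j + monomial (Finsupp.single k 1) (-c) := by
    rw [sub_eq_add_neg, ← C_mul_X_eq_monomial, C_neg, neg_mul]
  have hd1 : (lexOrder n).degree (X j : MvPolynomial (Fin n) K) = Finsupp.single j 1 :=
    MonomialOrder.degree_X
  have hd2 : (lexOrder n).degree (monomial (Finsupp.single k 1) (-c)) = Finsupp.single k 1 := by
    rw [MonomialOrder.degree_monomial, if_neg (neg_ne_zero.mpr hc)]
  rw [e]
  rcases lt_or_gt_of_ne h with hlt | hlt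
  · have hh : (lexOrder n).toSyn ((lexOrder n).degree (monomial (Finsupp.single k 1) (-c))) <
      (lexOrder n).toSyn ((lexOrder n).degree (X j : MvPolynomial (Fin n) K)) := by
      rw [hd1, hd2]; exact single_lex_lt hlt
    rw [MonomialOrder.degree_add_of_lt hh, MonomialOrder.leadingCoeff_add_of_lt hh, hd1, min_eq_left hlt.le,
      if_pos hlt, MonomialOrder.leadingCoeff_X]
    exact ⟨rfl, rfl⟩
  · have hh : (lexOrder n).toSyn ((lexOrder n).degree (X j : MvPolynomial (Fin n) K)) <
      (lexOrder n).toSyn ((lexOrder n).degree (monomial (Finsupp.single k 1) (-c))) := by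
      rw [hd1, hd2]; exact single_lex_lt hlt
    rw [add_comm, MonomialOrder.degree_add_of_lt hh, MonomialOrder.leadingCoeff_add_of_lt hh, hd2,
      min_eq_right hlt.le, if_neg hlt.not_gt, MonomialOrder.leadingCoeff_monomial]
    exact ⟨rfl, rfl⟩

theorem vand_eq_vandShift (i : Fin n) : vand K n = vandShift 1 i := by
  simp [vand, vandShift]

/-- The leading term of `x_i - s x_k` changes only for `k < i`, where it is `-s x_k` instead of
`-x_k`. There are `i` such factors. -/
theorem leading_vandShift {s : K} (hs : s ≠ 0) (i : Fin n) :
    (lexOrder n).degree (vandShift s i) = (lexOrder n).degree (vand K n) ∧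
      (lexOrder n).leadingCoeff (vandShift s i) = s ^ (i : ℕ) * (lexOrder n).leadingCoeff (vand K n) := by
  classical
  have hne : ∀ (c : K), ∀ j, ∀ k ∈ Finset.univ.erase j,
      (X j - C (if j = i then c else 1) * X k : MvPolynomial (Fin n) K) ≠ 0 := fun c j k hk =>
    X_sub_ne_zero (Finset.ne_of_mem_erase hk).symm _
  have hc0 : ∀ c : K, c ≠ 0 → ∀ j : Fin n, (if j = i then c else 1) ≠ 0 := fun c hc j => by
    split_ifs
    · exact hc
    · exact one_ne_zero
  have hreg : ∀ f : MvPolynomial (Fin n) K, f ≠ 0 → IsRegular ((lexOrder n).leadingCoeff f) := fun f hf =>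
    IsRegular.of_ne_zero (MonomialOrder.leadingCoeff_ne_zero_iff.mpr hf)
  have hdeg : ∀ c : K, c ≠ 0 → (lexOrder n).degree (vandShift c i) =
      ∑ j, ∑ k ∈ Finset.univ.erase j, (Finsupp.single (min j k) 1 : Fin n →₀ ℕ) := by
    intro c hc
    rw [vandShift, MonomialOrder.degree_prod fun j _ => Finset.prod_ne_zero_iff.mpr (hne c j)]
    refine Finset.sum_congr rfl fun j _ => ?_
    rw [MonomialOrder.degree_prod (hne c j)]
    exact Finset.sum_congr rfl fun k hk =>
      (degree_X_sub (Finset.ne_of_mem_erase hk).symm (hc0 c hc j)).1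
  have hlc : ∀ c : K, c ≠ 0 → (lexOrder n).leadingCoeff (vandShift c i) =
      ∏ j, ∏ k ∈ Finset.univ.erase j, (if j < k then 1 else -(if j = i then c else 1)) := by
    intro c hc
    rw [vandShift, MonomialOrder.leadingCoeff_prod_of_regular fun j _ =>
      hreg _ (Finset.prod_ne_zero_iff.mpr (hne c j))]
    refine Finset.prod_congr rfl fun j _ => ?_
    rw [MonomialOrder.leadingCoeff_prod_of_regular fun k hk => hreg _ (hne c j k hk)]
    exact Finset.prod_congr rfl fun k hk =>
      (degree_X_sub (Finset.ne_of_mem_erase hk).symm (hc0 c hc j)).2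
  rw [vand_eq_vandShift i]
  refine ⟨by rw [hdeg s hs, hdeg 1 one_ne_zero], ?_⟩
  rw [hlc s hs, hlc 1 one_ne_zero, ← Finset.mul_prod_erase _ _ (Finset.mem_univ i),
    ← Finset.mul_prod_erase Finset.univ (fun j => ∏ k ∈ Finset.univ.erase j,
      (if j < k then (1 : K) else -(if j = i then 1 else 1))) (Finset.mem_univ i), ← mul_assoc]
  congr 1
  · rw [if_pos rfl, if_pos rfl]
    have e : ∀ k : Fin n, (if i < k then (1 : K) else -s) =
        (if i < k then (1 : K) else s) * (if i < k then (1 : K) else -1) := fun k => by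
      split_ifs <;> ring
    rw [Finset.prod_congr rfl fun k _ => e k, Finset.prod_mul_distrib]
    congr 1
    rw [Finset.prod_ite, Finset.prod_const_one, one_mul, Finset.prod_const]
    congr 1
    have : (Finset.univ.erase i).filter (fun k => ¬ i < k) = Finset.Iio i := by
      ext k
      simp only [Finset.mem_filter, Finset.mem_erase, Finset.mem_univ, and_true, not_lt,
        Finset.mem_Iio]
      exact ⟨fun h => lt_of_le_of_ne h.2 h.1, fun h => ⟨h.ne, h.le⟩⟩
    rw [this, Fin.card_Iio]
  · refine Finset.prod_congr rfl fun j hj => ?_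
    rw [if_neg (Finset.ne_of_mem_erase hj), if_neg (Finset.ne_of_mem_erase hj)]

/-- The leading coefficient of the image `g` of `f` under the Macdonald operator. -/
theorem leading_of_vand_mul_eq (q : K) {s : K} (hs : s ≠ 0) {f g : MvPolynomial (Fin n) K}
    (hid : vand K n * g = C (s ^ n) * (vand K n * f) + C (1 - s) * ∑ i, vandShift s i * dilate q i f)
    {d : Fin n →₀ ℕ} (hd : (lexOrder n).toSyn ((lexOrder n).degree f) ≤ (lexOrder n).toSyn d) :
    coeff d g =
      (s ^ n + (1 - s) * ∑ i : Fin n, s ^ (i : ℕ) * q ^ d i) * coeff d f := by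
  set δ := (lexOrder n).degree (vand K n) with hδ
  set lc := (lexOrder n).leadingCoeff (vand K n) with hlc
  have hlc0 : lc ≠ 0 := MonomialOrder.leadingCoeff_ne_zero_iff.mpr vand_ne_zero
  have hdil : ∀ i, (lexOrder n).toSyn ((lexOrder n).degree (dilate q i f)) ≤ (lexOrder n).toSyn d := by
    intro i
    refine le_trans (MonomialOrder.degree_le_degree_of_support_subset fun e he => ?_) hd
    rw [mem_support_iff, coeff_dilate] at he
    exact mem_support_iff.mpr (right_ne_zero_of_mul he)
  have hv : ∀ i : Fin n, coeff δ (vandShift s i) = s ^ (i : ℕ) * lc := by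
    intro i
    rw [← (leading_vandShift hs i).2, MonomialOrder.leadingCoeff, (leading_vandShift hs i).1]
  have hR : coeff (δ + d) (C (s ^ n) * (vand K n * f) +
      C (1 - s) * ∑ i, vandShift s i * dilate q i f) =
      lc * ((s ^ n + (1 - s) * ∑ i : Fin n, s ^ (i : ℕ) * q ^ d i) * coeff d f) := by
    rw [coeff_add, coeff_C_mul, coeff_C_mul, coeff_sum,
      MonomialOrder.coeff_mul_of_add_of_degree_le (m := lexOrder n) le_rfl hd]
    have : ∀ i : Fin n, coeff (δ + d) (vandShift s i * dilate q i f) =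
        lc * (s ^ (i : ℕ) * q ^ d i * coeff d f) := by
      intro i
      rw [MonomialOrder.coeff_mul_of_add_of_degree_le (m := lexOrder n)
        (by rw [(leading_vandShift hs i).1]) (hdil i), hv, coeff_dilate]
      ring
    rw [Finset.sum_congr rfl fun i _ => this i, ← Finset.mul_sum, ← Finset.sum_mul]
    change s ^ n * (lc * _) + _ = _
    ring
  -- The leading exponent of `g` does not exceed `d`, so that the coefficient of `vand * g` at `δ +
  -- d` is the product of the two top coefficients.
  have hle : (lexOrder n).toSyn ((lexOrder n).degree g) ≤ (lexOrder n).toSyn d := by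
    by_cases h0 : g = 0
    · rw [h0, MonomialOrder.degree_zero, map_zero]; exact bot_le
    have h1 : (lexOrder n).toSyn ((lexOrder n).degree (vand K n * g)) ≤
        (lexOrder n).toSyn (δ + d) := by
      rw [hid]
      refine MonomialOrder.degree_add_le.trans (sup_le ?_ ?_)
      · refine MonomialOrder.degree_mul_le.trans ?_
        rw [MonomialOrder.degree_C, zero_add]
        refine MonomialOrder.degree_mul_le.trans ?_
        rw [map_add, map_add]
        gcongr
      · refine MonomialOrder.degree_mul_le.trans ?_
        rw [MonomialOrder.degree_C, zero_add]
        refine MonomialOrder.degree_sum_le.trans (Finset.sup_le fun i _ => ?_)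
        refine MonomialOrder.degree_mul_le.trans ?_
        rw [map_add, map_add, (leading_vandShift hs i).1]
        gcongr
        exact hdil i
    rw [MonomialOrder.degree_mul vand_ne_zero h0, map_add, map_add] at h1
    exact le_of_add_le_add_left h1
  have hL := MonomialOrder.coeff_mul_of_add_of_degree_le (m := lexOrder n) (f := vand K n) (a := δ)
    le_rfl hle
  rw [hid, hR] at hL
  exact (mul_left_cancel₀ hlc0 hL).symm

theorem leading_macOp [Algebra ℚ K] (q : K) {s : K} (hs : s ≠ 0) (G : MvPolynomial ℕ+ K)
    {d : Fin n →₀ ℕ}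
    (hd : (lexOrder n).toSyn ((lexOrder n).degree (toFin n G)) ≤ (lexOrder n).toSyn d) :
    coeff d (toFin n (macOp q s G)) =
      (s ^ n + (1 - s) * ∑ i : Fin n, s ^ (i : ℕ) * q ^ d i) * coeff d (toFin n G) :=
  leading_of_vand_mul_eq q hs (vand_mul_toFin_macOp q s G) hd

end Polynomials

/-! ### Change of the coefficient ring -/

section BaseChange

open MvPolynomial

variable {R S : Type} [CommRing R] [CommRing S] (φ : R →+* S)

theorem coeff_shift_map (γ : ℕ+ → R) (F : MvPolynomial ℕ+ R) (k : ℕ) :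
    (shift (fun n => φ (γ n)) (map φ F)).coeff k = map φ ((shift γ F).coeff k) := by
  induction F using MvPolynomial.induction_on generalizing k with
  | C a =>
    rw [map_C, shift_C, shift_C, Polynomial.coeff_C, Polynomial.coeff_C]
    split_ifs <;> simp
  | add p q hp hq => simp only [map_add, Polynomial.coeff_add, hp, hq]
  | mul_X p m hp =>
    rw [mul_comm, map_mul, map_X, coeff_shift_X_mul, coeff_shift_X_mul, hp, map_add, map_mul, map_X]
    congr 1
    split_ifs
    · rw [hp, map_mul, map_C]
    · rw [map_zero]

theorem form_map (o : ℕ+ → R) (F G : MvPolynomial ℕ+ R) :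
    form (fun n => φ (o n)) (map φ F) (map φ G) = φ (form o F G) := by
  rw [form_eq_sum _ _ _ (support_map_subset φ F), form, map_sum]
  refine Finset.sum_congr rfl fun m _ => ?_
  rw [map_mul, map_mul, coeff_map, coeff_map]
  simp [normFactor, Finsupp.prod]

theorem map_toFin (n : ℕ) (F : MvPolynomial ℕ+ R) : map φ (toFin n F) = toFin n (map φ F) := by
  induction F using MvPolynomial.induction_on with
  | C a => simp [toFin, psEval]
  | add p q hp hq => simp only [map_add, hp, hq]
  | mul_X p m hp =>
    rw [map_mul, map_mul, map_mul, map_mul, hp, map_X]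
    simp only [toFin, psEval_X, map_sum, map_pow, map_X]

variable [Algebra ℚ R] [Algebra ℚ S]

theorem coeff_genSeries_map (β : ℕ+ → R) (k : ℕ) :
    PowerSeries.coeff k (genSeries fun n => φ (β n)) = map φ (PowerSeries.coeff k (genSeries β)) := by
  have : PowerSeries.map (map φ) (logSeries β) = logSeries fun n => φ (β n) := by
    ext n : 1
    simp [logSeries]
  rw [genSeries, ← this, ← map_newtonExp, PowerSeries.coeff_map, genSeries]

theorem macOp_map (q s : R) (F : MvPolynomial ℕ+ R) :
    macOp (φ q) (φ s) (map φ F) = map φ (macOp q s F) := by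
  set N := (shift (fun n => q ^ (n : ℕ) - 1) F).natDegree +
    (shift (fun n => φ q ^ (n : ℕ) - 1) (map φ F)).natDegree + 1
  rw [macOp_eq_sum (φ q) (φ s) (map φ F) (N := N) (by omega),
    macOp_eq_sum q s F (N := N) (by omega), map_sum]
  refine Finset.sum_congr rfl fun k _ => ?_
  rw [map_mul, ← coeff_shift_map, ← coeff_genSeries_map]
  simp only [map_sub, map_one, map_pow]

theorem aeval_macOp_map (q s : R) (p : Polynomial R) (F : MvPolynomial ℕ+ R) :
    Polynomial.aeval (macOp (φ q) (φ s)) (p.map φ) (map φ F) =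
      map φ (Polynomial.aeval (macOp q s) p F) := by
  induction p using Polynomial.induction_on' with
  | add a b ha hb => simp only [Polynomial.map_add, map_add, LinearMap.add_apply, ha, hb]
  | monomial k a =>
    have hk : ((macOp (φ q) (φ s)) ^ k) (map φ F) = map φ ((macOp q s ^ k) F) := by
      induction k with
      | zero => simp
      | succ k ih => rw [pow_succ', pow_succ', Module.End.mul_apply, ih, macOp_map, Module.End.mul_apply]
    rw [Polynomial.map_monomial, Polynomial.aeval_monomial, Polynomial.aeval_monomial,
      Module.End.mul_apply, Module.End.mul_apply, hk, Module.algebraMap_end_apply,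
      Module.algebraMap_end_apply, smul_eq_C_mul, smul_eq_C_mul, map_mul, map_C]

end BaseChange

/-! ### Monomial symmetric functions as polynomials in the power sums -/

section Monomials

open MvPolynomial

/-- Setting the variables beyond the first `n` to zero retains the coefficients of the monomials in
the first `n` variables. Multiplication by a power sum acts on both sides by the recursion of
`coeff_powerSum_mul`. -/
theorem coeff_toFin {K : Type} [Field K] {n : ℕ} (F : MvPolynomial ℕ+ K) (d : Fin n →₀ ℕ) :
    coeff d (toFin n F) = MvPowerSeries.coeff (d.embDomain Fin.valEmbedding) (ofPowerSums K F) := by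
  classical
  induction F using MvPolynomial.induction_on generalizing d with
  | C a =>
    have h1 : toFin n (C a : MvPolynomial ℕ+ K) = C a := by simp [toFin, psEval]
    have h2 : ofPowerSums K (C a) = MvPowerSeries.C a := by
      rw [ofPowerSums, aeval_C]; rfl
    rw [h1, h2, coeff_C, MvPowerSeries.coeff_C]
    by_cases h : d = 0
    · simp [h]
    · rw [if_neg (Ne.symm h), if_neg (by simpa using h)]
  | add p q hp hq => simp only [map_add, coeff_add, hp, hq]
  | mul_X p m hp =>
    have hX : ofPowerSums K (X m) = powerSum K m := by simp [ofPowerSums]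
    rw [mul_comm, map_mul, map_mul, hX, coeff_powerSum_mul, Finsupp.support_embDomain,
      Finset.sum_map, toFin, psEval_X, Finset.sum_mul, coeff_sum]
    have h0 : ∀ i : Fin n, coeff d (X i ^ (m : ℕ) * psEval (X : Fin n → MvPolynomial (Fin n) K) p) =
        if (m : ℕ) ≤ d i then coeff (d - Finsupp.single i (m : ℕ))
          (psEval (X : Fin n → MvPolynomial (Fin n) K) p) else 0 := by
      intro i
      rw [X_pow_eq_monomial, coeff_monomial_mul', one_mul]
      simp only [Finsupp.single_le_iff]
    rw [← Finset.sum_subset (Finset.subset_univ d.support)]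
    · refine Finset.sum_congr rfl fun i hi => ?_
      rw [h0 i, Fin.valEmbedding_apply, ← Fin.valEmbedding_apply, Finsupp.embDomain_apply_self]
      split_ifs with h
      · change coeff _ (toFin n p) = _
        rw [hp]
        refine congrArg (fun e => MvPowerSeries.coeff e (ofPowerSums K p)) ?_
        ext j
        by_cases hj : ∃ j' : Fin n, Fin.valEmbedding j' = j
        · obtain ⟨j', rfl⟩ := hj
          rw [Finsupp.embDomain_apply_self, Finsupp.tsub_apply, Finsupp.tsub_apply,
            Finsupp.embDomain_apply_self]
          congr 1
          by_cases hij : j' = i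
          · subst hij; simp
          · rw [Finsupp.single_eq_of_ne hij, Finsupp.single_eq_of_ne]
            exact fun h => hij (Fin.valEmbedding.injective h)
        · have hj' : j ∉ Set.range (Fin.valEmbedding (n := n)) := hj
          rw [Finsupp.embDomain_of_notMem_range _ _ _ hj', Finsupp.tsub_apply,
            Finsupp.embDomain_of_notMem_range _ _ _ hj', zero_tsub]
      · rfl
    · intro i _ hi
      rw [h0, if_neg]
      rw [Finsupp.notMem_support_iff.mp hi]
      have := m.pos
      omega

/-- The monomial symmetric function over the rationals as a polynomial in the power sums. -/
def monomialPoly (lam : YoungDiagram) : MvPolynomial ℕ+ ℚ :=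
  (exists_ofPowerSums_eq (K := ℚ) lam).choose

/-- The monomial symmetric function as a polynomial in the power sums. -/
def mHat (R : Type) [CommRing R] [Algebra ℚ R] (lam : YoungDiagram) : MvPolynomial ℕ+ R :=
  map (algebraMap ℚ R) (monomialPoly lam)

/-- `mHat` comes from one polynomial over `ℚ`, which makes it compatible with every change of the
coefficient ring. -/
theorem map_mHat {R S : Type} [CommRing R] [Algebra ℚ R] [CommRing S] [Algebra ℚ S] (φ : R →+* S)
    (lam : YoungDiagram) : map φ (mHat R lam) = mHat S lam := by
  rw [mHat, mHat, map_map]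
  exact congrArg (fun ψ => map ψ (monomialPoly lam)) (Subsingleton.elim _ _)

theorem isHomog_map {R S : Type} [CommRing R] [CommRing S] (φ : R →+* S) {F : MvPolynomial ℕ+ R}
    {N : ℕ} (hF : IsHomog F N) : IsHomog (map φ F) N := by
  intro d hd
  refine hF fun h => hd ?_
  rw [coeff_map, h, map_zero]

theorem isHomog_mHat (R : Type) [CommRing R] [Algebra ℚ R] (lam : YoungDiagram) :
    IsHomog (mHat R lam) lam.card :=
  isHomog_map _ (exists_ofPowerSums_eq (K := ℚ) lam).choose_spec.1

theorem coeff_ofPowerSums_map {K L : Type} [Field K] [Field L] (φ : K →+* L)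
    (F : MvPolynomial ℕ+ K) (d : ℕ →₀ ℕ) :
    MvPowerSeries.coeff d (ofPowerSums L (map φ F)) = φ (MvPowerSeries.coeff d (ofPowerSums K F)) := by
  have : MvPowerSeries.map φ (ofPowerSums K F) = ofPowerSums L (map φ F) := by
    induction F using MvPolynomial.induction_on with
    | C a =>
      rw [map_C, ofPowerSums, ofPowerSums, aeval_C, aeval_C]
      exact MvPowerSeries.map_C _ _
    | add p q hp hq => simp only [map_add, hp, hq]
    | mul_X p m hp =>
      rw [map_mul, map_mul, hp, map_mul, map_mul, map_X]
      congr 1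
      ext d
      rw [MvPowerSeries.coeff_map, ofPowerSums, ofPowerSums, aeval_X, aeval_X]
      simp only [powerSum, MvPowerSeries.coeff_apply]
      split_ifs <;> simp
  rw [← this, MvPowerSeries.coeff_map]

theorem ofPowerSums_mHat (K : Type) [Field K] [Algebra ℚ K] (lam : YoungDiagram) :
    ofPowerSums K (mHat K lam) = monomialSymm K lam := by
  ext d
  rw [mHat, coeff_ofPowerSums_map, monomialPoly,
    (exists_ofPowerSums_eq (K := ℚ) lam).choose_spec.2, coeff_monomialSymm, coeff_monomialSymm]
  split_ifs <;> simp

variable {K : Type} [Field K]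

/-- The exponent of the first `n` rows. -/
def expoFin (n : ℕ) (lam : YoungDiagram) : Fin n →₀ ℕ :=
  Finsupp.equivFunOnFinite.symm fun i => lam.rowLen i

theorem expoFin_apply (n : ℕ) (lam : YoungDiagram) (i : Fin n) : expoFin n lam i = lam.rowLen i := rfl

theorem embDomain_expoFin {n : ℕ} {lam : YoungDiagram} (h : lam.colLen 0 ≤ n) :
    (expoFin n lam).embDomain Fin.valEmbedding = expo lam := by
  ext j
  by_cases hj : j < n
  · have := Finsupp.embDomain_apply_self Fin.valEmbedding (expoFin n lam) ⟨j, hj⟩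
    rw [expo_apply]
    exact this
  · rw [Finsupp.embDomain_of_notMem_range, expo_apply]
    · by_contra h0
      have := (rowLen_ne_zero_iff lam j).mp (Ne.symm h0)
      omega
    · rintro ⟨i, rfl⟩
      exact hj i.2

theorem coeff_expoFin_toFin {n : ℕ} {lam : YoungDiagram} (h : lam.colLen 0 ≤ n)
    (F : MvPolynomial ℕ+ K) : coeff (expoFin n lam) (toFin n F) = coeffAt lam F := by
  rw [coeff_toFin, embDomain_expoFin h, coeffAt_apply]

theorem sum_embDomain {n : ℕ} (d : Fin n →₀ ℕ) {k : ℕ} (hk : k ≤ n) :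
    ∑ i, d i * (if (i : ℕ) < k then 1 else 0) =
      ∑ i ∈ Finset.range k, d.embDomain Fin.valEmbedding i := by
  have h1 : ∀ i : Fin n, d i = d.embDomain Fin.valEmbedding (i : ℕ) := fun i =>
    (Finsupp.embDomain_apply_self Fin.valEmbedding d i).symm
  simp only [h1]
  rw [Fin.sum_univ_eq_sum_range (fun i => d.embDomain Fin.valEmbedding i * if i < k then 1 else 0) n]
  simp only [mul_ite, mul_one, mul_zero]
  rw [← Finset.sum_filter]
  congr 1
  ext i
  simp only [Finset.mem_filter, Finset.mem_range]
  omega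

/-- A homogeneous element whose restriction satisfies the degree bounds is supported below. -/
theorem dominates_of_natDegree_grade_le {F : MvPolynomial ℕ+ K} {lam : YoungDiagram}
    (hF : IsHomog F lam.card)
    (h : ∀ k ≤ lam.card, (grade (fun i : Fin lam.card => if (i : ℕ) < k then 1 else 0)
      (toFin lam.card F)).natDegree ≤ ∑ i ∈ Finset.range k, lam.rowLen i)
    {nu : YoungDiagram} (hnu : coeffAt nu F ≠ 0) : Dominates lam nu := by
  have hc := card_eq_of_coeffAt_ne_zero hF hnu
  have hle : nu.colLen 0 ≤ lam.card := hc ▸ colLen_le_card nu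
  have key : ∀ k ≤ lam.card, ∑ i ∈ Finset.range k, nu.rowLen i ≤
      ∑ i ∈ Finset.range k, lam.rowLen i := by
    intro k hk
    refine le_trans ?_ (h k hk)
    -- With weight one on the first `k` variables, the degree of `x^nu` is the `k`-th partial sum of
    -- `nu`. The degree bounds are therefore the dominance inequalities.
    have := le_natDegree_grade (fun i : Fin lam.card => if (i : ℕ) < k then 1 else 0)
      (f := toFin lam.card F) (d := expoFin lam.card nu) (by rwa [coeff_expoFin_toFin hle])
    rw [sum_embDomain _ hk, embDomain_expoFin hle] at this
    simpa only [expo_apply] using this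
  refine ⟨hc.symm, fun k => ?_⟩
  rcases le_total k lam.card with hk | hk
  · exact key k hk
  · rw [sum_rowLen_range (hle.trans hk), sum_rowLen_range ((colLen_le_card lam).trans hk), hc]

variable [Algebra ℚ K]

open Classical in
theorem coeffAt_mHat (lam mu : YoungDiagram) :
    coeffAt mu (mHat K lam) = if mu = lam then 1 else 0 := by
  rw [coeffAt_apply, ofPowerSums_mHat, coeff_expo_monomialSymm]

theorem eq_sum_mHat {F : MvPolynomial ℕ+ K} {S : Finset YoungDiagram}
    (hS : ∀ nu, coeffAt nu F ≠ 0 → nu ∈ S) : F = ∑ nu ∈ S, coeffAt nu F • mHat K nu := by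
  have : CharZero K := algebraRat.charZero K
  apply ofPowerSums_injective (K := K)
  rw [map_sum]
  simp only [map_smul, ofPowerSums_mHat]
  exact (isSymm_ofPowerSums F).eq_sum hS

/-- The degree bound that characterizes dominance. -/
theorem natDegree_grade_mHat_le (n k : ℕ) (hk : k ≤ n) (lam : YoungDiagram) :
    (grade (fun i : Fin n => if (i : ℕ) < k then 1 else 0) (toFin n (mHat K lam))).natDegree ≤
      ∑ i ∈ Finset.range k, lam.rowLen i := by
  refine natDegree_grade_le _ fun d hd => ?_
  rw [coeff_toFin, ofPowerSums_mHat, coeff_monomialSymm] at hd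
  rw [sum_embDomain d hk]
  refine sum_range_le_of_parts ?_ k
  by_contra h
  exact hd (if_neg h)

/-- Triangularity: each dominance inequality is a bound on a weighted degree, and the operator
raises none of these degrees. -/
theorem dominates_of_coeffAt_macOp_ne_zero (q s : K) {lam nu : YoungDiagram}
    (h : coeffAt nu (macOp q s (mHat K lam)) ≠ 0) : Dominates lam nu :=
  dominates_of_natDegree_grade_le (isHomog_macOp q s (isHomog_mHat K lam))
    (fun k hk => (natDegree_grade_macOp_le _ q s _).trans (natDegree_grade_mHat_le _ k hk lam)) h

end Monomials

/-! ### Triangular operators -/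

section Triangular

open Polynomial

variable {R V : Type*} [CommRing R] [AddCommGroup V] [Module R V] {T : Module.End R V}
  {m : YoungDiagram → V} {e : YoungDiagram → R}

theorem mem_lower_trans {lam mu nu : YoungDiagram} (h1 : mu ∈ lower lam) (h2 : nu ∈ lower mu) :
    nu ∈ lower lam := (lower_ssubset h1).1 h2

theorem notMem_lower_self (lam : YoungDiagram) : lam ∉ lower lam := fun h => (mem_lower.mp h).2 rfl

/-- The factor belonging to `lam` sends `m lam` into the span of the lower `m mu`, and the remaining
factors annihilate these by induction. -/
theorem aeval_prod_apply_eq_zero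
    (hT : ∀ lam, T (m lam) - e lam • m lam ∈ Submodule.span R (m '' lower lam)) (lam : YoungDiagram) :
    ∀ S : Finset YoungDiagram, lam ∈ S → (∀ mu ∈ lower lam, mu ∈ S) →
      aeval T (∏ nu ∈ S, (X - C (e nu))) (m lam) = 0 := by
  classical
  induction lam using dominance_induction with
  | h lam ih =>
    intro S hl hS
    rw [← Finset.prod_erase_mul S _ hl, map_mul, Module.End.mul_apply, map_sub, aeval_X, aeval_C,
      LinearMap.sub_apply, Module.algebraMap_end_apply]
    refine LinearMap.mem_ker.mp (Submodule.span_le.mpr ?_ (hT lam))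
    rintro _ ⟨mu, hmu, rfl⟩
    refine ih mu hmu _ (Finset.mem_erase.mpr ⟨(mem_lower.mp hmu).2, hS mu hmu⟩) fun nu hnu => ?_
    have := mem_lower_trans hmu hnu
    exact Finset.mem_erase.mpr ⟨(mem_lower.mp this).2, hS nu this⟩

/-- Modulo the span of the lower `m mu`, which `T` preserves, `T` acts on `m lam` as `e lam`. So
each factor `(T - e mu) / (e lam - e mu)` fixes `m lam` there. -/
theorem aeval_prod_apply_sub_mem {K : Type*} [Field K] [Module K V] {T : Module.End K V}
    {e : YoungDiagram → K}
    (hT : ∀ lam, T (m lam) - e lam • m lam ∈ Submodule.span K (m '' lower lam)) (lam : YoungDiagram)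
    (he : ∀ mu ∈ lower lam, e lam - e mu ≠ 0) :
    aeval T (∏ mu ∈ lower lam, (C (Ring.inverse (e lam - e mu)) * (X - C (e mu)))) (m lam) - m lam ∈
      Submodule.span K (m '' lower lam) := by
  classical
  set W := Submodule.span K (m '' lower lam) with hW
  have hinv : ∀ v ∈ W, T v ∈ W := by
    intro v hv
    refine (Submodule.span_le (p := W.comap T)).mpr ?_ hv
    rintro _ ⟨mu, hmu, rfl⟩
    have h1 := Submodule.span_mono (Set.image_mono (f := m) fun nu (h : nu ∈ lower mu) =>
      (mem_lower_trans hmu h : nu ∈ lower lam)) (hT mu)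
    have h2 : e mu • m mu ∈ W := W.smul_mem _ (Submodule.subset_span ⟨mu, hmu, rfl⟩)
    simpa using W.add_mem h1 h2
  have key : ∀ S ⊆ lower lam,
      aeval T (∏ mu ∈ S, (C (Ring.inverse (e lam - e mu)) * (X - C (e mu)))) (m lam) - m lam ∈ W := by
    intro S
    induction S using Finset.induction_on with
    | empty => intro _; simp
    | insert mu S hmu ih =>
      intro hS
      have h := ih fun x hx => hS (Finset.mem_insert_of_mem hx)
      rw [Finset.prod_insert hmu, map_mul, Module.End.mul_apply]
      set v := aeval T (∏ mu ∈ S, (C (Ring.inverse (e lam - e mu)) * (X - C (e mu)))) (m lam)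
      have hne := he mu (hS (Finset.mem_insert_self _ _))
      have hv : aeval T (C (Ring.inverse (e lam - e mu)) * (X - C (e mu))) v =
          (e lam - e mu)⁻¹ • (T v - e mu • v) := by
        rw [map_mul, Module.End.mul_apply, map_sub, aeval_X, aeval_C, aeval_C, LinearMap.sub_apply,
          Module.algebraMap_end_apply, Module.algebraMap_end_apply, Ring.inverse_eq_inv']
      have e1 : (e lam - e mu)⁻¹ • (T v - e mu • v) - m lam = (e lam - e mu)⁻¹ •
          (T (v - m lam) - e mu • (v - m lam) + (T (m lam) - e lam • m lam)) := by
        have : m lam = (e lam - e mu)⁻¹ • ((e lam - e mu) • m lam) := by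
          rw [smul_smul, inv_mul_cancel₀ hne, one_smul]
        nth_rewrite 1 [this]
        rw [← smul_sub, map_sub]
        congr 1
        module
      rw [hv, e1]
      exact W.smul_mem _ (W.add_mem (W.sub_mem (hinv _ h) (W.smul_mem _ h)) (hT lam))
  exact key _ (Finset.Subset.refl _)

/-- Applying the missing factor `X - e lam` completes the product that annihilates `m lam`. No
difference of eigenvalues has to be invertible for this. -/
theorem apply_aeval_prod (hT : ∀ lam, T (m lam) - e lam • m lam ∈ Submodule.span R (m '' lower lam))
    (lam : YoungDiagram) :
    T (aeval T (∏ mu ∈ lower lam, (C (Ring.inverse (e lam - e mu)) * (X - C (e mu)))) (m lam)) =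
      e lam • aeval T (∏ mu ∈ lower lam, (C (Ring.inverse (e lam - e mu)) * (X - C (e mu)))) (m lam) := by
  classical
  have h := aeval_prod_apply_eq_zero hT lam (insert lam (lower lam)) (Finset.mem_insert_self _ _)
    fun mu h => Finset.mem_insert_of_mem h
  rw [Finset.prod_insert (notMem_lower_self lam)] at h
  rw [← sub_eq_zero]
  set p := ∏ mu ∈ lower lam, (X - C (e mu)) with hp
  set c := ∏ mu ∈ lower lam, Ring.inverse (e lam - e mu) with hc
  have e1 : ∏ mu ∈ lower lam, (C (Ring.inverse (e lam - e mu)) * (X - C (e mu))) = C c * p := by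
    rw [Finset.prod_mul_distrib, hc, map_prod]
  have e2 : T (aeval T (C c * p) (m lam)) - e lam • aeval T (C c * p) (m lam) =
      aeval T (C c * ((X - C (e lam)) * p)) (m lam) := by
    rw [mul_left_comm, map_mul (aeval T) (X - C (e lam)), Module.End.mul_apply, map_sub, aeval_X,
      aeval_C, LinearMap.sub_apply, Module.algebraMap_end_apply]
  rw [e1, e2, map_mul, Module.End.mul_apply, h, map_zero]

end Triangular

/-! ### Eigenfunctions of the Macdonald operator -/

section Eigenfunctions

open MvPolynomial

/-- At the first place where the exponents differ, the partial sum that includes this place decides.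
Thus dominance implies the lexicographic inequality. -/
theorem lex_le_of_sum_le {n : ℕ} {d e : Fin n →₀ ℕ}
    (h : ∀ k ≤ n, ∑ i, d i * (if (i : ℕ) < k then 1 else 0) ≤
      ∑ i, e i * (if (i : ℕ) < k then 1 else 0)) :
    (lexOrder n).toSyn d ≤ (lexOrder n).toSyn e := by
  by_contra hlt
  rw [not_le, MonomialOrder.lex_lt_iff] at hlt
  obtain ⟨j, hj1, hj2⟩ := hlt
  change ∀ i, i < j → e i = d i at hj1
  change e j < d j at hj2
  refine absurd (h (j + 1) j.2) (not_le.mpr (Finset.sum_lt_sum (fun i _ => ?_) ⟨j, Finset.mem_univ _, ?_⟩))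
  · split_ifs with hi
    · rcases (Nat.lt_succ_iff.mp hi).lt_or_eq with h2 | h2
      · rw [hj1 i h2]
      · rw [Fin.ext h2]; omega
    · simp
  · rw [if_pos (Nat.lt_succ_self _)]; omega

theorem eps_eq_fin {R : Type*} [CommRing R] (q s : R) {lam : YoungDiagram} {n : ℕ}
    (hn : lam.colLen 0 ≤ n) :
    eps q s lam = s ^ n + (1 - s) * ∑ i : Fin n, s ^ (i : ℕ) * q ^ expoFin n lam i := by
  rw [eps_eq q s lam hn, ← Fin.sum_univ_eq_sum_range (fun i => s ^ i * q ^ lam.rowLen i)]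
  rfl

variable {K : Type} [Field K] [Algebra ℚ K]

theorem degree_toFin_mHat_le (n : ℕ) {lam : YoungDiagram} (hn : lam.colLen 0 ≤ n) :
    (lexOrder n).toSyn ((lexOrder n).degree (toFin n (mHat K lam))) ≤
      (lexOrder n).toSyn (expoFin n lam) := by
  refine MonomialOrder.degree_le_iff.mpr fun d hd => lex_le_of_sum_le fun k hk => ?_
  rw [mem_support_iff] at hd
  refine (le_natDegree_grade _ hd).trans ((natDegree_grade_mHat_le n k hk lam).trans ?_)
  rw [sum_embDomain _ hk, embDomain_expoFin hn]
  simp [expo_apply]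

/-- The exponent of `lam` is the lexicographically leading one of `m_lam`, so `leading_macOp`
applies to it. -/
theorem coeffAt_macOp_mHat_self (q : K) {s : K} (hs : s ≠ 0) (lam : YoungDiagram) :
    coeffAt lam (macOp q s (mHat K lam)) = eps q s lam := by
  have hn := colLen_le_card lam
  rw [← coeff_expoFin_toFin hn, leading_macOp q hs _ (degree_toFin_mHat_le _ hn),
    coeff_expoFin_toFin hn, coeffAt_mHat, if_pos rfl, mul_one, eps_eq_fin q s hn]

theorem mem_span_mHat {F : MvPolynomial ℕ+ K} {S : Finset YoungDiagram}
    (hS : ∀ nu, coeffAt nu F ≠ 0 → nu ∈ S) : F ∈ Submodule.span K (mHat K '' S) := by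
  rw [eq_sum_mHat hS]
  exact Submodule.sum_mem _ fun nu hnu => Submodule.smul_mem _ _ (Submodule.subset_span ⟨nu, hnu, rfl⟩)

theorem macOp_mHat_sub_mem (q : K) {s : K} (hs : s ≠ 0) (lam : YoungDiagram) :
    macOp q s (mHat K lam) - eps q s lam • mHat K lam ∈ Submodule.span K (mHat K '' lower lam) := by
  classical
  refine mem_span_mHat fun nu hnu => ?_
  rw [map_sub, map_smul, coeffAt_mHat] at hnu
  by_cases h : nu = lam
  · subst h
    rw [coeffAt_macOp_mHat_self q hs, if_pos rfl] at hnu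
    simp at hnu
  · rw [if_neg h, smul_zero, sub_zero] at hnu
    exact mem_lower.mpr ⟨dominates_of_coeffAt_macOp_ne_zero q s hnu, h⟩

/-- The eigenfunction of the Macdonald operator with leading term `m_lam`. -/
def macP {R : Type} [CommRing R] [Algebra ℚ R] (q s : R) (lam : YoungDiagram) : MvPolynomial ℕ+ R :=
  Polynomial.aeval (macOp q s) (∏ mu ∈ lower lam,
    (Polynomial.C (Ring.inverse (eps q s lam - eps q s mu)) *
      (Polynomial.X - Polynomial.C (eps q s mu)))) (mHat R lam)

/-- `macP` is an interpolation formula with `Ring.inverse`, meaningful over any `ℚ`-algebra; ring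
homomorphisms respect it once the differences of eigenvalues are units. This links the functions
over `ℚ(q,t)`, over the local ring of a point, and with numerical parameters. -/
theorem map_macP {R S : Type} [CommRing R] [CommRing S] [Algebra ℚ R] [Algebra ℚ S] (φ : R →+* S)
    (q s : R) (lam : YoungDiagram) (h : ∀ mu ∈ lower lam, IsUnit (eps q s lam - eps q s mu)) :
    map φ (macP q s lam) = macP (φ q) (φ s) lam := by
  rw [macP, ← aeval_macOp_map, map_mHat, macP]
  congr 2
  rw [Polynomial.map_prod]
  refine Finset.prod_congr rfl fun mu hmu => ?_
  obtain ⟨u, hu⟩ := h mu hmu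
  have : φ (Ring.inverse (eps q s lam - eps q s mu)) =
      Ring.inverse (eps (φ q) (φ s) lam - eps (φ q) (φ s) mu) := by
    rw [← map_eps, ← map_eps, ← map_sub, ← hu, Ring.inverse_unit]
    have := Ring.inverse_unit (Units.map (φ : R →* S) u)
    rw [Units.coe_map, ← map_inv, Units.coe_map] at this
    exact this.symm
  rw [Polynomial.map_mul, Polynomial.map_C, this, Polynomial.map_sub, Polynomial.map_X,
    Polynomial.map_C, map_eps]

theorem isHomog_macP {R : Type} [CommRing R] [Algebra ℚ R] (q s : R) (lam : YoungDiagram) :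
    IsHomog (macP q s lam) lam.card := by
  have h : ∀ (p : Polynomial R) (F : MvPolynomial ℕ+ R) (N : ℕ), IsHomog F N →
      IsHomog (Polynomial.aeval (macOp q s) p F) N := by
    intro p F N hF
    induction p using Polynomial.induction_on' with
    | add a b ha hb => rw [map_add, LinearMap.add_apply]; exact ha.add hb
    | monomial k a =>
      rw [Polynomial.aeval_monomial, Module.End.mul_apply, Module.algebraMap_end_apply, smul_eq_C_mul]
      refine IsWeightedHomogeneous.C_mul ?_ a
      induction k with
      | zero => simpa using hF
      | succ k ih => rw [pow_succ', Module.End.mul_apply]; exact isHomog_macOp q s ih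
  exact h _ _ _ (isHomog_mHat R lam)

theorem macP_sub_mem {q s : K} (hs : s ≠ 0) {lam : YoungDiagram}
    (h : ∀ mu ∈ lower lam, eps q s lam - eps q s mu ≠ 0) :
    macP q s lam - mHat K lam ∈ Submodule.span K (mHat K '' lower lam) :=
  aeval_prod_apply_sub_mem (macOp_mHat_sub_mem q hs) lam h

theorem macOp_macP (q : K) {s : K} (hs : s ≠ 0) (lam : YoungDiagram) :
    macOp q s (macP q s lam) = eps q s lam • macP q s lam :=
  apply_aeval_prod (macOp_mHat_sub_mem q hs) lam

/-- Eigenvectors of a self-adjoint operator with distinct eigenvalues; `ho` is the condition for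
self-adjointness in `form_macOp`. -/
theorem form_macP_eq_zero {q s : K} (hs : s ≠ 0) (o : ℕ+ → K)
    (ho : ∀ n : ℕ+, o n * (1 - s ^ (n : ℕ)) = ((n : ℕ) : K) * (s ^ (n : ℕ) * (q ^ (n : ℕ) - 1)))
    {lam mu : YoungDiagram} (h : eps q s lam ≠ eps q s mu) :
    form o (macP q s lam) (macP q s mu) = 0 := by
  have := form_macOp q s o ho (macP q s lam) (macP q s mu)
  rw [macOp_macP q hs, macOp_macP q hs, form_smul_left, form_smul_right, ← sub_eq_zero, ← sub_mul] at this
  exact (mul_eq_zero.mp this).resolve_left (sub_ne_zero.mpr h)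

theorem coeffAt_macP_self {q s : K} (hs : s ≠ 0) {lam : YoungDiagram}
    (h : ∀ mu ∈ lower lam, eps q s lam - eps q s mu ≠ 0) : coeffAt lam (macP q s lam) = 1 := by
  have h0 : coeffAt lam (macP q s lam - mHat K lam) = 0 := by
    refine LinearMap.mem_ker.mp (Submodule.span_le.mpr ?_ (macP_sub_mem hs h))
    rintro _ ⟨mu, hmu, rfl⟩
    rw [SetLike.mem_coe, LinearMap.mem_ker, coeffAt_mHat, if_neg]
    exact fun e => (mem_lower.mp hmu).2 e.symm
  rw [map_sub, coeffAt_mHat, if_pos rfl, sub_eq_zero] at h0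
  exact h0

end Eigenfunctions

/-! ### Orthogonal triangular families -/

section Families

open MvPolynomial

variable {K : Type} [Field K] [Algebra ℚ K]

/-- A family of polynomials in the power sums with the properties that characterize the Macdonald
symmetric functions, and with nonzero norms. -/
structure IsOrthoFamily (o : ℕ+ → K) (F : YoungDiagram → MvPolynomial ℕ+ K) : Prop where
  sub_mem : ∀ lam, F lam - mHat K lam ∈ Submodule.span K (mHat K '' lower lam)
  ortho : ∀ lam mu, lam ≠ mu → form o (F lam) (F mu) = 0
  norm_ne_zero : ∀ lam, form o (F lam) (F lam) ≠ 0

variable {o : ℕ+ → K} {F G : YoungDiagram → MvPolynomial ℕ+ K}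

theorem mHat_mem_span (hF : ∀ lam, F lam - mHat K lam ∈ Submodule.span K (mHat K '' lower lam))
    (lam : YoungDiagram) : ∀ S : Finset YoungDiagram, lam ∈ S → (∀ mu ∈ lower lam, mu ∈ S) →
      mHat K lam ∈ Submodule.span K (F '' S) := by
  induction lam using dominance_induction with
  | h lam ih =>
    intro S hl hS
    have h1 : F lam - mHat K lam ∈ Submodule.span K (F '' S) := by
      refine Submodule.span_le.mpr ?_ (hF lam)
      rintro _ ⟨mu, hmu, rfl⟩
      exact ih mu hmu S (hS mu hmu) fun nu hnu => hS nu (mem_lower_trans hmu hnu)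
    have := Submodule.sub_mem _ (Submodule.subset_span (Set.mem_image_of_mem F hl)) h1
    rwa [sub_sub_cancel] at this

theorem IsOrthoFamily.mem_span_of_isHomog (h : IsOrthoFamily o F) {D : MvPolynomial ℕ+ K} {N : ℕ}
    (hD : IsHomog D N) : D ∈ Submodule.span K (F '' diagrams N) := by
  have h1 : D ∈ Submodule.span K (mHat K '' diagrams N) :=
    mem_span_mHat fun nu hnu => mem_diagrams.mpr (card_eq_of_coeffAt_ne_zero hD hnu)
  refine Submodule.span_le.mpr ?_ h1
  rintro _ ⟨mu, hmu, rfl⟩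
  refine mHat_mem_span h.sub_mem mu _ hmu fun nu hnu => ?_
  rw [mem_diagrams, ← (mem_lower.mp hnu).1.1]
  exact mem_diagrams.mp hmu

theorem IsOrthoFamily.eq_zero (h : IsOrthoFamily o F) {S : Finset YoungDiagram}
    {D : MvPolynomial ℕ+ K} (hD : D ∈ Submodule.span K (F '' S))
    (h0 : ∀ mu ∈ S, form o D (F mu) = 0) : D = 0 := by
  classical
  obtain ⟨c, rfl⟩ := (Submodule.mem_span_image_finset_iff_exists_fun K).mp hD
  refine Finset.sum_eq_zero fun mu hmu => ?_
  have h1 := h0 mu mu.2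
  rw [← formL_apply, map_sum, LinearMap.sum_apply, Finset.sum_eq_single_of_mem mu hmu, map_smul,
    LinearMap.smul_apply, formL_apply, smul_eq_mul] at h1
  · rw [(mul_eq_zero.mp h1).resolve_right (h.norm_ne_zero mu), zero_smul]
  · intro nu _ hne
    rw [map_smul, LinearMap.smul_apply, formL_apply, h.ortho nu mu fun e => hne (Subtype.ext e), smul_zero]

/-- By triangularity `G lam - F lam` lies in the span of the `F mu` with `mu` below `lam`. It is
orthogonal to each of them, since `F mu = G mu` by induction; as the norms do not vanish, it is
zero. -/
theorem IsOrthoFamily.eq_of (h : IsOrthoFamily o F)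
    (hG : ∀ lam, G lam - mHat K lam ∈ Submodule.span K (mHat K '' lower lam))
    (hG' : ∀ lam mu, lam ≠ mu → form o (G lam) (G mu) = 0) (lam : YoungDiagram) : G lam = F lam := by
  induction lam using dominance_induction with
  | h lam ih =>
    rw [← sub_eq_zero]
    have h1 : G lam - F lam ∈ Submodule.span K (mHat K '' lower lam) := by
      have := Submodule.sub_mem _ (hG lam) (h.sub_mem lam)
      rwa [sub_sub_sub_cancel_right] at this
    have h2 : G lam - F lam ∈ Submodule.span K (F '' lower lam) := by
      refine Submodule.span_le.mpr ?_ h1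
      rintro _ ⟨mu, hmu, rfl⟩
      exact mHat_mem_span h.sub_mem mu _ hmu fun nu hnu => mem_lower_trans hmu hnu
    refine h.eq_zero h2 fun mu hmu => ?_
    have hne : lam ≠ mu := fun e => (mem_lower.mp hmu).2 e.symm
    rw [← formL_apply, map_sub, LinearMap.sub_apply, formL_apply, formL_apply, h.ortho _ _ hne,
      ← ih mu hmu, hG' _ _ hne, sub_zero]

theorem zFactor_eq_normFactor {K : Type} [Field K] (q t : K) (m : ℕ+ →₀ ℕ) :
    zFactor q t m = normFactor (oscCoeff q t) m := by
  rw [zFactor, normFactor]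
  refine Finset.prod_congr rfl fun n _ => ?_
  simp only [oscCoeff, mul_pow]
  ring

theorem powerSumExpansion_ofPowerSums (F : MvPolynomial ℕ+ K) :
    powerSumExpansion (ofPowerSums K F) = F := by
  have : CharZero K := algebraRat.charZero K
  exact Function.leftInverse_invFun ofPowerSums_injective F

theorem scalarProd_ofPowerSums (q t : K) (F G : MvPolynomial ℕ+ K) :
    scalarProd q t (ofPowerSums K F) (ofPowerSums K G) = form (oscCoeff q t) F G := by
  simp only [scalarProd, powerSumExpansion_ofPowerSums, zFactor_eq_normFactor, form]

theorem map_span_mHat (S : Set YoungDiagram) :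
    (Submodule.span K (mHat K '' S)).map (ofPowerSums K).toLinearMap =
      Submodule.span K (monomialSymm K '' S) := by
  rw [Submodule.map_span, Set.image_image]
  congr 1
  exact Set.image_congr fun mu _ => ofPowerSums_mHat K mu

theorem IsOrthoFamily.isMacdonaldFamily {q t : K} (h : IsOrthoFamily (oscCoeff q t) F) :
    IsMacdonaldFamily q t fun lam => ofPowerSums K (F lam) := by
  refine ⟨fun lam => ?_, fun lam mu hne => ?_⟩
  · rw [← ofPowerSums_mHat, ← map_sub]
    rw [← coe_lower, ← map_span_mHat]
    exact Submodule.mem_map_of_mem (f := (ofPowerSums K).toLinearMap) (h.sub_mem lam)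
  · simp only [scalarProd_ofPowerSums]
    exact h.ortho lam mu hne

/-- Condition (A) makes each `P lam` a polynomial in the power sums, so the uniqueness of triangular
orthogonal families applies. In particular the family chosen in `macdonaldP` is an explicit one. -/
theorem IsOrthoFamily.eq_of_isMacdonaldFamily {q t : K} (h : IsOrthoFamily (oscCoeff q t) F)
    {P : YoungDiagram → MvPowerSeries ℕ K} (hP : IsMacdonaldFamily q t P) (lam : YoungDiagram) :
    P lam = ofPowerSums K (F lam) := by
  have hex : ∀ lam, ∃ G : MvPolynomial ℕ+ K, ofPowerSums K G = P lam ∧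
      G - mHat K lam ∈ Submodule.span K (mHat K '' lower lam) := by
    intro lam
    have h1 := hP.1 lam
    rw [← coe_lower, ← map_span_mHat] at h1
    obtain ⟨D, hD, hD'⟩ := h1
    refine ⟨D + mHat K lam, ?_, by rwa [add_sub_cancel_right]⟩
    rw [map_add]
    have : ofPowerSums K D = P lam - monomialSymm K lam := hD'
    rw [this, ofPowerSums_mHat, sub_add_cancel]
  choose G hG1 hG2 using hex
  rw [← hG1, h.eq_of hG2 fun lam mu hne => ?_]
  rw [← scalarProd_ofPowerSums, hG1, hG1]
  exact hP.2 lam mu hne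

/-- The hypothesis `ho` of `form_macOp` for the norms `oscCoeff q t` and `s = t⁻¹`. -/
theorem mul_oscCoeff_eq {K : Type} [Field K] {q t : K} (ht0 : t ≠ 0) (ht : ∀ n : ℕ+, 1 - t ^ (n : ℕ) ≠ 0) (n : ℕ+) :
    oscCoeff q t n * (1 - t⁻¹ ^ (n : ℕ)) =
      ((n : ℕ) : K) * (t⁻¹ ^ (n : ℕ) * (q ^ (n : ℕ) - 1)) := by
  have h1 := ht n
  have h2 : t ^ (n : ℕ) ≠ 0 := pow_ne_zero _ ht0
  rw [oscCoeff, inv_pow]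
  field_simp
  ring

end Families

/-! ### Positivity for real parameters -/

section Positivity

open MvPolynomial

theorem normFactor_pos {o : ℕ+ → ℝ} (ho : ∀ n, 0 < o n) (m : ℕ+ →₀ ℕ) : 0 < normFactor o m :=
  Finset.prod_pos fun n _ => mul_pos (pow_pos (ho n) _) (by exact_mod_cast Nat.factorial_pos _)

theorem form_self_pos {o : ℕ+ → ℝ} (ho : ∀ n, 0 < o n) {F : MvPolynomial ℕ+ ℝ} (hF : F ≠ 0) :
    0 < form o F F := by
  refine Finset.sum_pos (fun m hm => ?_) (support_nonempty.mpr hF)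
  have : F.coeff m ≠ 0 := mem_support_iff.mp hm
  exact mul_pos (mul_self_pos.mpr this) (normFactor_pos ho m)

theorem one_sub_pow_pos {a : ℝ} (h0 : 0 < a) (h1 : a < 1) (n : ℕ+) : 0 < 1 - a ^ (n : ℕ) :=
  sub_pos.mpr (pow_lt_one₀ h0.le h1 n.ne_zero)

theorem oscCoeff_pos {a b : ℝ} (ha0 : 0 < a) (ha1 : a < 1) (hb0 : 0 < b) (hb1 : b < 1) (n : ℕ+) :
    0 < oscCoeff a b n :=
  mul_pos (by exact_mod_cast n.pos)
    (div_pos (one_sub_pow_pos ha0 ha1 n) (one_sub_pow_pos hb0 hb1 n))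

theorem map_oscCoeff {K L : Type} [Field K] [Field L] (φ : K →+* L) (q t : K) (n : ℕ+) :
    φ (oscCoeff q t n) = oscCoeff (φ q) (φ t) n := by
  simp [oscCoeff]

end Positivity

/-! ### Eigenvalues for independent parameters -/

section Generic

open MvPolynomial

variable {K : Type} [Field K] [Algebra ℚ K] {q t : K}

theorem aeval_ne_zero_of_algebraicIndependent (h : AlgebraicIndependent ℚ ![q, t])
    {p : MvPolynomial (Fin 2) ℚ} (hp : p ≠ 0) : aeval ![q, t] p ≠ 0 := fun h0 =>
  hp (h (h0.trans (map_zero _).symm))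

theorem generic_ne_zero (h : AlgebraicIndependent ℚ ![q, t]) : t ≠ 0 := by
  have := aeval_ne_zero_of_algebraicIndependent h (p := X 1) (X_ne_zero 1)
  simpa using this

theorem generic_one_sub_pow_ne_zero (h : AlgebraicIndependent ℚ ![q, t]) (n : ℕ+) :
    1 - t ^ (n : ℕ) ≠ 0 := by
  have := aeval_ne_zero_of_algebraicIndependent h (p := 1 - X 1 ^ (n : ℕ)) fun h0 => by
    have := congrArg (eval fun _ => (0 : ℚ)) h0
    simp at this
  simpa using this

theorem AlgebraicIndependent.pair_swap (h : AlgebraicIndependent ℚ ![q, t]) :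
    AlgebraicIndependent ℚ ![t, q] := by
  have := h.comp ![1, 0] (by decide)
  convert this using 1
  ext i
  fin_cases i <;> rfl

/-- Multiplied by `t ^ n`, the sum becomes the polynomial `∑ q^(d i) t^(n - i)` in independent `q`,
`t`. Its monomials have distinct exponents of `t`, so every `d i` can be read off. -/
theorem eq_of_eigenvalue_eq (h : AlgebraicIndependent ℚ ![q, t]) {n : ℕ} {d e : Fin n →₀ ℕ}
    (he : t⁻¹ ^ n + (1 - t⁻¹) * ∑ i : Fin n, t⁻¹ ^ (i : ℕ) * q ^ d i =
      t⁻¹ ^ n + (1 - t⁻¹) * ∑ i : Fin n, t⁻¹ ^ (i : ℕ) * q ^ e i) : d = e := by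
  classical
  have ht0 := generic_ne_zero h
  have ht1 : (1 : K) - t⁻¹ ≠ 0 := by
    have := generic_one_sub_pow_ne_zero h 1
    rw [sub_ne_zero] at this ⊢
    intro h1
    apply this
    rw [PNat.one_coe, pow_one, ← inv_inv t, ← h1, inv_one]
  have h2 := mul_left_cancel₀ ht1 (add_left_cancel he)
  set m : (Fin n →₀ ℕ) → Fin n → (Fin 2 →₀ ℕ) := fun d i =>
    Finsupp.single 0 (d i) + Finsupp.single 1 (n - i) with hm
  set p : (Fin n →₀ ℕ) → MvPolynomial (Fin 2) ℚ := fun d => ∑ i, monomial (m d i) 1 with hp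
  have hval : ∀ d, aeval ![q, t] (p d) = t ^ n * ∑ i : Fin n, t⁻¹ ^ (i : ℕ) * q ^ d i := by
    intro d
    rw [hp, map_sum, Finset.mul_sum]
    refine Finset.sum_congr rfl fun i _ => ?_
    rw [hm, aeval_monomial, map_one, one_mul, Finsupp.prod_add_index' (by simp) (by
      intros; exact pow_add _ _ _), Finsupp.prod_single_index (by simp),
      Finsupp.prod_single_index (by simp)]
    have : t ^ n = t ^ (n - (i : ℕ)) * t ^ (i : ℕ) := by
      rw [← pow_add, Nat.sub_add_cancel i.2.le]
    simp only [Matrix.cons_val_zero, Matrix.cons_val_one]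
    rw [this, inv_pow]
    field_simp
  have hpe : p d = p e := h (by rw [hval, hval, h2])
  ext i
  have hc := congrArg (coeff (m d i)) hpe
  have hcoef : ∀ d' i', coeff (m d i) (monomial (m d' i') (1 : ℚ)) =
      if i' = i ∧ d' i = d i then 1 else 0 := by
    intro d' i'
    rw [coeff_monomial]
    refine if_congr ⟨fun h => ?_, fun h => ?_⟩ rfl rfl
    · have h0 := DFunLike.congr_fun h 0
      have h1 := DFunLike.congr_fun h 1
      simp [hm] at h0 h1
      have : i' = i := Fin.ext (by have := i.2; have := i'.2; omega)
      subst this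
      exact ⟨rfl, h0⟩
    · rw [h.1, hm]
      simp only [h.2]
  rw [hp, coeff_sum, coeff_sum, Finset.sum_congr rfl fun i' _ => hcoef d i',
    Finset.sum_congr rfl fun i' _ => hcoef e i'] at hc
  by_contra hne
  simp [Ne.symm hne] at hc

end Generic

/-! ### Specialization of the parameters -/

section Specialization

open MvPolynomial

/-- A ring `O` of functions of two independent parameters `x`, `y`, contained in the field `K`,
with an evaluation at the point `(a, b)`. -/
structure ParamRing (O K : Type) [CommRing O] [Algebra ℚ O] [Field K] [Algebra ℚ K] (a b : ℝ) where
  toField : O →+* K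
  toField_injective : Function.Injective toField
  ev : O →+* ℂ
  isUnit_of_ev : ∀ u, ev u ≠ 0 → IsUnit u
  x : O
  y : O
  ev_x : ev x = a
  ev_y : ev y = b
  algebraicIndependent : AlgebraicIndependent ℚ ![toField x, toField y]

/-- The Macdonald function with numerical parameters. -/
def macC (a b : ℝ) (lam : YoungDiagram) : MvPolynomial ℕ+ ℂ := macP (a : ℂ) (b : ℂ)⁻¹ lam

variable {a b : ℝ}

theorem macC_eq_map (ha0 : 0 < a) (ha1 : a < 1) (hb0 : 0 < b) (hb1 : b < 1) (lam : YoungDiagram) :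
    macC a b lam = map Complex.ofRealHom (macP a b⁻¹ lam) := by
  rw [map_macP]
  · simp [macC]
  · intro mu hmu
    exact (sub_ne_zero.mpr (eps_ne_of_dominates ha0 ha1 ((one_lt_inv₀ hb0).mpr hb1) hmu)).isUnit

theorem eps_sub_ne_zero (ha0 : 0 < a) (ha1 : a < 1) (hb0 : 0 < b) (hb1 : b < 1)
    {lam mu : YoungDiagram} (h : mu ∈ lower lam) :
    eps (a : ℂ) (b : ℂ)⁻¹ lam - eps (a : ℂ) (b : ℂ)⁻¹ mu ≠ 0 := by
  have h1 := eps_ne_of_dominates ha0 ha1 ((one_lt_inv₀ hb0).mpr hb1) h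
  have h2 : ∀ nu, eps (a : ℂ) (b : ℂ)⁻¹ nu = ((eps a b⁻¹ nu : ℝ) : ℂ) := fun nu => by
    have := map_eps Complex.ofRealHom a b⁻¹ nu
    simp only [Complex.ofRealHom_eq_coe, Complex.ofReal_inv] at this
    exact this.symm
  rw [h2, h2, sub_ne_zero]
  exact_mod_cast h1

theorem ofReal_oscCoeff (n : ℕ+) : oscCoeff (a : ℂ) (b : ℂ) n = ((oscCoeff a b n : ℝ) : ℂ) :=
  (map_oscCoeff Complex.ofRealHom a b n).symm

variable {O K : Type} [CommRing O] [Algebra ℚ O] [Field K] [Algebra ℚ K] (S : ParamRing O K a b)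

namespace ParamRing

/-- The Macdonald function over the ring of parameters. -/
def mac (lam : YoungDiagram) : MvPolynomial ℕ+ O := macP S.x (Ring.inverse S.y) lam

theorem map_inverse {L : Type} [Field L] (φ : O →+* L) {u : O} (hu : S.ev u ≠ 0) :
    φ (Ring.inverse u) = (φ u)⁻¹ := by
  obtain ⟨v, rfl⟩ := S.isUnit_of_ev u hu
  rw [Ring.inverse_unit]
  exact map_units_inv φ v

theorem ev_y_ne_zero (hb0 : 0 < b) : S.ev S.y ≠ 0 := by
  rw [S.ev_y]; exact_mod_cast hb0.ne'

theorem isUnit_eps_sub (ha0 : 0 < a) (ha1 : a < 1) (hb0 : 0 < b) (hb1 : b < 1)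
    {lam mu : YoungDiagram} (h : mu ∈ lower lam) :
    IsUnit (eps S.x (Ring.inverse S.y) lam - eps S.x (Ring.inverse S.y) mu) := by
  refine S.isUnit_of_ev _ ?_
  rw [map_sub, map_eps, map_eps, S.map_inverse S.ev (S.ev_y_ne_zero hb0), S.ev_x, S.ev_y]
  exact eps_sub_ne_zero ha0 ha1 hb0 hb1 h

theorem map_toField_mac (ha0 : 0 < a) (ha1 : a < 1) (hb0 : 0 < b) (hb1 : b < 1)
    (lam : YoungDiagram) :
    map S.toField (S.mac lam) = macP (S.toField S.x) (S.toField S.y)⁻¹ lam := by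
  rw [mac, map_macP S.toField _ _ _ fun mu h => S.isUnit_eps_sub ha0 ha1 hb0 hb1 h,
    S.map_inverse _ (S.ev_y_ne_zero hb0)]

theorem map_ev_mac (ha0 : 0 < a) (ha1 : a < 1) (hb0 : 0 < b) (hb1 : b < 1) (lam : YoungDiagram) :
    map S.ev (S.mac lam) = macC a b lam := by
  rw [mac, map_macP S.ev _ _ _ fun mu h => S.isUnit_eps_sub ha0 ha1 hb0 hb1 h,
    S.map_inverse _ (S.ev_y_ne_zero hb0), S.ev_x, S.ev_y, macC]

/-- The norms of the power sums over the ring of parameters. -/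
def osc (n : ℕ+) : O := ((n : ℕ) : O) * ((1 - S.x ^ (n : ℕ)) * Ring.inverse (1 - S.y ^ (n : ℕ)))

theorem ev_one_sub_ne_zero (hb0 : 0 < b) (hb1 : b < 1) (n : ℕ+) : S.ev (1 - S.y ^ (n : ℕ)) ≠ 0 := by
  rw [map_sub, map_one, map_pow, S.ev_y]
  exact_mod_cast (one_sub_pow_pos hb0 hb1 n).ne'

theorem map_osc {L : Type} [Field L] (φ : O →+* L) (hb0 : 0 < b) (hb1 : b < 1) :
    (fun n => φ (S.osc n)) = oscCoeff (φ S.x) (φ S.y) := by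
  ext n
  rw [osc, map_mul, map_mul, S.map_inverse φ (S.ev_one_sub_ne_zero hb0 hb1 n), oscCoeff]
  simp [div_eq_mul_inv]

theorem eps_toField_ne {lam mu : YoungDiagram} (h : lam ≠ mu) :
    eps (S.toField S.x) (S.toField S.y)⁻¹ lam ≠ eps (S.toField S.x) (S.toField S.y)⁻¹ mu := by
  intro he
  have h1 : lam.colLen 0 ≤ max (lam.colLen 0) (mu.colLen 0) := le_max_left _ _
  have h2 : mu.colLen 0 ≤ max (lam.colLen 0) (mu.colLen 0) := le_max_right _ _
  rw [eps_eq_fin _ _ h1, eps_eq_fin _ _ h2] at he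
  have := eq_of_eigenvalue_eq S.algebraicIndependent he
  refine h (ext_rowLen fun i => ?_)
  by_cases hi : i < max (lam.colLen 0) (mu.colLen 0)
  · exact DFunLike.congr_fun this ⟨i, hi⟩
  · have e : ∀ nu : YoungDiagram, nu.colLen 0 ≤ max (lam.colLen 0) (mu.colLen 0) →
        nu.rowLen i = 0 := fun nu hnu => by
      by_contra h0
      have := (rowLen_ne_zero_iff nu i).mp h0
      omega
    rw [e _ h1, e _ h2]

/-- Orthogonality holds in the field, where all eigenvalues differ, and descends to the ring by
injectivity. Evaluation then gives it at `(a, b)`, even for partitions whose eigenvalues coincide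
there. -/
theorem form_mac (ha0 : 0 < a) (ha1 : a < 1) (hb0 : 0 < b) (hb1 : b < 1) {lam mu : YoungDiagram}
    (h : lam ≠ mu) : form S.osc (S.mac lam) (S.mac mu) = 0 := by
  apply S.toField_injective
  rw [map_zero, ← form_map, S.map_toField_mac ha0 ha1 hb0 hb1, S.map_toField_mac ha0 ha1 hb0 hb1,
    S.map_osc _ hb0 hb1]
  exact form_macP_eq_zero (inv_ne_zero (generic_ne_zero S.algebraicIndependent)) _
    (mul_oscCoeff_eq (generic_ne_zero S.algebraicIndependent)
      (generic_one_sub_pow_ne_zero S.algebraicIndependent)) (S.eps_toField_ne h)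

theorem ev_form_mac (ha0 : 0 < a) (ha1 : a < 1) (hb0 : 0 < b) (hb1 : b < 1)
    (lam mu : YoungDiagram) : S.ev (form S.osc (S.mac lam) (S.mac mu)) =
      form (oscCoeff (a : ℂ) b) (macC a b lam) (macC a b mu) := by
  rw [← form_map, S.map_ev_mac ha0 ha1 hb0 hb1, S.map_ev_mac ha0 ha1 hb0 hb1,
    S.map_osc _ hb0 hb1, S.ev_x, S.ev_y]

theorem toField_form_mac (ha0 : 0 < a) (ha1 : a < 1) (hb0 : 0 < b) (hb1 : b < 1)
    (lam mu : YoungDiagram) : S.toField (form S.osc (S.mac lam) (S.mac mu)) =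
      form (oscCoeff (S.toField S.x) (S.toField S.y)) (macP (S.toField S.x) (S.toField S.y)⁻¹ lam)
        (macP (S.toField S.x) (S.toField S.y)⁻¹ mu) := by
  rw [← form_map, S.map_toField_mac ha0 ha1 hb0 hb1, S.map_toField_mac ha0 ha1 hb0 hb1,
    S.map_osc _ hb0 hb1]

end ParamRing

/-- The norms of the Macdonald functions are positive. -/
theorem exists_form_macC_self (ha0 : 0 < a) (ha1 : a < 1) (hb0 : 0 < b) (hb1 : b < 1)
    (lam : YoungDiagram) : ∃ r : ℝ, 0 < r ∧
      form (oscCoeff (a : ℂ) b) (macC a b lam) (macC a b lam) = r := by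
  refine ⟨form (oscCoeff a b) (macP a b⁻¹ lam) (macP a b⁻¹ lam),
    form_self_pos (oscCoeff_pos ha0 ha1 hb0 hb1) fun h => ?_, ?_⟩
  · have := coeffAt_macP_self (inv_ne_zero hb0.ne') (q := a) (lam := lam) fun mu hmu =>
      sub_ne_zero.mpr (eps_ne_of_dominates ha0 ha1 ((one_lt_inv₀ hb0).mpr hb1) hmu)
    rw [h, map_zero] at this
    exact zero_ne_one this
  · rw [macC_eq_map ha0 ha1 hb0 hb1, show oscCoeff (a : ℂ) (b : ℂ) = fun n =>
      Complex.ofRealHom (oscCoeff a b n) from funext ofReal_oscCoeff, form_map]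
    rfl

theorem form_macC_self_ne_zero (ha0 : 0 < a) (ha1 : a < 1) (hb0 : 0 < b) (hb1 : b < 1)
    (lam : YoungDiagram) : form (oscCoeff (a : ℂ) b) (macC a b lam) (macC a b lam) ≠ 0 := by
  obtain ⟨r, hr, h⟩ := exists_form_macC_self ha0 ha1 hb0 hb1 lam
  rw [h]
  exact_mod_cast hr.ne'

namespace ParamRing

theorem isOrthoFamily_macC (S : ParamRing O K a b) (ha0 : 0 < a) (ha1 : a < 1) (hb0 : 0 < b) (hb1 : b < 1) :
    IsOrthoFamily (oscCoeff (a : ℂ) b) (macC a b) where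
  sub_mem lam := macP_sub_mem (inv_ne_zero (by exact_mod_cast hb0.ne')) fun mu hmu =>
    eps_sub_ne_zero ha0 ha1 hb0 hb1 hmu
  ortho lam mu h := by rw [← S.ev_form_mac ha0 ha1 hb0 hb1, S.form_mac ha0 ha1 hb0 hb1 h, map_zero]
  norm_ne_zero lam := form_macC_self_ne_zero ha0 ha1 hb0 hb1 lam

theorem isOrthoFamily_toField (ha0 : 0 < a) (ha1 : a < 1) (hb0 : 0 < b) (hb1 : b < 1) :
    IsOrthoFamily (oscCoeff (S.toField S.x) (S.toField S.y))
      (macP (S.toField S.x) (S.toField S.y)⁻¹) where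
  sub_mem lam := macP_sub_mem (inv_ne_zero (generic_ne_zero S.algebraicIndependent)) fun mu hmu =>
    sub_ne_zero.mpr (S.eps_toField_ne fun e => (mem_lower.mp hmu).2 e.symm)
  ortho lam mu h := by
    rw [← S.toField_form_mac ha0 ha1 hb0 hb1, S.form_mac ha0 ha1 hb0 hb1 h, map_zero]
  -- A norm that vanishes in the field vanishes in the ring, hence also at `(a, b)`, where the norms
  -- are positive.
  norm_ne_zero lam h := form_macC_self_ne_zero ha0 ha1 hb0 hb1 lam (by
    rw [← S.toField_form_mac ha0 ha1 hb0 hb1] at h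
    rw [← S.ev_form_mac ha0 ha1 hb0 hb1, S.toField_injective (h.trans (map_zero _).symm), map_zero])

/-- Adding columns of length `r` multiplies the restriction to `r` variables by a monomial. -/
theorem toFin_mac_boost (ha0 : 0 < a) (ha1 : a < 1) (hb0 : 0 < b) (hb1 : b < 1)
    {lam mu : YoungDiagram} {r c : ℕ} (hlam : lam.colLen 0 ≤ r)
    (hmu : ∀ i, mu.rowLen i = lam.rowLen i + if i < r then c else 0) :
    toFin r (S.mac mu) = (∏ i, X i ^ c) * toFin r (S.mac lam) := by
  have hmu' : mu.colLen 0 ≤ r := by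
    by_contra h
    have h1 := (rowLen_ne_zero_iff mu r).mpr (by omega)
    rw [hmu, if_neg (lt_irrefl _), add_zero] at h1
    have := (rowLen_ne_zero_iff lam r).mp h1
    omega
  apply MvPolynomial.map_injective S.toField S.toField_injective
  rw [map_mul, map_prod, map_toFin, map_toFin, S.map_toField_mac ha0 ha1 hb0 hb1,
    S.map_toField_mac ha0 ha1 hb0 hb1]
  simp only [map_pow, map_X]
  set q := S.toField S.x
  set t := S.toField S.y
  have hai : AlgebraicIndependent ℚ ![q, t] := S.algebraicIndependent
  have hs : t⁻¹ ≠ 0 := inv_ne_zero (generic_ne_zero hai)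
  have hdist : ∀ nu, ∀ m ∈ lower nu, eps q t⁻¹ nu - eps q t⁻¹ m ≠ 0 := fun nu m hm =>
    sub_ne_zero.mpr (S.eps_toField_ne fun e => (mem_lower.mp hm).2 e.symm)
  set f := toFin r (macP q t⁻¹ lam)
  set g := toFin r (macP q t⁻¹ mu)
  set xc : MvPolynomial (Fin r) K := ∏ i, X i ^ c with hxc
  have hf : vand K r * (C (eps q t⁻¹ lam) * f) = C (t⁻¹ ^ r) * (vand K r * f) +
      C (1 - t⁻¹) * ∑ i, vandShift t⁻¹ i * dilate q i f := by
    rw [← vand_mul_toFin_macOp, macOp_macP q hs, map_smul, smul_eq_C_mul]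
  have hg : vand K r * (C (eps q t⁻¹ mu) * g) = C (t⁻¹ ^ r) * (vand K r * g) +
      C (1 - t⁻¹) * ∑ i, vandShift t⁻¹ i * dilate q i g := by
    rw [← vand_mul_toFin_macOp, macOp_macP q hs, map_smul, smul_eq_C_mul]
  have heps : eps q t⁻¹ mu = t⁻¹ ^ r + q ^ c * (eps q t⁻¹ lam - t⁻¹ ^ r) := by
    rw [eps_eq q t⁻¹ mu hmu', eps_eq q t⁻¹ lam hlam]
    have : ∑ i ∈ Finset.range r, t⁻¹ ^ i * q ^ mu.rowLen i =
        q ^ c * ∑ i ∈ Finset.range r, t⁻¹ ^ i * q ^ lam.rowLen i := by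
      rw [Finset.mul_sum]
      refine Finset.sum_congr rfl fun i hi => ?_
      rw [hmu, if_pos (Finset.mem_range.mp hi), pow_add]
      ring
    rw [this]
    ring
  have hdil : ∀ i, dilate q i (xc * f) = C (q ^ c) * (xc * dilate q i f) := by
    intro i
    rw [map_mul, hxc, map_prod, ← Finset.mul_prod_erase _ _ (Finset.mem_univ i),
      ← Finset.mul_prod_erase _ (fun i => X i ^ c) (Finset.mem_univ i),
      Finset.prod_congr (g := fun j => (X j : MvPolynomial (Fin r) K) ^ c) rfl fun j hj => by
        rw [map_pow, dilate, aeval_X, Function.update_of_ne (Finset.ne_of_mem_erase hj)],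
      map_pow, dilate, aeval_X, Function.update_self, mul_pow, C_pow]
    ring
  -- Multiplication by the monomial turns each dilation of `f` into `q ^ c` times itself, and by
  -- `heps` this changes the eigenvalue of `lam` into that of `mu`. So `xc * f` and `g` are
  -- eigenfunctions with the same eigenvalue.
  have hxf : vand K r * (C (eps q t⁻¹ mu) * (xc * f)) = C (t⁻¹ ^ r) * (vand K r * (xc * f)) +
      C (1 - t⁻¹) * ∑ i, vandShift t⁻¹ i * dilate q i (xc * f) := by
    have h1 : ∑ i, vandShift t⁻¹ i * dilate q i (xc * f) =
        C (q ^ c) * xc * ∑ i, vandShift t⁻¹ i * dilate q i f := by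
      rw [Finset.mul_sum]
      exact Finset.sum_congr rfl fun i _ => by rw [hdil]; ring
    rw [h1, heps, map_add, map_mul, map_sub]
    linear_combination C (q ^ c) * xc * hf
  have hd : vand K r * (C (eps q t⁻¹ mu) * (g - xc * f)) =
      C (t⁻¹ ^ r) * (vand K r * (g - xc * f)) +
      C (1 - t⁻¹) * ∑ i, vandShift t⁻¹ i * dilate q i (g - xc * f) := by
    simp only [map_sub, mul_sub, Finset.sum_sub_distrib] at hg hxf ⊢
    linear_combination hg - hxf
  rw [← sub_eq_zero]
  -- If the difference were nonzero, its leading exponent would carry the eigenvalue of `mu`, hence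
  -- be the exponent of `mu`. But there both functions have coefficient one.
  by_contra hne
  have hlead := leading_of_vand_mul_eq q hs hd (d := (lexOrder r).degree (g - xc * f)) le_rfl
  rw [coeff_C_mul, eps_eq_fin q t⁻¹ hmu'] at hlead
  have hlc : coeff ((lexOrder r).degree (g - xc * f)) (g - xc * f) ≠ 0 :=
    MonomialOrder.leadingCoeff_ne_zero_iff.mpr hne
  have hde := eq_of_eigenvalue_eq hai (mul_right_cancel₀ hlc hlead)
  apply hlc
  rw [← hde, coeff_sub, coeff_expoFin_toFin hmu', coeffAt_macP_self hs (hdist mu)]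
  have hx : xc = monomial (Finsupp.equivFunOnFinite.symm fun _ => c) 1 := by
    rw [monomial_eq, Finsupp.prod_fintype _ _ (by simp), C_1, one_mul]
    rfl
  have he : expoFin r mu = (Finsupp.equivFunOnFinite.symm fun _ => c) + expoFin r lam := by
    ext i
    rw [expoFin_apply, hmu, if_pos i.2, Finsupp.add_apply, expoFin_apply, add_comm]
    rfl
  rw [hx, he, coeff_monomial_mul, one_mul, coeff_expoFin_toFin hlam, coeffAt_macP_self hs (hdist lam),
    sub_self]

theorem psEval_macC_boost (S : ParamRing O K a b) (ha0 : 0 < a) (ha1 : a < 1) (hb0 : 0 < b) (hb1 : b < 1)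
    {lam mu : YoungDiagram} {r c : ℕ} (hlam : lam.colLen 0 ≤ r)
    (hmu : ∀ i, mu.rowLen i = lam.rowLen i + if i < r then c else 0) (z : Fin r → ℂ) :
    psEval z (macC a b mu) = (∏ i, z i ^ c) * psEval z (macC a b lam) := by
  have h := congrArg (fun p => aeval z (map S.ev p)) (S.toFin_mac_boost ha0 ha1 hb0 hb1 hlam hmu)
  simp only [map_mul, map_prod, map_pow, map_X, aeval_X, map_toFin,
    S.map_ev_mac ha0 ha1 hb0 hb1, aeval_toFin] at h
  exact h

end ParamRing

end Specialization

/-! ### The local ring of rational functions without a pole at a point -/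

section LocalRing

open MvPolynomial

variable (q t : ℝ)

/-- The evaluation of polynomials in two indeterminates. -/
def evalPoint : MvPolynomial (Fin 2) ℚ →ₐ[ℚ] ℂ := aeval ![(q : ℂ), (t : ℂ)]

/-- The prime ideal of the polynomials that vanish at the point. -/
def pointIdeal : Ideal (MvPolynomial (Fin 2) ℚ) := RingHom.ker (evalPoint q t)

instance : (pointIdeal q t).IsPrime := RingHom.ker_isPrime _

/-- The ring of rational functions without a pole at the point. -/
abbrev LocalRing : Type := Localization (pointIdeal q t).primeCompl

variable {q t} in
theorem evalPoint_ne_zero (b : (pointIdeal q t).primeCompl) : evalPoint q t b ≠ 0 := fun h =>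
  b.2 ((RingHom.mem_ker).mpr h)

/-- The evaluation of the rational functions without a pole. -/
def localEval : LocalRing q t →+* ℂ :=
  IsLocalization.lift (M := (pointIdeal q t).primeCompl) (g := (evalPoint q t : _ →+* ℂ))
    fun b => (evalPoint_ne_zero b).isUnit

theorem algebraMap_primeCompl_ne_zero (b : (pointIdeal q t).primeCompl) :
    algebraMap (MvPolynomial (Fin 2) ℚ) RatQT b ≠ 0 := by
  intro h
  have h0 : (b : MvPolynomial (Fin 2) ℚ) = 0 :=
    IsFractionRing.injective (MvPolynomial (Fin 2) ℚ) RatQT (h.trans (map_zero _).symm)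
  have := evalPoint_ne_zero b
  rw [h0, map_zero] at this
  exact this rfl

/-- The inclusion in the field of rational functions. -/
def localToField : LocalRing q t →+* RatQT :=
  IsLocalization.lift (M := (pointIdeal q t).primeCompl)
    (g := algebraMap (MvPolynomial (Fin 2) ℚ) RatQT)
    fun b => (algebraMap_primeCompl_ne_zero q t b).isUnit

theorem localEval_algebraMap (f : MvPolynomial (Fin 2) ℚ) :
    localEval q t (algebraMap _ _ f) = evalPoint q t f := IsLocalization.lift_eq _ _

theorem localToField_algebraMap (f : MvPolynomial (Fin 2) ℚ) :
    localToField q t (algebraMap _ _ f) = algebraMap _ RatQT f := IsLocalization.lift_eq _ _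

theorem localEval_mk' (f : MvPolynomial (Fin 2) ℚ) (b : (pointIdeal q t).primeCompl) :
    localEval q t (IsLocalization.mk' _ f b) = evalPoint q t f / evalPoint q t b := by
  rw [eq_div_iff (evalPoint_ne_zero b), ← localEval_algebraMap, ← localEval_algebraMap, ← map_mul,
    IsLocalization.mk'_spec]

theorem localToField_mk' (f : MvPolynomial (Fin 2) ℚ) (b : (pointIdeal q t).primeCompl) :
    localToField q t (IsLocalization.mk' _ f b) =
      algebraMap _ RatQT f / algebraMap _ RatQT (b : MvPolynomial (Fin 2) ℚ) := by
  rw [eq_div_iff (algebraMap_primeCompl_ne_zero q t b), ← localToField_algebraMap,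
    ← localToField_algebraMap, ← map_mul, IsLocalization.mk'_spec]

/-- `RegularAt` and `ratEval` refer to the reduced fraction. Its denominator is prime to its
numerator, so it divides the denominator `b` of any other representation, and `b` does not vanish at
the point. -/
theorem regularAt_localToField (u : LocalRing q t) :
    RegularAt q t (localToField q t u) ∧ ratEval q t (localToField q t u) = localEval q t u := by
  obtain ⟨f, b, rfl⟩ := IsLocalization.exists_mk'_eq (pointIdeal q t).primeCompl u
  rw [localEval_mk']
  set v := localToField q t (IsLocalization.mk' _ f b) with hv
  have hb := algebraMap_primeCompl_ne_zero q t b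
  have h1 : f * (IsFractionRing.den (MvPolynomial (Fin 2) ℚ) v : MvPolynomial (Fin 2) ℚ) =
      IsFractionRing.num (MvPolynomial (Fin 2) ℚ) v * b := by
    apply IsFractionRing.injective (MvPolynomial (Fin 2) ℚ) RatQT
    have h2 := IsFractionRing.mk'_num_den (MvPolynomial (Fin 2) ℚ) v
    rw [IsFractionRing.mk'_eq_div] at h2
    have h3 : algebraMap (MvPolynomial (Fin 2) ℚ) RatQT
        (IsFractionRing.den (MvPolynomial (Fin 2) ℚ) v : MvPolynomial (Fin 2) ℚ) ≠ 0 :=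
      IsFractionRing.to_map_ne_zero_of_mem_nonZeroDivisors (IsFractionRing.den _ v).2
    rw [map_mul, map_mul]
    rw [div_eq_iff h3] at h2
    rw [h2, hv, localToField_mk']
    field_simp
  have hdvd : (IsFractionRing.den (MvPolynomial (Fin 2) ℚ) v : MvPolynomial (Fin 2) ℚ) ∣ b :=
    (IsFractionRing.num_den_reduced (MvPolynomial (Fin 2) ℚ) v).symm.dvd_of_dvd_mul_left
      ⟨f, by rw [← h1, mul_comm]⟩
  have hden : evalPoint q t (IsFractionRing.den (MvPolynomial (Fin 2) ℚ) v :
      MvPolynomial (Fin 2) ℚ) ≠ 0 := by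
    intro h0
    obtain ⟨c, hc⟩ := hdvd
    apply evalPoint_ne_zero b
    rw [hc, map_mul, h0, zero_mul]
  refine ⟨hden, ?_⟩
  have h4 := congrArg (evalPoint q t) h1
  rw [map_mul, map_mul] at h4
  exact (div_eq_div_iff hden (evalPoint_ne_zero b)).mpr h4.symm

theorem algebraicIndependent_ind : AlgebraicIndependent ℚ ![indQ, indT] := by
  have : (aeval ![indQ, indT] : MvPolynomial (Fin 2) ℚ →ₐ[ℚ] RatQT) =
      IsScalarTower.toAlgHom ℚ (MvPolynomial (Fin 2) ℚ) RatQT := by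
    refine algHom_ext fun i => ?_
    fin_cases i
    · simp [indQ]
    · simp [indT]
  rw [AlgebraicIndependent, this]
  exact IsFractionRing.injective (MvPolynomial (Fin 2) ℚ) RatQT

/-- The parameters `q`, `t`. -/
def paramQT : ParamRing (LocalRing q t) RatQT q t where
  toField := localToField q t
  toField_injective := by
    rw [injective_iff_map_eq_zero]
    intro u hu
    obtain ⟨f, b, rfl⟩ := IsLocalization.exists_mk'_eq (pointIdeal q t).primeCompl u
    rw [localToField_mk', div_eq_zero_iff] at hu
    have h0 : f = 0 := IsFractionRing.injective (MvPolynomial (Fin 2) ℚ) RatQT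
      ((hu.resolve_right (algebraMap_primeCompl_ne_zero q t b)).trans (map_zero _).symm)
    rw [h0, IsLocalization.mk'_zero]
  ev := localEval q t
  isUnit_of_ev u hu := by
    obtain ⟨f, b, rfl⟩ := IsLocalization.exists_mk'_eq (pointIdeal q t).primeCompl u
    rw [localEval_mk'] at hu
    have hf : f ∈ (pointIdeal q t).primeCompl := fun h => hu (by
      rw [show evalPoint q t f = 0 from h, zero_div])
    exact (IsLocalization.AtPrime.isUnit_mk'_iff _ (pointIdeal q t) f b).mpr hf
  x := algebraMap (MvPolynomial (Fin 2) ℚ) _ (X 0)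
  y := algebraMap (MvPolynomial (Fin 2) ℚ) _ (X 1)
  ev_x := by rw [localEval_algebraMap]; simp [evalPoint]
  ev_y := by rw [localEval_algebraMap]; simp [evalPoint]
  algebraicIndependent := by
    rw [localToField_algebraMap, localToField_algebraMap]
    exact algebraicIndependent_ind

/-- The same ring with the parameters interchanged. -/
def ParamRing.swap {O K : Type} [CommRing O] [Algebra ℚ O] [Field K] [Algebra ℚ K] {a b : ℝ}
    (S : ParamRing O K a b) : ParamRing O K b a where
  toField := S.toField
  toField_injective := S.toField_injective
  ev := S.ev
  isUnit_of_ev := S.isUnit_of_ev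
  x := S.y
  y := S.x
  ev_x := S.ev_y
  ev_y := S.ev_x
  algebraicIndependent := AlgebraicIndependent.pair_swap S.algebraicIndependent

theorem toField_x_paramQT : (paramQT q t).toField (paramQT q t).x = indQ :=
  localToField_algebraMap q t _

theorem toField_y_paramQT : (paramQT q t).toField (paramQT q t).y = indT :=
  localToField_algebraMap q t _

/-! ### The Macdonald functions -/

/-- The Macdonald function as a polynomial in the power sums. -/
def macQT (lam : YoungDiagram) : MvPolynomial ℕ+ RatQT := macP indQ indT⁻¹ lam

theorem isOrthoFamily_macQT : IsOrthoFamily (oscCoeff indQ indT) macQT := by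
  -- The claim involves no numerical point; `(1/2, 1/2)` is one choice in the square, needed only to
  -- have a `ParamRing`.
  have h0 : (0 : ℝ) < 1 / 2 := by norm_num
  have h1 : (1 / 2 : ℝ) < 1 := by norm_num
  have := (paramQT (1 / 2) (1 / 2)).isOrthoFamily_toField h0 h1 h0 h1
  rwa [toField_x_paramQT, toField_y_paramQT] at this

theorem isMacdonaldFamily_macdonaldP : IsMacdonaldFamily indQ indT macdonaldP :=
  Classical.epsilon_spec ⟨_, isOrthoFamily_macQT.isMacdonaldFamily⟩

theorem macdonaldP_eq (lam : YoungDiagram) : macdonaldP lam = ofPowerSums RatQT (macQT lam) :=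
  isOrthoFamily_macQT.eq_of_isMacdonaldFamily isMacdonaldFamily_macdonaldP lam

variable {q t}

theorem map_localToField_mac (hq0 : 0 < q) (hq1 : q < 1) (ht0 : 0 < t) (ht1 : t < 1)
    (lam : YoungDiagram) : map (localToField q t) ((paramQT q t).mac lam) = macQT lam := by
  have := (paramQT q t).map_toField_mac hq0 hq1 ht0 ht1 lam
  rwa [toField_x_paramQT, toField_y_paramQT] at this

theorem regularAt_coeff_macQT (hq0 : 0 < q) (hq1 : q < 1) (ht0 : 0 < t) (ht1 : t < 1)
    (lam : YoungDiagram) (d : ℕ+ →₀ ℕ) : RegularAt q t (coeff d (macQT lam)) ∧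
      ratEval q t (coeff d (macQT lam)) = coeff d (macC q t lam) := by
  rw [← map_localToField_mac hq0 hq1 ht0 ht1, coeff_map,
    ← (paramQT q t).map_ev_mac hq0 hq1 ht0 ht1, coeff_map]
  exact regularAt_localToField q t _

theorem ratEval_scalarProd (hq0 : 0 < q) (hq1 : q < 1) (ht0 : 0 < t) (ht1 : t < 1)
    (lam : YoungDiagram) :
    ratEval q t (scalarProd indQ indT (macdonaldP lam) (macdonaldP lam)) =
      form (oscCoeff (q : ℂ) t) (macC q t lam) (macC q t lam) := by
  have h := (paramQT q t).toField_form_mac hq0 hq1 ht0 ht1 lam lam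
  rw [toField_x_paramQT, toField_y_paramQT] at h
  rw [macdonaldP_eq, scalarProd_ofPowerSums, macQT, ← h,
    ← (paramQT q t).ev_form_mac hq0 hq1 ht0 ht1]
  exact (regularAt_localToField q t _).2

theorem psEval_eq_sum {n : ℕ} (x : Fin n → ℂ) (F : MvPolynomial ℕ+ ℂ) :
    psEval x F = ∑ᶠ d : Fin n →₀ ℕ, coeff d (toFin n F) * d.prod fun i k => x i ^ k := by
  rw [← aeval_toFin, aeval_def, eval₂_eq, finsum_eq_sum_of_support_subset (s := (toFin n F).support)]
  · rfl
  · intro d hd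
    exact mem_support_iff.mpr (left_ne_zero_of_mul hd)

theorem evalSymm_macdonaldP (hq0 : 0 < q) (hq1 : q < 1) (ht0 : 0 < t) (ht1 : t < 1)
    (lam : YoungDiagram) {n : ℕ} (x : Fin n → ℂ) :
    evalSymm q t (macdonaldP lam) x = psEval x (macC q t lam) := by
  rw [evalSymm, psEval_eq_sum]
  refine finsum_congr fun d => ?_
  congr 1
  rw [macdonaldP_eq, ← coeff_toFin, ← map_localToField_mac hq0 hq1 ht0 ht1, ← map_toFin, coeff_map,
    (regularAt_localToField q t _).2, ← (paramQT q t).map_ev_mac hq0 hq1 ht0 ht1, ← map_toFin,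
    coeff_map]
  rfl

end LocalRing

/-! ### Vacuum expectation values -/

section Vev

open MvPolynomial

variable {K R : Type} [Field K] [CommRing R] [Algebra K R]

/-- The derivation `∑ p_n ∂/∂a_n`. -/
def translation (p : ℕ+ → R) : Derivation R (MvPolynomial ℕ+ R) (MvPolynomial ℕ+ R) :=
  mkDerivation R fun n => C (p n)

theorem finsum_pderiv (p : ℕ+ → R) (w : MvPolynomial ℕ+ R) :
    ∑ᶠ n : ℕ+, p n • pderiv n w = translation p w := by
  classical
  have hfin : ∀ w : MvPolynomial ℕ+ R, (Function.support fun n => p n • pderiv n w).Finite := by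
    intro w
    refine Set.Finite.subset (Finset.finite_toSet w.vars) fun n hn => ?_
    by_contra h
    apply hn
    change p n • pderiv n w = 0
    rw [pderiv_eq_zero_of_notMem_vars h, smul_zero]
  induction w using MvPolynomial.induction_on with
  | C a => simp [translation]
  | add f g hf hg =>
    simp only [map_add, smul_add]
    rw [finsum_add_distrib (hfin f) (hfin g), hf, hg]
  | mul_X f m hf =>
    have h1 : ∀ n, p n • pderiv n (f * X m) = X m * (p n • pderiv n f) +
        if n = m then f * C (p m) else 0 := by
      intro n
      rw [Derivation.leibniz, smul_add, add_comm, smul_eq_mul, smul_eq_mul, mul_smul_comm]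
      congr 1
      split_ifs with h
      · subst h
        rw [pderiv_X_self, mul_one, smul_eq_C_mul, mul_comm]
      · rw [pderiv_X_of_ne (Ne.symm h), mul_zero, smul_zero]
    simp only [h1]
    have h2 : (Function.support fun n => X m * (p n • pderiv n f)).Finite :=
      (hfin f).subset fun n hn h0 => hn (by
        change X m * (p n • pderiv n f) = 0
        rw [show p n • pderiv n f = 0 from h0, mul_zero])
    rw [finsum_add_distrib h2, ← mul_finsum' (fun n => p n • pderiv n f) (X m) (hfin f), hf, finsum_eq_single _ m fun n hn => if_neg hn,
      if_pos rfl, Derivation.leibniz, translation, mkDerivation_X, smul_eq_mul, smul_eq_mul, add_comm]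
    refine (Set.finite_singleton m).subset fun n hn => ?_
    by_contra h
    exact hn (if_neg h)

/-- The translation by `u p_n`. -/
def translate (p : ℕ+ → R) : MvPolynomial ℕ+ R →ₐ[R] Polynomial (MvPolynomial ℕ+ R) :=
  aeval fun n => Polynomial.C (X n) + Polynomial.C (C (p n)) * Polynomial.X

theorem derivative_translate (p : ℕ+ → R) (w : MvPolynomial ℕ+ R) :
    Polynomial.derivative (translate p w) = translate p (translation p w) := by
  induction w using MvPolynomial.induction_on with
  | C a => simp [translate, translation, Polynomial.derivative_C, Polynomial.algebraMap_apply]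
  | add f g hf hg => simp only [map_add, hf, hg]
  | mul_X f m hf =>
    have hX : translate p (X m) = Polynomial.C (X m) + Polynomial.C (C (p m)) * Polynomial.X := by
      simp [translate]
    have hC : translate p (C (p m)) = Polynomial.C (C (p m)) := by
      simp [translate, Polynomial.algebraMap_apply]
    rw [map_mul, Polynomial.derivative_mul, hf, Derivation.leibniz, map_add, smul_eq_mul,
      smul_eq_mul, map_mul, map_mul, hX]
    have : translation p (X m) = C (p m) := by simp [translation]
    rw [this, hC]
    simp
    ring

theorem coeff_zero_translate (p : ℕ+ → R) (w : MvPolynomial ℕ+ R) :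
    (translate p w).coeff 0 = w := by
  have : (Polynomial.constantCoeff.comp (translate p : _ →+* Polynomial (MvPolynomial ℕ+ R))) =
      RingHom.id _ := by
    refine MvPolynomial.ringHom_ext (fun a => ?_) fun n => ?_
    · simp [translate, Polynomial.algebraMap_apply]
    · simp [translate]
  exact DFunLike.congr_fun this w

/-- Taylor coefficients: the derivative in `u` of the translation by `u p` is the translate of the
derivation. -/
theorem coeff_translate [CharZero K] (p : ℕ+ → R) (k : ℕ) (w : MvPolynomial ℕ+ R) :
    (translate p w).coeff k = ((k.factorial : K)⁻¹) • (translation p)^[k] w := by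
  induction k generalizing w with
  | zero => simp [coeff_zero_translate]
  | succ k ih =>
    have h1 := congrArg (fun f => Polynomial.coeff f k) (derivative_translate p w)
    simp only [Polynomial.coeff_derivative] at h1
    rw [ih, ← Function.iterate_succ_apply] at h1
    have hk : ((k : K) + 1) ≠ 0 := by exact_mod_cast Nat.succ_ne_zero k
    have h2 : (translate p w).coeff (k + 1) * ((k : MvPolynomial ℕ+ R) + 1) =
        ((k : K) + 1) • (translate p w).coeff (k + 1) := by
      rw [Algebra.smul_def]; simp [mul_comm]
    rw [h2] at h1
    rw [Nat.factorial_succ, Nat.cast_mul, mul_inv, mul_smul, ← h1, smul_smul, Nat.cast_succ,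
      inv_mul_cancel₀ hk, one_smul]

/-- Taylor's formula: the exponential of `∑ p_n ∂/∂a_n` is the translation `a_n ↦ a_n + p_n`, here
the polynomial `translate p w` at `u = 1`. Its constant term is the value at `p`. -/
theorem constantCoeff_expOp [CharZero K] (p : ℕ+ → R) (w : MvPolynomial ℕ+ R) :
    constantCoeff (expOp K (translation p) w) = aeval p w := by
  have h : expOp K (translation p) w = (translate p w).eval 1 := by
    rw [expOp]
    simp only [← coeff_translate]
    rw [finsum_eq_sum_of_support_subset (s := (translate p w).support), Polynomial.eval_eq_sum,
      Polynomial.sum_def]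
    · simp
    · intro k hk
      exact Polynomial.mem_support_iff.mpr hk
  rw [h]
  have : (constantCoeff.comp ((Polynomial.evalRingHom 1).comp
      (translate p : _ →+* Polynomial (MvPolynomial ℕ+ R)))) =
      (aeval p : MvPolynomial ℕ+ R →ₐ[R] R).toRingHom := by
    refine MvPolynomial.ringHom_ext (fun a => ?_) fun n => ?_
    · simp [translate, Polynomial.algebraMap_apply]
    · simp [translate]
  exact DFunLike.congr_fun this w

end Vev

/-! ### The operators attached to a symmetric function. -/

section Hat

open MvPolynomial

variable {K : Type} [Field K] {q t : K}

theorem translation_powerSum_eq [CharZero K] (hq : ∀ n : ℕ+, 1 - q ^ (n : ℕ) ≠ 0)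
    (ht : ∀ n : ℕ+, 1 - t ^ (n : ℕ) ≠ 0) (n : ℕ+) (w : MvPolynomial ℕ+ (MvPowerSeries ℕ K)) :
    (((1 - t ^ (n : ℕ)) / (1 - q ^ (n : ℕ)) / ((n : ℕ) : K)) • powerSum K n) •
      algebraMap K (MvPowerSeries ℕ K) (oscCoeff q t n) • w = powerSum K n • w := by
  have hn : ((n : ℕ) : K) ≠ 0 := by exact_mod_cast n.ne_zero
  have h1 := hq n
  have h2 := ht n
  have : oscCoeff q t n * ((1 - t ^ (n : ℕ)) / (1 - q ^ (n : ℕ)) / ((n : ℕ) : K)) = 1 := by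
    rw [oscCoeff]
    field_simp
  rw [algebraMap_smul, smul_assoc, smul_comm (powerSum K n) (oscCoeff q t n) w, smul_smul, mul_comm,
    this, one_smul]

theorem aeval_map_powerSum (A : MvPolynomial ℕ+ K) :
    aeval (powerSum K) (map (algebraMap K (MvPowerSeries ℕ K)) A) = ofPowerSums K A := by
  rw [aeval_map_algebraMap]; rfl

/-- The factor of `p_n` in the exponent of `C(x)` is the inverse of the commutator of `a_n` and
`a_{-n}`. So `C(x)` acts as `exp (∑ p_n ∂/∂a_{-n})`, and the vacuum expectation substitutes `p_n`
for `a_{-n}`. -/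
theorem vevC_eq [CharZero K] (hq : ∀ n : ℕ+, 1 - q ^ (n : ℕ) ≠ 0)
    (ht : ∀ n : ℕ+, 1 - t ^ (n : ℕ) ≠ 0) (A : MvPolynomial ℕ+ K) :
    vevC q t A = ofPowerSums K A := by
  rw [vevC, opC, mul_one]
  have h : ∀ (n : ℕ+) (w : MvPolynomial ℕ+ (MvPowerSeries ℕ K)),
      (((1 - t ^ (n : ℕ)) / (1 - q ^ (n : ℕ)) / ((n : ℕ) : K)) • powerSum K n) •
      osc (MvPowerSeries ℕ K) q t ((n : ℕ) : ℤ) w = powerSum K n • pderiv n w := by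
    intro n w
    have hn : (0 : ℤ) < ((n : ℕ) : ℤ) := by exact_mod_cast n.pos
    rw [osc, if_neg hn.not_gt, if_pos hn, Int.natAbs_natCast, PNat.coe_toPNat',
      ← translation_powerSum_eq hq ht n (pderiv n w)]
    rfl
  simp only [h, finsum_pderiv]
  exact (constantCoeff_expOp (K := K) _ _).trans (aeval_map_powerSum A)

theorem vevCStar_eq [CharZero K] (hq : ∀ n : ℕ+, 1 - q ^ (n : ℕ) ≠ 0)
    (ht : ∀ n : ℕ+, 1 - t ^ (n : ℕ) ≠ 0) (A : MvPolynomial ℕ+ K) :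
    vevCStar q t A = ofPowerSums K A := by
  rw [vevCStar, opCStar, one_mul]
  have h : ∀ (n : ℕ+) (w : MvPolynomial ℕ+ (MvPowerSeries ℕ K)),
      (((1 - t ^ (n : ℕ)) / (1 - q ^ (n : ℕ)) / ((n : ℕ) : K)) • powerSum K n) •
      oscDual (MvPowerSeries ℕ K) q t (-((n : ℕ) : ℤ)) w = powerSum K n • pderiv n w := by
    intro n w
    have hn : (0 : ℤ) < ((n : ℕ) : ℤ) := by exact_mod_cast n.pos
    rw [oscDual, if_neg (by omega), if_pos (by omega), Int.natAbs_neg, Int.natAbs_natCast,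
      PNat.coe_toPNat', ← translation_powerSum_eq hq ht n (pderiv n w)]
    rfl
  simp only [h, finsum_pderiv]
  exact (constantCoeff_expOp (K := K) _ _).trans (aeval_map_powerSum A)

theorem hat_ofPowerSums [CharZero K] (hq : ∀ n : ℕ+, 1 - q ^ (n : ℕ) ≠ 0)
    (ht : ∀ n : ℕ+, 1 - t ^ (n : ℕ) ≠ 0) (A : MvPolynomial ℕ+ K) :
    hat q t (ofPowerSums K A) = A := by
  rw [hat, show vevC q t = ofPowerSums K from funext (vevC_eq hq ht)]
  exact Function.leftInverse_invFun ofPowerSums_injective A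

theorem hatStar_ofPowerSums [CharZero K] (hq : ∀ n : ℕ+, 1 - q ^ (n : ℕ) ≠ 0)
    (ht : ∀ n : ℕ+, 1 - t ^ (n : ℕ) ≠ 0) (A : MvPolynomial ℕ+ K) :
    hatStar q t (ofPowerSums K A) = A := by
  rw [hatStar, show vevCStar q t = ofPowerSums K from funext (vevCStar_eq hq ht)]
  exact Function.leftInverse_invFun ofPowerSums_injective A

end Hat

theorem one_sub_indQ_pow_ne_zero (n : ℕ+) : 1 - indQ ^ (n : ℕ) ≠ 0 :=
  generic_one_sub_pow_ne_zero (AlgebraicIndependent.pair_swap algebraicIndependent_ind) n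

theorem one_sub_indT_pow_ne_zero (n : ℕ+) : 1 - indT ^ (n : ℕ) ≠ 0 :=
  generic_one_sub_pow_ne_zero algebraicIndependent_ind n

theorem hat_macdonaldP (lam : YoungDiagram) : hat indQ indT (macdonaldP lam) = macQT lam := by
  rw [macdonaldP_eq, hat_ofPowerSums one_sub_indQ_pow_ne_zero one_sub_indT_pow_ne_zero]

theorem hatStar_macdonaldP (lam : YoungDiagram) :
    hatStar indQ indT (macdonaldP lam) = macQT lam := by
  rw [macdonaldP_eq, hatStar_ofPowerSums one_sub_indQ_pow_ne_zero one_sub_indT_pow_ne_zero]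

theorem vevC_hat_macdonaldP (lam : YoungDiagram) :
    vevC indQ indT (hat indQ indT (macdonaldP lam)) = macdonaldP lam := by
  rw [hat_macdonaldP, vevC_eq one_sub_indQ_pow_ne_zero one_sub_indT_pow_ne_zero, macdonaldP_eq]

theorem vevCStar_hatStar_macdonaldP (lam : YoungDiagram) :
    vevCStar indQ indT (hatStar indQ indT (macdonaldP lam)) = macdonaldP lam := by
  rw [hatStar_macdonaldP, vevCStar_eq one_sub_indQ_pow_ne_zero one_sub_indT_pow_ne_zero,
    macdonaldP_eq]

/-! ### Products of generating functions and coefficients -/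

section Products

open MvPolynomial

variable {K : Type} [Field K] [Algebra ℚ K]

/-- The product of the coefficients of the generating function with the given indices. -/
def genProd (β : ℕ+ → K) (d : ℕ →₀ ℕ) : MvPolynomial ℕ+ K :=
  d.prod fun _ k => PowerSeries.coeff k (genSeries β)

/-- The substitution `p_n ↦ γ_n p_n`. -/
def scalePS {K : Type} [Field K] (γ : ℕ+ → K) : MvPolynomial ℕ+ K →ₐ[K] MvPolynomial ℕ+ K :=
  aeval fun n => C (γ n) * X n

theorem coeff_scalePS {K : Type} [Field K] (γ : ℕ+ → K) (F : MvPolynomial ℕ+ K) (d : ℕ+ →₀ ℕ) :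
    coeff d (scalePS γ F) = (d.prod fun n k => γ n ^ k) * coeff d F := by
  classical
  induction F using MvPolynomial.induction_on' with
  | monomial e a =>
    have : scalePS γ (monomial e a) = monomial e ((e.prod fun n k => γ n ^ k) * a) := by
      rw [scalePS, aeval_monomial, monomial_eq (s := e) (a := _ * a), C_mul, algebraMap_eq, Finsupp.prod, Finsupp.prod,
        Finsupp.prod, map_prod]
      simp only [mul_pow, Finset.prod_mul_distrib, C_pow]
      ring
    rw [this, coeff_monomial, coeff_monomial]
    split_ifs with h
    · rw [h]
    · rw [mul_zero]
  | add p q hp hq => rw [map_add, coeff_add, coeff_add, hp, hq, mul_add]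

theorem coeff_zero_genSeries (β : ℕ+ → K) : PowerSeries.coeff 0 (genSeries β) = 1 := by
  rw [PowerSeries.coeff_zero_eq_constantCoeff_apply, genSeries, constantCoeff_newtonExp]

theorem pderiv_prod {K : Type} [Field K] {ι : Type*} (m : ℕ+) (s : Finset ι) [DecidableEq ι] (f : ι → MvPolynomial ℕ+ K) :
    pderiv m (∏ i ∈ s, f i) = ∑ i ∈ s, pderiv m (f i) * ∏ j ∈ s.erase i, f j := by
  induction s using Finset.induction_on with
  | empty => simp
  | insert a s ha ih =>
    rw [Finset.prod_insert ha, Derivation.leibniz, ih, Finset.sum_insert ha, Finset.erase_insert ha,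
      smul_eq_mul, smul_eq_mul, Finset.mul_sum, add_comm, mul_comm]
    congr 1
    refine Finset.sum_congr rfl fun i hi => ?_
    have hne : a ≠ i := fun e => ha (e ▸ hi)
    rw [Finset.erase_insert_of_ne hne, Finset.prod_insert fun h => ha (Finset.mem_of_mem_erase h)]
    ring

theorem C_mul_pderiv_genSeries {o β γ : ℕ+ → K} (hγ : ∀ n : ℕ+, o n * β n = ((n : ℕ) : K) * γ n)
    (m : ℕ+) (k : ℕ) : C (o m) * pderiv m (PowerSeries.coeff k (genSeries β)) =
      if (m : ℕ) ≤ k then C (γ m) * PowerSeries.coeff (k - m) (genSeries β) else 0 := by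
  have : CharZero K := algebraRat.charZero K
  have hm : (C ((m : ℕ) : K) : MvPolynomial ℕ+ K) ≠ 0 := by
    rw [Ne, C_eq_zero]; exact_mod_cast m.ne_zero
  apply mul_left_cancel₀ hm
  rw [mul_left_comm, pderiv_genSeries]
  split_ifs
  · rw [← mul_assoc, ← mul_assoc, ← C_mul, ← C_mul, hγ]
  · rw [mul_zero, mul_zero]

/-- Products of coefficients of the generating function are dual to the monomial functions, up to
the rescaling `γ`. For the induction, `p_m` acts on the left factor as `o_m ∂/∂p_m`, which lowers
one index by `m`; this is the recursion of `coeff_powerSum_mul`. -/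
theorem form_genProd {o β γ : ℕ+ → K} (hγ : ∀ n : ℕ+, o n * β n = ((n : ℕ) : K) * γ n)
    (F : MvPolynomial ℕ+ K) (d : ℕ →₀ ℕ) :
    form o (genProd β d) F = MvPowerSeries.coeff d (ofPowerSums K (scalePS γ F)) := by
  classical
  induction F using MvPolynomial.induction_on generalizing d with
  | C a =>
    have h1 : ofPowerSums K (scalePS γ (C a)) = MvPowerSeries.C a := by
      rw [scalePS, aeval_C, algebraMap_eq, ofPowerSums, aeval_C]; rfl
    rw [form_C_right, h1, MvPowerSeries.coeff_C, genProd, Finsupp.prod, map_prod]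
    simp only [constantCoeff_genSeries]
    split_ifs with h
    · simp [h]
    · obtain ⟨i, hi⟩ := Finsupp.support_nonempty_iff.mpr h
      rw [Finset.prod_eq_zero hi (if_neg (Finsupp.mem_support_iff.mp hi)), mul_zero]
  | add p q hp hq => simp only [form_add_right, map_add, hp, hq]
  | mul_X p m hp =>
    have h1 : ofPowerSums K (scalePS γ (p * X m)) =
        γ m • (powerSum K m * ofPowerSums K (scalePS γ p)) := by
      rw [map_mul, map_mul, mul_comm, ← smul_mul_assoc]
      congr 1
      rw [scalePS, aeval_X, ← smul_eq_C_mul, map_smul]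
      simp [ofPowerSums]
    rw [h1, map_smul, coeff_powerSum_mul, smul_eq_mul, Finset.mul_sum, form_comm, mul_comm p,
      form_X_mul_left, genProd, Finsupp.prod, pderiv_prod, Finset.mul_sum, ← formL_apply, map_sum]
    refine Finset.sum_congr rfl fun i hi => ?_
    rw [← mul_assoc, C_mul_pderiv_genSeries hγ]
    split_ifs with h
    · rw [← hp, mul_assoc, ← smul_eq_C_mul, map_smul, formL_apply, form_comm, smul_eq_mul]
      congr 2
      have hs : (d - Finsupp.single i (m : ℕ)).support ⊆ d.support := Finsupp.support_mono tsub_le_self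
      rw [genProd, Finsupp.prod_of_support_subset _ hs _ fun _ _ => coeff_zero_genSeries β,
        ← Finset.mul_prod_erase _ _ hi]
      congr 1
      · rw [Finsupp.tsub_apply, Finsupp.single_eq_same]
      · refine Finset.prod_congr rfl fun j hj => ?_
        rw [Finsupp.tsub_apply, Finsupp.single_eq_of_ne (Finset.ne_of_mem_erase hj), tsub_zero]
    · rw [zero_mul, map_zero, mul_zero]

/-! ### Elementary symmetric functions -/

/-- The signs `(-1)^(n-1)`. -/
def altSign (n : ℕ+) : K := -(-1) ^ (n : ℕ)

/-- In `n` variables the generating function is `∏ (1 + x_j u)`, so its coefficients are the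
elementary symmetric functions. -/
theorem toFin_coeff_genSeries_altSign (n k : ℕ) :
    toFin n (PowerSeries.coeff k (genSeries (altSign : ℕ+ → K))) =
      ∑ S ∈ Finset.univ.powerset.filter (fun S : Finset (Fin n) => S.card = k), ∏ j ∈ S, X j := by
  classical
  have h1 : PowerSeries.map ((toFin n : MvPolynomial ℕ+ K →ₐ[K] MvPolynomial (Fin n) K) : MvPolynomial ℕ+ K →+* MvPolynomial (Fin n) K) (logSeries altSign) =
      ∑ j : Fin n, PowerSeries.mk fun m => -(-X j) ^ (m + 1) := by
    ext m : 1
    rw [PowerSeries.coeff_map, logSeries, PowerSeries.coeff_mk, map_sum]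
    simp only [PowerSeries.coeff_mk, RingHom.coe_coe]
    rw [map_mul, toFin, psEval_X, ← algebraMap_eq, AlgHom.commutes, algebraMap_eq, Finset.mul_sum]
    refine Finset.sum_congr rfl fun j _ => ?_
    rw [altSign, Nat.succPNat_coe, neg_pow (X j : MvPolynomial (Fin n) K), C_neg, C_pow, C_neg, C_1, neg_mul, Nat.succ_eq_add_one]
  have h2 := map_newtonExp ((toFin n : MvPolynomial ℕ+ K →ₐ[K] MvPolynomial (Fin n) K) : MvPolynomial ℕ+ K →+* MvPolynomial (Fin n) K) (logSeries altSign)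
  rw [h1, newtonExp_sum] at h2
  simp only [newtonExp_neg_geom] at h2
  have h3 : ∀ j : Fin n, (1 - PowerSeries.C (-X j) * PowerSeries.X : PowerSeries (MvPolynomial (Fin n) K)) =
      1 + PowerSeries.C (X j) * PowerSeries.X := fun j => by rw [map_neg]; ring
  simp only [h3, Finset.prod_one_add] at h2
  have h4 := congrArg (PowerSeries.coeff k) h2
  rw [PowerSeries.coeff_map, map_sum] at h4
  refine Eq.trans h4 ?_
  rw [Finset.sum_filter]
  refine Finset.sum_congr rfl fun S _ => ?_
  rw [Finset.prod_mul_distrib, Finset.prod_const, ← map_prod, PowerSeries.coeff_C_mul,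
    PowerSeries.coeff_X_pow]
  simp only [eq_comm, mul_ite, mul_one, mul_zero]

/-- The exponent of `x_0 ⋯ x_{k-1}`. -/
def firstOnes (n k : ℕ) : Fin n →₀ ℕ :=
  Finsupp.equivFunOnFinite.symm fun i => if (i : ℕ) < k then 1 else 0

theorem coeff_toFin_coeff_genSeries_altSign (n k : ℕ) (d : Fin n →₀ ℕ) :
    coeff d (toFin n (PowerSeries.coeff k (genSeries (altSign : ℕ+ → K)))) =
      if (∀ i, d i ≤ 1) ∧ ∑ i, d i = k then 1 else 0 := by
  classical
  rw [toFin_coeff_genSeries_altSign, coeff_sum]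
  have h0 : ∀ S : Finset (Fin n), coeff d (∏ j ∈ S, X j : MvPolynomial (Fin n) K) =
      if (∀ i, d i ≤ 1) ∧ S = d.support then 1 else 0 := by
    intro S
    have : (∏ j ∈ S, X j : MvPolynomial (Fin n) K) = monomial (∑ j ∈ S, Finsupp.single j 1) 1 := by
      rw [monomial_sum_one]
      rfl
    rw [this, coeff_monomial]
    refine if_congr ⟨fun h => ?_, fun h => ?_⟩ rfl rfl
    · have hd : ∀ i, d i = if i ∈ S then 1 else 0 := fun i => by
        rw [← h, Finsupp.finsetSum_apply]
        simp [Finsupp.single_apply]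
      refine ⟨fun i => by rw [hd]; split_ifs <;> simp, ?_⟩
      ext i
      rw [Finsupp.mem_support_iff, hd]
      simp
    · ext i
      rw [Finsupp.finsetSum_apply]
      simp only [Finsupp.single_apply, Finset.sum_ite_eq', h.2, Finsupp.mem_support_iff]
      have := h.1 i
      split_ifs with h2
      · omega
      · omega
  simp only [h0]
  have hcard : (∀ i, d i ≤ 1) → ∑ i, d i = d.support.card := by
    intro h
    rw [Finset.card_eq_sum_ones, ← Finset.sum_subset (Finset.subset_univ d.support)]
    · refine Finset.sum_congr rfl fun i hi => ?_
      have := h i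
      have := Finsupp.mem_support_iff.mp hi
      omega
    · intro i _ hi
      exact Finsupp.notMem_support_iff.mp hi
  by_cases h : ∀ i, d i ≤ 1
  · simp only [h, implies_true, true_and, hcard h]
    rw [Finset.sum_ite_eq' _ d.support]
    simp
  · simp [h]

theorem natDegree_grade_elementary_le (n k l : ℕ) :
    (grade (fun i : Fin n => if (i : ℕ) < l then 1 else 0)
      (toFin n (PowerSeries.coeff k (genSeries (altSign : ℕ+ → K))))).natDegree ≤ min l k := by
  refine natDegree_grade_le _ fun d hd => ?_
  rw [coeff_toFin_coeff_genSeries_altSign] at hd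
  have h : (∀ i, d i ≤ 1) ∧ ∑ i, d i = k := by
    by_contra h
    exact hd (if_neg h)
  refine le_min ?_ ?_
  · calc ∑ i, d i * (if (i : ℕ) < l then 1 else 0)
        ≤ ∑ i : Fin n, if (i : ℕ) < l then 1 else 0 := Finset.sum_le_sum fun i _ => by
          have := h.1 i
          split_ifs <;> omega
      _ = ∑ i ∈ Finset.range n, if i < l then 1 else 0 :=
          Fin.sum_univ_eq_sum_range (fun i => if i < l then 1 else 0) n
      _ ≤ l := by
          rw [Finset.sum_boole, Nat.cast_id]
          refine (Finset.card_le_card fun i hi => ?_).trans (Finset.card_range l).le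
          exact Finset.mem_range.mpr (Finset.mem_filter.mp hi).2
  · rw [← h.2]
    exact Finset.sum_le_sum fun i _ => by split_ifs <;> omega

theorem sum_firstOnes {n k : ℕ} (hk : k ≤ n) (l : ℕ) :
    ∑ i, firstOnes n k i * (if (i : ℕ) < l then 1 else 0) = min l k := by
  have : ∀ i : Fin n, firstOnes n k i * (if (i : ℕ) < l then 1 else 0) =
      if (i : ℕ) < min l k then 1 else 0 := by
    intro i
    change (if (i : ℕ) < k then 1 else 0) * (if (i : ℕ) < l then 1 else 0) = _
    split_ifs <;> omega
  simp only [this]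
  rw [Fin.sum_univ_eq_sum_range (fun i => if i < min l k then 1 else 0) n, Finset.sum_boole,
    Nat.cast_id]
  have : (Finset.range n).filter (fun i => i < min l k) = Finset.range (min l k) := by
    ext i
    simp only [Finset.mem_filter, Finset.mem_range]
    omega
  rw [this, Finset.card_range]

theorem degree_elementary_le {n k : ℕ} (hk : k ≤ n) :
    (lexOrder n).toSyn ((lexOrder n).degree
      (toFin n (PowerSeries.coeff k (genSeries (altSign : ℕ+ → K))))) ≤
      (lexOrder n).toSyn (firstOnes n k) := by
  refine MonomialOrder.degree_le_iff.mpr fun d hd => lex_le_of_sum_le fun l _ => ?_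
  rw [sum_firstOnes hk]
  exact (le_natDegree_grade _ (mem_support_iff.mp hd)).trans (natDegree_grade_elementary_le n k l)

theorem coeff_firstOnes {n k : ℕ} (hk : k ≤ n) :
    coeff (firstOnes n k) (toFin n (PowerSeries.coeff k (genSeries (altSign : ℕ+ → K)))) = 1 := by
  rw [coeff_toFin_coeff_genSeries_altSign, if_pos]
  refine ⟨fun i => ?_, ?_⟩
  · change (if (i : ℕ) < k then 1 else 0) ≤ 1
    split_ifs <;> omega
  · have := sum_firstOnes hk n
    rw [min_eq_right hk] at this
    refine Eq.trans (Finset.sum_congr rfl fun i _ => ?_) this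
    rw [if_pos i.2, mul_one]

theorem isHomog_genProd (β : ℕ+ → K) (nu : YoungDiagram) : IsHomog (genProd β (expo nu)) nu.card := by
  have h := IsWeightedHomogeneous.prod (w := fun n : ℕ+ => (n : ℕ)) (expo nu).support
    (fun i => PowerSeries.coeff (expo nu i) (genSeries β)) (fun i => expo nu i)
    fun i _ => isHomog_genSeries β _
  have e : ∑ i ∈ (expo nu).support, expo nu i = nu.card := by
    rw [← sum_rowLen_range (le_refl (nu.colLen 0))]
    refine Finset.sum_subset_zero_on_sdiff (fun i hi => ?_) (fun i hi => ?_) fun i _ => expo_apply nu i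
    · rw [Finsupp.mem_support_iff, expo_apply] at hi
      exact Finset.mem_range.mpr ((rowLen_ne_zero_iff nu i).mp hi)
    · rw [Finset.mem_sdiff, Finsupp.notMem_support_iff, expo_apply] at hi
      exact hi.2
  rwa [e] at h

/-- The product in question is `e_nu`. The degree of `e_{nu_i}` in the first `k` variables is at
most `min k nu_i`, and these minima add up to the `k`-th partial sum of the conjugate partition. -/
theorem dominates_of_coeffAt_genProd {nu mu : YoungDiagram}
    (h : coeffAt mu (genProd (altSign : ℕ+ → K) (expo nu)) ≠ 0) : Dominates nu.transpose mu := by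
  have hc := card_transpose nu
  refine dominates_of_natDegree_grade_le (by rw [hc]; exact isHomog_genProd _ nu) (fun k _ => ?_) h
  set n := nu.transpose.card
  rw [genProd, Finsupp.prod, map_prod, map_prod, sum_rowLen_eq_sum_min nu.transpose k n le_rfl]
  refine (Polynomial.natDegree_prod_le _ _).trans ?_
  refine (Finset.sum_le_sum (g := fun j => min k (nu.transpose.colLen j)) fun i _ => ?_).trans
    (Finset.sum_le_sum_of_subset fun i hi => ?_)
  · rw [YoungDiagram.colLen_transpose, ← expo_apply]
    exact natDegree_grade_elementary_le n _ k
  · rw [Finsupp.mem_support_iff, expo_apply] at hi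
    have := (rowLen_ne_zero_iff nu i).mp hi
    have := colLen_le_card nu
    exact Finset.mem_range.mpr (by omega)

/-- The leading exponent of `e_{nu_i}` consists of `nu_i` ones and has coefficient one; together
these exponents form the conjugate of `nu`. -/
theorem coeffAt_transpose_genProd (nu : YoungDiagram) :
    coeffAt nu.transpose (genProd (altSign : ℕ+ → K) (expo nu)) = 1 := by
  classical
  set n := nu.card with hn
  have hcol : nu.transpose.colLen 0 ≤ n := by
    rw [YoungDiagram.colLen_transpose]; exact rowLen_le_card nu 0
  rw [← coeff_expoFin_toFin hcol, genProd, Finsupp.prod, map_prod]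
  have key : ∀ S : Finset ℕ,
      (lexOrder n).toSyn ((lexOrder n).degree (∏ i ∈ S,
        toFin n (PowerSeries.coeff (expo nu i) (genSeries (altSign : ℕ+ → K))))) ≤
        (lexOrder n).toSyn (∑ i ∈ S, firstOnes n (expo nu i)) ∧
      coeff (∑ i ∈ S, firstOnes n (expo nu i)) (∏ i ∈ S,
        toFin n (PowerSeries.coeff (expo nu i) (genSeries (altSign : ℕ+ → K)))) = 1 := by
    intro S
    induction S using Finset.induction_on with
    | empty => simp
    | insert i S hi ih =>
      have hk : expo nu i ≤ n := by rw [expo_apply]; exact rowLen_le_card nu i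
      rw [Finset.prod_insert hi, Finset.sum_insert hi]
      refine ⟨MonomialOrder.degree_mul_le.trans ?_, ?_⟩
      · rw [map_add, map_add]
        exact add_le_add (degree_elementary_le hk) ih.1
      · rw [MonomialOrder.coeff_mul_of_add_of_degree_le (m := lexOrder n) (degree_elementary_le hk) ih.1,
          coeff_firstOnes hk, ih.2, one_mul]
  have he : expoFin n nu.transpose = ∑ i ∈ (expo nu).support, firstOnes n (expo nu i) := by
    ext j
    rw [Finsupp.finsetSum_apply, expoFin_apply]
    change _ = ∑ i ∈ (expo nu).support, if (j : ℕ) < expo nu i then 1 else 0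
    rw [YoungDiagram.rowLen_transpose, Finset.sum_boole, Nat.cast_id,
      ← Finset.card_range (nu.colLen j)]
    congr 1
    ext i
    rw [Finset.mem_range, Finset.mem_filter, Finsupp.mem_support_iff, expo_apply, lt_rowLen_iff]
    refine ⟨fun h => ⟨fun h0 => ?_, h⟩, fun h => h.2⟩
    have := (lt_rowLen_iff nu i j).mpr h
    omega
  rw [he]
  exact (key _).2

end Products

/-! ### The reproducing kernel -/

section Reproducing

open MvPolynomial

variable {K : Type} [Field K]

/-- Setting the letters to zero after the shift replaces `p_n` by `γ_n u^n`, which turns a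
homogeneous `F` of degree `N` into `F(γ) u^N`. -/
theorem constantCoeff_coeff_shift (γ : ℕ+ → K) {F : MvPolynomial ℕ+ K} {N : ℕ} (hF : IsHomog F N)
    (k : ℕ) : constantCoeff ((shift γ F).coeff k) = if k = N then aeval γ F else 0 := by
  classical
  have hmon : ∀ (d : ℕ+ →₀ ℕ) (a : K), constantCoeff ((shift γ (monomial d a)).coeff k) =
      if k = Finsupp.weight (fun n : ℕ+ => (n : ℕ)) d then aeval γ (monomial d a) else 0 := by
    intro d a
    have h1 : Polynomial.map constantCoeff (shift γ (monomial d a)) =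
        Polynomial.C (aeval γ (monomial d a)) *
          Polynomial.X ^ (Finsupp.weight (fun n : ℕ+ => (n : ℕ)) d) := by
      rw [shift, aeval_monomial, aeval_monomial, Finsupp.weight_apply, Finsupp.prod, Finsupp.prod,
        Finsupp.sum, Polynomial.map_mul, Polynomial.map_prod, ← Finset.prod_pow_eq_pow_sum, map_mul,
        map_prod, mul_assoc, ← Finset.prod_mul_distrib]
      congr 1
      · simp [Polynomial.algebraMap_apply]
      · refine Finset.prod_congr rfl fun n _ => ?_
        rw [Polynomial.map_pow, Polynomial.map_add, Polynomial.map_mul, Polynomial.map_pow,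
          Polynomial.map_C, Polynomial.map_C, Polynomial.map_X, constantCoeff_X, constantCoeff_C,
          Polynomial.C_0, zero_add, mul_pow, ← pow_mul, map_pow, smul_eq_mul, mul_comm (n : ℕ)]
    rw [← Polynomial.coeff_map, h1, Polynomial.coeff_C_mul, Polynomial.coeff_X_pow]
    split_ifs <;> simp
  rw [F.as_sum, map_sum, Polynomial.finsetSum_coeff, map_sum, map_sum]
  rw [Finset.sum_congr rfl fun d _ => hmon d _]
  have : ∀ d ∈ F.support, Finsupp.weight (fun n : ℕ+ => (n : ℕ)) d = N := fun d hd =>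
    hF (mem_support_iff.mp hd)
  rw [Finset.sum_congr rfl fun d hd => by rw [this d hd]]
  split_ifs <;> simp

variable [Algebra ℚ K]

/-- The coefficient of degree `k` of the Cauchy kernel, as a symmetric function of one set of the
variables. -/
def cauchyCoeff (σ : ℕ+ → K) {n : ℕ} (x : Fin n → K) (k : ℕ) : MvPolynomial ℕ+ K :=
  PowerSeries.coeff k (genSeries fun m => σ m * ∑ i, x i ^ (m : ℕ))

/-- Multiplication by the kernel is adjoint to the shift of `p_n` by `p_n(x) u^n`. Pairing with `1`
afterwards leaves the value of `F` at `x`, the reproducing property. -/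
theorem form_cauchyCoeff {o σ : ℕ+ → K} (hσ : ∀ m : ℕ+, o m * σ m = ((m : ℕ) : K)) {n : ℕ}
    (x : Fin n → K) {F : MvPolynomial ℕ+ K} {N : ℕ} (hF : IsHomog F N) (k : ℕ) :
    form o F (cauchyCoeff σ x k) = if k = N then psEval x F else 0 := by
  have h := form_genSeries_mul o (fun m => σ m * ∑ i, x i ^ (m : ℕ)) (fun m => ∑ i, x i ^ (m : ℕ))
    (fun m => by rw [← mul_assoc, hσ]) 1 F k
  rw [mul_one, form_comm, ← C_1, form_comm o (C 1), form_C_right, one_mul,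
    constantCoeff_coeff_shift _ hF] at h
  exact h

end Reproducing

/-! ### Duality -/

section Duality

open MvPolynomial

variable {K : Type} [Field K]

theorem form_scalePS {o o' γ : ℕ+ → K} (h : ∀ n, o n * γ n ^ 2 = o' n) (F G : MvPolynomial ℕ+ K) :
    form o (scalePS γ F) (scalePS γ G) = form o' F G := by
  have hs : (scalePS γ F).support ⊆ F.support := fun d hd => by
    rw [mem_support_iff, coeff_scalePS] at hd
    exact mem_support_iff.mpr (right_ne_zero_of_mul hd)
  rw [form_eq_sum _ _ _ hs, form]
  refine Finset.sum_congr rfl fun d _ => ?_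
  rw [coeff_scalePS, coeff_scalePS]
  have : normFactor o' d = (d.prod fun n k => γ n ^ k) ^ 2 * normFactor o d := by
    rw [normFactor, normFactor, Finsupp.prod, Finsupp.prod, Finsupp.prod, ← Finset.prod_pow,
      ← Finset.prod_mul_distrib]
    refine Finset.prod_congr rfl fun n _ => ?_
    rw [← h]
    ring
  rw [this]
  ring

variable [Algebra ℚ K]

/-- Both `e_nu` and `F nu.transpose` are the monomial function of the conjugate partition plus lower
terms. -/
theorem genProd_sub_mem {o : ℕ+ → K} {F : YoungDiagram → MvPolynomial ℕ+ K} (h : IsOrthoFamily o F)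
    (nu : YoungDiagram) : genProd altSign (expo nu) - F nu.transpose ∈
      Submodule.span K (F '' lower nu.transpose) := by
  classical
  have h1 : genProd altSign (expo nu) - mHat K nu.transpose ∈
      Submodule.span K (mHat K '' lower nu.transpose) := by
    refine mem_span_mHat fun mu hmu => ?_
    rw [map_sub, coeffAt_mHat] at hmu
    by_cases he : mu = nu.transpose
    · rw [he, if_pos rfl, coeffAt_transpose_genProd, sub_self] at hmu
      exact absurd rfl hmu
    · rw [if_neg he, sub_zero] at hmu
      exact mem_lower.mpr ⟨dominates_of_coeffAt_genProd hmu, he⟩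
  have h2 := Submodule.sub_mem _ h1 (h.sub_mem nu.transpose)
  rw [sub_sub_sub_cancel_right] at h2
  refine Submodule.span_le.mpr ?_ h2
  rintro _ ⟨mu, hmu, rfl⟩
  exact mHat_mem_span h.sub_mem mu _ hmu fun k hk => mem_lower_trans hmu hk

theorem form_genProd_sub {o : ℕ+ → K} {F : YoungDiagram → MvPolynomial ℕ+ K} (h : IsOrthoFamily o F)
    (nu kap : YoungDiagram) (hk : kap ∉ lower nu.transpose) :
    form o (genProd altSign (expo nu)) (F kap) = form o (F nu.transpose) (F kap) := by
  have h1 : genProd altSign (expo nu) - F nu.transpose ∈ LinearMap.ker ((formL o).flip (F kap)) := by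
    refine Submodule.span_le.mpr ?_ (genProd_sub_mem h nu)
    rintro _ ⟨mu, hmu, rfl⟩
    exact h.ortho mu kap fun e => hk (e ▸ hmu)
  rw [LinearMap.mem_ker, map_sub, sub_eq_zero] at h1
  exact h1

/-- Duality for orthogonal triangular families. -/
theorem IsOrthoFamily.dual {o o' : ℕ+ → K} (hoo : ∀ n : ℕ+, o n * o' n = ((n : ℕ) : K) ^ 2)
    {F F' : YoungDiagram → MvPolynomial ℕ+ K} (h : IsOrthoFamily o F) (h' : IsOrthoFamily o' F')
    (lam : YoungDiagram) :
    F lam = (form o' (F' lam.transpose) (F' lam.transpose))⁻¹ •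
      scalePS (fun n => o' n * altSign n / ((n : ℕ) : K)) (F' lam.transpose) := by
  classical
  have hch : CharZero K := algebraRat.charZero K
  have hn : ∀ n : ℕ+, ((n : ℕ) : K) ≠ 0 := fun n => by exact_mod_cast n.ne_zero
  set γ : ℕ+ → K := fun n => o' n * altSign n / ((n : ℕ) : K) with hγ
  -- It suffices that the right-hand sides form a triangular orthogonal family for `o`; uniqueness
  -- then identifies it with `F`.
  refine (h.eq_of (G := fun lam => (form o' (F' lam.transpose) (F' lam.transpose))⁻¹ •
      scalePS γ (F' lam.transpose)) (fun lam => ?_) (fun lam mu hne => ?_) lam).symm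
  · have hco : ∀ nu, coeffAt nu ((form o' (F' lam.transpose) (F' lam.transpose))⁻¹ •
        scalePS γ (F' lam.transpose)) = (form o' (F' lam.transpose) (F' lam.transpose))⁻¹ *
          form o' (genProd altSign (expo nu)) (F' lam.transpose) := by
      intro nu
      rw [map_smul, smul_eq_mul, coeffAt_apply, ← form_genProd (β := altSign)]
      intro n
      rw [hγ]
      exact (mul_div_cancel₀ _ (hn n)).symm
    refine mem_span_mHat fun nu hnu => ?_
    rw [map_sub, hco, coeffAt_mHat] at hnu
    by_cases he : nu = lam
    · rw [he, if_pos rfl, form_genProd_sub h' lam _ (notMem_lower_self _),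
        inv_mul_cancel₀ (h'.norm_ne_zero _), sub_self] at hnu
      exact absurd rfl hnu
    · rw [if_neg he, sub_zero] at hnu
      refine mem_lower.mpr ⟨?_, he⟩
      by_contra hd
      refine right_ne_zero_of_mul hnu ?_
      rw [form_genProd_sub h' nu]
      · refine h'.ortho _ _ fun e => he ?_
        rw [← nu.transpose_transpose, e, lam.transpose_transpose]
      · intro hl
        have := (mem_lower.mp hl).1.transpose
        rw [nu.transpose_transpose, lam.transpose_transpose] at this
        exact hd this
  · have hs : ∀ n, o n * γ n ^ 2 = o' n := by
      intro n
      have e : o n * γ n ^ 2 = (o n * o' n) * o' n * (altSign n) ^ 2 / ((n : ℕ) : K) ^ 2 := by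
        rw [hγ]; ring
      have e2 : (altSign n : K) ^ 2 = 1 := by
        rw [altSign, neg_sq, ← pow_mul, mul_comm, pow_mul, neg_one_sq, one_pow]
      rw [e, hoo, e2]
      have := hn n
      field_simp
    rw [form_smul_left, form_smul_right, form_scalePS hs, h'.ortho lam.transpose mu.transpose fun e => hne ?_,
      mul_zero, mul_zero]
    rw [← lam.transpose_transpose, e, mu.transpose_transpose]

end Duality

/-! ### Duality for numerical parameters. -/

section Dual

open MvPolynomial

variable {O K : Type} [CommRing O] [Algebra ℚ O] [Field K] [Algebra ℚ K] {a b : ℝ}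

theorem coeff_macC_dual (S : ParamRing O K a b) (ha0 : 0 < a) (ha1 : a < 1) (hb0 : 0 < b)
    (hb1 : b < 1) (lam : YoungDiagram) (d : ℕ+ →₀ ℕ) :
    coeff d (macC a b lam) =
      (form (oscCoeff (b : ℂ) a) (macC b a lam.transpose) (macC b a lam.transpose))⁻¹ *
        ((d.prod fun n k => (oscCoeff (b : ℂ) a n * altSign n / ((n : ℕ) : ℂ)) ^ k) *
          coeff d (macC b a lam.transpose)) := by
  have h := (S.isOrthoFamily_macC ha0 ha1 hb0 hb1).dual (fun n => ?_)
    (S.swap.isOrthoFamily_macC hb0 hb1 ha0 ha1) lam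
  · nth_rewrite 1 [h]
    rw [coeff_smul, coeff_scalePS, smul_eq_mul]
  · have h1 : (1 : ℂ) - (a : ℂ) ^ (n : ℕ) ≠ 0 := by
      exact_mod_cast (one_sub_pow_pos ha0 ha1 n).ne'
    have h2 : (1 : ℂ) - (b : ℂ) ^ (n : ℕ) ≠ 0 := by
      exact_mod_cast (one_sub_pow_pos hb0 hb1 n).ne'
    rw [oscCoeff, oscCoeff]
    field_simp

end Dual

/-! ### Coefficients of the vertex operators -/

section Vertex

/-- The series `∑ c_n b_n`. -/
def linSeries (c : ℕ+ → ℂ) : MvPowerSeries ℕ+ ℂ :=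
  fun d => ∑ n ∈ d.support, if d = Finsupp.single n 1 then c n else 0

theorem coeff_linSeries_mul (c : ℕ+ → ℂ) (f : MvPowerSeries ℕ+ ℂ) (d : ℕ+ →₀ ℕ) :
    MvPowerSeries.coeff d (linSeries c * f) =
      ∑ n ∈ d.support, c n * MvPowerSeries.coeff (d - Finsupp.single n 1) f := by
  classical
  have hlin : ∀ e : ℕ+ →₀ ℕ, e ≤ d → MvPowerSeries.coeff e (linSeries c) =
      ∑ n ∈ d.support, if e = Finsupp.single n 1 then c n else 0 := by
    intro e he
    refine Finset.sum_subset (Finsupp.support_mono he) fun n _ hn => if_neg fun h => hn ?_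
    rw [h]; simp
  rw [MvPowerSeries.coeff_mul]
  calc _ = ∑ p ∈ Finset.HasAntidiagonal.antidiagonal d, ∑ n ∈ d.support,
        (if p.1 = Finsupp.single n 1 then c n else 0) * MvPowerSeries.coeff p.2 f := by
        refine Finset.sum_congr rfl fun p hp => ?_
        rw [hlin p.1 (Finset.HasAntidiagonal.mem_antidiagonal.mp hp ▸ le_self_add), Finset.sum_mul]
    _ = ∑ n ∈ d.support, ∑ p ∈ Finset.HasAntidiagonal.antidiagonal d,
        (if p.1 = Finsupp.single n 1 then c n else 0) * MvPowerSeries.coeff p.2 f :=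
        Finset.sum_comm
    _ = _ := by
        refine Finset.sum_congr rfl fun n hn => ?_
        have hle : Finsupp.single n 1 ≤ d := by
          rw [Finsupp.single_le_iff]
          exact Nat.one_le_iff_ne_zero.mpr (Finsupp.mem_support_iff.mp hn)
        rw [Finset.sum_eq_single (Finsupp.single n 1, d - Finsupp.single n 1)]
        · simp
        · rintro ⟨p1, p2⟩ hp hne
          rw [if_neg, zero_mul]
          intro h
          apply hne
          have h3 := Finset.HasAntidiagonal.mem_antidiagonal.mp hp
          simp only at h h3
          rw [Prod.mk.injEq, ← h3, h]
          simp
        · intro h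
          exact absurd (Finset.HasAntidiagonal.mem_antidiagonal.mpr (add_tsub_cancel_of_le hle)) h

/-- The coefficients of the exponential of a linear series. -/
def expCoeff (c : ℕ+ → ℂ) (d : ℕ+ →₀ ℕ) : ℂ := d.prod fun n k => c n ^ k / (k.factorial : ℂ)

theorem expCoeff_eq (c : ℕ+ → ℂ) {d : ℕ+ →₀ ℕ} {n : ℕ+} (hn : n ∈ d.support) :
    (d n : ℂ) * expCoeff c d = c n * expCoeff c (d - Finsupp.single n 1) := by
  classical
  have hs : (d - Finsupp.single n 1).support ⊆ d.support := Finsupp.support_mono tsub_le_self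
  rw [expCoeff, expCoeff, Finsupp.prod_of_support_subset _ hs _ fun _ _ => by simp, Finsupp.prod,
    ← Finset.mul_prod_erase _ _ hn, ← Finset.mul_prod_erase d.support (fun i => c i ^ (d - Finsupp.single n 1 : ℕ+ →₀ ℕ) i /
      ((((d - Finsupp.single n 1 : ℕ+ →₀ ℕ) i).factorial : ℕ) : ℂ)) hn]
  have : ∏ j ∈ d.support.erase n, c j ^ (d - Finsupp.single n 1 : ℕ+ →₀ ℕ) j /
      ((((d - Finsupp.single n 1 : ℕ+ →₀ ℕ) j).factorial : ℕ) : ℂ) =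
      ∏ j ∈ d.support.erase n, c j ^ d j / (((d j).factorial : ℕ) : ℂ) := by
    refine Finset.prod_congr rfl fun j hj => ?_
    rw [Finsupp.tsub_apply, Finsupp.single_eq_of_ne (Finset.ne_of_mem_erase hj), tsub_zero]
  rw [this, Finsupp.tsub_apply, Finsupp.single_eq_same]
  obtain ⟨k, hk⟩ := Nat.exists_eq_succ_of_ne_zero (Finsupp.mem_support_iff.mp hn)
  rw [hk, Nat.succ_sub_one, Nat.factorial_succ, pow_succ]
  have h1 : ((k + 1 : ℕ) : ℂ) ≠ 0 := by exact_mod_cast Nat.succ_ne_zero k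
  have h2 : ((k.factorial : ℕ) : ℂ) ≠ 0 := by exact_mod_cast Nat.factorial_ne_zero k
  push_cast at h1 ⊢
  field_simp

/-- The multinomial theorem, by induction from `expCoeff_eq` and `∑ d n = k + 1`. -/
theorem coeff_linSeries_pow (c : ℕ+ → ℂ) (k : ℕ) (d : ℕ+ →₀ ℕ) :
    MvPowerSeries.coeff d (linSeries c ^ k) =
      if d.degree = k then (k.factorial : ℂ) * expCoeff c d else 0 := by
  classical
  induction k generalizing d with
  | zero =>
    rw [pow_zero, MvPowerSeries.coeff_one]
    by_cases h : d = 0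
    · simp [h, expCoeff]
    · rw [if_neg h, if_neg fun h' => h ((Finsupp.degree_eq_zero_iff d).mp h')]
  | succ k ih =>
    rw [pow_succ', coeff_linSeries_mul]
    simp only [ih]
    have hdeg : ∀ n ∈ d.support, ((d - Finsupp.single n 1).degree = k ↔ d.degree = k + 1) := by
      intro n hn
      have hle : Finsupp.single n 1 ≤ d := by
        rw [Finsupp.single_le_iff]
        exact Nat.one_le_iff_ne_zero.mpr (Finsupp.mem_support_iff.mp hn)
      have : d.degree = (d - Finsupp.single n 1).degree + 1 := by
        conv_lhs => rw [← tsub_add_cancel_of_le hle]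
        rw [map_add, Finsupp.degree_single]
      omega
    rw [Finset.sum_congr rfl fun n hn => by rw [if_congr (hdeg n hn) rfl rfl]]
    split_ifs with h
    · have : ∀ n ∈ d.support, c n * ((k.factorial : ℂ) * expCoeff c (d - Finsupp.single n 1)) =
          (d n : ℂ) * ((k.factorial : ℂ) * expCoeff c d) := fun n hn => by
        rw [mul_left_comm, ← expCoeff_eq c hn]; ring
      rw [Finset.sum_congr rfl this, ← Finset.sum_mul]
      have h2 : ∑ n ∈ d.support, (d n : ℂ) = ((k + 1 : ℕ) : ℂ) := by
        rw [← h, Finsupp.degree_apply]; push_cast; rfl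
      rw [h2, Nat.factorial_succ]
      push_cast
      ring
    · simp

theorem coeff_expLinear (c : ℕ+ → ℂ) (d : ℕ+ →₀ ℕ) :
    MvPowerSeries.coeff d (expLinear c) = expCoeff c d := by
  have h0 : expLinear c = (PowerSeries.exp ℂ).subst (linSeries c) := rfl
  have hs : PowerSeries.HasSubst (linSeries c) := by
    refine PowerSeries.HasSubst.of_constantCoeff_zero ?_
    rw [← MvPowerSeries.coeff_zero_eq_constantCoeff_apply]
    change ∑ n ∈ (0 : ℕ+ →₀ ℕ).support, (if (0 : ℕ+ →₀ ℕ) = Finsupp.single n 1 then c n else 0) = 0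
    rw [Finsupp.support_zero, Finset.sum_empty]
  rw [h0, PowerSeries.coeff_subst hs, finsum_eq_single _ d.degree]
  · rw [coeff_linSeries_pow, if_pos rfl, PowerSeries.coeff_exp, smul_eq_mul, ← mul_assoc]
    have : ((d.degree.factorial : ℕ) : ℂ) ≠ 0 := by exact_mod_cast Nat.factorial_ne_zero _
    simp [this]
  · intro k hk
    rw [coeff_linSeries_pow, if_neg (Ne.symm hk), smul_zero]

theorem coeff_linSeries_single_mul (n : ℕ+) (f : MvPowerSeries ℕ+ ℂ) (d : ℕ+ →₀ ℕ) :
    MvPowerSeries.coeff d (linSeries (fun m => if m = n then 1 else 0) * f) =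
      if n ∈ d.support then MvPowerSeries.coeff (d - Finsupp.single n 1) f else 0 := by
  rw [coeff_linSeries_mul]
  simp only [ite_mul, one_mul, zero_mul]
  rw [Finset.sum_ite_eq' d.support n]

theorem mul_coeff_of_expCoeff {f : MvPowerSeries ℕ+ ℂ} {c : ℕ+ → ℂ}
    (hf : ∀ d, MvPowerSeries.coeff d f = expCoeff c d) (n : ℕ+) (d : ℕ+ →₀ ℕ) :
    (d n : ℂ) * MvPowerSeries.coeff d f =
      MvPowerSeries.coeff d (c n • (linSeries (fun m => if m = n then 1 else 0) * f)) := by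
  rw [MvPowerSeries.coeff_smul, coeff_linSeries_single_mul]
  split_ifs with h
  · rw [hf, hf, expCoeff_eq c h]
  · rw [Finsupp.notMem_support_iff.mp h]; simp

/-- Multiplying the coefficient at `d` by `d n` is a derivation of the ring of series (the Euler
operator of one letter). Hence the product satisfies the recursion of `expCoeff_eq` for the sum of
the two families, and the recursion determines it. -/
theorem coeff_mul_of_expCoeff {f g : MvPowerSeries ℕ+ ℂ} {b c : ℕ+ → ℂ}
    (hf : ∀ d, MvPowerSeries.coeff d f = expCoeff b d)
    (hg : ∀ d, MvPowerSeries.coeff d g = expCoeff c d) (d : ℕ+ →₀ ℕ) :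
    MvPowerSeries.coeff d (f * g) = expCoeff (fun n => b n + c n) d := by
  classical
  have hrec : ∀ (n : ℕ+) (d : ℕ+ →₀ ℕ), n ∈ d.support → (d n : ℂ) * MvPowerSeries.coeff d (f * g) =
      (b n + c n) * MvPowerSeries.coeff (d - Finsupp.single n 1) (f * g) := by
    intro n d hn
    set L := linSeries fun m => if m = n then 1 else 0
    have h1 : (d n : ℂ) * MvPowerSeries.coeff d (f * g) =
        MvPowerSeries.coeff d ((b n • (L * f)) * g) + MvPowerSeries.coeff d (f * (c n • (L * g))) := by
      rw [MvPowerSeries.coeff_mul, MvPowerSeries.coeff_mul, MvPowerSeries.coeff_mul, Finset.mul_sum,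
        ← Finset.sum_add_distrib]
      refine Finset.sum_congr rfl fun p hp => ?_
      rw [← mul_coeff_of_expCoeff hf, ← mul_coeff_of_expCoeff hg,
        ← Finset.HasAntidiagonal.mem_antidiagonal.mp hp, Finsupp.add_apply]
      push_cast
      ring
    have h2 := coeff_linSeries_single_mul n (f * g) d
    rw [if_pos hn] at h2
    rw [h1, ← h2, smul_mul_assoc, mul_smul_comm, MvPowerSeries.coeff_smul, MvPowerSeries.coeff_smul,
      mul_assoc, mul_left_comm f, add_mul]
  induction hN : d.degree generalizing d with
  | zero =>
    rw [Finsupp.degree_eq_zero_iff] at hN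
    have h0 : ∀ (h : MvPowerSeries ℕ+ ℂ) (c : ℕ+ → ℂ), (∀ d, MvPowerSeries.coeff d h = expCoeff c d) →
        MvPowerSeries.constantCoeff h = 1 := fun h c hh => by
      rw [← MvPowerSeries.coeff_zero_eq_constantCoeff_apply, hh]; simp [expCoeff]
    rw [hN, MvPowerSeries.coeff_zero_eq_constantCoeff_apply, map_mul, h0 f b hf, h0 g c hg]
    simp [expCoeff]
  | succ N ih =>
    have hne : d ≠ 0 := fun h => by simp [h] at hN
    obtain ⟨n, hn⟩ := Finsupp.support_nonempty_iff.mpr hne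
    have hdn : (d n : ℂ) ≠ 0 := by exact_mod_cast Finsupp.mem_support_iff.mp hn
    have hle : Finsupp.single n 1 ≤ d := by
      rw [Finsupp.single_le_iff]
      exact Nat.one_le_iff_ne_zero.mpr (Finsupp.mem_support_iff.mp hn)
    apply mul_left_cancel₀ hdn
    rw [hrec n d hn, expCoeff_eq _ hn, ih]
    have : d.degree = (d - Finsupp.single n 1).degree + 1 := by
      conv_lhs => rw [← tsub_add_cancel_of_le hle]
      rw [map_add, Finsupp.degree_single]
    omega

theorem coeff_prod_expLinear {ι : Type*} (s : Finset ι) (c : ι → ℕ+ → ℂ) (d : ℕ+ →₀ ℕ) :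
    MvPowerSeries.coeff d (∏ j ∈ s, expLinear (c j)) = expCoeff (fun n => ∑ j ∈ s, c j n) d := by
  classical
  induction s using Finset.induction_on generalizing d with
  | empty =>
    rw [Finset.prod_empty, MvPowerSeries.coeff_one]
    by_cases h : d = 0
    · simp [h, expCoeff]
    · rw [if_neg h]
      obtain ⟨n, hn⟩ := Finsupp.support_nonempty_iff.mpr h
      refine (Finset.prod_eq_zero hn ?_).symm
      simp [Finsupp.mem_support_iff.mp hn]
  | insert a s ha ih =>
    rw [Finset.prod_insert ha, coeff_mul_of_expCoeff (coeff_expLinear (c a)) ih]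
    simp only [Finset.sum_insert ha]

theorem psEval_monomial_one {n : ℕ} (x : Fin n → ℂ) (d : ℕ+ →₀ ℕ) :
    psEval x (MvPolynomial.monomial d (1 : ℂ)) = d.prod fun m k => (∑ j, x j ^ (m : ℕ)) ^ k := by
  rw [psEval, MvPolynomial.aeval_monomial, map_one, one_mul]

/-- The exponents add up to `∑ p_n(1/x) b_n / o_n` with `o_n = oscCoeff q t n`; the factorials of
the exponential series complete the powers of `o_n` to `z_d`. -/
theorem coeff_vertexPlus {q t : ℝ} (hq0 : 0 < q) (hq1 : q < 1) (ht0 : 0 < t) (ht1 : t < 1) {m : ℕ}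
    (x : Fin m → ℂ) (d : ℕ+ →₀ ℕ) : MvPowerSeries.coeff d (vertexPlus q t x) =
      (normFactor (oscCoeff (q : ℂ) t) d)⁻¹ *
        psEval (fun j => (x j)⁻¹) (MvPolynomial.monomial d (1 : ℂ)) := by
  rw [vertexPlus, coeff_prod_expLinear, psEval_monomial_one, expCoeff, normFactor, Finsupp.prod,
    Finsupp.prod, Finsupp.prod, ← Finset.prod_inv_distrib, ← Finset.prod_mul_distrib]
  refine Finset.prod_congr rfl fun n _ => ?_
  have h1 : (1 : ℂ) - (q : ℂ) ^ (n : ℕ) ≠ 0 := by exact_mod_cast (one_sub_pow_pos hq0 hq1 n).ne'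
  have h2 : (1 : ℂ) - (t : ℂ) ^ (n : ℕ) ≠ 0 := by exact_mod_cast (one_sub_pow_pos ht0 ht1 n).ne'
  have h3 : ((n : ℕ) : ℂ) ≠ 0 := by exact_mod_cast n.ne_zero
  rw [← Finset.mul_sum, mul_pow]
  have : (1 - (t : ℂ) ^ (n : ℕ)) / (1 - (q : ℂ) ^ (n : ℕ)) * (1 / ((n : ℕ) : ℂ)) =
      (oscCoeff (q : ℂ) t n)⁻¹ := by
    rw [oscCoeff]
    field_simp
  simp only [inv_pow] at this ⊢
  rw [this, mul_inv, inv_pow]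
  ring

theorem coeff_vertexMinus {m : ℕ} (x : Fin m → ℂ) (d : ℕ+ →₀ ℕ) :
    MvPowerSeries.coeff d (vertexMinus x) =
      (d.prod fun n k => (altSign n / ((n : ℕ) : ℂ)) ^ k / (k.factorial : ℂ)) *
        psEval (fun j => (x j)⁻¹) (MvPolynomial.monomial d (1 : ℂ)) := by
  rw [vertexMinus, coeff_prod_expLinear, psEval_monomial_one, expCoeff, Finsupp.prod,
    Finsupp.prod, Finsupp.prod, ← Finset.prod_mul_distrib]
  refine Finset.prod_congr rfl fun n _ => ?_
  have : ∀ j, -(1 / ((n : ℕ) : ℂ) * ((-x j) ^ (n : ℕ))⁻¹) =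
      altSign n / ((n : ℕ) : ℂ) * (x j)⁻¹ ^ (n : ℕ) := by
    intro j
    rw [neg_pow, mul_inv, altSign, ← inv_pow, ← inv_pow, inv_neg, inv_one]
    ring
  simp only [this]
  rw [← Finset.mul_sum, mul_pow]
  ring

end Vertex

/-! ### The infinite `q`-shifted factorial -/

theorem summable_norm_qPoch {q : ℝ} (hq0 : 0 < q) (hq1 : q < 1) (a : ℂ) :
    Summable fun k : ℕ => ‖-(a * (q : ℂ) ^ k)‖ := by
  have h : ∀ k : ℕ, ‖-(a * (q : ℂ) ^ k)‖ = ‖a‖ * q ^ k := fun k => by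
    simp [abs_of_pos hq0]
  simp only [h]
  exact (summable_geometric_of_lt_one hq0.le hq1).mul_left _

theorem differentiable_qPoch {q : ℝ} (hq0 : 0 < q) (hq1 : q < 1) :
    Differentiable ℂ fun a : ℂ => qPoch a q := by
  have h : HasProdLocallyUniformlyOn (fun (k : ℕ) (a : ℂ) => 1 - a * (q : ℂ) ^ k)
      (fun a => qPoch a q) Set.univ := by
    simp_rw [sub_eq_add_neg]
    unfold qPoch
    simp_rw [sub_eq_add_neg]
    apply hasProdLocallyUniformlyOn_of_forall_compact isOpen_univ
    intro K _ hcK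
    obtain ⟨M, hM⟩ := hcK.isBounded.exists_norm_le
    refine ((summable_geometric_of_lt_one hq0.le hq1).mul_left M).hasProdUniformlyOn_nat_one_add
      hcK (.of_forall fun n x hx ↦ ?_) (fun _ ↦ by fun_prop)
    rw [norm_neg, norm_mul, norm_pow, Complex.norm_real, Real.norm_of_nonneg hq0.le]
    exact mul_le_mul_of_nonneg_right (hM x hx) (by positivity)
  rw [← differentiableOn_univ]
  refine h.differentiableOn (.of_forall fun s ↦ ?_) isOpen_univ
  have hs : Differentiable ℂ fun a : ℂ => ∏ k ∈ s, (1 - a * (q : ℂ) ^ k) := by fun_prop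
  simpa [Finset.prod_fn] using hs.differentiableOn

theorem continuous_qPoch {q : ℝ} (hq0 : 0 < q) (hq1 : q < 1) :
    Continuous fun a : ℂ => qPoch a q :=
  (differentiable_qPoch hq0 hq1).continuous

theorem qPoch_zero (q : ℝ) : qPoch 0 q = 1 := by simp [qPoch]

theorem qPoch_ne_zero {q : ℝ} (hq0 : 0 < q) (hq1 : q < 1) {a : ℂ} (ha : ‖a‖ < 1) :
    qPoch a q ≠ 0 := by
  unfold qPoch
  simp_rw [sub_eq_add_neg]
  refine tprod_one_add_ne_zero_of_summable (fun k hk => ?_) (summable_norm_qPoch hq0 hq1 a)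
  have h : a * (q : ℂ) ^ k = 1 := by linear_combination -hk
  have h2 : ‖a * (q : ℂ) ^ k‖ < 1 := by
    rw [norm_mul, norm_pow, Complex.norm_real, Real.norm_of_nonneg hq0.le]
    calc ‖a‖ * q ^ k ≤ ‖a‖ * 1 :=
          mul_le_mul_of_nonneg_left (pow_le_one₀ hq0.le hq1.le) (norm_nonneg _)
      _ < 1 := by simpa using ha
  rw [h] at h2
  simp at h2

theorem qPoch_eq {q : ℝ} (hq0 : 0 < q) (hq1 : q < 1) (a : ℂ) :
    qPoch a q = (1 - a) * qPoch (q * a) q := by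
  have hm : ∀ b : ℂ, Multipliable fun k : ℕ => 1 - b * (q : ℂ) ^ k := fun b => by
    simp_rw [sub_eq_add_neg]
    exact multipliable_one_add_of_summable (summable_norm_qPoch hq0 hq1 b)
  have h : Multipliable fun k : ℕ => 1 - a * (q : ℂ) ^ (k + 1) := by
    refine (hm (q * a)).congr fun k => ?_
    rw [pow_succ]
    ring
  have h1 : qPoch a q = (1 - a * (q : ℂ) ^ 0) * ∏' k : ℕ, (1 - a * (q : ℂ) ^ (k + 1)) :=
    tprod_eq_zero_mul' h
  have h2 : qPoch (q * a) q = ∏' k : ℕ, (1 - a * (q : ℂ) ^ (k + 1)) :=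
    tprod_congr fun k => by rw [pow_succ]; ring
  rw [h1, h2, pow_zero, mul_one]

theorem conj_qPoch {q : ℝ} (hq0 : 0 < q) (hq1 : q < 1) (a : ℂ) :
    (starRingEnd ℂ) (qPoch a q) = qPoch ((starRingEnd ℂ) a) q := by
  have hm : Multipliable fun k : ℕ => 1 - a * (q : ℂ) ^ k := by
    simp_rw [sub_eq_add_neg]
    exact multipliable_one_add_of_summable (summable_norm_qPoch hq0 hq1 a)
  unfold qPoch
  rw [hm.map_tprod (starRingEnd ℂ) Complex.continuous_conj]
  simp

/-- `(z;q)_∞ / (tz;q)_∞`. -/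
def qRatio (q t : ℝ) (z : ℂ) : ℂ := qPoch z q / qPoch (t * z) q

theorem qPoch_mul_ne_zero {q t : ℝ} (hq0 : 0 < q) (hq1 : q < 1) (ht0 : 0 < t) {z : ℂ}
    (hz : t * ‖z‖ < 1) : qPoch (t * z) q ≠ 0 := by
  refine qPoch_ne_zero hq0 hq1 ?_
  rwa [norm_mul, Complex.norm_real, Real.norm_of_nonneg ht0.le]

theorem differentiableAt_qRatio {q t : ℝ} (hq0 : 0 < q) (hq1 : q < 1) (ht0 : 0 < t) {z : ℂ}
    (hz : t * ‖z‖ < 1) : DifferentiableAt ℂ (qRatio q t) z := by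
  have hd := differentiable_qPoch hq0 hq1
  have h2 : DifferentiableAt ℂ (fun z : ℂ => qPoch (t * z) q) z :=
    (hd (t * z)).comp z (by fun_prop : DifferentiableAt ℂ (fun z : ℂ => (t : ℂ) * z) z)
  exact (hd z).div h2 (qPoch_mul_ne_zero hq0 hq1 ht0 hz)

theorem conj_qRatio {q t : ℝ} (hq0 : 0 < q) (hq1 : q < 1) (z : ℂ) :
    (starRingEnd ℂ) (qRatio q t z) = qRatio q t ((starRingEnd ℂ) z) := by
  simp [qRatio, conj_qPoch hq0 hq1]

theorem qRatio_mul_eq {q t : ℝ} (hq0 : 0 < q) (hq1 : q < 1) (ht0 : 0 < t) {z : ℂ}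
    (hz : t * ‖z‖ < 1) : (1 - t * z) * qRatio q t z = (1 - z) * qRatio q t (q * z) := by
  have h1 := qPoch_mul_ne_zero hq0 hq1 ht0 hz
  have h2 : qPoch (t * z) q = (1 - t * z) * qPoch (t * (q * z)) q := by
    rw [qPoch_eq hq0 hq1 (t * z)]
    ring_nf
  have h3 := h1
  rw [h2] at h3
  have h4 := left_ne_zero_of_mul h3
  have h5 := right_ne_zero_of_mul h3
  unfold qRatio
  rw [h2, qPoch_eq hq0 hq1 z]
  field_simp

theorem continuousOn_qRatio {q : ℝ} (hq0 : 0 < q) (hq1 : q < 1) :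
    ContinuousOn (fun p : ℝ × ℂ => qRatio q p.1 p.2) {p | 0 < p.1 ∧ p.1 * ‖p.2‖ < 1} := by
  have hc := continuous_qPoch hq0 hq1
  refine ContinuousOn.div ?_ ?_ fun p hp => qPoch_mul_ne_zero hq0 hq1 hp.1 hp.2
  · exact (hc.comp continuous_snd).continuousOn
  · exact (hc.comp (by fun_prop : Continuous fun p : ℝ × ℂ => (p.1 : ℂ) * p.2)).continuousOn

theorem weight_eq (q t : ℝ) {n : ℕ} (x : Fin n → ℂ) :
    weight q t x = ∏ i, ∏ j, if i = j then 1 else qRatio q t (x i / x j) := rfl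

/-! ### The expansion of the kernel -/

/-- `(t;q)_k / (q;q)_k`. -/
def binomCoeff (q t : ℝ) : ℕ → ℝ
  | 0 => 1
  | k + 1 => binomCoeff q t k * ((1 - t * q ^ k) / (1 - q ^ (k + 1)))

theorem binomCoeff_pos {q t : ℝ} (hq0 : 0 < q) (hq1 : q < 1) (ht0 : 0 < t) (ht1 : t < 1) (k : ℕ) :
    0 < binomCoeff q t k := by
  induction k with
  | zero => simp [binomCoeff]
  | succ k ih =>
    have h1 : 0 < 1 - q ^ (k + 1) := one_sub_pow_pos hq0 hq1 k.succPNat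
    have h2 : t * q ^ k < 1 := by
      calc t * q ^ k ≤ t * 1 := mul_le_mul_of_nonneg_left (pow_le_one₀ hq0.le hq1.le) ht0.le
        _ < 1 := by linarith
    exact mul_pos ih (div_pos (by linarith) h1)

theorem summable_binomCoeff {q t : ℝ} (hq0 : 0 < q) (hq1 : q < 1) (ht0 : 0 < t) (ht1 : t < 1)
    {ρ : ℝ} (hρ0 : 0 ≤ ρ) (hρ1 : ρ < 1) : Summable fun k => binomCoeff q t k * ρ ^ k := by
  rcases hρ0.eq_or_lt with rfl | hρ0
  · refine summable_of_ne_finset_zero (s := {0}) fun k hk => ?_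
    rw [zero_pow (by simpa using hk), mul_zero]
  refine summable_of_ratio_test_tendsto_lt_one hρ1 (.of_forall fun k =>
    (mul_pos (binomCoeff_pos hq0 hq1 ht0 ht1 k) (pow_pos hρ0 k)).ne') ?_
  have h1 : ∀ k, ‖binomCoeff q t (k + 1) * ρ ^ (k + 1)‖ / ‖binomCoeff q t k * ρ ^ k‖ =
      (1 - t * q ^ k) / (1 - q ^ (k + 1)) * ρ := by
    intro k
    have hb := binomCoeff_pos hq0 hq1 ht0 ht1
    rw [Real.norm_of_nonneg (mul_pos (hb _) (pow_pos hρ0 _)).le,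
      Real.norm_of_nonneg (mul_pos (hb _) (pow_pos hρ0 _)).le, pow_succ]
    have := (hb k).ne'
    have := (pow_pos hρ0 k).ne'
    simp only [binomCoeff]
    field_simp
  simp only [h1]
  have h2 := tendsto_pow_atTop_nhds_zero_of_lt_one hq0.le hq1
  have h3 : Filter.Tendsto (fun k => (1 - t * q ^ k) / (1 - q ^ (k + 1)) * ρ) Filter.atTop
      (nhds ((1 - t * 0) / (1 - 0) * ρ)) :=
    ((tendsto_const_nhds.sub (h2.const_mul t)).div
      (tendsto_const_nhds.sub (h2.comp (Filter.tendsto_add_atTop_nat 1))) (by norm_num)).mul_const ρ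
  simpa using h3

theorem summable_norm_binomCoeff {q t : ℝ} (hq0 : 0 < q) (hq1 : q < 1) (ht0 : 0 < t) (ht1 : t < 1)
    {z : ℂ} (hz : ‖z‖ < 1) : Summable fun k => ‖(binomCoeff q t k : ℂ) * z ^ k‖ := by
  refine (summable_binomCoeff hq0 hq1 ht0 ht1 (norm_nonneg z) hz).congr fun k => ?_
  rw [norm_mul, norm_pow, Complex.norm_real,
    Real.norm_of_nonneg (binomCoeff_pos hq0 hq1 ht0 ht1 k).le]

/-- The `q`-binomial theorem. -/
theorem tsum_binomCoeff {q t : ℝ} (hq0 : 0 < q) (hq1 : q < 1) (ht0 : 0 < t) (ht1 : t < 1)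
    {z : ℂ} (hz : ‖z‖ < 1) :
    ∑' k, (binomCoeff q t k : ℂ) * z ^ k = qPoch (t * z) q / qPoch z q := by
  set f : ℂ → ℂ := fun z => ∑' k, (binomCoeff q t k : ℂ) * z ^ k with hf
  have hs : ∀ {z : ℂ}, ‖z‖ < 1 → Summable fun k => (binomCoeff q t k : ℂ) * z ^ k :=
    fun h => (summable_norm_binomCoeff hq0 hq1 ht0 ht1 h).of_norm
  have hqz : ∀ {z : ℂ}, ‖z‖ < 1 → ‖(q : ℂ) * z‖ < 1 := by
    intro z hz
    rw [norm_mul, Complex.norm_real, Real.norm_of_nonneg hq0.le]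
    nlinarith [norm_nonneg z]
  have htz : ∀ {z : ℂ}, ‖z‖ < 1 → t * ‖z‖ < 1 := fun {z} hz => by nlinarith [norm_nonneg z]
  -- The recursion `(1 - q^(k+1)) c_(k+1) = (1 - t q^k) c_k` of the coefficients, multiplied by
  -- `z^(k+1)` and summed.
  have hfe : ∀ {z : ℂ}, ‖z‖ < 1 → (1 - z) * f z = (1 - t * z) * f (q * z) := by
    intro z hz
    have h1 : ∀ z, f z = ∑' k, (binomCoeff q t k : ℂ) * z ^ k := fun _ => rfl
    have hc : ∀ k, (binomCoeff q t (k + 1) : ℂ) * (1 - (q : ℂ) ^ (k + 1)) =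
        binomCoeff q t k * (1 - t * (q : ℂ) ^ k) := by
      intro k
      have h1 : 1 - q ^ (k + 1) ≠ 0 := (one_sub_pow_pos hq0 hq1 k.succPNat).ne'
      have : binomCoeff q t (k + 1) * (1 - q ^ (k + 1)) = binomCoeff q t k * (1 - t * q ^ k) := by
        simp only [binomCoeff]
        field_simp
      exact_mod_cast this
    have h2 : f z - f (q * z) = z * f z - t * z * f (q * z) := by
      have e1 : f z - f (q * z) =
          ∑' k, ((binomCoeff q t k : ℂ) * z ^ k - binomCoeff q t k * (q * z) ^ k) :=
        ((hs hz).tsum_sub (hs (hqz hz))).symm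
      have e2 : z * f z - t * z * f (q * z) = ∑' k, (z * ((binomCoeff q t k : ℂ) * z ^ k) -
          t * z * (binomCoeff q t k * (q * z) ^ k)) := by
        rw [((hs hz).mul_left z).tsum_sub ((hs (hqz hz)).mul_left (t * z)), tsum_mul_left,
          tsum_mul_left]
      rw [e1, e2, ((hs hz).sub (hs (hqz hz))).tsum_eq_zero_add]
      simp only [pow_zero, sub_self, zero_add]
      refine tsum_congr fun k => ?_
      rw [mul_pow, mul_pow, pow_succ z]
      linear_combination (z ^ k * z) * hc k
    linear_combination h2
  -- By the two functional equations `h z = h (q z)`. Iterating, `q^n z` tends to zero, and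
  -- continuity at zero gives `h z = h 0 = 1`.
  set h : ℂ → ℂ := fun z => f z * qRatio q t z with hh
  have hh1 : ∀ {z : ℂ}, ‖z‖ < 1 → h z = h (q * z) := by
    intro z hz
    have e1 := hfe hz
    have e2 := qRatio_mul_eq (z := z) hq0 hq1 ht0 (htz hz)
    have e3 : (1 - t * z : ℂ) ≠ 0 := by
      intro e
      have : ‖(t : ℂ) * z‖ = 1 := by
        rw [show (t : ℂ) * z = 1 by linear_combination -e]; simp
      rw [norm_mul, Complex.norm_real, Real.norm_of_nonneg ht0.le] at this
      exact absurd this (htz hz).ne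
    refine mul_left_cancel₀ e3 ?_
    simp only [hh]
    linear_combination f z * e2 + qRatio q t (q * z) * e1
  have hh2 : ∀ n : ℕ, ‖(q : ℂ) ^ n * z‖ < 1 ∧ h z = h ((q : ℂ) ^ n * z) := by
    intro n
    induction n with
    | zero => simpa using hz
    | succ n ih =>
      rw [show (q : ℂ) ^ (n + 1) * z = q * ((q : ℂ) ^ n * z) by ring]
      exact ⟨hqz ih.1, ih.2.trans (hh1 ih.1)⟩
  have hfc : ContinuousAt f 0 := by
    have : ContinuousOn f (Metric.closedBall 0 2⁻¹) := by
      refine continuousOn_tsum (u := fun k => binomCoeff q t k * 2⁻¹ ^ k) (fun k => by fun_prop)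
        (summable_binomCoeff hq0 hq1 ht0 ht1 (by norm_num) (by norm_num)) fun k x hx => ?_
      rw [norm_mul, norm_pow, Complex.norm_real,
        Real.norm_of_nonneg (binomCoeff_pos hq0 hq1 ht0 ht1 k).le]
      refine mul_le_mul_of_nonneg_left (pow_le_pow_left₀ (norm_nonneg _) (by simpa using hx) k)
        (binomCoeff_pos hq0 hq1 ht0 ht1 k).le
    exact this.continuousAt (Metric.closedBall_mem_nhds _ (by norm_num))
  have hhc : ContinuousAt h 0 :=
    hfc.mul (differentiableAt_qRatio hq0 hq1 ht0 (by simp)).continuousAt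
  have h0 : h 0 = 1 := by
    have : f 0 = 1 := by
      rw [hf]
      simp only
      rw [tsum_eq_single 0 fun k hk => by rw [zero_pow hk, mul_zero]]
      simp [binomCoeff]
    simp [hh, this, qRatio, qPoch_zero]
  have hlim : Filter.Tendsto (fun n : ℕ => (q : ℂ) ^ n * z) Filter.atTop (nhds 0) := by
    have := (tendsto_pow_atTop_nhds_zero_of_norm_lt_one (x := (q : ℂ))
      (by rw [Complex.norm_real, Real.norm_of_nonneg hq0.le]; exact hq1)).mul_const z
    simpa using this
  have hz1 : h z = 1 := by
    have e1 := (hhc.tendsto.comp hlim)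
    rw [h0] at e1
    refine tendsto_nhds_unique (tendsto_const_nhds.congr fun n => ?_) e1
    exact (hh2 n).2
  have e1 := qPoch_mul_ne_zero hq0 hq1 ht0 (htz hz)
  have e2 := qPoch_ne_zero hq0 hq1 hz
  simp only [hh, qRatio] at hz1
  change f z = _
  field_simp at hz1 ⊢
  exact hz1

/-- The formal counterpart of `tsum_binomCoeff`. The exponential satisfies the relation between `z`
and `q z` that characterizes the `q`-binomial series, and this relation determines the coefficients
one after another. -/
theorem newtonExp_binomCoeff {q t : ℝ} (hq0 : 0 < q) (hq1 : q < 1) (z : ℂ) :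
    newtonExp (PowerSeries.mk fun n =>
      (1 - (t : ℂ) ^ (n + 1)) / (1 - (q : ℂ) ^ (n + 1)) * z ^ (n + 1)) =
    PowerSeries.mk fun n => (binomCoeff q t n : ℂ) * z ^ n := by
  have hq : ∀ n : ℕ, (1 - (q : ℂ) ^ (n + 1)) ≠ 0 := fun n => by
    exact_mod_cast (one_sub_pow_pos hq0 hq1 n.succPNat).ne'
  set B : ℂ → PowerSeries ℂ := fun z => PowerSeries.mk fun n =>
      (1 - (t : ℂ) ^ (n + 1)) / (1 - (q : ℂ) ^ (n + 1)) * z ^ (n + 1) with hB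
  have hfe : ∀ z : ℂ, (1 - PowerSeries.C z * PowerSeries.X) * newtonExp (B z) =
      (1 - PowerSeries.C ((t : ℂ) * z) * PowerSeries.X) * newtonExp (B (q * z)) := by
    intro z
    rw [← newtonExp_neg_geom, ← newtonExp_neg_geom, ← newtonExp_add, ← newtonExp_add]
    congr 1
    ext n
    simp only [hB, map_add, PowerSeries.coeff_mk, mul_pow]
    have := hq n
    field_simp
    ring
  have hsc : ∀ (z : ℂ) k, PowerSeries.coeff k (newtonExp (B z)) =
      z ^ k * PowerSeries.coeff k (newtonExp (B 1)) := by
    intro z k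
    induction k using Nat.strong_induction_on with
    | _ k ih =>
      cases k with
      | zero => simp [PowerSeries.coeff_zero_eq_constantCoeff_apply, constantCoeff_newtonExp]
      | succ k =>
        have hk : ((k : ℂ) + 1) ≠ 0 := by exact_mod_cast k.succ_ne_zero
        refine mul_right_cancel₀ hk ?_
        rw [mul_assoc, coeff_newtonExp_succ, coeff_newtonExp_succ, Finset.mul_sum]
        refine Finset.sum_congr rfl fun x hx => ?_
        have hx' := Finset.HasAntidiagonal.mem_antidiagonal.mp hx
        rw [ih x.2 (by omega), ← hx']
        simp only [hB, PowerSeries.coeff_mk, one_pow]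
        ring
  have hc : ∀ k, PowerSeries.coeff k (newtonExp (B 1)) = (binomCoeff q t k : ℂ) := by
    intro k
    induction k with
    | zero => simp [PowerSeries.coeff_zero_eq_constantCoeff_apply, constantCoeff_newtonExp,
        binomCoeff]
    | succ k ih =>
      have h := congrArg (PowerSeries.coeff (k + 1)) (hfe 1)
      rw [sub_mul, sub_mul, one_mul, one_mul, map_sub, map_sub, mul_assoc, mul_assoc,
        PowerSeries.coeff_C_mul, PowerSeries.coeff_C_mul, PowerSeries.coeff_succ_X_mul,
        PowerSeries.coeff_succ_X_mul, hsc (q * 1), hsc (q * 1), ih] at h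
      have := hq k
      simp only [binomCoeff]
      push_cast
      field_simp
      linear_combination h
  ext k
  rw [hsc z k, hc, PowerSeries.coeff_mk, mul_comm]

theorem tsum_coeff_prod {ι : Type*} (s : Finset ι) (F : ι → PowerSeries ℂ)
    (hF : ∀ i ∈ s, Summable fun k => ‖PowerSeries.coeff k (F i)‖) :
    (Summable fun k => ‖PowerSeries.coeff k (∏ i ∈ s, F i)‖) ∧
      ∑' k, PowerSeries.coeff k (∏ i ∈ s, F i) = ∏ i ∈ s, ∑' k, PowerSeries.coeff k (F i) := by
  classical
  induction s using Finset.induction_on with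
  | empty =>
    simp only [Finset.prod_empty, PowerSeries.coeff_one]
    refine ⟨summable_of_ne_finset_zero (s := {0}) fun k hk => ?_, ?_⟩
    · rw [if_neg (by simpa using hk), norm_zero]
    · rw [tsum_eq_single 0 fun k hk => if_neg hk, if_pos rfl]
  | insert a s ha ih =>
    obtain ⟨h1, h2⟩ := ih fun i hi => hF i (Finset.mem_insert_of_mem hi)
    have h3 := hF a (Finset.mem_insert_self a s)
    rw [Finset.prod_insert ha, Finset.prod_insert ha]
    set f : ℕ → ℂ := fun k => PowerSeries.coeff k (F a) with hf
    set g : ℕ → ℂ := fun k => PowerSeries.coeff k (∏ i ∈ s, F i) with hg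
    have h4 : ∀ k, PowerSeries.coeff k (F a * ∏ i ∈ s, F i) =
        ∑ p ∈ Finset.HasAntidiagonal.antidiagonal k, f p.1 * g p.2 := fun k =>
      PowerSeries.coeff_mul _ _ _
    simp only [h4]
    refine ⟨summable_norm_sum_mul_antidiagonal_of_summable_norm (f := f) (g := g) h3 h1, ?_⟩
    rw [← h2]
    exact (tsum_mul_tsum_eq_tsum_sum_antidiagonal_of_summable_norm (f := f) (g := g) h3 h1).symm

/-- A product of majorants with nonnegative coefficients is a majorant of the product. It provides
the bound on the kernel that is uniform in the variables. -/
theorem norm_coeff_prod_le {ι : Type*} (s : Finset ι) (F : ι → PowerSeries ℂ)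
    (G : ι → PowerSeries ℂ)
    (hF : ∀ i ∈ s, ∀ k, ‖PowerSeries.coeff k (F i)‖ ≤ ‖PowerSeries.coeff k (G i)‖)
    (hG : ∀ i ∈ s, ∀ k, ∃ r : ℝ, 0 ≤ r ∧ PowerSeries.coeff k (G i) = r) (k : ℕ) :
    ‖PowerSeries.coeff k (∏ i ∈ s, F i)‖ ≤ ‖PowerSeries.coeff k (∏ i ∈ s, G i)‖ ∧
      ∃ r : ℝ, 0 ≤ r ∧ PowerSeries.coeff k (∏ i ∈ s, G i) = r := by
  classical
  induction s using Finset.induction_on generalizing k with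
  | empty =>
    simp only [Finset.prod_empty, PowerSeries.coeff_one]
    refine ⟨le_rfl, if k = 0 then 1 else 0, by split_ifs <;> norm_num, by split_ifs <;> norm_num⟩
  | insert a s ha ih =>
    have ih := ih (fun i hi => hF i (Finset.mem_insert_of_mem hi))
      (fun i hi => hG i (Finset.mem_insert_of_mem hi))
    have hF := hF a (Finset.mem_insert_self a s)
    have hG := hG a (Finset.mem_insert_self a s)
    rw [Finset.prod_insert ha, Finset.prod_insert ha]
    simp only [PowerSeries.coeff_mul]
    choose r hr0 hr using hG
    choose u hu0 hu using fun k => (ih k).2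
    have e : ∑ p ∈ Finset.HasAntidiagonal.antidiagonal k, PowerSeries.coeff p.1 (G a) *
        PowerSeries.coeff p.2 (∏ i ∈ s, G i) =
        ((∑ p ∈ Finset.HasAntidiagonal.antidiagonal k, r p.1 * u p.2 : ℝ) : ℂ) := by
      push_cast
      exact Finset.sum_congr rfl fun p _ => by rw [hr, hu]
    have e0 : 0 ≤ ∑ p ∈ Finset.HasAntidiagonal.antidiagonal k, r p.1 * u p.2 :=
      Finset.sum_nonneg fun p _ => mul_nonneg (hr0 _) (hu0 _)
    refine ⟨?_, _, e0, e⟩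
    rw [e, Complex.norm_real, Real.norm_of_nonneg e0]
    refine (norm_sum_le _ _).trans (Finset.sum_le_sum fun p _ => ?_)
    rw [norm_mul]
    have e1 := hF p.1
    have e2 := (ih p.2).1
    rw [hr, Complex.norm_real, Real.norm_of_nonneg (hr0 _)] at e1
    rw [hu, Complex.norm_real, Real.norm_of_nonneg (hu0 _)] at e2
    exact mul_le_mul e1 e2 (norm_nonneg _) (hr0 _)

/-- Since `p_n(x) p_n(y) = ∑ (x_i y_j)^n`, the exponential of the Cauchy kernel factors over the
pairs `(i, j)` into `q`-binomial series. -/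
theorem psEval_cauchyCoeff (q t : ℝ) (hq0 : 0 < q) (hq1 : q < 1) {n m : ℕ} (x : Fin n → ℂ)
    (y : Fin m → ℂ) (k : ℕ) :
    psEval y (cauchyCoeff (fun m : ℕ+ => (1 - (t : ℂ) ^ (m : ℕ)) / (1 - (q : ℂ) ^ (m : ℕ))) x k) =
      PowerSeries.coeff k (∏ p : Fin n × Fin m, PowerSeries.mk fun k =>
        (binomCoeff q t k : ℂ) * (x p.1 * y p.2) ^ k) := by
  have h1 : psEval y (cauchyCoeff (fun m : ℕ+ => (1 - (t : ℂ) ^ (m : ℕ)) / (1 - (q : ℂ) ^ (m : ℕ)))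
      x k) = PowerSeries.coeff k (PowerSeries.map (psEval y : MvPolynomial ℕ+ ℂ →ₐ[ℂ] ℂ).toRingHom
        (genSeries fun m : ℕ+ => (1 - (t : ℂ) ^ (m : ℕ)) / (1 - (q : ℂ) ^ (m : ℕ)) *
          ∑ i, x i ^ (m : ℕ))) := by
    rw [PowerSeries.coeff_map]
    rfl
  rw [h1, genSeries, map_newtonExp]
  simp only [← newtonExp_binomCoeff hq0 hq1]
  rw [← newtonExp_sum]
  congr 2
  ext n
  rw [PowerSeries.coeff_map, logSeries, PowerSeries.coeff_mk, map_sum]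
  simp only [PowerSeries.coeff_mk, AlgHom.toRingHom_eq_coe, RingHom.coe_coe, map_mul, psEval_X,
    Nat.succPNat_coe, Nat.succ_eq_add_one]
  rw [← MvPolynomial.algebraMap_eq, AlgHom.commutes, AlgHom.commutes, Fintype.sum_prod_type,
    Algebra.algebraMap_self_apply, Algebra.algebraMap_self_apply, mul_assoc, Finset.sum_mul_sum, Finset.mul_sum]
  refine Finset.sum_congr rfl fun i _ => ?_
  rw [Finset.mul_sum]
  refine Finset.sum_congr rfl fun j _ => ?_
  rw [mul_pow]

/-- The expansion of the kernel, with a uniform summable bound. -/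
theorem hasSum_kernel {q t : ℝ} (hq0 : 0 < q) (hq1 : q < 1) (ht0 : 0 < t) (ht1 : t < 1)
    (n m : ℕ) {ρ : ℝ} (hρ0 : 0 ≤ ρ) (hρ1 : ρ < 1) :
    ∃ u : ℕ → ℝ, Summable u ∧ ∀ (x : Fin n → ℂ) (y : Fin m → ℂ), (∀ i j, ‖x i * y j‖ ≤ ρ) →
      (∀ k, ‖psEval y (cauchyCoeff
        (fun m : ℕ+ => (1 - (t : ℂ) ^ (m : ℕ)) / (1 - (q : ℂ) ^ (m : ℕ))) x k)‖ ≤ u k) ∧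
      HasSum (fun k => psEval y (cauchyCoeff
        (fun m : ℕ+ => (1 - (t : ℂ) ^ (m : ℕ)) / (1 - (q : ℂ) ^ (m : ℕ))) x k))
        (kernel q t x y) := by
  set G : Fin n × Fin m → PowerSeries ℂ := fun _ => PowerSeries.mk fun k =>
    (binomCoeff q t k : ℂ) * (ρ : ℂ) ^ k with hG
  have hb := binomCoeff_pos hq0 hq1 ht0 ht1
  have hGs := (tsum_coeff_prod Finset.univ G fun _ _ => by
    simp only [hG, PowerSeries.coeff_mk]
    exact summable_norm_binomCoeff hq0 hq1 ht0 ht1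
      (by rwa [Complex.norm_real, Real.norm_of_nonneg hρ0])).1
  refine ⟨_, hGs, fun x y hxy => ?_⟩
  set F : Fin n × Fin m → PowerSeries ℂ := fun p => PowerSeries.mk fun k =>
    (binomCoeff q t k : ℂ) * (x p.1 * y p.2) ^ k with hF
  have hle := norm_coeff_prod_le Finset.univ F G (fun p _ k => by
    simp only [hF, hG, PowerSeries.coeff_mk]
    rw [norm_mul, norm_mul, norm_pow, norm_pow, Complex.norm_real ρ, Real.norm_of_nonneg hρ0]
    exact mul_le_mul_of_nonneg_left (pow_le_pow_left₀ (norm_nonneg _) (hxy _ _) k) (norm_nonneg _))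
    (fun p _ k => ⟨binomCoeff q t k * ρ ^ k, mul_nonneg (hb k).le (pow_nonneg hρ0 k), by
      simp [hG]⟩)
  have hFs := tsum_coeff_prod Finset.univ F fun p _ => by
    simp only [hF, PowerSeries.coeff_mk]
    exact summable_norm_binomCoeff hq0 hq1 ht0 ht1 ((hxy _ _).trans_lt hρ1)
  simp only [psEval_cauchyCoeff q t hq0 hq1]
  refine ⟨fun k => (hle k).1, ?_⟩
  have hk := hFs.1.of_norm.hasSum
  rw [hFs.2, Fintype.prod_prod_type fun p => ∑' k, PowerSeries.coeff k (F p)] at hk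
  suffices h : kernel q t x y = ∏ i, ∏ j, ∑' k, PowerSeries.coeff k (F (i, j)) by
    rw [h]
    exact hk
  unfold kernel
  refine Finset.prod_congr rfl fun i _ => Finset.prod_congr rfl fun j _ => ?_
  simp only [hF, PowerSeries.coeff_mk]
  exact (tsum_binomCoeff hq0 hq1 ht0 ht1 ((hxy _ _).trans_lt hρ1)).symm

/-! ### Averages over the unit torus -/

/-- The unit torus in `ℂⁿ`. -/
def torus (n : ℕ) : Set (Fin n → ℂ) := {x | ∀ i, ‖x i‖ = 1}

/-- The point of the unit torus with given angles. -/
def torusPoint {n : ℕ} (θ : Fin n → ℝ) : Fin n → ℂ := fun i => Complex.exp (θ i * Complex.I)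

/-- The Lebesgue measure on the cube of angles. -/
def angleMeasure (n : ℕ) : MeasureTheory.Measure (Fin n → ℝ) :=
  MeasureTheory.Measure.pi fun _ =>
    MeasureTheory.volume.restrict (Set.Icc 0 (2 * Real.pi))

instance (n : ℕ) : MeasureTheory.IsFiniteMeasure (angleMeasure n) := by
  unfold angleMeasure
  infer_instance

/-- The average of a function over the unit torus. -/
def torusAvg {n : ℕ} (F : (Fin n → ℂ) → ℂ) : ℂ :=
  ((2 * (Real.pi : ℂ)) ^ n)⁻¹ * ∫ θ, F (torusPoint θ) ∂(angleMeasure n)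

theorem torusPoint_mem {n : ℕ} (θ : Fin n → ℝ) : torusPoint θ ∈ torus n := fun i => by
  simp [torusPoint, Complex.norm_exp_ofReal_mul_I]

theorem continuous_torusPoint {n : ℕ} : Continuous (torusPoint (n := n)) := by
  unfold torusPoint
  fun_prop

theorem isCompact_torus (n : ℕ) : IsCompact (torus n) := by
  have : torus n = Set.pi Set.univ fun _ => Metric.sphere (0 : ℂ) 1 := by
    ext x
    simp [torus, Set.mem_pi]
  rw [this]
  exact isCompact_univ_pi fun _ => isCompact_sphere _ _

theorem angleMeasure_eq (n : ℕ) : angleMeasure n =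
    MeasureTheory.volume.restrict (Set.Icc (0 : Fin n → ℝ) fun _ => 2 * Real.pi) := by
  rw [angleMeasure, ← MeasureTheory.Measure.restrict_pi_pi, ← MeasureTheory.volume_pi,
    Set.pi_univ_Icc]
  rfl

/-- Each `dx_j / (2 π i x_j)` becomes `dθ_j / (2 π)`, so the radius survives only in the argument of
`f`. -/
theorem contour_eq_torusAvg {n : ℕ} {ρ : ℝ} (hρ : ρ ≠ 0) (f : (Fin n → ℂ) → ℂ) :
    contour ρ f = torusAvg fun x => f fun j => ρ * x j := by
  unfold contour torusAvg torusIntegral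
  rw [angleMeasure_eq, ← MeasureTheory.integral_const_mul]
  refine MeasureTheory.integral_congr_ae (.of_forall fun θ => ?_)
  have h1 : torusMap 0 (fun _ => ρ) θ = fun j => (ρ : ℂ) * torusPoint θ j := by
    funext j
    simp [torusMap, torusPoint]
  have h2 : (∏ i : Fin n, (ρ : ℂ) * Complex.exp (θ i * Complex.I) * Complex.I) *
      ∏ j : Fin n, (2 * (Real.pi : ℂ) * Complex.I * ((ρ : ℂ) * torusPoint θ j))⁻¹ =
      ((2 * (Real.pi : ℂ)) ^ n)⁻¹ := by
    rw [← Finset.prod_mul_distrib, ← inv_pow, ← Fin.prod_const]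
    refine Finset.prod_congr rfl fun j _ => ?_
    have h3 : (ρ : ℂ) ≠ 0 := by exact_mod_cast hρ
    have h4 : Complex.exp (θ j * Complex.I) ≠ 0 := Complex.exp_ne_zero _
    have h5 : (Real.pi : ℂ) ≠ 0 := by exact_mod_cast Real.pi_ne_zero
    have h6 := Complex.I_ne_zero
    simp only [torusPoint]
    field_simp
  simp only [h1, smul_eq_mul]
  rw [← mul_assoc, h2]

theorem integrable_torusPoint {n : ℕ} {F : (Fin n → ℂ) → ℂ} (hF : ContinuousOn F (torus n)) :
    MeasureTheory.Integrable (fun θ => F (torusPoint θ)) (angleMeasure n) := by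
  obtain ⟨C, hC⟩ := (isCompact_torus n).exists_bound_of_continuousOn hF
  have hc : Continuous fun θ => F (torusPoint (n := n) θ) :=
    hF.comp_continuous continuous_torusPoint torusPoint_mem
  exact MeasureTheory.Integrable.of_bound hc.aestronglyMeasurable C
    (.of_forall fun θ => hC _ (torusPoint_mem θ))

theorem torusAvg_congr {n : ℕ} {F G : (Fin n → ℂ) → ℂ} (h : ∀ x ∈ torus n, F x = G x) :
    torusAvg F = torusAvg G := by
  unfold torusAvg
  congr 1
  exact MeasureTheory.integral_congr_ae (.of_forall fun θ => h _ (torusPoint_mem θ))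

theorem torusAvg_add {n : ℕ} {F G : (Fin n → ℂ) → ℂ} (hF : ContinuousOn F (torus n))
    (hG : ContinuousOn G (torus n)) :
    torusAvg (fun x => F x + G x) = torusAvg F + torusAvg G := by
  unfold torusAvg
  rw [MeasureTheory.integral_add (integrable_torusPoint hF) (integrable_torusPoint hG), mul_add]

theorem torusAvg_const_mul {n : ℕ} (c : ℂ) (F : (Fin n → ℂ) → ℂ) :
    torusAvg (fun x => c * F x) = c * torusAvg F := by
  unfold torusAvg
  rw [MeasureTheory.integral_const_mul, mul_left_comm]

theorem torusAvg_sum {n : ℕ} {ι : Type*} (s : Finset ι) {F : ι → (Fin n → ℂ) → ℂ}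
    (hF : ∀ i ∈ s, ContinuousOn (F i) (torus n)) :
    torusAvg (fun x => ∑ i ∈ s, F i x) = ∑ i ∈ s, torusAvg (F i) := by
  unfold torusAvg
  rw [MeasureTheory.integral_finsetSum _ fun i hi => integrable_torusPoint (hF i hi),
    Finset.mul_sum]

theorem hasSum_torusAvg {n : ℕ} {F : ℕ → (Fin n → ℂ) → ℂ} {G : (Fin n → ℂ) → ℂ} {u : ℕ → ℝ}
    (hu : Summable u) (hF : ∀ k, ContinuousOn (F k) (torus n))
    (hb : ∀ k, ∀ x ∈ torus n, ‖F k x‖ ≤ u k) (hG : ∀ x ∈ torus n, HasSum (fun k => F k x) (G x)) :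
    HasSum (fun k => torusAvg (F k)) (torusAvg G) := by
  unfold torusAvg
  refine HasSum.mul_left _ ?_
  refine MeasureTheory.hasSum_integral_of_dominated_convergence (fun k _ => u k)
    (fun k => (integrable_torusPoint (hF k)).aestronglyMeasurable)
    (fun k => .of_forall fun θ => hb k _ (torusPoint_mem θ)) (.of_forall fun _ => hu)
    (MeasureTheory.integrable_const _) (.of_forall fun θ => hG _ (torusPoint_mem θ))

/-- Cauchy's theorem for `h z / z` on the annulus between the radii `1` and `R`. -/
theorem integral_circle_eq {h : ℂ → ℂ} {R : ℝ} (hR : 1 ≤ R)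
    (hh : ∀ z : ℂ, 1 ≤ ‖z‖ → ‖z‖ ≤ R → DifferentiableAt ℂ h z) :
    ∫ θ in Set.Icc 0 (2 * Real.pi), h (Complex.exp (θ * Complex.I)) =
      ∫ θ in Set.Icc 0 (2 * Real.pi), h (R * Complex.exp (θ * Complex.I)) := by
  have key := Complex.circleIntegral_sub_center_inv_smul_eq_of_differentiable_on_annulus_off_countable
    (c := 0) (r := 1) (R := R) (f := h) one_pos hR Set.countable_empty
    (fun z hz => (hh z (by simpa using hz.2) (by simpa using hz.1)).continuousAt.continuousWithinAt)
    (fun z hz => hh z (by have := hz.1.2; simp at this; exact this.le)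
      (by have := hz.1.1; simp at this; exact this.le))
  have aux : ∀ r : ℝ, 0 < r → (∮ z in C(0, r), (z - 0)⁻¹ • h z) =
      Complex.I * ∫ θ in Set.Icc 0 (2 * Real.pi), h (r * Complex.exp (θ * Complex.I)) := by
    intro r hr
    rw [circleIntegral_def_Icc, ← MeasureTheory.integral_const_mul]
    refine MeasureTheory.integral_congr_ae (.of_forall fun θ => ?_)
    have h1 : circleMap 0 r θ ≠ 0 := circleMap_ne_center hr.ne'
    have h2 : circleMap 0 r θ = r * Complex.exp (θ * Complex.I) := by simp [circleMap]
    simp only [deriv_circleMap, smul_eq_mul, sub_zero]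
    rw [← h2]
    field_simp
  rw [aux 1 one_pos, aux R (one_pos.trans_le hR)] at key
  have := mul_left_cancel₀ Complex.I_ne_zero key
  simpa using this.symm

theorem integral_angleMeasure_succ {n : ℕ} (i : Fin (n + 1)) {F : (Fin (n + 1) → ℂ) → ℂ}
    (hF : ContinuousOn F (torus (n + 1))) :
    ∫ θ, F (torusPoint θ) ∂(angleMeasure (n + 1)) =
      ∫ η, (∫ a in Set.Icc 0 (2 * Real.pi),
        F (i.insertNth (Complex.exp (a * Complex.I)) (torusPoint η))) ∂(angleMeasure n) := by
  have hmp := MeasureTheory.measurePreserving_piFinSuccAbove (n := n) (α := fun _ => ℝ)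
    (fun _ => MeasureTheory.volume.restrict (Set.Icc 0 (2 * Real.pi))) i
  set e := MeasurableEquiv.piFinSuccAbove (fun _ : Fin (n + 1) => ℝ) i with he
  change MeasureTheory.MeasurePreserving e (angleMeasure (n + 1))
    ((MeasureTheory.volume.restrict (Set.Icc 0 (2 * Real.pi))).prod (angleMeasure n)) at hmp
  have hpt : ∀ a η, torusPoint (i.insertNth a η : Fin (n + 1) → ℝ) =
      (i.insertNth (Complex.exp (a * Complex.I)) (torusPoint η) : Fin (n + 1) → ℂ) := by
    intro a η
    funext j
    refine Fin.succAboveCases i ?_ (fun k => ?_) j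
    · simp [torusPoint]
    · simp [torusPoint]
  have h1 : ∀ θ, F (torusPoint θ) = F (torusPoint (e.symm (e θ))) := fun θ => by
    rw [e.symm_apply_apply]
  have hint : MeasureTheory.Integrable (fun p => F (torusPoint (e.symm p)))
      ((MeasureTheory.volume.restrict (Set.Icc 0 (2 * Real.pi))).prod (angleMeasure n)) := by
    rw [← hmp.integrable_comp_emb e.measurableEmbedding]
    refine (integrable_torusPoint hF).congr (.of_forall fun θ => ?_)
    simp
  calc ∫ θ, F (torusPoint θ) ∂(angleMeasure (n + 1))
      = ∫ θ, F (torusPoint (e.symm (e θ))) ∂(angleMeasure (n + 1)) := by simp only [← h1]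
    _ = ∫ p, F (torusPoint (e.symm p))
          ∂((MeasureTheory.volume.restrict (Set.Icc 0 (2 * Real.pi))).prod (angleMeasure n)) :=
        hmp.integral_comp e.measurableEmbedding fun p => F (torusPoint (e.symm p))
    _ = _ := by
        rw [MeasureTheory.integral_prod_symm _ hint]
        refine MeasureTheory.integral_congr_ae (.of_forall fun η => ?_)
        refine MeasureTheory.integral_congr_ae (.of_forall fun a => ?_)
        simp only
        rw [← hpt]
        rfl

/-- Moving the contour of one variable. -/
theorem torusAvg_dilate {n : ℕ} (i : Fin n) {R : ℝ} (hR : 1 ≤ R) {F : (Fin n → ℂ) → ℂ}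
    (hF : ∀ x : Fin n → ℂ, (∀ j, j ≠ i → ‖x j‖ = 1) → 1 ≤ ‖x i‖ → ‖x i‖ ≤ R →
      DifferentiableAt ℂ F x) :
    torusAvg F = torusAvg fun x => F (Function.update x i (R * x i)) := by
  obtain _ | n := n
  · exact i.elim0
  have hR0 : 0 < R := one_pos.trans_le hR
  have hc1 : ContinuousOn F (torus (n + 1)) := fun x hx =>
    (hF x (fun j _ => hx j) (hx i).ge ((hx i).trans_le hR)).continuousAt.continuousWithinAt
  have hnu : ∀ x ∈ torus (n + 1), (∀ j, j ≠ i → ‖Function.update x i (R * x i) j‖ = 1) ∧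
      ‖Function.update x i (R * x i) i‖ = R := by
    intro x hx
    refine ⟨fun j hj => by rw [Function.update_of_ne hj, hx j], ?_⟩
    rw [Function.update_self, norm_mul, hx i, Complex.norm_real, Real.norm_of_nonneg hR0.le,
      mul_one]
  have hc2 : ContinuousOn (fun x => F (Function.update x i (R * x i))) (torus (n + 1)) := by
    intro x hx
    obtain ⟨h1, h2⟩ := hnu x hx
    have hd := (hF _ h1 (hR.trans h2.ge) h2.le).continuousAt
    have hu : ContinuousAt (fun x : Fin (n + 1) → ℂ => Function.update x i (R * x i)) x := by
      fun_prop
    exact (ContinuousAt.comp (f := fun x : Fin (n + 1) → ℂ => Function.update x i (R * x i))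
      hd hu).continuousWithinAt
  unfold torusAvg
  congr 1
  rw [integral_angleMeasure_succ i hc1, integral_angleMeasure_succ i hc2]
  refine MeasureTheory.integral_congr_ae (.of_forall fun η => ?_)
  have hup : ∀ a : ℂ, Function.update (i.insertNth a (torusPoint η) : Fin (n + 1) → ℂ) i
      (R * (i.insertNth a (torusPoint η) : Fin (n + 1) → ℂ) i) =
        (i.insertNth (R * a) (torusPoint η) : Fin (n + 1) → ℂ) := by
    intro a
    rw [Fin.insertNth_apply_same, Fin.update_insertNth]
  simp only [hup]
  refine integral_circle_eq (h := fun z => F (i.insertNth z (torusPoint η))) hR fun z hz1 hz2 => ?_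
  have hz : (i.insertNth z (torusPoint η) : Fin (n + 1) → ℂ) i = z := Fin.insertNth_apply_same _ _ _
  have hd := hF (i.insertNth z (torusPoint η)) (fun j hj => by
    obtain ⟨k, rfl⟩ := Fin.exists_succAbove_eq hj
    rw [Fin.insertNth_apply_succAbove]
    exact torusPoint_mem η k) (by rwa [hz]) (by rwa [hz])
  refine DifferentiableAt.comp z hd ?_
  rw [differentiableAt_pi]
  intro j
  refine Fin.succAboveCases i ?_ (fun k => ?_) j
  · simp
  · simp

/-! ### The Macdonald operator is self-adjoint on the torus -/

theorem differentiable_psEval {n : ℕ} (F : MvPolynomial ℕ+ ℂ) :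
    Differentiable ℂ fun x : Fin n → ℂ => psEval x F := by
  induction F using MvPolynomial.induction_on with
  | C a =>
    have : ∀ x : Fin n → ℂ, psEval x (MvPolynomial.C a) = a := fun x => by simp [psEval]
    simp only [this]
    fun_prop
  | add F G hF hG =>
    simp only [map_add]
    fun_prop
  | mul_X F k hF =>
    simp only [map_mul, psEval_X]
    fun_prop

theorem weight_eq_prod_erase (q t : ℝ) {n : ℕ} (x : Fin n → ℂ) :
    weight q t x = ∏ j, ∏ k ∈ Finset.univ.erase j, qRatio q t (x k / x j) := by
  rw [weight_eq, Finset.prod_comm]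
  refine Finset.prod_congr rfl fun j _ => ?_
  rw [← Finset.mul_prod_erase _ _ (Finset.mem_univ j), if_pos rfl, one_mul]
  exact Finset.prod_congr rfl fun k hk => if_neg (Finset.ne_of_mem_erase hk)

theorem weight_inv (q t : ℝ) {n : ℕ} (x : Fin n → ℂ) :
    weight q t (fun j => (x j)⁻¹) = weight q t x := by
  rw [weight_eq, weight_eq, Finset.prod_comm]
  refine Finset.prod_congr rfl fun i _ => Finset.prod_congr rfl fun j _ => ?_
  rw [inv_div_inv]
  exact if_congr eq_comm rfl rfl

theorem weight_mul (q t : ℝ) {n : ℕ} {c : ℂ} (hc : c ≠ 0) (x : Fin n → ℂ) :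
    weight q t (fun j => c * x j) = weight q t x := by
  rw [weight_eq, weight_eq]
  simp only [mul_div_mul_left _ _ hc]

/-- The weight that accompanies the dilation of the variable `x_i`. -/
def shiftWeight (q t : ℝ) {n : ℕ} (i : Fin n) (x : Fin n → ℂ) : ℂ :=
  (∏ k ∈ Finset.univ.erase i, (qRatio q t (x k / x i) * qRatio q t (q * (x i / x k)))) *
    ∏ j ∈ Finset.univ.erase i, ∏ k ∈ (Finset.univ.erase j).erase i, qRatio q t (x k / x j)

/-- The linear factors contained in `Δ` cancel the denominators `x_i - x_j` of the difference
operator. What remains is `shiftWeight`, in which the contour of `x_i` can be moved. -/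
theorem weight_mul_psEval_macOp {q t : ℝ} (hq0 : 0 < q) (hq1 : q < 1) (ht0 : 0 < t) (ht1 : t < 1)
    {n : ℕ} (F : MvPolynomial ℕ+ ℂ) {x : Fin n → ℂ} (hx : x ∈ torus n) :
    weight q t x * psEval x (macOp (q : ℂ) (t : ℂ)⁻¹ F) =
      ((t : ℂ)⁻¹) ^ n * (weight q t x * psEval x F) + (1 - (t : ℂ)⁻¹) * ((t : ℂ)⁻¹) ^ (n - 1) *
        ∑ i, shiftWeight q t i x * psEval (Function.update x i (q * x i)) F := by
  have hx0 : ∀ i, x i ≠ 0 := fun i h => by have := hx i; rw [h, norm_zero] at this; norm_num at this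
  have ht : (t : ℂ) ≠ 0 := by exact_mod_cast ht0.ne'
  have hu : ∀ i j, ‖x i / x j‖ = 1 := fun i j => by rw [norm_div, hx i, hx j, div_one]
  have hden : ∀ z : ℂ, ‖z‖ = 1 → qPoch (t * z) q ≠ 0 := fun z hz =>
    qPoch_mul_ne_zero hq0 hq1 ht0 (by rwa [hz, mul_one])
  -- `h j k` is the factor `qRatio q t (x k / x j)` of the weight without its linear factor `x j - x
  -- k`.
  set h : Fin n → Fin n → ℂ := fun j k => (x j)⁻¹ * (qPoch (q * (x k / x j)) q /
    qPoch (t * (x k / x j)) q) with hh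
  set H : ℂ := ∏ j, ∏ k ∈ Finset.univ.erase j, h j k with hH
  have hr : ∀ j k, (x j - x k) * h j k = qRatio q t (x k / x j) := by
    intro j k
    rw [qRatio, qPoch_eq hq0 hq1 (x k / x j), hh]
    have := hx0 j
    simp only
    rw [mul_div_assoc, ← mul_assoc]
    congr 1
    field_simp
  have hvand : MvPolynomial.aeval x (vand ℂ n) * H = weight q t x := by
    rw [weight_eq_prod_erase, vand, map_prod, hH, ← Finset.prod_mul_distrib]
    refine Finset.prod_congr rfl fun j _ => ?_
    rw [map_prod, ← Finset.prod_mul_distrib]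
    refine Finset.prod_congr rfl fun k _ => ?_
    rw [map_sub, MvPolynomial.aeval_X, MvPolynomial.aeval_X, hr]
  -- The numerator `x_i - t⁻¹ x_k` cancels the first factor of `(t x_i/x_k; q)_∞`, so that the
  -- argument `x_i/x_k` of one of the two ratios becomes `q x_i/x_k`.
  have hpair : ∀ i k, (x i - (t : ℂ)⁻¹ * x k) * h i k * ((x k - x i) * h k i) =
      (t : ℂ)⁻¹ * (qRatio q t (x k / x i) * qRatio q t (q * (x i / x k))) := by
    intro i k
    rw [hr]
    have h1 := hden _ (hu k i)
    have h2 := hden _ (hu i k)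
    have h3 : qPoch (t * (x i / x k)) q = (1 - t * (x i / x k)) * qPoch (t * (q * (x i / x k))) q := by
      rw [qPoch_eq hq0 hq1 (t * (x i / x k))]
      ring_nf
    have h4 := h2
    rw [h3] at h4
    have h5 := left_ne_zero_of_mul h4
    have h6 := right_ne_zero_of_mul h4
    simp only [qRatio, hh]
    rw [h3, qPoch_eq hq0 hq1 (x k / x i), qPoch_eq hq0 hq1 (x i / x k)]
    have h7 := hx0 i
    have h8 := hx0 k
    have h9 : x k - t * x i ≠ 0 := by
      intro h
      apply h5
      field_simp
      rw [h, mul_zero]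
    generalize qPoch (t * (q * (x i / x k))) q = A at *
    generalize qPoch (q * (x i / x k)) q = B at *
    generalize qPoch (q * (x k / x i)) q = C at *
    generalize qPoch (t * (x k / x i)) q = D at *
    have e1 : (1 - t * (x i / x k)) = (x k - t * x i) / x k := by field_simp
    have e2 : (x i - (t : ℂ)⁻¹ * x k) = -(t : ℂ)⁻¹ * (x k - t * x i) := by
      field_simp
      ring
    rw [e1, e2]
    generalize x k - t * x i = m at *
    field_simp
    ring
  have hshift : ∀ i, MvPolynomial.aeval x (vandShift ((t : ℂ)⁻¹) i) * H =
      ((t : ℂ)⁻¹) ^ (n - 1) * shiftWeight q t i x := by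
    intro i
    set g : Fin n → Fin n → ℂ := fun j k =>
      (x j - (if j = i then (t : ℂ)⁻¹ else 1) * x k) * h j k with hg
    have h1 : MvPolynomial.aeval x (vandShift ((t : ℂ)⁻¹) i) * H =
        ∏ j, ∏ k ∈ Finset.univ.erase j, g j k := by
      rw [vandShift, map_prod, hH, ← Finset.prod_mul_distrib]
      refine Finset.prod_congr rfl fun j _ => ?_
      rw [map_prod, ← Finset.prod_mul_distrib]
      refine Finset.prod_congr rfl fun k _ => ?_
      rw [map_sub, map_mul, MvPolynomial.aeval_X, MvPolynomial.aeval_X, MvPolynomial.aeval_C,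
        Algebra.algebraMap_self_apply]
    have h2 : ∀ j ∈ Finset.univ.erase i, ∏ k ∈ Finset.univ.erase j, g j k =
        g j i * ∏ k ∈ (Finset.univ.erase j).erase i, qRatio q t (x k / x j) := by
      intro j hj
      have hji := Finset.ne_of_mem_erase hj
      rw [← Finset.mul_prod_erase _ _ (Finset.mem_erase.mpr ⟨hji.symm, Finset.mem_univ i⟩)]
      congr 1
      refine Finset.prod_congr rfl fun k _ => ?_
      rw [hg]
      simp only
      rw [if_neg hji, one_mul, hr]
    have h3 : ∀ k ∈ Finset.univ.erase i, g i k * g k i =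
        (t : ℂ)⁻¹ * (qRatio q t (x k / x i) * qRatio q t (q * (x i / x k))) := by
      intro k hk
      rw [← hpair]
      simp only [hg, if_true, if_neg (Finset.ne_of_mem_erase hk), one_mul]
    rw [h1, ← Finset.mul_prod_erase _ _ (Finset.mem_univ i), Finset.prod_congr rfl h2,
      Finset.prod_mul_distrib (f := fun j => g j i), ← mul_assoc, ← Finset.prod_mul_distrib, Finset.prod_congr rfl h3,
      Finset.prod_mul_distrib, Finset.prod_const, Finset.card_erase_of_mem (Finset.mem_univ i),
      Finset.card_univ, Fintype.card_fin, mul_assoc, shiftWeight]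
  have hdil : ∀ i (f : MvPolynomial (Fin n) ℂ), MvPolynomial.aeval x (dilate (q : ℂ) i f) =
      MvPolynomial.aeval (Function.update x i (q * x i)) f := by
    intro i f
    rw [dilate, ← AlgHom.comp_apply]
    congr 1
    refine MvPolynomial.algHom_ext fun j => ?_
    rw [AlgHom.comp_apply, MvPolynomial.aeval_X, MvPolynomial.aeval_X]
    by_cases hj : j = i
    · subst hj
      simp
    · simp [Function.update_of_ne hj]
  have key := congrArg (fun f => MvPolynomial.aeval x f * H)
    (vand_mul_toFin_macOp (n := n) (q : ℂ) ((t : ℂ)⁻¹) F)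
  simp only [map_add, map_mul, map_sum, MvPolynomial.aeval_C, Algebra.algebraMap_self_apply,
    aeval_toFin, hdil] at key
  calc weight q t x * psEval x (macOp (q : ℂ) (t : ℂ)⁻¹ F)
      = MvPolynomial.aeval x (vand ℂ n) * psEval x (macOp (q : ℂ) (t : ℂ)⁻¹ F) * H := by
        rw [← hvand]; ring
    _ = _ := by
        rw [key, ← hvand, add_mul, Finset.mul_sum]
        congr 1
        · ring
        · rw [Finset.mul_sum, Finset.sum_mul]
          refine Finset.sum_congr rfl fun i _ => ?_
          linear_combination (1 - (t : ℂ)⁻¹) * psEval (Function.update x i (q * x i)) F * hshift i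

theorem differentiableAt_inv_coord {n : ℕ} {x : Fin n → ℂ} (hx : ∀ i, x i ≠ 0) :
    DifferentiableAt ℂ (fun x : Fin n → ℂ => fun j => (x j)⁻¹) x := by
  rw [differentiableAt_pi]
  intro j
  have h : DifferentiableAt ℂ (fun x : Fin n → ℂ => x j) x := by fun_prop
  exact h.fun_inv (hx j)

theorem continuousOn_inv_torus (n : ℕ) :
    ContinuousOn (fun x : Fin n → ℂ => fun j => (x j)⁻¹) (torus n) := by
  refine fun x hx => (differentiableAt_inv_coord fun i h => ?_).continuousAt.continuousWithinAt
  have := hx i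
  rw [h, norm_zero] at this
  norm_num at this

theorem inv_mem_torus {n : ℕ} {x : Fin n → ℂ} (hx : x ∈ torus n) :
    (fun j => (x j)⁻¹) ∈ torus n := fun j => by rw [norm_inv, hx j, inv_one]

theorem differentiableAt_qRatio_div {q t : ℝ} (hq0 : 0 < q) (hq1 : q < 1) (ht0 : 0 < t) {n : ℕ}
    {x : Fin n → ℂ} (c : ℂ) (i j : Fin n) (hj : x j ≠ 0) (h : t * ‖c * (x i / x j)‖ < 1) :
    DifferentiableAt ℂ (fun x : Fin n → ℂ => qRatio q t (c * (x i / x j))) x := by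
  have h1 : DifferentiableAt ℂ (fun x : Fin n → ℂ => c * (x i / x j)) x :=
by
    have h2 : DifferentiableAt ℂ (fun x : Fin n → ℂ => x j) x := by fun_prop
    have h3 : DifferentiableAt ℂ (fun x : Fin n → ℂ => x i) x := by fun_prop
    simp only [div_eq_mul_inv]
    exact (h3.fun_mul (h2.fun_inv hj)).const_mul c
  exact (differentiableAt_qRatio hq0 hq1 ht0 h).comp x h1

theorem differentiableAt_prod {E ι : Type*} [NormedAddCommGroup E] [NormedSpace ℂ E] {s : Finset ι}
    {f : ι → E → ℂ} {x : E} (h : ∀ i ∈ s, DifferentiableAt ℂ (f i) x) :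
    DifferentiableAt ℂ (fun x => ∏ i ∈ s, f i x) x := by
  classical
  induction s using Finset.induction_on with
  | empty => simp
  | insert a s ha ih =>
    simp only [Finset.prod_insert ha]
    exact (h a (Finset.mem_insert_self a s)).fun_mul
      (ih fun i hi => h i (Finset.mem_insert_of_mem hi))

theorem continuousOn_weight {q t : ℝ} (hq0 : 0 < q) (hq1 : q < 1) (ht0 : 0 < t) (ht1 : t < 1)
    (n : ℕ) : ContinuousOn (weight q t (n := n)) (torus n) := by
  have h : weight q t (n := n) = fun x => ∏ j, ∏ k ∈ Finset.univ.erase j,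
      qRatio q t (1 * (x k / x j)) := by
    funext x
    simp only [one_mul]
    exact weight_eq_prod_erase q t x
  rw [h]
  refine continuousOn_finsetProd _ fun j _ => continuousOn_finsetProd _ fun k _ => fun x hx => ?_
  refine (differentiableAt_qRatio_div hq0 hq1 ht0 1 k j (fun h => ?_) ?_).continuousAt
    |>.continuousWithinAt
  · have := hx j
    rw [h, norm_zero] at this
    norm_num at this
  · rw [one_mul, norm_div, hx j, hx k]
    linarith

/-- For `1 ≤ |x_i| ≤ 1/q` and the other variables on the unit circle, all arguments of `qRatio` have
modulus at most one, while its poles have modulus at least `1/t`. -/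
theorem differentiableAt_shiftWeight {q t : ℝ} (hq0 : 0 < q) (hq1 : q < 1) (ht0 : 0 < t)
    (ht1 : t < 1) {n : ℕ} (i : Fin n) {x : Fin n → ℂ} (hx : ∀ j, j ≠ i → ‖x j‖ = 1)
    (h1 : 1 ≤ ‖x i‖) (h2 : q * ‖x i‖ ≤ 1) : DifferentiableAt ℂ (shiftWeight q t i) x := by
  have hx0 : ∀ j, x j ≠ 0 := by
    intro j h
    by_cases hj : j = i
    · subst hj
      rw [h, norm_zero] at h1
      norm_num at h1
    · have := hx j hj
      rw [h, norm_zero] at this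
      norm_num at this
  have h : shiftWeight q t i = fun x : Fin n → ℂ => (∏ k ∈ Finset.univ.erase i,
      (qRatio q t (1 * (x k / x i)) * qRatio q t (q * (x i / x k)))) *
      ∏ j ∈ Finset.univ.erase i, ∏ k ∈ (Finset.univ.erase j).erase i,
        qRatio q t (1 * (x k / x j)) := by
    funext x
    simp only [one_mul, shiftWeight]
  rw [h]
  refine DifferentiableAt.fun_mul (differentiableAt_prod fun k hk => ?_)
    (differentiableAt_prod fun j hj => differentiableAt_prod fun k hk => ?_)
  · have hk := hx k (Finset.ne_of_mem_erase hk)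
    refine DifferentiableAt.fun_mul (differentiableAt_qRatio_div hq0 hq1 ht0 _ _ _ (hx0 i) ?_)
      (differentiableAt_qRatio_div hq0 hq1 ht0 _ _ _ (hx0 k) ?_)
    · rw [one_mul, norm_div, hk]
      have : 1 / ‖x i‖ ≤ 1 := by rw [div_le_one (by linarith)]; exact h1
      nlinarith
    · rw [norm_mul, norm_div, hk, div_one, Complex.norm_real, Real.norm_of_nonneg hq0.le]
      nlinarith
  · have hk := hx k (Finset.ne_of_mem_erase hk)
    have hj' := hx j (Finset.ne_of_mem_erase hj)
    refine differentiableAt_qRatio_div hq0 hq1 ht0 _ _ _ (hx0 j) ?_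
    rw [one_mul, norm_div, hk, hj']
    linarith

/-- The bilinear form on symmetric functions given by the torus average. -/
def torusForm (q t : ℝ) (n : ℕ) (F G : MvPolynomial ℕ+ ℂ) : ℂ :=
  torusAvg fun x : Fin n → ℂ => psEval x F * psEval (fun j => (x j)⁻¹) G * weight q t x

theorem continuousOn_psEval_inv {n : ℕ} (G : MvPolynomial ℕ+ ℂ) :
    ContinuousOn (fun x : Fin n → ℂ => psEval (fun j => (x j)⁻¹) G) (torus n) :=
  (differentiable_psEval G).continuous.comp_continuousOn (continuousOn_inv_torus n)

theorem continuousOn_torusForm {q t : ℝ} (hq0 : 0 < q) (hq1 : q < 1) (ht0 : 0 < t) (ht1 : t < 1)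
    (n : ℕ) (F G : MvPolynomial ℕ+ ℂ) :
    ContinuousOn (fun x : Fin n → ℂ => psEval x F * psEval (fun j => (x j)⁻¹) G * weight q t x)
      (torus n) :=
  ((differentiable_psEval F).continuous.continuousOn.mul (continuousOn_psEval_inv G)).mul
    (continuousOn_weight hq0 hq1 ht0 ht1 n)

/-- Moving the contour of `x_i` to radius `1/q` substitutes `x_i / q` for `x_i`. This undoes the
dilation in `F`, puts one on `G`, and changes `shiftWeight` at `x` into `shiftWeight` at `1/x`. -/
theorem torusAvg_shiftWeight {q t : ℝ} (hq0 : 0 < q) (hq1 : q < 1) (ht0 : 0 < t) (ht1 : t < 1)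
    {n : ℕ} (i : Fin n) (F G : MvPolynomial ℕ+ ℂ) :
    torusAvg (fun x : Fin n → ℂ => shiftWeight q t i x *
        psEval (Function.update x i (q * x i)) F * psEval (fun j => (x j)⁻¹) G) =
      torusAvg (fun x : Fin n → ℂ => shiftWeight q t i (fun j => (x j)⁻¹) *
        psEval x F *
          psEval (Function.update (fun j => (x j)⁻¹) i (q * (x i)⁻¹)) G) := by
  have hq : (q : ℂ) ≠ 0 := by exact_mod_cast hq0.ne'
  rw [torusAvg_dilate i (R := q⁻¹) (one_le_inv_iff₀.mpr ⟨hq0, hq1.le⟩)]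
  · refine torusAvg_congr fun x hx => ?_
    have hx0 : ∀ i, x i ≠ 0 := fun i h => by
      have := hx i; rw [h, norm_zero] at this; norm_num at this
    have e1 : Function.update (Function.update x i (((q⁻¹ : ℝ) : ℂ) * x i)) i
        (q * Function.update x i (((q⁻¹ : ℝ) : ℂ) * x i) i) = x := by
      rw [Function.update_self, Function.update_idem]
      refine Function.update_eq_self_iff.mpr ?_
      push_cast
      field_simp
    have e2 : (fun j => (Function.update x i (((q⁻¹ : ℝ) : ℂ) * x i) j)⁻¹) =
        Function.update (fun j => (x j)⁻¹) i (q * (x i)⁻¹) := by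
      funext j
      by_cases hj : j = i
      · subst hj
        simp [mul_comm]
      · simp [Function.update_of_ne hj]
    rw [e1, e2]
    congr 2
    unfold shiftWeight
    congr 1
    · refine Finset.prod_congr rfl fun k hk => ?_
      rw [Function.update_self, Function.update_of_ne (Finset.ne_of_mem_erase hk), mul_comm]
      have h1 := hx0 i
      have h2 := hx0 k
      congr 2
      · push_cast
        field_simp
      · push_cast
        field_simp
    · rw [Finset.prod_comm' (t' := Finset.univ.erase i)
        (s' := fun k => (Finset.univ.erase k).erase i)
        (fun j k => by simp only [Finset.mem_erase, Finset.mem_univ, and_true]; tauto)]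
      refine Finset.prod_congr rfl fun j hj => Finset.prod_congr rfl fun k hk => ?_
      rw [Function.update_of_ne (Finset.ne_of_mem_erase hj),
        Function.update_of_ne (Finset.ne_of_mem_erase hk), inv_div_inv]
  · intro x hx h1 h2
    have hx0 : ∀ j, x j ≠ 0 := by
      intro j h
      by_cases hj : j = i
      · subst hj
        rw [h, norm_zero] at h1
        norm_num at h1
      · have := hx j hj
        rw [h, norm_zero] at this
        norm_num at this
    refine ((differentiableAt_shiftWeight hq0 hq1 ht0 ht1 i hx h1 ?_).mul ?_).mul ?_
    · calc q * ‖x i‖ ≤ q * q⁻¹ := mul_le_mul_of_nonneg_left h2 hq0.le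
        _ = 1 := mul_inv_cancel₀ hq0.ne'
    · refine (differentiable_psEval F _).comp x ?_
      rw [differentiableAt_pi]
      intro j
      by_cases hj : j = i
      · subst hj
        simp only [Function.update_self]
        fun_prop
      · simp only [Function.update_of_ne hj]
        fun_prop
    · exact (differentiable_psEval G _).comp x (differentiableAt_inv_coord hx0)

/-! ### Orthogonality on the torus -/

theorem ne_zero_of_mem_torus {n : ℕ} {x : Fin n → ℂ} (hx : x ∈ torus n) (i : Fin n) : x i ≠ 0 := by
  intro h
  have := hx i
  rw [h, norm_zero] at this
  norm_num at this

theorem torusForm_add_right {q t : ℝ} (hq0 : 0 < q) (hq1 : q < 1) (ht0 : 0 < t) (ht1 : t < 1)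
    (n : ℕ) (F G H : MvPolynomial ℕ+ ℂ) :
    torusForm q t n F (G + H) = torusForm q t n F G + torusForm q t n F H := by
  unfold torusForm
  rw [← torusAvg_add (continuousOn_torusForm hq0 hq1 ht0 ht1 n F G)
    (continuousOn_torusForm hq0 hq1 ht0 ht1 n F H)]
  congr 1
  funext x
  rw [map_add]
  ring

theorem torusForm_smul_left (q t : ℝ) (n : ℕ) (a : ℂ) (F G : MvPolynomial ℕ+ ℂ) :
    torusForm q t n (a • F) G = a * torusForm q t n F G := by
  unfold torusForm
  rw [← torusAvg_const_mul]
  congr 1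
  funext x
  rw [map_smul, smul_eq_mul]
  ring

theorem torusForm_smul_right (q t : ℝ) (n : ℕ) (a : ℂ) (F G : MvPolynomial ℕ+ ℂ) :
    torusForm q t n F (a • G) = a * torusForm q t n F G := by
  unfold torusForm
  rw [← torusAvg_const_mul]
  congr 1
  funext x
  rw [map_smul, smul_eq_mul]
  ring

theorem torusForm_macOp {q t : ℝ} (hq0 : 0 < q) (hq1 : q < 1) (ht0 : 0 < t) (ht1 : t < 1)
    (n : ℕ) (F G : MvPolynomial ℕ+ ℂ) :
    torusForm q t n (macOp (q : ℂ) (t : ℂ)⁻¹ F) G =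
      torusForm q t n F (macOp (q : ℂ) (t : ℂ)⁻¹ G) := by
  set c : ℂ := (1 - (t : ℂ)⁻¹) * ((t : ℂ)⁻¹) ^ (n - 1) with hc
  have hsw : ∀ i : Fin n, ContinuousOn (shiftWeight q t i) (torus n) := fun i x hx =>
    (differentiableAt_shiftWeight hq0 hq1 ht0 ht1 i (fun j _ => hx j) (hx i).ge
      (by rw [hx i, mul_one]; exact hq1.le)).continuousAt.continuousWithinAt
  have hup : ∀ i : Fin n, Continuous fun x : Fin n → ℂ => Function.update x i (q * x i) := by
    intro i
    fun_prop
  have hA : ∀ i : Fin n, ContinuousOn (fun x : Fin n → ℂ => shiftWeight q t i x *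
      psEval (Function.update x i (q * x i)) F * psEval (fun j => (x j)⁻¹) G) (torus n) := fun i =>
    ((hsw i).mul (((differentiable_psEval F).continuous.comp (hup i)).continuousOn)).mul
      (continuousOn_psEval_inv G)
  have hB : ∀ i : Fin n, ContinuousOn (fun x : Fin n → ℂ => shiftWeight q t i (fun j => (x j)⁻¹) *
      psEval x F * psEval (Function.update (fun j => (x j)⁻¹) i (q * (x i)⁻¹)) G) (torus n) :=
    fun i => (((hsw i).comp (continuousOn_inv_torus n) fun x hx => inv_mem_torus hx).mul
      (differentiable_psEval F).continuous.continuousOn).mul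
      (((differentiable_psEval G).continuous.comp (hup i)).comp_continuousOn
        (continuousOn_inv_torus n))
  have h0 := continuousOn_torusForm hq0 hq1 ht0 ht1 n F G
  have e1 : torusForm q t n (macOp (q : ℂ) (t : ℂ)⁻¹ F) G = torusAvg fun x : Fin n → ℂ =>
      ((t : ℂ)⁻¹) ^ n * (psEval x F * psEval (fun j => (x j)⁻¹) G * weight q t x) +
      c * ∑ i, shiftWeight q t i x * psEval (Function.update x i (q * x i)) F *
        psEval (fun j => (x j)⁻¹) G := by
    refine torusAvg_congr fun x hx => ?_
    have := weight_mul_psEval_macOp hq0 hq1 ht0 ht1 F hx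
    rw [← Finset.sum_mul]
    linear_combination psEval (fun j => (x j)⁻¹) G * this
  -- The weight is invariant under inversion of the variables, so the formula for the operator may
  -- be used at `1/x`, where `G` is evaluated.
  have e2 : torusForm q t n F (macOp (q : ℂ) (t : ℂ)⁻¹ G) = torusAvg fun x : Fin n → ℂ =>
      ((t : ℂ)⁻¹) ^ n * (psEval x F * psEval (fun j => (x j)⁻¹) G * weight q t x) +
      c * ∑ i, shiftWeight q t i (fun j => (x j)⁻¹) * psEval x F *
        psEval (Function.update (fun j => (x j)⁻¹) i (q * (x i)⁻¹)) G := by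
    refine torusAvg_congr fun x hx => ?_
    have := weight_mul_psEval_macOp hq0 hq1 ht0 ht1 G (inv_mem_torus hx)
    rw [weight_inv] at this
    have e : ∑ i, shiftWeight q t i (fun j => (x j)⁻¹) * psEval x F *
        psEval (Function.update (fun j => (x j)⁻¹) i (q * (x i)⁻¹)) G =
        psEval x F * ∑ i, shiftWeight q t i (fun j => (x j)⁻¹) *
          psEval (Function.update (fun j => (x j)⁻¹) i (q * (x i)⁻¹)) G := by
      rw [Finset.mul_sum]
      exact Finset.sum_congr rfl fun i _ => by ring
    rw [e]
    linear_combination psEval x F * this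
  have hm : ∀ (a : ℂ) {F : (Fin n → ℂ) → ℂ}, ContinuousOn F (torus n) →
      ContinuousOn (fun x => a * F x) (torus n) := fun a F h => continuousOn_const.mul h
  rw [e1, e2, torusAvg_add (hm _ h0) (hm _ (continuousOn_finsetSum _ fun i _ => hA i)),
    torusAvg_add (hm _ h0) (hm _ (continuousOn_finsetSum _ fun i _ => hB i)),
    torusAvg_const_mul c, torusAvg_const_mul c, torusAvg_sum _ fun i _ => hA i,
    torusAvg_sum _ fun i _ => hB i]
  congr 2
  exact Finset.sum_congr rfl fun i _ => torusAvg_shiftWeight hq0 hq1 ht0 ht1 i F G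

theorem torusForm_macC_of_eps_ne {q t : ℝ} (hq0 : 0 < q) (hq1 : q < 1) (ht0 : 0 < t) (ht1 : t < 1)
    (n : ℕ) {lam mu : YoungDiagram} (h : eps (q : ℂ) (t : ℂ)⁻¹ lam ≠ eps (q : ℂ) (t : ℂ)⁻¹ mu) :
    torusForm q t n (macC q t lam) (macC q t mu) = 0 := by
  have ht : (t : ℂ)⁻¹ ≠ 0 := inv_ne_zero (by exact_mod_cast ht0.ne')
  have h1 := torusForm_macOp hq0 hq1 ht0 ht1 n (macC q t lam) (macC q t mu)
  rw [macC, macC, macOp_macP _ ht, macOp_macP _ ht, torusForm_smul_left, torusForm_smul_right] at h1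
  exact (mul_eq_zero.mp (show (eps (q : ℂ) (t : ℂ)⁻¹ lam - eps (q : ℂ) (t : ℂ)⁻¹ mu) * _ = 0 by
    rw [sub_mul]; exact sub_eq_zero.mpr h1)).resolve_left (sub_ne_zero.mpr h)

/-- Since `t < 1`, the factor `1 - t⁻¹` is nonzero and can be divided out. Then `t⁻¹` is a root of
the polynomial with coefficients `q^{lam_i} - q^{mu_i}`, not all zero. -/
theorem finite_eps_eq {q : ℝ} (hq0 : 0 < q) (hq1 : q < 1) {lam mu : YoungDiagram} (h : lam ≠ mu) :
    {t : ℝ | t < 1 ∧ eps (q : ℂ) (t : ℂ)⁻¹ lam = eps (q : ℂ) (t : ℂ)⁻¹ mu}.Finite := by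
  set N := max (lam.colLen 0) (mu.colLen 0) with hN
  set p : Polynomial ℂ := ∑ i ∈ Finset.range N, Polynomial.C ((q : ℂ) ^ lam.rowLen i -
    (q : ℂ) ^ mu.rowLen i) * Polynomial.X ^ i with hp
  have hz : ∀ i, N ≤ i → lam.rowLen i = 0 ∧ mu.rowLen i = 0 := by
    intro i hi
    constructor
    · by_contra h
      have := (rowLen_ne_zero_iff _ _).mp h
      omega
    · by_contra h
      have := (rowLen_ne_zero_iff _ _).mp h
      omega
  have hp0 : p ≠ 0 := by
    intro h0
    refine h (ext_rowLen fun i => ?_)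
    by_cases hi : i < N
    · have := congrArg (fun p => Polynomial.coeff p i) h0
      simp only [hp, Polynomial.finsetSum_coeff, Polynomial.coeff_C_mul, Polynomial.coeff_X_pow,
        Polynomial.coeff_zero, mul_ite, mul_one, mul_zero] at this
      rw [Finset.sum_ite_eq, if_pos (Finset.mem_range.mpr hi), sub_eq_zero] at this
      have h2 : q ^ lam.rowLen i = q ^ mu.rowLen i := by exact_mod_cast this
      exact pow_right_injective₀ hq0 hq1.ne h2
    · rw [(hz i (by omega)).1, (hz i (by omega)).2]
  have hfin : (p.rootSet ℂ).Finite := p.rootSet_finite ℂ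
  refine (hfin.preimage (f := fun t : ℝ => (t : ℂ)⁻¹)
    (Function.Injective.injOn fun a b hab => by simpa using hab)).subset ?_
  rintro t ⟨ht1, ht⟩
  rw [Set.mem_preimage, Polynomial.mem_rootSet]
  refine ⟨hp0, ?_⟩
  rw [eps_eq _ _ lam (le_max_left _ _ : _ ≤ N), eps_eq _ _ mu (le_max_right _ _ : _ ≤ N)] at ht
  have h1 : (1 - (t : ℂ)⁻¹) ≠ 0 := by
    intro h1
    have : t⁻¹ = 1 := by
      have h2 : (t : ℂ)⁻¹ = 1 := by linear_combination -h1
      exact_mod_cast h2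
    rw [inv_eq_one] at this
    exact ht1.ne this
  refine (mul_eq_zero.mp (?_ : (1 - (t : ℂ)⁻¹) * _ = 0)).resolve_left h1
  simp only [hp, map_sum, map_mul, map_pow, Polynomial.aeval_C, Polynomial.aeval_X,
    Algebra.algebraMap_self_apply, sub_mul _ _ (_ ^ _), Finset.sum_sub_distrib]
  rw [mul_sub, sub_eq_zero]
  have := add_left_cancel ht
  rw [hN]
  simpa only [mul_comm] using this

theorem psEval_macC_eq_sum {q t : ℝ} (hq0 : 0 < q) (hq1 : q < 1) (ht0 : 0 < t) (ht1 : t < 1)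
    (lam : YoungDiagram) {n : ℕ} (x : Fin n → ℂ) :
    psEval x (macC q t lam) = ∑ d ∈ (macQT lam).support,
      ratEval q t ((macQT lam).coeff d) * psEval x (MvPolynomial.monomial d (1 : ℂ)) := by
  have hr := fun d => (regularAt_coeff_macQT hq0 hq1 ht0 ht1 lam d).2
  have hs : (macC q t lam).support ⊆ (macQT lam).support := by
    intro d hd
    rw [MvPolynomial.mem_support_iff] at hd ⊢
    intro h
    apply hd
    rw [← hr d, h]
    simp [ratEval]
  rw [(macC q t lam).as_sum, map_sum, Finset.sum_subset hs]
  · refine Finset.sum_congr rfl fun d _ => ?_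
    rw [hr, ← smul_eq_mul, ← map_smul, MvPolynomial.smul_monomial, smul_eq_mul, mul_one]
  · intro d _ hd
    rw [MvPolynomial.notMem_support_iff.mp hd, MvPolynomial.monomial_zero, map_zero]

theorem continuousOn_ratEval {q : ℝ} (u : RatQT) :
    ContinuousOn (fun t : ℝ => ratEval q t u) {t | RegularAt q t u} := by
  have h : ∀ p : MvPolynomial (Fin 2) ℚ, Continuous fun t : ℝ =>
      MvPolynomial.aeval ![(q : ℂ), (t : ℂ)] p := by
    intro p
    simp only [MvPolynomial.aeval_eq_eval₂Hom, MvPolynomial.coe_eval₂Hom]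
    simp only [MvPolynomial.eval₂_eq]
    refine continuous_finsetSum _ fun d _ => continuous_const.mul
      (continuous_finsetProd _ fun i _ => Continuous.pow ?_ _)
    fin_cases i
    · simpa using continuous_const
    · simpa using Complex.continuous_ofReal
  exact (h _).continuousOn.div (h _).continuousOn fun t ht => ht

theorem continuousOn_psEval_macC {q : ℝ} (hq0 : 0 < q) (hq1 : q < 1) (lam : YoungDiagram) (n : ℕ) :
    ContinuousOn (fun p : ℝ × (Fin n → ℂ) => psEval p.2 (macC q p.1 lam))
      (Set.Ioo 0 1 ×ˢ Set.univ) := by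
  have h : ∀ p ∈ (Set.Ioo 0 1 ×ˢ Set.univ : Set (ℝ × (Fin n → ℂ))), psEval p.2 (macC q p.1 lam) =
      ∑ d ∈ (macQT lam).support, ratEval q p.1 ((macQT lam).coeff d) *
        psEval p.2 (MvPolynomial.monomial d (1 : ℂ)) := fun p hp =>
    psEval_macC_eq_sum hq0 hq1 hp.1.1 hp.1.2 lam p.2
  refine ContinuousOn.congr (continuousOn_finsetSum _ fun d _ => ?_) h
  refine ContinuousOn.mul ?_ ((differentiable_psEval _).continuous.comp continuous_snd).continuousOn
  exact (continuousOn_ratEval (q := q) ((macQT lam).coeff d)).comp continuous_fst.continuousOn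
    fun p hp => (regularAt_coeff_macQT hq0 hq1 hp.1.1 hp.1.2 lam d).1

theorem continuousOn_weight_prod {q : ℝ} (hq0 : 0 < q) (hq1 : q < 1) (n : ℕ) :
    ContinuousOn (fun p : ℝ × (Fin n → ℂ) => weight q p.1 p.2) (Set.Ioo 0 1 ×ˢ torus n) := by
  simp only [weight_eq_prod_erase]
  refine continuousOn_finsetProd _ fun j _ => continuousOn_finsetProd _ fun k _ => ?_
  refine ContinuousOn.comp (g := fun p : ℝ × ℂ => qRatio q p.1 p.2)
    (f := fun p : ℝ × (Fin n → ℂ) => (p.1, p.2 k / p.2 j))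
    (continuousOn_qRatio hq0 hq1) ?_ fun p hp => ?_
  · refine continuousOn_fst.prodMk (ContinuousOn.div ?_ ?_ fun p hp => ne_zero_of_mem_torus hp.2 j)
    · fun_prop
    · fun_prop
  · refine ⟨hp.1.1, ?_⟩
    simp only [norm_div]
    rw [hp.2 k, hp.2 j, div_one, mul_one]
    exact hp.1.2

/-- At the given `t` the eigenvalues may coincide, but for fixed `q` they do so only at finitely
many values below one. The pairing vanishes at all other nearby parameters and is continuous in the
parameter by dominated convergence. -/
theorem torusForm_macC {q t : ℝ} (hq0 : 0 < q) (hq1 : q < 1) (ht0 : 0 < t) (ht1 : t < 1)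
    (n : ℕ) {lam mu : YoungDiagram} (h : lam ≠ mu) :
    torusForm q t n (macC q t lam) (macC q t mu) = 0 := by
  set Φ : ℝ × (Fin n → ℂ) → ℂ := fun p => psEval p.2 (macC q p.1 lam) *
    psEval (fun j => (p.2 j)⁻¹) (macC q p.1 mu) * weight q p.1 p.2 with hΦ
  have hcont : ContinuousOn Φ (Set.Ioo 0 1 ×ˢ torus n) := by
    refine ContinuousOn.mul (ContinuousOn.mul ?_ ?_) (continuousOn_weight_prod hq0 hq1 n)
    · exact (continuousOn_psEval_macC hq0 hq1 lam n).mono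
        (Set.prod_mono_right (Set.subset_univ _))
    · refine ContinuousOn.comp (g := fun p : ℝ × (Fin n → ℂ) => psEval p.2 (macC q p.1 mu))
        (f := fun p : ℝ × (Fin n → ℂ) => (p.1, fun j => (p.2 j)⁻¹))
        (continuousOn_psEval_macC hq0 hq1 mu n) ?_ fun p hp => ⟨hp.1, Set.mem_univ _⟩
      exact continuousOn_fst.prodMk ((continuousOn_inv_torus n).comp continuousOn_snd
        fun p hp => hp.2)
  obtain ⟨a, b, hat, htb⟩ : ∃ a b : ℝ, (0 < a ∧ a < t) ∧ (t < b ∧ b < 1) :=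
    ⟨t / 2, (t + 1) / 2, ⟨by linarith, by linarith⟩, ⟨by linarith, by linarith⟩⟩
  have hsub : Set.Icc a b ⊆ Set.Ioo 0 1 := fun s hs => ⟨hat.1.trans_le hs.1, hs.2.trans_lt htb.2⟩
  obtain ⟨C, hC⟩ := ((isCompact_Icc (a := a) (b := b)).prod
    (isCompact_torus n)).exists_bound_of_continuousOn (hcont.mono (Set.prod_mono_left hsub))
  have hev : ∀ᶠ s in nhdsWithin t {t}ᶜ, s ∈ Set.Icc a b :=
    mem_nhdsWithin_of_mem_nhds (Icc_mem_nhds hat.2 htb.1)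
  have hlim : Filter.Tendsto (fun s => torusForm q s n (macC q s lam) (macC q s mu))
      (nhdsWithin t {t}ᶜ) (nhds (torusForm q t n (macC q t lam) (macC q t mu))) := by
    unfold torusForm torusAvg
    refine Filter.Tendsto.const_mul _ ?_
    refine MeasureTheory.tendsto_integral_filter_of_dominated_convergence (fun _ => C) ?_ ?_
      (MeasureTheory.integrable_const _) ?_
    · filter_upwards [hev] with s hs
      exact (integrable_torusPoint (continuousOn_torusForm hq0 hq1 (hsub hs).1 (hsub hs).2 n
        (macC q s lam) (macC q s mu))).aestronglyMeasurable
    · filter_upwards [hev] with s hs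
      exact .of_forall fun θ => hC (s, torusPoint θ) ⟨hs, torusPoint_mem θ⟩
    · refine .of_forall fun θ => ?_
      have h1 : ContinuousAt (fun s => Φ (s, torusPoint θ)) t := by
        have h2 : ContinuousOn (fun s => Φ (s, torusPoint θ)) (Set.Ioo 0 1) :=
          ContinuousOn.comp hcont (by fun_prop) fun s hs => ⟨hs, torusPoint_mem θ⟩
        exact h2.continuousAt (Ioo_mem_nhds ht0 ht1)
      exact h1.tendsto.mono_left nhdsWithin_le_nhds
  have hzero : ∀ᶠ s in nhdsWithin t {t}ᶜ,
      torusForm q s n (macC q s lam) (macC q s mu) = 0 := by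
    have hfin := (finite_eps_eq hq0 hq1 h)
    have hcl : ({s : ℝ | s < 1 ∧ eps (q : ℂ) (s : ℂ)⁻¹ lam = eps (q : ℂ) (s : ℂ)⁻¹ mu} \ {t})ᶜ ∈
        nhds t := (hfin.subset Set.sdiff_subset).isClosed.isOpen_compl.mem_nhds (by simp)
    filter_upwards [hev, mem_nhdsWithin_of_mem_nhds hcl, self_mem_nhdsWithin] with s hs hs2 hs3
    refine torusForm_macC_of_eps_ne hq0 hq1 (hsub hs).1 (hsub hs).2 n fun he => hs2 ?_
    exact ⟨⟨(hsub hs).2, he⟩, hs3⟩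
  exact tendsto_nhds_unique (hlim.congr' hzero) tendsto_const_nhds |>.symm ▸ rfl

/-! ### Norms on the torus and the reproducing property -/

/-- The analogue of the Vandermonde product, with `weight = |qVand|²` on the torus. -/
def qVand (q t : ℝ) {n : ℕ} (x : Fin n → ℂ) : ℂ :=
  ∏ j, ∏ k ∈ Finset.univ.filter (j < ·), qRatio q t (x k / x j)

theorem conj_of_mem_torus {n : ℕ} {x : Fin n → ℂ} (hx : x ∈ torus n) (i : Fin n) :
    (starRingEnd ℂ) (x i) = (x i)⁻¹ := by
  rw [Complex.inv_def, Complex.normSq_eq_norm_sq, hx i]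
  simp

theorem weight_eq_qVand {q : ℝ} (hq0 : 0 < q) (hq1 : q < 1) (t : ℝ) {n : ℕ} {x : Fin n → ℂ}
    (hx : x ∈ torus n) : weight q t x = qVand q t x * (starRingEnd ℂ) (qVand q t x) := by
  have h1 : (starRingEnd ℂ) (qVand q t x) =
      ∏ j, ∏ k ∈ Finset.univ.filter (· < j), qRatio q t (x k / x j) := by
    rw [qVand, map_prod, Finset.prod_comm' (t' := Finset.univ)
      (s' := fun k => Finset.univ.filter (k < ·)) (fun j k => by simp)]
    refine Finset.prod_congr rfl fun j _ => ?_
    rw [map_prod]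
    refine Finset.prod_congr rfl fun k _ => ?_
    rw [conj_qRatio hq0 hq1, map_div₀, conj_of_mem_torus hx, conj_of_mem_torus hx, inv_div_inv]
  rw [h1, weight_eq_prod_erase, qVand, ← Finset.prod_mul_distrib]
  refine Finset.prod_congr rfl fun j _ => ?_
  rw [← Finset.prod_union (Finset.disjoint_left.mpr fun k h1 h2 => by
    simp only [Finset.mem_filter, Finset.mem_univ, true_and] at h1 h2
    exact lt_asymm h1 h2)]
  refine Finset.prod_congr ?_ fun _ _ => rfl
  ext k
  simp only [Finset.mem_erase, Finset.mem_univ, and_true, Finset.mem_union, Finset.mem_filter,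
    true_and]
  rw [ne_iff_lt_or_gt, or_comm]

theorem qVand_ne_zero {q t : ℝ} (hq0 : 0 < q) (hq1 : q < 1) (ht0 : 0 < t) (ht1 : t < 1) {n : ℕ}
    {x : Fin n → ℂ} (hx : x ∈ torus n) (hv : MvPolynomial.aeval x (vand ℂ n) ≠ 0) :
    qVand q t x ≠ 0 := by
  refine Finset.prod_ne_zero_iff.mpr fun j _ => Finset.prod_ne_zero_iff.mpr fun k hk => ?_
  have hn : ‖x k / x j‖ = 1 := by rw [norm_div, hx, hx, div_one]
  have hkj : k ≠ j := (Finset.mem_filter.mp hk).2.ne'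
  have hd : x j - x k ≠ 0 := by
    rw [vand, map_prod, Finset.prod_ne_zero_iff] at hv
    have := hv j (Finset.mem_univ j)
    rw [map_prod, Finset.prod_ne_zero_iff] at this
    have := this k (Finset.mem_erase.mpr ⟨hkj, Finset.mem_univ k⟩)
    rwa [map_sub, MvPolynomial.aeval_X, MvPolynomial.aeval_X] at this
  refine div_ne_zero ?_ (qPoch_mul_ne_zero hq0 hq1 ht0 (by rwa [hn, mul_one]))
  rw [qPoch_eq hq0 hq1]
  refine mul_ne_zero (fun h => hd ?_) (qPoch_ne_zero hq0 hq1 ?_)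
  · have h2 := ne_zero_of_mem_torus hx j
    have h3 : x k / x j = 1 := by linear_combination -h
    rw [div_eq_one_iff_eq h2] at h3
    rw [h3, sub_self]
  · rw [norm_mul, hn, mul_one, Complex.norm_real, Real.norm_of_nonneg hq0.le]
    exact hq1

theorem conj_psEval_macC {q t : ℝ} (hq0 : 0 < q) (hq1 : q < 1) (ht0 : 0 < t) (ht1 : t < 1)
    (lam : YoungDiagram) {n : ℕ} (x : Fin n → ℂ) :
    (starRingEnd ℂ) (psEval x (macC q t lam)) =
      psEval (fun j => (starRingEnd ℂ) (x j)) (macC q t lam) := by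
  have h : ∀ G : MvPolynomial ℕ+ ℝ, (starRingEnd ℂ) (psEval x (MvPolynomial.map Complex.ofRealHom G)) =
      psEval (fun j => (starRingEnd ℂ) (x j)) (MvPolynomial.map Complex.ofRealHom G) := by
    intro G
    induction G using MvPolynomial.induction_on with
    | C a => simp [psEval]
    | add F G hF hG => simp only [map_add, hF, hG]
    | mul_X F k hF =>
      rw [map_mul, map_mul, map_mul, map_mul, hF, MvPolynomial.map_X, psEval_X, psEval_X]
      simp
  rw [macC_eq_map hq0 hq1 ht0 ht1, h]

/-- On the torus the integrand is `|P_lam qVand|²`. As `lam` has at most `n` parts, `P_lam`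
restricts to a nonzero polynomial, so `P_lam vand` cannot vanish on a product of infinite sets;
where it is nonzero, so is the integrand. -/
theorem torusForm_macC_self_ne_zero {q t : ℝ} (hq0 : 0 < q) (hq1 : q < 1) (ht0 : 0 < t)
    (ht1 : t < 1) {n : ℕ} {lam : YoungDiagram} (hlam : lam.colLen 0 ≤ n) :
    torusForm q t n (macC q t lam) (macC q t lam) ≠ 0 := by
  set f := macC q t lam with hf
  set g : (Fin n → ℝ) → ℝ := fun θ =>
    ‖psEval (torusPoint θ) f * qVand q t (torusPoint θ)‖ ^ 2 with hg
  have hfg : ∀ x ∈ torus n, psEval x f * psEval (fun j => (x j)⁻¹) f * weight q t x =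
      ((‖psEval x f * qVand q t x‖ ^ 2 : ℝ) : ℂ) := by
    intro x hx
    have h1 : psEval (fun j => (x j)⁻¹) f = (starRingEnd ℂ) (psEval x f) := by
      rw [hf, conj_psEval_macC hq0 hq1 ht0 ht1]
      simp only [conj_of_mem_torus hx]
    rw [h1, weight_eq_qVand hq0 hq1 t hx]
    push_cast
    rw [← Complex.mul_conj', map_mul]
    ring
  have hcont : Continuous g := by
    have h1 : ContinuousOn (fun x : Fin n → ℂ => psEval x f * psEval (fun j => (x j)⁻¹) f *
      weight q t x) (torus n) := continuousOn_torusForm hq0 hq1 ht0 ht1 n f f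
    have h2 := h1.comp_continuous continuous_torusPoint torusPoint_mem
    have h3 : g = fun θ => (psEval (torusPoint θ) f * psEval (fun j => (torusPoint θ j)⁻¹) f *
      weight q t (torusPoint θ)).re := by
      funext θ
      rw [hfg _ (torusPoint_mem θ), Complex.ofReal_re]
    rw [h3]
    exact Complex.continuous_re.comp h2
  obtain ⟨θ, hθ, hgθ⟩ : ∃ θ : Fin n → ℝ, (∀ i, θ i ∈ Set.Ioo 0 (2 * Real.pi)) ∧ g θ ≠ 0 := by
    -- The open interval of angles keeps the point in the interior of the cube, so a neighbourhood
    -- of it has positive measure.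
    set S : Set ℂ := (fun a : ℝ => Complex.exp (a * Complex.I)) '' Set.Ioo 0 (2 * Real.pi) with hS
    have hSinf : S.Infinite := by
      have hinj : Set.InjOn (fun a : ℝ => Complex.exp (a * Complex.I)) (Set.Ioo 0 Real.pi) := by
        intro a ha b hb hab
        have h1 := congrArg Complex.arg hab
        simp only at h1
        rwa [Complex.arg_exp_mul_I, Complex.arg_exp_mul_I, toIocMod_eq_self .. |>.mpr,
          toIocMod_eq_self .. |>.mpr] at h1
        · exact ⟨by linarith [hb.1, Real.pi_pos], by linarith [hb.2]⟩
        · exact ⟨by linarith [ha.1, Real.pi_pos], by linarith [ha.2]⟩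
      refine ((Set.Ioo_infinite Real.pi_pos).image hinj).mono (Set.image_mono ?_)
      exact Set.Ioo_subset_Ioo_right (by linarith [Real.pi_pos])
    have hp0 : toFin n f * vand ℂ n ≠ 0 := by
      refine mul_ne_zero (fun h => ?_) vand_ne_zero
      have h1 := coeff_expoFin_toFin hlam f
      rw [h, MvPolynomial.coeff_zero, hf, macC, coeffAt_macP_self] at h1
      · exact zero_ne_one h1
      · exact inv_ne_zero (by exact_mod_cast ht0.ne')
      · exact fun mu hmu => eps_sub_ne_zero hq0 hq1 ht0 ht1 hmu
    obtain ⟨x, hxS, hx⟩ : ∃ x : Fin n → ℂ, (∀ i, x i ∈ S) ∧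
        MvPolynomial.eval x (toFin n f * vand ℂ n) ≠ 0 := by
      by_contra! hcon
      refine hp0 (MvPolynomial.funext_set (fun _ => S) (fun _ => hSinf) fun x hx => ?_)
      rw [hcon x fun i => hx i (Set.mem_univ i), map_zero]
    choose θ hθ hθx using hxS
    have hxp : torusPoint θ = x := funext hθx
    refine ⟨θ, hθ, ?_⟩
    have hxt : x ∈ torus n := hxp ▸ torusPoint_mem θ
    rw [map_mul] at hx
    simp only [hg, hxp]
    refine pow_ne_zero 2 (norm_ne_zero_iff.mpr (mul_ne_zero ?_
      (qVand_ne_zero hq0 hq1 ht0 ht1 hxt ?_)))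
    · rw [← aeval_toFin, MvPolynomial.aeval_eq_eval]
      exact left_ne_zero_of_mul hx
    · rw [MvPolynomial.aeval_eq_eval]
      exact right_ne_zero_of_mul hx
  have hint : MeasureTheory.Integrable g (angleMeasure n) := by
    have h1 := (integrable_torusPoint (continuousOn_torusForm hq0 hq1 ht0 ht1 n f f)).re
    refine h1.congr (.of_forall fun θ => ?_)
    simp only
    rw [hfg _ (torusPoint_mem θ)]
    exact Complex.ofReal_re _
  have hpos : 0 < ∫ θ, g θ ∂(angleMeasure n) := by
    rw [MeasureTheory.integral_pos_iff_support_of_nonneg (fun θ => by positivity) hint]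
    set U : Set (Fin n → ℝ) := Function.support g ∩ Set.univ.pi fun _ => Set.Ioo 0 (2 * Real.pi)
      with hU
    have hUo : IsOpen U := hcont.isOpen_support.inter
      (isOpen_set_pi Set.finite_univ fun _ _ => isOpen_Ioo)
    have hUpos : 0 < MeasureTheory.volume U :=
      hUo.measure_pos _ ⟨θ, hgθ, fun i _ => hθ i⟩
    have h1 : angleMeasure n U = MeasureTheory.volume U := by
      rw [angleMeasure_eq, MeasureTheory.Measure.restrict_eq_self]
      intro a ha
      exact ⟨fun i => (ha.2 i (Set.mem_univ i)).1.le, fun i => (ha.2 i (Set.mem_univ i)).2.le⟩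
    exact (h1 ▸ hUpos).trans_le (MeasureTheory.measure_mono Set.inter_subset_left)
  unfold torusForm torusAvg
  refine mul_ne_zero (inv_ne_zero (pow_ne_zero _ (mul_ne_zero two_ne_zero
    (by exact_mod_cast Real.pi_ne_zero)))) ?_
  rw [MeasureTheory.integral_congr_ae (g := fun θ => ((g θ : ℝ) : ℂ))
    (.of_forall fun θ => hfg _ (torusPoint_mem θ)), integral_complex_ofReal]
  exact_mod_cast hpos.ne'

/-- The ratio of the norms for the two scalar products. -/
def normRatio (q t : ℝ) (n : ℕ) (lam : YoungDiagram) : ℂ :=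
  torusForm q t n (macC q t lam) (macC q t lam) /
    form (oscCoeff (q : ℂ) t) (macC q t lam) (macC q t lam)

/-- Both forms make the `P_mu` orthogonal and the `P_mu` span. So pairing with `P_lam` gives the
same functional up to the ratio of the norms. -/
theorem torusForm_macC_eq {q t : ℝ} (hq0 : 0 < q) (hq1 : q < 1) (ht0 : 0 < t) (ht1 : t < 1)
    (n : ℕ) (lam : YoungDiagram) (G : MvPolynomial ℕ+ ℂ) :
    torusForm q t n (macC q t lam) G =
      normRatio q t n lam * form (oscCoeff (q : ℂ) t) (macC q t lam) G := by
  have hO := (paramQT q t).isOrthoFamily_macC hq0 hq1 ht0 ht1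
  set L : MvPolynomial ℕ+ ℂ →ₗ[ℂ] ℂ :=
    { toFun := torusForm q t n (macC q t lam)
      map_add' := torusForm_add_right hq0 hq1 ht0 ht1 n _
      map_smul' := fun a G => torusForm_smul_right q t n a _ G } with hL
  set M : MvPolynomial ℕ+ ℂ →ₗ[ℂ] ℂ :=
    normRatio q t n lam • formL (oscCoeff (q : ℂ) t) (macC q t lam) with hM
  have hmu : ∀ mu, L (macC q t mu) = M (macC q t mu) := by
    intro mu
    change torusForm q t n _ _ = normRatio q t n lam * form _ _ _
    by_cases h : lam = mu
    · subst h
      rw [normRatio, div_mul_cancel₀]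
      exact form_macC_self_ne_zero hq0 hq1 ht0 ht1 lam
    · rw [torusForm_macC hq0 hq1 ht0 ht1 n h, hO.ortho _ _ h, mul_zero]
  have hmon : ∀ d a, L (MvPolynomial.monomial d a) = M (MvPolynomial.monomial d a) := by
    intro d a
    have h1 : IsHomog (MvPolynomial.monomial d a : MvPolynomial ℕ+ ℂ)
        (Finsupp.weight (fun n : ℕ+ => (n : ℕ)) d) :=
      MvPolynomial.isWeightedHomogeneous_monomial _ _ _ rfl
    have h2 := hO.mem_span_of_isHomog h1
    rw [← sub_eq_zero, ← LinearMap.sub_apply, ← LinearMap.mem_ker]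
    refine Submodule.span_le.mpr ?_ h2
    rintro _ ⟨mu, _, rfl⟩
    rw [SetLike.mem_coe, LinearMap.mem_ker, LinearMap.sub_apply, hmu, sub_self]
  have : L = M := by
    refine LinearMap.ext fun G => ?_
    rw [G.as_sum, map_sum, map_sum]
    exact Finset.sum_congr rfl fun d _ => hmon d _
  exact LinearMap.congr_fun this G

/-! ### The nested integrals -/

theorem contour_const_mul {n : ℕ} (ρ : ℝ) (c : ℂ) (f : (Fin n → ℂ) → ℂ) :
    contour ρ (fun x => c * f x) = c * contour ρ f := by
  unfold contour torusIntegral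
  rw [← MeasureTheory.integral_const_mul]
  refine MeasureTheory.integral_congr_ae (.of_forall fun θ => ?_)
  simp only [smul_eq_mul]
  ring

theorem contour_congr {n : ℕ} {ρ : ℝ} (hρ : 0 < ρ) {f g : (Fin n → ℂ) → ℂ}
    (h : ∀ x : Fin n → ℂ, (∀ i, ‖x i‖ = ρ) → f x = g x) : contour ρ f = contour ρ g := by
  rw [contour_eq_torusAvg hρ.ne', contour_eq_torusAvg hρ.ne']
  refine torusAvg_congr fun x hx => h _ fun i => ?_
  rw [norm_mul, hx i, Complex.norm_real, Real.norm_of_nonneg hρ.le, mul_one]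

theorem contour_of_eq_zero {n : ℕ} (hn : n = 0) (ρ : ℝ) (f : (Fin n → ℂ) → ℂ) (x : Fin n → ℂ) :
    contour ρ f = f x := by
  subst hn
  rw [contour, torusIntegral_dim0, Fin.prod_univ_zero, one_mul]
  congr 1
  exact Subsingleton.elim _ _

theorem psEval_mul_left {n : ℕ} (c : ℂ) (x : Fin n → ℂ) (F : MvPolynomial ℕ+ ℂ) :
    psEval (fun j => c * x j) F = psEval x (scalePS (fun k : ℕ+ => c ^ (k : ℕ)) F) := by
  have h : psEval (R := ℂ) (fun j => c * x j) =
      (psEval (R := ℂ) x).comp (scalePS fun k : ℕ+ => c ^ (k : ℕ)) := by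
    refine MvPolynomial.algHom_ext fun k => ?_
    rw [AlgHom.comp_apply, scalePS, MvPolynomial.aeval_X, map_mul, ← MvPolynomial.algebraMap_eq,
      AlgHom.commutes, psEval_X, psEval_X, Finset.mul_sum]
    simp [mul_pow]
  rw [h, AlgHom.comp_apply]

theorem coeff_scalePS_pow (c : ℂ) (F : MvPolynomial ℕ+ ℂ) (d : ℕ+ →₀ ℕ) :
    MvPolynomial.coeff d (scalePS (fun k : ℕ+ => c ^ (k : ℕ)) F) =
      c ^ (Finsupp.weight (fun n : ℕ+ => (n : ℕ)) d) * MvPolynomial.coeff d F := by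
  rw [coeff_scalePS, Finsupp.weight_apply, Finsupp.sum, ← Finset.prod_pow_eq_pow_sum, Finsupp.prod]
  congr 1
  refine Finset.prod_congr rfl fun n _ => ?_
  rw [← pow_mul, smul_eq_mul, mul_comm]

/-- The radius has no effect: `Δ` is homogeneous of degree zero, `P_lam` contributes `ρ^|lam|`, and
pairing with `P_lam` sees only the part of `G` of degree `|lam|`, which contributes `ρ^(-|lam|)`. -/
theorem contour_inv_mul_macC {q t : ℝ} (hq0 : 0 < q) (hq1 : q < 1) (ht0 : 0 < t) (ht1 : t < 1)
    {n : ℕ} {ρ : ℝ} (hρ : 0 < ρ) (lam : YoungDiagram) (G : MvPolynomial ℕ+ ℂ) :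
    contour ρ (fun y : Fin n → ℂ => psEval (fun j => (y j)⁻¹) G *
        (weight q t y * psEval y (macC q t lam))) =
      normRatio q t n lam * form (oscCoeff (q : ℂ) t) (macC q t lam) G := by
  have hρ' : (ρ : ℂ) ≠ 0 := by exact_mod_cast hρ.ne'
  have hom : IsHomog (macC q t lam) lam.card := isHomog_macP _ _ _
  have h1 : scalePS (fun k : ℕ+ => (ρ : ℂ) ^ (k : ℕ)) (macC q t lam) =
      (ρ : ℂ) ^ lam.card • macC q t lam := by
    ext d
    rw [coeff_scalePS_pow, MvPolynomial.coeff_smul, smul_eq_mul]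
    by_cases hd : MvPolynomial.coeff d (macC q t lam) = 0
    · rw [hd, mul_zero, mul_zero]
    · rw [hom hd]
  have h2 : form (oscCoeff (q : ℂ) t) (macC q t lam)
      (scalePS (fun k : ℕ+ => ((ρ : ℂ)⁻¹) ^ (k : ℕ)) G) =
      ((ρ : ℂ)⁻¹) ^ lam.card * form (oscCoeff (q : ℂ) t) (macC q t lam) G := by
    unfold form
    rw [Finset.mul_sum]
    refine Finset.sum_congr rfl fun d hd => ?_
    rw [coeff_scalePS_pow, hom (MvPolynomial.mem_support_iff.mp hd)]
    ring
  rw [contour_eq_torusAvg hρ.ne']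
  simp only [mul_inv, psEval_mul_left, h1, weight_mul q t hρ', map_smul, smul_eq_mul]
  have h3 := torusForm_macC_eq hq0 hq1 ht0 ht1 n lam
    (scalePS (fun k : ℕ+ => ((ρ : ℂ)⁻¹) ^ (k : ℕ)) G)
  rw [h2] at h3
  calc _ = torusAvg (fun x : Fin n → ℂ => (ρ : ℂ) ^ lam.card * (psEval x (macC q t lam) *
        psEval (fun j => (x j)⁻¹) (scalePS (fun k : ℕ+ => ((ρ : ℂ)⁻¹) ^ (k : ℕ)) G) *
          weight q t x)) := torusAvg_congr fun x _ => by ring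
    _ = (ρ : ℂ) ^ lam.card * torusForm q t n (macC q t lam)
        (scalePS (fun k : ℕ+ => ((ρ : ℂ)⁻¹) ^ (k : ℕ)) G) := torusAvg_const_mul _ _
    _ = _ := by
        rw [h3, inv_pow]
        have := pow_ne_zero lam.card hρ'
        field_simp

/-- The kernel is expanded by degree and integrated term by term, the bound being summable because
`σ / ρ < 1`. By the reproducing property only the term of degree `|lam|` survives, and it gives
`P_lam(x)`. -/
theorem contour_kernel_mul_macC {q t : ℝ} (hq0 : 0 < q) (hq1 : q < 1) (ht0 : 0 < t) (ht1 : t < 1)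
    {n m : ℕ} {ρ σ : ℝ} (hσ : 0 < σ) (hρ : σ < ρ) (lam : YoungDiagram) {x : Fin m → ℂ}
    (hx : ∀ i, ‖x i‖ = σ) :
    contour ρ (fun y : Fin n → ℂ => kernel q t x (fun j => (y j)⁻¹) *
        (weight q t y * psEval y (macC q t lam))) =
      normRatio q t n lam * psEval x (macC q t lam) := by
  have hρ0 : 0 < ρ := hσ.trans hρ
  have hρ' : (ρ : ℂ) ≠ 0 := by exact_mod_cast hρ0.ne'
  set κ : ℕ+ → ℂ := fun m => (1 - (t : ℂ) ^ (m : ℕ)) / (1 - (q : ℂ) ^ (m : ℕ)) with hκ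
  obtain ⟨u, hu, hker⟩ := hasSum_kernel hq0 hq1 ht0 ht1 m n (ρ := σ / ρ) (by positivity)
    ((div_lt_one hρ0).mpr hρ)
  have hxy : ∀ y ∈ torus n, ∀ i j, ‖x i * ((ρ : ℂ) * y j)⁻¹‖ ≤ σ / ρ := by
    intro y hy i j
    rw [norm_mul, norm_inv, norm_mul, hy j, hx i, Complex.norm_real, Real.norm_of_nonneg hρ0.le,
      mul_one]
    rfl
  set H : (Fin n → ℂ) → ℂ := fun y =>
    weight q t (fun j => (ρ : ℂ) * y j) * psEval (fun j => (ρ : ℂ) * y j) (macC q t lam) with hH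
  have hHc : ContinuousOn H (torus n) := by
    simp only [hH, weight_mul q t hρ', psEval_mul_left]
    exact (continuousOn_weight hq0 hq1 ht0 ht1 n).mul
      (differentiable_psEval _).continuous.continuousOn
  obtain ⟨C, hC⟩ := (isCompact_torus n).exists_bound_of_continuousOn hHc
  have hinv : ∀ y : Fin n → ℂ, (fun j => ((ρ : ℂ) * y j)⁻¹) = fun j => (ρ : ℂ)⁻¹ * (y j)⁻¹ :=
    fun y => funext fun j => mul_inv _ _
  have hsum := hasSum_torusAvg (n := n)
    (F := fun k y => psEval (fun j => ((ρ : ℂ) * y j)⁻¹) (cauchyCoeff κ x k) * H y)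
    (G := fun y => kernel q t x (fun j => ((ρ : ℂ) * y j)⁻¹) * H y) (hu.mul_right C)
    (fun k => by
      simp only [hinv, psEval_mul_left]
      exact (continuousOn_psEval_inv _).mul hHc)
    (fun k y hy => by
      rw [norm_mul]
      have h1 := (hker x _ (hxy y hy)).1 k
      exact mul_le_mul h1 (hC y hy) (norm_nonneg _) ((norm_nonneg _).trans h1))
    (fun y hy => (hker x _ (hxy y hy)).2.mul_right _)
  rw [contour_eq_torusAvg hρ0.ne']
  refine hsum.unique ?_
  have hκo : ∀ m : ℕ+, oscCoeff (q : ℂ) t m * κ m = ((m : ℕ) : ℂ) := by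
    intro m
    have h1 : (1 : ℂ) - (q : ℂ) ^ (m : ℕ) ≠ 0 := by
      exact_mod_cast (one_sub_pow_pos hq0 hq1 m).ne'
    have h2 : (1 : ℂ) - (t : ℂ) ^ (m : ℕ) ≠ 0 := by
      exact_mod_cast (one_sub_pow_pos ht0 ht1 m).ne'
    rw [oscCoeff, hκ]
    field_simp
  have hk : ∀ k, torusAvg (fun y : Fin n → ℂ =>
      psEval (fun j => ((ρ : ℂ) * y j)⁻¹) (cauchyCoeff κ x k) * H y) =
      if k = lam.card then normRatio q t n lam * psEval x (macC q t lam) else 0 := by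
    intro k
    have h1 := contour_inv_mul_macC hq0 hq1 ht0 ht1 (n := n) hρ0 lam (cauchyCoeff κ x k)
    rw [contour_eq_torusAvg hρ0.ne', form_cauchyCoeff hκo x (F := macC q t lam) (isHomog_macP _ _ _) k, mul_ite,
      mul_zero] at h1
    exact h1
  simp only [hk]
  exact hasSum_ite_eq _ _

theorem macC_eq_one {q t : ℝ} (hq0 : 0 < q) (hq1 : q < 1) (ht0 : 0 < t) (ht1 : t < 1)
    {lam : YoungDiagram} (h : lam.card = 0) : macC q t lam = 1 := by
  have hlam : lam = ⊥ := by
    ext c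
    rw [Finset.card_eq_zero.mp h]
    simp
  have h1 : macC q t lam = MvPolynomial.C (MvPolynomial.coeff 0 (macC q t lam)) := by
    ext d
    rw [MvPolynomial.coeff_C]
    split_ifs with hd
    · rw [hd]
    · by_contra hne
      have hw := isHomog_macP (q : ℂ) (t : ℂ)⁻¹ lam hne
      rw [h] at hw
      refine hd (Finsupp.ext fun n => ?_)
      have := Finsupp.le_weight (fun n : ℕ+ => (n : ℕ)) n.ne_zero d
      rw [hw] at this
      simpa using (Nat.le_zero.mp this).symm
  have h2 : coeffAt lam (macC q t lam) = 1 :=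
    coeffAt_macP_self (inv_ne_zero (by exact_mod_cast ht0.ne')) fun mu hmu =>
      eps_sub_ne_zero hq0 hq1 ht0 ht1 hmu
  have h3 : expo lam = 0 := by
    ext i
    rw [expo_apply, hlam]
    simp [YoungDiagram.rowLen_eq_card, YoungDiagram.row]
  rw [h1, coeffAt_apply, h3, ofPowerSums, MvPolynomial.aeval_C] at h2
  have h4 : MvPolynomial.coeff 0 (macC q t lam) = 1 := by
    simpa [MvPowerSeries.algebraMap_apply] using h2
  rw [h1, h4, MvPolynomial.C_1]

/-! ### Rectangle decompositions and the coefficients of the integrals. -/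

section Decomposition

variable (D : RectDecomp)

theorem RectDecomp.r_mono {a b : ℕ} (hab : a ≤ b) (hb : b ≤ D.N) : D.r a ≤ D.r b := by
  induction b, hab using Nat.le_induction with
  | base => exact le_rfl
  | succ b hab ih => exact (ih (by omega)).trans (D.r_lt b (by omega)).le

theorem RectDecomp.sub_rowLen (a i : ℕ) : (D.sub a).rowLen i = D.rows a i :=
  diagramOfRows_rowLen _ _ _ (D.rows_eq_zero a) i

theorem RectDecomp.sub_rowLen_succ (a i : ℕ) : (D.sub (a + 1)).rowLen i =
    (D.sub a).rowLen i + if i < D.r (a + 1) then D.s (a + 1) else 0 := by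
  rw [D.sub_rowLen, D.sub_rowLen, RectDecomp.rows, Finset.sum_Icc_succ_top (by omega)]
  rfl

theorem RectDecomp.sub_colLen_le {a b : ℕ} (hab : a ≤ b) (hb : b ≤ D.N) :
    (D.sub a).colLen 0 ≤ D.r b := by
  by_contra! h
  have h1 := (rowLen_ne_zero_iff (D.sub a) _).mpr h
  rw [D.sub_rowLen] at h1
  refine h1 (Finset.sum_eq_zero fun c hc => if_neg ?_)
  have := D.r_mono ((Finset.mem_Icc.mp hc).2.trans hab) hb
  omega

theorem RectDecomp.card_sub_zero : (D.sub 0).card = 0 := by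
  simp [RectDecomp.sub, diagramOfRows, YoungDiagram.card]

variable {D} {ρ : ℕ → ℝ} {q t : ℝ}

/-- By induction, the integral over `x^a` reproduces `P` of `lam^(a)` in the variables `x^{a+1}`,
and the monomial of exponent `s_{a+1}` in all `r_{a+1}` variables turns it into `P` of `lam^(a+1)`.
-/
theorem nested_eq (hρ : D.Radii ρ) (hq0 : 0 < q) (hq1 : q < 1) (ht0 : 0 < t) (ht1 : t < 1)
    (a : ℕ) (ha : a + 1 ≤ D.N) (x : Fin (D.r (a + 1)) → ℂ) (hx : ∀ i, ‖x i‖ = ρ (a + 1)) :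
    nested q t D ρ (a + 1) x =
      (∏ b ∈ Finset.Icc 1 a, normRatio q t (D.r b) (D.sub b)) *
        (weight q t x * psEval x (macC q t (D.sub (a + 1)))) := by
  have hboost := (paramQT q t).psEval_macC_boost hq0 hq1 ht0 ht1
    (D.sub_colLen_le a.le_succ ha) (D.sub_rowLen_succ a) x
  induction a with
  | zero =>
    -- Since `r 0 = 0`, this is an integral over a point, equal to one whatever the unconstrained `ρ
    -- 0` is.
    have h0 : contour (ρ 0) (fun y : Fin (D.r 0) → ℂ =>
        kernel q t x (fun j => (y j)⁻¹) * nested q t D ρ 0 y) = 1 := by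
      rw [contour_of_eq_zero D.r_zero _ _ 0]
      have : IsEmpty (Fin (D.r 0)) := by rw [D.r_zero]; infer_instance
      simp [kernel, nested]
    rw [nested, h0, hboost, macC_eq_one hq0 hq1 ht0 ht1 D.card_sub_zero]
    simp
  | succ a ih =>
    have h0 : contour (ρ (a + 1)) (fun y : Fin (D.r (a + 1)) → ℂ =>
        kernel q t x (fun j => (y j)⁻¹) * nested q t D ρ (a + 1) y) =
        (∏ b ∈ Finset.Icc 1 a, normRatio q t (D.r b) (D.sub b)) *
          (normRatio q t (D.r (a + 1)) (D.sub (a + 1)) * psEval x (macC q t (D.sub (a + 1)))) := by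
      rw [← contour_kernel_mul_macC hq0 hq1 ht0 ht1 (hρ.1 (a + 2) (by omega) ha)
        (hρ.2 (a + 1) (by omega) (by omega)) _ hx, ← contour_const_mul]
      refine contour_congr (hρ.1 (a + 1) (by omega) (by omega)) fun y hy => ?_
      rw [ih (by omega) y hy ((paramQT q t).psEval_macC_boost hq0 hq1 ht0 ht1
        (D.sub_colLen_le a.le_succ (by omega)) (D.sub_rowLen_succ a) y)]
      ring
    rw [nested, h0, hboost, Finset.prod_Icc_succ_top (by omega)]
    ring

/-- The outermost integration pairs with `P` of `lam^(a)` and supplies the last norm ratio. The case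
`a = 0` is included for the empty partition. -/
theorem contour_nested (hρ : D.Radii ρ) (hq0 : 0 < q) (hq1 : q < 1) (ht0 : 0 < t) (ht1 : t < 1)
    (a : ℕ) (ha : a ≤ D.N) (G : MvPolynomial ℕ+ ℂ) :
    contour (ρ a) (fun x : Fin (D.r a) → ℂ =>
        nested q t D ρ a x * psEval (fun j => (x j)⁻¹) G) =
      (∏ b ∈ Finset.Icc 1 a, normRatio q t (D.r b) (D.sub b)) *
        form (oscCoeff (q : ℂ) t) (macC q t (D.sub a)) G := by
  cases a with
  | zero =>
    rw [contour_of_eq_zero D.r_zero _ _ 0, macC_eq_one hq0 hq1 ht0 ht1 D.card_sub_zero]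
    have : IsEmpty (Fin (D.r 0)) := by rw [D.r_zero]; infer_instance
    have h1 : psEval (fun j : Fin (D.r 0) => ((0 : Fin (D.r 0) → ℂ) j)⁻¹) G =
        MvPolynomial.constantCoeff G := by
      induction G using MvPolynomial.induction_on with
      | C a => simp [psEval]
      | add F G hF hG => rw [map_add, map_add, hF, hG]
      | mul_X F k hF => rw [map_mul, psEval_X, map_mul]; simp
    rw [h1, form_comm, ← MvPolynomial.C_1, form_C_right]
    simp [nested]
  | succ a =>
    rw [Finset.prod_Icc_succ_top (by omega), mul_assoc,
      ← contour_inv_mul_macC hq0 hq1 ht0 ht1 (hρ.1 (a + 1) (by omega) ha), ← contour_const_mul]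
    refine contour_congr (hρ.1 (a + 1) (by omega) ha) fun x hx => ?_
    rw [nested_eq hρ hq0 hq1 ht0 ht1 a ha x hx]
    ring

/-- The factor `r_a!` cancels the `1/n!` of `scalarProd'`, so each factor of `C^+` is the inverse of
a norm ratio. The torus norm is nonzero because `lam^(a)` has at most `r_a` parts. -/
theorem constPlus_mul (D : RectDecomp) (hq0 : 0 < q) (hq1 : q < 1) (ht0 : 0 < t) (ht1 : t < 1) :
    constPlus q t D * ∏ b ∈ Finset.Icc 1 D.N, normRatio q t (D.r b) (D.sub b) = 1 := by
  rw [constPlus, ← Finset.prod_mul_distrib]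
  refine Finset.prod_eq_one fun b hb => ?_
  have hs : ((D.r b).factorial : ℂ) *
      scalarProd' q t (D.r b) (macdonaldP (D.sub b)) (macdonaldP (D.sub b)) =
      torusForm q t (D.r b) (macC q t (D.sub b)) (macC q t (D.sub b)) := by
    rw [scalarProd', ← mul_assoc, mul_inv_cancel₀ (by exact_mod_cast Nat.factorial_ne_zero _),
      one_mul, contour_eq_torusAvg one_ne_zero, torusForm]
    simp only [evalSymm_macdonaldP hq0 hq1 ht0 ht1, Complex.ofReal_one, one_mul]
    refine torusAvg_congr fun x _ => ?_
    ring
  have h1 := form_macC_self_ne_zero hq0 hq1 ht0 ht1 (D.sub b)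
  have h2 := torusForm_macC_self_ne_zero hq0 hq1 ht0 ht1
    (D.sub_colLen_le le_rfl (Finset.mem_Icc.mp hb).2)
  rw [hs, ratEval_scalarProd hq0 hq1 ht0 ht1, normRatio]
  field_simp

theorem normFactor_ne_zero {o : ℕ+ → ℂ} (ho : ∀ n, o n ≠ 0) (d : ℕ+ →₀ ℕ) : normFactor o d ≠ 0 :=
  Finset.prod_ne_zero_iff.mpr fun n _ =>
    mul_ne_zero (pow_ne_zero _ (ho n)) (by exact_mod_cast Nat.factorial_ne_zero _)

theorem oscCoeff_ne_zero (hq0 : 0 < q) (hq1 : q < 1) (ht0 : 0 < t) (ht1 : t < 1) (n : ℕ+) :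
    oscCoeff (q : ℂ) t n ≠ 0 := by
  have h1 : (1 : ℂ) - (q : ℂ) ^ (n : ℕ) ≠ 0 := by
    exact_mod_cast (one_sub_pow_pos hq0 hq1 n).ne'
  have h2 : (1 : ℂ) - (t : ℂ) ^ (n : ℕ) ≠ 0 := by
    exact_mod_cast (one_sub_pow_pos ht0 ht1 n).ne'
  exact mul_ne_zero (by exact_mod_cast n.ne_zero) (div_ne_zero h1 h2)

/-- Pairing `P_lam` with `p_d` gives `z_d` times the coefficient of `p_d`; the vertex operator
supplies `1/z_d`, and `C^+` removes the norm ratios. -/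
theorem coeff_bosonContour_plus (hρ : D.Radii ρ) (hq0 : 0 < q) (hq1 : q < 1) (ht0 : 0 < t)
    (ht1 : t < 1) (d : ℕ+ →₀ ℕ) :
    MvPowerSeries.coeff d (bosonContour (ρ D.N) (FPlus q t D ρ) (vertexPlus q t)) =
      MvPolynomial.coeff d (macC q t D.partition) := by
  have h := contour_nested hρ hq0 hq1 ht0 ht1 D.N le_rfl (MvPolynomial.monomial d 1)
  rw [form_comm, form_monomial_left, one_mul] at h
  have hn := normFactor_ne_zero (oscCoeff_ne_zero hq0 hq1 ht0 ht1) d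
  calc MvPowerSeries.coeff d (bosonContour (ρ D.N) (FPlus q t D ρ) (vertexPlus q t))
      = contour (ρ D.N) (fun x => (constPlus q t D * (normFactor (oscCoeff (q : ℂ) t) d)⁻¹) *
          (nested q t D ρ D.N x * psEval (fun j => (x j)⁻¹) (MvPolynomial.monomial d (1 : ℂ)))) := by
        change contour (ρ D.N) (fun x => FPlus q t D ρ x *
          MvPowerSeries.coeff d (vertexPlus q t x)) = _
        congr 1
        funext x
        rw [coeff_vertexPlus hq0 hq1 ht0 ht1, FPlus]
        ring
    _ = _ := by
        rw [contour_const_mul, h, RectDecomp.partition]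
        have h1 := constPlus_mul D hq0 hq1 ht0 ht1
        generalize constPlus q t D = A at *
        generalize ∏ b ∈ Finset.Icc 1 D.N, normRatio q t (D.r b) (D.sub b) = B at *
        field_simp
        linear_combination (MvPolynomial.coeff d (macC q t (D.sub D.N))) * h1

/-- The nested integral with `q` and `t` interchanged extracts coefficients of `P_{lam'}(t,q)`. The
coefficients of the second vertex operator, times `z_d(t,q)`, are the scaling factors of the
duality, and `C^-` contains the inverse norm that the duality requires. -/
theorem coeff_bosonContour_minus (hρ : D.Radii ρ) (hq0 : 0 < q) (hq1 : q < 1) (ht0 : 0 < t)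
    (ht1 : t < 1) {lam : YoungDiagram} (hD : D.partition = lam.transpose) (d : ℕ+ →₀ ℕ) :
    MvPowerSeries.coeff d (bosonContour (ρ D.N) (FMinus q t D ρ) vertexMinus) =
      MvPolynomial.coeff d (macC q t lam) := by
  have h := contour_nested hρ ht0 ht1 hq0 hq1 D.N le_rfl (MvPolynomial.monomial d 1)
  rw [form_comm, form_monomial_left, one_mul] at h
  set V : ℂ := d.prod fun n k => (altSign n / ((n : ℕ) : ℂ)) ^ k / (k.factorial : ℂ) with hV
  have hVn : V * normFactor (oscCoeff (t : ℂ) q) d =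
      d.prod fun n k => (oscCoeff (t : ℂ) q n * altSign n / ((n : ℕ) : ℂ)) ^ k := by
    rw [hV, normFactor, ← Finsupp.prod_mul]
    refine Finsupp.prod_congr fun n _ => ?_
    have : ((d n).factorial : ℂ) ≠ 0 := by exact_mod_cast Nat.factorial_ne_zero _
    rw [mul_div_assoc, mul_pow]
    field_simp
  rw [coeff_macC_dual (paramQT q t) hq0 hq1 ht0 ht1 lam d, ← hD, ← hVn]
  calc MvPowerSeries.coeff d (bosonContour (ρ D.N) (FMinus q t D ρ) vertexMinus)
      = contour (ρ D.N) (fun x => (constMinus t q D * V) *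
          (nested t q D ρ D.N x * psEval (fun j => (x j)⁻¹) (MvPolynomial.monomial d (1 : ℂ)))) := by
        change contour (ρ D.N) (fun x => FMinus q t D ρ x *
          MvPowerSeries.coeff d (vertexMinus x)) = _
        congr 1
        funext x
        rw [coeff_vertexMinus, FMinus]
        ring
    _ = _ := by
        have h1 := constPlus_mul D ht0 ht1 hq0 hq1
        rw [contour_const_mul, h, constMinus, ratEval_scalarProd ht0 ht1 hq0 hq1, div_eq_mul_inv]
        simp only [RectDecomp.partition]
        linear_combination (V * normFactor (oscCoeff (t : ℂ) q) d *
          (form (oscCoeff (t : ℂ) q) (macC t q (D.sub D.N)) (macC t q (D.sub D.N)))⁻¹ *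
          MvPolynomial.coeff d (macC t q (D.sub D.N))) * h1

end Decomposition

end MacdonaldBoson

end

open MacdonaldBoson in
theorem proposition3p6
    (lam : YoungDiagram) (D D' : RectDecomp)
    (hD : D.partition = lam) (hD' : D'.partition = lam.transpose)
    (q t : ℝ) (hq0 : 0 < q) (hq1 : q < 1) (ht0 : 0 < t) (ht1 : t < 1)
    (ρ ρ' : ℕ → ℝ) (hρ : D.Radii ρ) (hρ' : D'.Radii ρ') :
    IsMacdonaldFamily indQ indT macdonaldP ∧
    SpecializesTo q t (hat indQ indT (macdonaldP lam))
      (bosonContour (ρ D.N) (FPlus q t D ρ) (vertexPlus q t)) ∧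
    SpecializesTo q t (hat indQ indT (macdonaldP lam))
      (bosonContour (ρ' D'.N) (FMinus q t D' ρ') vertexMinus) ∧
    SpecializesTo q t (hatStar indQ indT (macdonaldP lam))
      (bosonContour (ρ D.N) (FPlus q t D ρ) (vertexPlus q t)) ∧
    SpecializesTo q t (hatStar indQ indT (macdonaldP lam))
      (bosonContour (ρ' D'.N) (FMinus q t D' ρ') vertexMinus) ∧
    vevC indQ indT (hat indQ indT (macdonaldP lam)) = macdonaldP lam ∧
    vevCStar indQ indT (hatStar indQ indT (macdonaldP lam)) = macdonaldP lam := by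
  -- Both operators attached to `P_lam` are the expansion `macQT lam`, so one identity for each of
  -- the two integrals yields the four formulas.
  have hreg := regularAt_coeff_macQT hq0 hq1 ht0 ht1 lam
  have hplus : SpecializesTo q t (macQT lam)
      (bosonContour (ρ D.N) (FPlus q t D ρ) (vertexPlus q t)) := fun d =>
    ⟨(hreg d).1, by rw [(hreg d).2, coeff_bosonContour_plus hρ hq0 hq1 ht0 ht1, hD]⟩
  have hminus : SpecializesTo q t (macQT lam)
      (bosonContour (ρ' D'.N) (FMinus q t D' ρ') vertexMinus) := fun d =>
    ⟨(hreg d).1, by rw [(hreg d).2, coeff_bosonContour_minus hρ' hq0 hq1 ht0 ht1 hD']⟩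
  refine ⟨isMacdonaldFamily_macdonaldP, ?_, ?_, ?_, ?_, vevC_hat_macdonaldP lam,
    vevCStar_hatStar_macdonaldP lam⟩
  · rwa [hat_macdonaldP]
  · rwa [hat_macdonaldP]
  · rwa [hatStar_macdonaldP]
  · rwa [hatStar_macdonaldP]
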